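/- An instance of Subset Sum consists of $n \ge 0$ nonnegative integers $a_1,\dots,a_n$ and a target $t \ge 0$. A solution is a vector $x\in\{0,1\}^n$ with $\sum_{i=1}^n a_i x_i = t$. Let $\rho_\ell = 1+\ell(\ell+1)/2$, and define $\tau:(0,1]\to[0,1]$ as follows: if $0<\sigma\le 1/2$, let $\ell\ge 1$ be the unique integer with $1/\rho_{\ell+1}<\sigma\le 1/\rho_\ell$ and put $$\tau(\sigma)=1-\frac{1}{\ell+1}-\frac{\rho_\ell-2}{\ell+1}\,\sigma ;$$ if $\sigma>1/2$, put $\tau(\sigma)=1/2$. **Theorem.** For every $\sigma\in(0,1]$ there is a randomized algorithm that solves the Subset Sum problem in the worst case with high probability and runs in time $O^*(2^{\tau(\sigma)n})$ and space $O^*(2^{\sigma n})$. Here an algorithm is a finite program for a random access machine with logarithmic cost: time and space are counted in bits, the input is read-only, and fair coin flips are available. The machine may evaluate $\lfloor \sigma m\rfloor$ for integers $m$ that it has computed, at a cost linear in the bit length of $m$; if $\sigma$ is rational, the program does not use this operation. The program solves the problem with high probability if, on every instance with $n$ items, it outputs a solution when there is one and reports that there is none otherwise, with probability at least $1-\delta(n)$,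 where $\delta(n)\to 0$ as $n\to\infty$ and $\delta$ does not depend on the numbers $a_i$ and $t$. The bounds hold for every outcome of the coin flips, and $O^*(2^{en})$ means at most $p(n)\,2^{en}+q(L)$, where $L$ is the bit length of the instance and $p$, $q$ are polynomials that depend only on $\sigma$. -/

import Mathlib

namespace SubsetSum

/-! ## The problem -/

/-- A Subset Sum instance: `n` nonnegative integers and a nonnegative target. -/
structure Instance where
  n : ℕ
  a : Fin n → ℕ
  t : ℕ

/-- `x ∈ {0,1}ⁿ` is a solution if `∑ᵢ aᵢ xᵢ = t`. -/
def Instance.IsSolution (I : Instance) (x : Fin I.n → Bool) : Prop :=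
  ∑ i, I.a i * (x i).toNat = I.t

/-- The bit length of an instance. -/
def Instance.bitLength (I : Instance) : ℕ :=
  I.n + Nat.size I.t + ∑ i, Nat.size (I.a i)

/-- Correct answers: `some x` with `x` a solution, or `none` if there is no solution. -/
def Instance.IsCorrectAnswer (I : Instance) : Option (Fin I.n → Bool) → Prop
  | some x => I.IsSolution x
  | none => ∀ x, ¬ I.IsSolution x

/-! ## The tradeoff curve -/

/-- The magic sequence `ρ_ℓ = 1 + ℓ(ℓ+1)/2`. -/
noncomputable def rho (l : ℕ) : ℝ := 1 + (l : ℝ) * ((l : ℝ) + 1) / 2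

/-- For `σ ∈ (0,1/2]`, the index `ℓ` with `1/ρ_{ℓ+1} < σ ≤ 1/ρ_ℓ`. There is exactly one, so that
the infimum below is over a one-element set. -/
noncomputable def index (σ : ℝ) : ℕ := sInf {l : ℕ | 1 / rho (l + 1) < σ ∧ σ ≤ 1 / rho l}

/-- The tradeoff curve `τ`, meant for `σ ∈ (0,1]`. -/
noncomputable def tau (σ : ℝ) : ℝ :=
  if 1 / 2 < σ then 1 / 2
  else 1 - 1 / ((index σ : ℝ) + 1) - (rho (index σ) - 2) / ((index σ : ℝ) + 1) * σ

/-! ## The machine model: random access machines with logarithmic cost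

A machine has registers `0, 1, 2, …`, each holding a natural number and initially `0`, a read-only
input, and a source of independent fair coin flips. The space parameter `σ` is a real number that
the machine can read to any precision, through the instruction `scale`. -/

/-- Instructions. Numbers `r, s, u` are register names; `[r]` is the content of register `r`. -/
inductive Instr
  /-- `[r] := c` -/
  | const (r c : ℕ)
  /-- `[r] :=` the input number with index `[s]` -/
  | read (r s : ℕ)
  /-- `[r] := [[s]]` (indirect addressing) -/
  | load (r s : ℕ)
  /-- `[[r]] := [s]` (indirect addressing) -/
  | store (r s : ℕ)
  /-- `[r] := [s] + [u]` -/
  | add (r s u : ℕ)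
  /-- `[r] := max ([s] - [u]) 0` -/
  | sub (r s u : ℕ)
  /-- `[r] := [s] * [u]` -/
  | mul (r s u : ℕ)
  /-- `[r] := ⌊[s] / [u]⌋`, and `0` if `[u] = 0` -/
  | div (r s u : ℕ)
  /-- `[r] := ⌊σ * [s]⌋` -/
  | scale (r s : ℕ)
  /-- `[r] :=` a fresh random bit -/
  | flip (r : ℕ)
  /-- if `[r] = 0`, continue with the instruction numbered `k` -/
  | jumpZero (r k : ℕ)

/-- A program is a finite list of instructions, numbered from `0`. -/
abbrev Program := List Instr

/-- A configuration. The machine itself cannot access `coins` (the number of coins flipped so far)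
and `time` (the total cost of the instructions executed so far). -/
structure Config where
  pc : ℕ
  mem : ℕ →₀ ℕ
  coins : ℕ
  time : ℕ

/-- All registers are `0`. -/
noncomputable def Config.start : Config := ⟨0, 0, 0, 0⟩

/-- The space a configuration occupies, in bits: every register with nonzero content counts with
the bit length of its content plus that of its address. -/
noncomputable def Config.space (c : Config) : ℕ :=
  ∑ r ∈ c.mem.support, (Nat.size r + Nat.size (c.mem r))

/-- The input numbers are `n, t, a₁, …, aₙ`, with indices `0, 1, …, n + 1`. -/
def Instance.input (I : Instance) : ℕ → ℕ
  | 0 => I.n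
  | 1 => I.t
  | i + 2 => if h : i < I.n then I.a ⟨i, h⟩ else 0

/-- Write `v` to register `r` at cost `k`, and go to the next instruction. -/
noncomputable def Config.write (c : Config) (r v k : ℕ) : Config :=
  { c with pc := c.pc + 1, mem := c.mem.update r v, time := c.time + k }

/-- Execute one instruction, with parameter `σ`, input `inp` and coin flips `ω`. The cost is one
plus the bit lengths of the numbers and indirect addresses involved; multiplication and division
cost the product of the (successors of the) bit lengths of the operands. -/
noncomputable def Config.exec (σ : ℝ) (inp : ℕ → ℕ) (ω : ℕ → Bool) (c : Config) :
    Instr → Config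
  | .const r v => c.write r v (1 + Nat.size v)
  | .read r s => c.write r (inp (c.mem s)) (1 + Nat.size (c.mem s) + Nat.size (inp (c.mem s)))
  | .load r s =>
      c.write r (c.mem (c.mem s)) (1 + Nat.size (c.mem s) + Nat.size (c.mem (c.mem s)))
  | .store r s => c.write (c.mem r) (c.mem s) (1 + Nat.size (c.mem r) + Nat.size (c.mem s))
  | .add r s u => c.write r (c.mem s + c.mem u) (1 + Nat.size (c.mem s) + Nat.size (c.mem u))
  | .sub r s u => c.write r (c.mem s - c.mem u) (1 + Nat.size (c.mem s) + Nat.size (c.mem u))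
  | .mul r s u =>
      c.write r (c.mem s * c.mem u) ((1 + Nat.size (c.mem s)) * (1 + Nat.size (c.mem u)))
  | .div r s u =>
      c.write r (c.mem s / c.mem u) ((1 + Nat.size (c.mem s)) * (1 + Nat.size (c.mem u)))
  | .scale r s => c.write r ⌊σ * (c.mem s : ℝ)⌋₊ (1 + Nat.size (c.mem s))
  | .flip r => { c.write r (ω c.coins).toNat 1 with coins := c.coins + 1 }
  | .jumpZero r k =>
      { c with
        pc := if c.mem r = 0 then k else c.pc + 1
        time := c.time + 1 + Nat.size (c.mem r) }

/-- The machine halts when there is no instruction with the current number. -/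
def Config.Halted (P : Program) (c : Config) : Prop := P[c.pc]? = none

/-- One step of program `P`; halted configurations do not change. -/
noncomputable def Config.step (σ : ℝ) (P : Program) (inp : ℕ → ℕ) (ω : ℕ → Bool) (c : Config) :
    Config :=
  match P[c.pc]? with
  | none => c
  | some i => c.exec σ inp ω i

/-- The configuration after `k` steps of program `P` on instance `I` with coin flips `ω`. -/
noncomputable def run (σ : ℝ) (P : Program) (I : Instance) (ω : ℕ → Bool) (k : ℕ) : Config :=
  (Config.step σ P I.input ω)^[k] Config.start

/-- The output: `none` if `[0] = 0`, and otherwise the vector whose entries are the binary digits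
of `[1]`. -/
noncomputable def Config.answer (c : Config) (n : ℕ) : Option (Fin n → Bool) :=
  if c.mem 0 = 0 then none else some fun i => (c.mem 1).testBit i

/-- The program halts on `I` with coin flips `ω`, and its answer is correct. -/
def AnswersCorrectly (σ : ℝ) (P : Program) (I : Instance) (ω : ℕ → Bool) : Prop :=
  ∃ k, (run σ P I ω k).Halted P ∧ I.IsCorrectAnswer ((run σ P I ω k).answer I.n)

/-- The law of a sequence of independent fair coin flips. -/
noncomputable def coinLaw : MeasureTheory.Measure (ℕ → Bool) :=
  MeasureTheory.Measure.infinitePi fun _ => (PMF.uniformOfFintype Bool).toMeasure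

/-- The program always halts. Its running time is at most `T I` and its space at most `S I` on
every instance `I`, whatever the outcomes of the coin flips. -/
def RunsWithin (σ : ℝ) (P : Program) (T S : Instance → ℝ) : Prop :=
  ∀ (I : Instance) (ω : ℕ → Bool),
    (∃ k, (run σ P I ω k).Halted P ∧ ((run σ P I ω k).time : ℝ) ≤ T I) ∧
    ∀ k, ((run σ P I ω k).space : ℝ) ≤ S I

/-- With high probability: the answer is correct with probability `1 - o(1)` as `n → ∞`,
uniformly over all instances with `n` items. -/
def SolvesWithHighProbability (σ : ℝ) (P : Program) : Prop :=
  ∃ δ : ℕ → ℝ, Filter.Tendsto δ Filter.atTop (nhds 0) ∧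
    ∀ I : Instance, 1 - δ I.n ≤ coinLaw.real {ω | AnswersCorrectly σ P I ω}

/-- The bound `O*(2^{e n})`: a factor `p` polynomial in the number `n` of items, and an additive
term `q` polynomial in the bit length of the instance, for reading and reducing its numbers. -/
noncomputable def starBound (e : ℝ) (p q : Polynomial ℕ) (I : Instance) : ℝ :=
  ((p.eval I.n : ℕ) : ℝ) * (2 : ℝ) ^ (e * (I.n : ℝ)) + ((q.eval I.bitLength : ℕ) : ℝ)

end SubsetSum

/-!
Write `s = min σ (1/2)` and let `l` be the index with `1/ρ_(l+1) < s ≤ 1/ρ_l`. With `m = ⌊s n⌋` and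
`c = ⌊(n - ρ_l m)/(l + 1)⌋`, the items fall into blocks `0, …, l`: block `j ≥ 1` has `j m + c` items,
and block `0` has the remaining ones, about `m + c` (`firstPart`, `secondPart`). For random primes
`p_1` of `c + 2` bits and `p_2, …, p_(l+1)` of `m + 2` bits, let `M_j = p_1 ⋯ p_j`.

The search goes through all residues `s_l, …, s_1` that the sums of the blocks may have modulo
`M_l, …, M_1`; the residue of block `0` modulo `p_1` is then determined by the target. The table `T j`
lists the sums of block `j` in its residue class, about `2 ^ m` of them, in buckets given by the
residue modulo `p_(j+1)` (`p_2` for `j = 0`). It is filled without going through all sums of the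
block: for each sum of the first part, the sums of the second part in the right class modulo `p_j`
(`p_1` for `j = 0`) are read off a table `B j`. Since `p_(j+1)` divides `M_i` for `i > j`, the residues that have been fixed for the higher
blocks and the sum of the lower blocks determine the one bucket of `T j` that can extend a partial
solution, so that the tables are matched level by level (`search`, `extend`). There are
`M_1 ⋯ M_l ≈ 2 ^ (l c + l (l - 1)/2 · m)` choices of residues with work `2 ^ m` for each, and
`l c + (1 + l (l - 1)/2) m ≤ τ(σ) n` up to a constant (`exponent_le`); the memory holds `2 ^ m`
table entries. Since `τ` is constant on `[1/2, 1]`, nothing is lost by `s ≤ 1/2`.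

Buckets have a fixed capacity, and what does not fit is dropped, so that the bounds on time and space
hold for all coin flips. A bucket stores each sum only once, with one subset that has it, so that it
overflows only if many *distinct* sums fall into it. If the buckets that the parts of one solution
fall into do not overflow, the search finds a subset with the same sum (`Rooms`, `Star`). Another sum
falls into the same bucket only if random primes divide its difference from the sum of the solution,
which is a nonzero number with few prime factors; so the expected load is small, and overflow is
unlikely by Markov's inequality (`measure_crowd`, `measure_not_room`).
That primes are found among the random numbers is a consequence of a Chebyshev bound
(`measure_not_findsPrime`).

The numbers of the instance may be long, so they are first replaced by their residues modulo a random
number `N` of `poly(n, log L)` bits, and the target by `t % N + k N` for `k ≤ n`. With high probability no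
subset with a wrong sum gets the right one modulo `N` (`measure_not_goodModulus`), so that whatever
is output is a solution (`Sound`). The factors
`poly(n, log L)` in the bounds are split into the two terms of `O*` by `exists_starBound`.

The algorithm is written in a small loop language. Weakest preconditions (`Stmt.Wp`) give what it
computes, `Stmt.cost` bounds the number of steps, and `exec_program` gives the run of the machine.
-/

namespace SubsetSum

set_option linter.unusedSectionVars false
set_option linter.constructorNameAsVariable false

/-! ### A loop language over the random access machine -/

/-- What a run depends on besides the program: the space parameter, the input and the coins. -/
structure Env where
  σ : ℝ
  inp : ℕ → ℕ
  ω : ℕ → Bool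

/-- A state of the loop language: scalar registers named by `ι`, arrays named by `κ`, and the number
of coins flipped so far. -/
structure St (ι κ : Type) where
  reg : ι → ℕ
  arr : κ → ℕ → ℕ
  coins : ℕ

/-- The numbers by which the scalar registers and arrays are placed in the memory of the machine.
Only arrays with number below `S` may be used. -/
structure Layout (ι κ : Type) where
  reg : ι → ℕ
  reg_inj : Function.Injective reg
  arr : κ → ℕ
  arr_inj : Function.Injective arr
  S : ℕ

/-- The binary operations of the machine. -/
inductive Op
  | add | sub | mul | div

/-- The value of a binary operation. -/
def Op.eval : Op → ℕ → ℕ → ℕ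
  | .add, a, b => a + b
  | .sub, a, b => a - b
  | .mul, a, b => a * b
  | .div, a, b => a / b

/-- The result of a binary operation has at most `V` bits if the operands have; only sums and products
may violate this. -/
def Op.Ok (V : ℕ) : Op → ℕ → ℕ → Prop
  | .add, a, b => a + b < 2 ^ V
  | .sub, _, _ => True
  | .mul, a, b => a * b < 2 ^ V
  | .div, _, _ => True

lemma Op.Ok.lt {V a b : ℕ} {o : Op} (h : o.Ok V a b) (ha : a < 2 ^ V) : o.eval a b < 2 ^ V := by
  cases o
  · exact h
  · exact lt_of_le_of_lt (Nat.sub_le _ _) ha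
  · exact h
  · exact lt_of_le_of_lt (Nat.div_le_self _ _) ha

/-- The machine instruction of a binary operation. -/
def Op.instr : Op → ℕ → ℕ → ℕ → Instr
  | .add => .add
  | .sub => .sub
  | .mul => .mul
  | .div => .div

/-- Expressions of the loop language. -/
inductive Expr (ι κ : Type)
  | const (c : ℕ)
  | reg (r : ι)
  | bin (o : Op) (a b : Expr ι κ)
  | load (q : κ) (e : Expr ι κ)
  | input (e : Expr ι κ)
  | scale (e : Expr ι κ)

/-- Statements of the loop language. The body of `loop h i u s` is executed `[u]` times (or
`Nat.size [u]` times, if `h` holds), with `i` set to `0, 1, 2, …`; the number of rounds is fixed when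
the loop is entered. -/
inductive Stmt (ι κ : Type)
  | skip
  | assign (r : ι) (e : Expr ι κ)
  | store (q : κ) (e₁ e₂ : Expr ι κ)
  | flip (r : ι)
  | seq (s₁ s₂ : Stmt ι κ)
  | ifz (e : Expr ι κ) (s₁ s₂ : Stmt ι κ)
  | loop (h : Bool) (i u : ι) (s : Stmt ι κ)

section semantics

variable {ι κ : Type}

/-- The value of an expression. -/
noncomputable def Expr.eval (E : Env) (st : St ι κ) : Expr ι κ → ℕ
  | .const c => c
  | .reg r => st.reg r
  | .bin o a b => o.eval (a.eval E st) (b.eval E st)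
  | .load q e => st.arr q (e.eval E st)
  | .input e => E.inp (e.eval E st)
  | .scale e => ⌊E.σ * (e.eval E st : ℝ)⌋₊

variable [DecidableEq ι] [DecidableEq κ]

/-- Set a register. -/
def St.set (st : St ι κ) (r : ι) (v : ℕ) : St ι κ :=
  { st with reg := Function.update st.reg r v }

/-- Set an array cell. -/
def St.put (st : St ι κ) (q : κ) (i v : ℕ) : St ι κ :=
  { st with arr := Function.update st.arr q (Function.update (st.arr q) i v) }

/-- The number of rounds of a loop. -/
def rounds (h : Bool) (v : ℕ) : ℕ := if h then Nat.size v else v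

/-- The effect of a statement. -/
noncomputable def Stmt.denote (E : Env) : Stmt ι κ → St ι κ → St ι κ
  | .skip, st => st
  | .assign r e, st => st.set r (e.eval E st)
  | .store q e₁ e₂, st => st.put q (e₁.eval E st) (e₂.eval E st)
  | .flip r, st => { st.set r (E.ω st.coins).toNat with coins := st.coins + 1 }
  | .seq s₁ s₂, st => s₂.denote E (s₁.denote E st)
  | .ifz e s₁ s₂, st => if e.eval E st = 0 then s₁.denote E st else s₂.denote E st
  | .loop h i u s, st =>
      Nat.rec st (fun k st' => s.denote E (st'.set i k)) (rounds h (st.reg u))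

/-- The state after `k` rounds of a loop with index `i` and body `s`. -/
noncomputable def Stmt.iter (E : Env) (i : ι) (s : Stmt ι κ) (st : St ι κ) (k : ℕ) : St ι κ :=
  Nat.rec st (fun k st' => s.denote E (st'.set i k)) k

/-- The array cells read and all the numbers computed in an expression stay within the address bound
`A` and the bit length `V`. -/
def Expr.Ok (L : Layout ι κ) (A V : ℕ) (E : Env) (st : St ι κ) : Expr ι κ → Prop
  | .const c => c < 2 ^ V
  | .reg _ => True
  | .bin o a b => a.Ok L A V E st ∧ b.Ok L A V E st ∧ o.Ok V (a.eval E st) (b.eval E st)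
  | .load q e => e.Ok L A V E st ∧ L.arr q < L.S ∧ 2 * (e.eval E st * L.S + L.arr q) + 1 < A
  | .input e => e.Ok L A V E st ∧ E.inp (e.eval E st) < 2 ^ V
  | .scale e => e.Ok L A V E st

/-- The array cells used and all the numbers computed by a statement stay within the address bound
`A` and the bit length `V`. -/
def Stmt.Ok (L : Layout ι κ) (A V : ℕ) (E : Env) : Stmt ι κ → St ι κ → Prop
  | .skip, _ => True
  | .assign _ e, st => e.Ok L A V E st
  | .store q e₁ e₂, st => e₁.Ok L A V E st ∧ e₂.Ok L A V E st ∧ L.arr q < L.S ∧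
      2 * (e₁.eval E st * L.S + L.arr q) + 1 < A
  | .flip _, _ => True
  | .seq s₁ s₂, st => s₁.Ok L A V E st ∧ s₂.Ok L A V E (s₁.denote E st)
  | .ifz e s₁ s₂, st => e.Ok L A V E st ∧
      (e.eval E st = 0 → s₁.Ok L A V E st) ∧ (e.eval E st ≠ 0 → s₂.Ok L A V E st)
  | .loop h i u s, st =>
      ∀ k < rounds h (st.reg u), s.Ok L A V E ((s.iter E i st k).set i k)

/-- The number of machine instructions of a compiled expression. -/
def Expr.len : Expr ι κ → ℕ
  | .const _ => 1
  | .reg _ => 1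
  | .bin _ a b => a.len + b.len + 2
  | .load _ e => e.len + 9
  | .input e => e.len + 1
  | .scale e => e.len + 1

/-- A bound on the number of machine instructions executed for a statement. -/
noncomputable def Stmt.steps (E : Env) : Stmt ι κ → St ι κ → ℕ
  | .skip, _ => 0
  | .assign _ e, _ => e.len + 2
  | .store _ e₁ e₂, _ => e₁.len + e₂.len + 11
  | .flip _, _ => 1
  | .seq s₁ s₂, st => s₁.steps E st + s₂.steps E (s₁.denote E st)
  | .ifz e s₁ s₂, st => e.len + 3 + if e.eval E st = 0 then s₁.steps E st else s₂.steps E st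
  | .loop h i u s, st =>
      3 + ∑ k ∈ Finset.range (rounds h (st.reg u)), (s.steps E ((s.iter E i st k).set i k) + 8)

end semantics

section compile

variable {ι κ : Type}

/-- Addresses of the auxiliary registers of compiled programs. Between statements, those that do not
control a loop in progress are zero. -/
def aux (k : ℕ) : ℕ := 4 * k + 2

/-- The address of cell `i` of the array with number `q`. -/
def cell (S q i : ℕ) : ℕ := 2 * (i * S + q) + 1

/-- Code that replaces `i` in the auxiliary register `k` by the address of cell `i` of array `q`. -/
def addressCode (S q k : ℕ) : List Instr :=
  [.const (aux (k + 1)) S, .mul (aux k) (aux k) (aux (k + 1)), .const (aux (k + 1)) q,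
    .add (aux k) (aux k) (aux (k + 1)), .add (aux k) (aux k) (aux k), .const (aux (k + 1)) 1,
    .add (aux k) (aux k) (aux (k + 1)), .const (aux (k + 1)) 0]

/-- Code that writes the value of an expression to the auxiliary register `k`. -/
def Expr.code (L : Layout ι κ) : Expr ι κ → ℕ → List Instr
  | .const c, k => [.const (aux k) c]
  | .reg r, k => [.add (aux k) (4 * L.reg r) (aux (k + 1))]
  | .bin o a b, k => a.code L k ++ (b.code L (k + 1) ++
      [o.instr (aux k) (aux k) (aux (k + 1)), .const (aux (k + 1)) 0])
  | .load q e, k => e.code L k ++ (addressCode L.S (L.arr q) k ++ [.load (aux k) (aux k)])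
  | .input e, k => e.code L k ++ [.read (aux k) (aux k)]
  | .scale e, k => e.code L k ++ [.scale (aux k) (aux k)]

/-- The length of the code of a statement. -/
def Stmt.len : Stmt ι κ → ℕ
  | .skip => 0
  | .assign _ e => e.len + 2
  | .store _ e₁ e₂ => e₁.len + e₂.len + 11
  | .flip _ => 1
  | .seq s₁ s₂ => s₁.len + s₂.len
  | .ifz e s₁ s₂ => e.len + s₁.len + s₂.len + 3
  | .loop _ _ _ s => s.len + 10

/-- Code for a statement, placed at position `pc`, that may use the auxiliary registers from `k`
on. -/
def Stmt.code (L : Layout ι κ) : Stmt ι κ → ℕ → ℕ → List Instr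
  | .skip, _, _ => []
  | .assign r e, k, _ => e.code L k ++ [.add (4 * L.reg r) (aux k) (aux (k + 1)), .const (aux k) 0]
  | .store q e₁ e₂, k, _ => e₁.code L k ++ (addressCode L.S (L.arr q) k ++ (e₂.code L (k + 1) ++
      [.store (aux k) (aux (k + 1)), .const (aux (k + 1)) 0, .const (aux k) 0]))
  | .flip r, _, _ => [.flip (4 * L.reg r)]
  | .seq s₁ s₂, k, pc => s₁.code L k pc ++ s₂.code L k (pc + s₁.len)
  | .ifz e s₁ s₂, k, pc => e.code L k ++
      ([.jumpZero (aux k) (pc + e.len + s₂.len + 3), .const (aux k) 0] ++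
      (s₂.code L k (pc + e.len + 2) ++
      ([.jumpZero (aux k) (pc + e.len + s₂.len + 3 + s₁.len)] ++
      s₁.code L k (pc + e.len + s₂.len + 3))))
  | .loop h i u s, k, pc =>
      [.add (aux k) (4 * L.reg u) (aux (k + 1)), .jumpZero (aux k) (pc + 9 + s.len),
        .add (4 * L.reg i) (aux (k + 1)) (aux (k + 2))] ++
      (s.code L (k + 2) (pc + 3) ++
      [.const (aux (k + 2)) 1, .add (aux (k + 1)) (aux (k + 1)) (aux (k + 2)),
        .const (aux (k + 2)) (if h then 2 else 1),
        if h then .div (aux k) (aux k) (aux (k + 2)) else .sub (aux k) (aux k) (aux (k + 2)),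
        .const (aux (k + 2)) 0, .jumpZero (aux (k + 2)) (pc + 1), .const (aux (k + 1)) 0])

/-- A bound on the addresses of the registers used by the code of an expression. -/
def Expr.top (L : Layout ι κ) : Expr ι κ → ℕ → ℕ
  | .const _, k => aux (k + 2)
  | .reg r, k => 4 * L.reg r + 1 + aux (k + 2)
  | .bin _ a b, k => a.top L k + b.top L (k + 1) + aux (k + 2)
  | .load _ e, k => e.top L k + aux (k + 2)
  | .input e, k => e.top L k + aux (k + 2)
  | .scale e, k => e.top L k + aux (k + 2)

/-- A bound on the addresses of the registers used by the code of a statement, and on the constants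
that compilation introduces. -/
def Stmt.top (L : Layout ι κ) : Stmt ι κ → ℕ → ℕ
  | .skip, _ => 0
  | .assign r e, k => e.top L k + 4 * L.reg r + 1 + aux (k + 2)
  | .store _ e₁ e₂, k => e₁.top L k + e₂.top L (k + 1) + aux (k + 3)
  | .flip r, _ => 4 * L.reg r + 1
  | .seq s₁ s₂, k => s₁.top L k + s₂.top L k
  | .ifz e s₁ s₂, k => e.top L k + s₁.top L k + s₂.top L k + aux (k + 2)
  | .loop _ i u s, k => s.top L (k + 2) + 4 * L.reg i + 4 * L.reg u + 1 + aux (k + 4)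

/-- The list `l` of instructions occurs in the program `P` at position `pc`. -/
def CodeAt (P : Program) : ℕ → List Instr → Prop
  | _, [] => True
  | pc, i :: l => P[pc]? = some i ∧ CodeAt P (pc + 1) l

lemma codeAt_append {P : Program} (l₁ l₂ : List Instr) (pc : ℕ) :
    CodeAt P pc (l₁ ++ l₂) ↔ CodeAt P pc l₁ ∧ CodeAt P (pc + l₁.length) l₂ := by
  induction l₁ generalizing pc with
  | nil => simp [CodeAt]
  | cons i l ih => simp [CodeAt, ih, and_assoc, Nat.add_assoc, Nat.add_comm 1]

lemma codeAt_self (l₁ l₂ l₃ : List Instr) : CodeAt (l₁ ++ (l₂ ++ l₃)) l₁.length l₂ := by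
  induction l₂ generalizing l₁ with
  | nil => simp [CodeAt]
  | cons i l ih =>
    refine ⟨by simp, ?_⟩
    have := ih (l₁ ++ [i])
    simpa using this

@[simp] lemma addressCode_length (S q k : ℕ) : (addressCode S q k).length = 8 := rfl

@[simp] lemma Expr.code_length (L : Layout ι κ) (e : Expr ι κ) (k : ℕ) :
    (e.code L k).length = e.len := by
  induction e generalizing k <;> simp_all [Expr.code, Expr.len]
  omega

@[simp] lemma Stmt.code_length (L : Layout ι κ) (s : Stmt ι κ) (k pc : ℕ) :
    (s.code L k pc).length = s.len := by
  induction s generalizing k pc with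
  | skip => rfl
  | _ => simp_all [Stmt.code, Stmt.len]; try omega

end compile

section correctness

/-- All nonzero registers have addresses below `A` and contents below `2 ^ V`. -/
def Within (A V : ℕ) (mem : ℕ →₀ ℕ) : Prop := ∀ a, mem a ≠ 0 → a < A ∧ mem a < 2 ^ V

lemma Within.lt {A V : ℕ} {mem : ℕ →₀ ℕ} (h : Within A V mem) (a : ℕ) : mem a < 2 ^ V := by
  by_cases h0 : mem a = 0
  · rw [h0]; positivity
  · exact (h a h0).2

lemma Within.size_le {A V : ℕ} {mem : ℕ →₀ ℕ} (h : Within A V mem) (a : ℕ) :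
    Nat.size (mem a) ≤ V := Nat.size_le.2 (h.lt a)

lemma Within.update {A V : ℕ} {mem : ℕ →₀ ℕ} (h : Within A V mem) {a v : ℕ} (ha : a < A)
    (hv : v < 2 ^ V) : Within A V (mem.update a v) := by
  intro b hb
  rw [Finsupp.coe_update, Function.update_apply] at *
  split_ifs at * with hab
  · subst hab; exact ⟨ha, hv⟩
  · exact h b hb

lemma Within.space_le {A V : ℕ} {c : Config} (h : Within A V c.mem) :
    c.space ≤ A * (Nat.size A + V) := by
  unfold Config.space
  have hsub : c.mem.support ⊆ Finset.range A := by
    intro a ha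
    exact Finset.mem_range.2 (h a (Finsupp.mem_support_iff.1 ha)).1
  calc _ ≤ ∑ r ∈ c.mem.support, (Nat.size A + V) := by
        refine Finset.sum_le_sum fun r hr => Nat.add_le_add ?_ (h.size_le r)
        exact Nat.size_le_size (Finset.mem_range.1 (hsub hr)).le
    _ = c.mem.support.card * (Nat.size A + V) := by simp
    _ ≤ _ := Nat.mul_le_mul_right _ (by simpa using Finset.card_le_card hsub)

/-- `c'` is reached from `c` in at most `N` steps, each at cost at most `(1 + V) ^ 2`, through
configurations with memory within `A` and `V`. -/
def Reach (E : Env) (P : Program) (A V N : ℕ) (c c' : Config) : Prop :=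
  ∃ k ≤ N, (Config.step E.σ P E.inp E.ω)^[k] c = c' ∧ c'.time ≤ c.time + k * (1 + V) ^ 2 ∧
    ∀ i ≤ k, Within A V ((Config.step E.σ P E.inp E.ω)^[i] c).mem

variable {E : Env} {P : Program} {A V : ℕ}

lemma Reach.refl {c : Config} (h : Within A V c.mem) : Reach E P A V 0 c c :=
  ⟨0, le_rfl, rfl, by simp, fun i hi => by rw [Nat.le_zero.1 hi]; exact h⟩

lemma Reach.trans {N₁ N₂ : ℕ} {c₁ c₂ c₃ : Config} (h₁ : Reach E P A V N₁ c₁ c₂)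
    (h₂ : Reach E P A V N₂ c₂ c₃) : Reach E P A V (N₁ + N₂) c₁ c₃ := by
  obtain ⟨k₁, hk₁, e₁, t₁, w₁⟩ := h₁
  obtain ⟨k₂, hk₂, e₂, t₂, w₂⟩ := h₂
  refine ⟨k₂ + k₁, by omega, by rw [Function.iterate_add_apply, e₁, e₂], ?_, fun i hi => ?_⟩
  · rw [add_mul]; omega
  · rcases le_total i k₁ with h | h
    · exact w₁ i h
    · obtain ⟨j, rfl⟩ := Nat.exists_eq_add_of_le' h
      rw [Function.iterate_add_apply, e₁]; exact w₂ j (by omega)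

lemma Reach.mono {N₁ N₂ : ℕ} {c₁ c₂ : Config} (h : Reach E P A V N₁ c₁ c₂) (hN : N₁ ≤ N₂) :
    Reach E P A V N₂ c₁ c₂ := by
  obtain ⟨k, hk, h⟩ := h
  exact ⟨k, hk.trans hN, h⟩

lemma Reach.within {N : ℕ} {c₁ c₂ : Config} (h : Reach E P A V N c₁ c₂) : Within A V c₂.mem := by
  obtain ⟨k, hk, rfl, t, w⟩ := h
  exact w k le_rfl

lemma Reach.single {c c' : Config} {i : Instr} (hi : P[c.pc]? = some i)
    (hc : c.exec E.σ E.inp E.ω i = c') (ht : c'.time ≤ c.time + (1 + V) ^ 2)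
    (h : Within A V c.mem) (h' : Within A V c'.mem) : Reach E P A V 1 c c' := by
  have hs : c.step E.σ P E.inp E.ω = c' := by simp [Config.step, hi, hc]
  refine ⟨1, le_rfl, by simpa using hs, by simpa using ht, fun j hj => ?_⟩
  interval_cases j
  · exact h
  · simpa [hs] using h'

/-- One instruction that writes to a register. -/
lemma Reach.write {c : Config} {i : Instr} {r v t : ℕ} (hi : P[c.pc]? = some i)
    (hc : c.exec E.σ E.inp E.ω i = c.write r v t) (ht : t ≤ (1 + V) ^ 2)
    (h : Within A V c.mem) (hr : r < A) (hv : v < 2 ^ V) :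
    Reach E P A V 1 c (c.write r v t) :=
  Reach.single hi hc (by simpa [Config.write] using ht) h (by simpa [Config.write] using h.update hr hv)

lemma cost_le {a b : ℕ} (ha : a ≤ V) (hb : b ≤ V) : 1 + a + b ≤ (1 + V) ^ 2 := by nlinarith

lemma cost_le_one {a : ℕ} (ha : a ≤ V) : 1 + a ≤ (1 + V) ^ 2 := by nlinarith

lemma cost_le_mul {a b : ℕ} (ha : a ≤ V) (hb : b ≤ V) : (1 + a) * (1 + b) ≤ (1 + V) ^ 2 := by
  rw [sq]; gcongr

/-- From position `pc` with memory `mem` within `A` and `V`, and with `n` coins flipped, the machine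
reaches position `pc + d` with memory `mem'` in `N` steps, without flipping coins. -/
def Goes (E : Env) (P : Program) (A V N pc : ℕ) (mem : ℕ →₀ ℕ) (n d : ℕ) (mem' : ℕ →₀ ℕ) : Prop :=
  Within A V mem → ∀ t, ∃ t', Reach E P A V N ⟨pc, mem, n, t⟩ ⟨pc + d, mem', n, t'⟩

variable {pc n : ℕ} {mem : ℕ →₀ ℕ}

lemma Goes.intro {N d : ℕ} {mem' : ℕ →₀ ℕ} (h : Within A V mem → Goes E P A V N pc mem n d mem') :
    Goes E P A V N pc mem n d mem' := fun w => h w w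

lemma Goes.trans {N₁ N₂ d₁ d₂ : ℕ} {m₁ m₂ : ℕ →₀ ℕ} (h₁ : Goes E P A V N₁ pc mem n d₁ m₁)
    (h₂ : Goes E P A V N₂ (pc + d₁) m₁ n d₂ m₂) :
    Goes E P A V (N₁ + N₂) pc mem n (d₁ + d₂) m₂ := by
  intro w t
  obtain ⟨t₁, h₁⟩ := h₁ w t
  obtain ⟨t₂, h₂⟩ := h₂ h₁.within t₁
  exact ⟨t₂, by simpa [Nat.add_assoc] using h₁.trans h₂⟩

lemma Goes.cast {N N' d d' : ℕ} {m m' : ℕ →₀ ℕ} (h : Goes E P A V N pc mem n d m)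
    (hN : N ≤ N') (hd : d = d') (hm : m = m') : Goes E P A V N' pc mem n d' m' := by
  subst hd hm
  intro w t
  obtain ⟨t', h⟩ := h w t
  exact ⟨t', h.mono hN⟩

lemma Goes.write {i : Instr} {r v k : ℕ} (hi : P[pc]? = some i)
    (hc : ∀ t, Config.exec E.σ E.inp E.ω ⟨pc, mem, n, t⟩ i = Config.write ⟨pc, mem, n, t⟩ r v k)
    (ht : Within A V mem → k ≤ (1 + V) ^ 2) (hr : r < A) (hv : Within A V mem → v < 2 ^ V) :
    Goes E P A V 1 pc mem n 1 (mem.update r v) :=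
  fun w t => ⟨t + k, Reach.write (c := ⟨pc, mem, n, t⟩) hi (hc t) (ht w) w hr (hv w)⟩

lemma Goes.const {r v : ℕ} (hi : P[pc]? = some (.const r v)) (hr : r < A) (hv : v < 2 ^ V) :
    Goes E P A V 1 pc mem n 1 (mem.update r v) :=
  Goes.write hi (fun _ => rfl) (fun _ => cost_le_one (Nat.size_le.2 hv)) hr fun _ => hv

lemma Goes.op {o : Op} {r s u : ℕ} (hi : P[pc]? = some (o.instr r s u)) (hr : r < A)
    (hv : o.eval (mem s) (mem u) < 2 ^ V) :
    Goes E P A V 1 pc mem n 1 (mem.update r (o.eval (mem s) (mem u))) := by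
  cases o
  · exact Goes.write hi (fun _ => rfl) (fun h => cost_le (h.size_le s) (h.size_le u)) hr fun _ => hv
  · exact Goes.write hi (fun _ => rfl) (fun h => cost_le (h.size_le s) (h.size_le u)) hr fun _ => hv
  · exact Goes.write hi (fun _ => rfl) (fun h => cost_le_mul (h.size_le s) (h.size_le u)) hr
      fun _ => hv
  · exact Goes.write hi (fun _ => rfl) (fun h => cost_le_mul (h.size_le s) (h.size_le u)) hr
      fun _ => hv

lemma Goes.load {r s : ℕ} (hi : P[pc]? = some (.load r s)) (hr : r < A) :
    Goes E P A V 1 pc mem n 1 (mem.update r (mem (mem s))) :=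
  Goes.write hi (fun _ => rfl) (fun h => cost_le (h.size_le s) (h.size_le (mem s))) hr
    fun h => h.lt _

lemma Goes.store {r s : ℕ} (hi : P[pc]? = some (.store r s)) (hr : mem r < A) :
    Goes E P A V 1 pc mem n 1 (mem.update (mem r) (mem s)) :=
  Goes.write hi (fun _ => rfl) (fun h => cost_le (h.size_le r) (h.size_le s)) hr fun h => h.lt _

lemma Goes.read {r s : ℕ} (hi : P[pc]? = some (.read r s)) (hr : r < A)
    (hv : E.inp (mem s) < 2 ^ V) :
    Goes E P A V 1 pc mem n 1 (mem.update r (E.inp (mem s))) :=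
  Goes.write hi (fun _ => rfl) (fun h => cost_le (h.size_le s) (Nat.size_le.2 hv)) hr fun _ => hv

lemma Goes.scale {r s : ℕ} (hi : P[pc]? = some (.scale r s)) (hr : r < A) (hσ : E.σ ≤ 1) :
    Goes E P A V 1 pc mem n 1 (mem.update r ⌊E.σ * (mem s : ℝ)⌋₊) := by
  refine Goes.write hi (fun _ => rfl) (fun h => cost_le_one (h.size_le s)) hr fun h =>
    lt_of_le_of_lt ?_ (h.lt s)
  calc ⌊E.σ * (mem s : ℝ)⌋₊ ≤ ⌊(mem s : ℝ)⌋₊ :=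
        Nat.floor_le_floor (by nlinarith [Nat.cast_nonneg (α := ℝ) (mem s)])
    _ = mem s := Nat.floor_natCast _

lemma Goes.jump {r k d : ℕ} (hi : P[pc]? = some (.jumpZero r k))
    (hd : (if mem r = 0 then k else pc + 1) = pc + d) : Goes E P A V 1 pc mem n d mem := by
  intro w t
  refine ⟨t + 1 + Nat.size (mem r), Reach.single hi ?_ ?_ w w⟩
  · simp only [Config.exec, hd]
  · have := cost_le_one (w.size_le r); simp only; omega

end correctness

variable {ι κ : Type} {E : Env} {P : Program} {A V : ℕ}

/-! ### Correctness of the compilation -/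

@[simp] lemma aux_inj {j k : ℕ} : aux j = aux k ↔ j = k := by unfold aux; omega

@[simp] lemma aux_ne_reg (k r : ℕ) : aux k ≠ 4 * r := by unfold aux; omega

@[simp] lemma reg_ne_aux (k r : ℕ) : 4 * r ≠ aux k := by unfold aux; omega

@[simp] lemma aux_ne_cell (k S q i : ℕ) : aux k ≠ cell S q i := by unfold aux cell; omega

@[simp] lemma cell_ne_aux (k S q i : ℕ) : cell S q i ≠ aux k := by unfold aux cell; omega

@[simp] lemma reg_ne_cell (r S q i : ℕ) : 4 * r ≠ cell S q i := by unfold cell; omega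

@[simp] lemma cell_ne_reg (r S q i : ℕ) : cell S q i ≠ 4 * r := by unfold cell; omega

lemma cell_inj {S q q' i i' : ℕ} (hq : q < S) (hq' : q' < S) :
    cell S q i = cell S q' i' ↔ q = q' ∧ i = i' := by
  constructor
  · intro h
    have h : i * S + q = i' * S + q' := by unfold cell at h; omega
    have h1 : (i * S + q) % S = q := by rw [Nat.mul_add_mod_self_right, Nat.mod_eq_of_lt hq]
    have h2 : (i' * S + q') % S = q' := by rw [Nat.mul_add_mod_self_right, Nat.mod_eq_of_lt hq']
    have hqq : q = q' := by rw [← h1, h, h2]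
    subst hqq; exact ⟨rfl, Nat.eq_of_mul_eq_mul_right (by omega) (Nat.add_right_cancel h)⟩
  · rintro ⟨rfl, rfl⟩; rfl

/-- The memory `mem` represents the state `st`, and the auxiliary registers from `k` on are zero. -/
structure Rep (L : Layout ι κ) (st : St ι κ) (k : ℕ) (mem : ℕ →₀ ℕ) : Prop where
  reg : ∀ r, mem (4 * L.reg r) = st.reg r
  arr : ∀ q, L.arr q < L.S → ∀ i, mem (cell L.S (L.arr q) i) = st.arr q i
  aux : ∀ j, k ≤ j → mem (aux j) = 0
  other : ∀ a, mem a ≠ 0 → (∃ r, a = 4 * L.reg r) ∨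
    (∃ q, L.arr q < L.S ∧ ∃ i, a = cell L.S (L.arr q) i) ∨ ∃ j, a = SubsetSum.aux j

lemma Rep.update_aux {L : Layout ι κ} {st : St ι κ} {k : ℕ} {mem : ℕ →₀ ℕ} (h : Rep L st k mem)
    (v : ℕ) : Rep L st (k + 1) (mem.update (SubsetSum.aux k) v) where
  reg r := by simpa [Function.update_apply] using h.reg r
  arr q hq i := by simpa [Function.update_apply] using h.arr q hq i
  aux j hj := by simpa [Function.update_apply, show j ≠ k by omega] using h.aux j (by omega)
  other a ha := by
    simp only [Finsupp.coe_update, Function.update_apply] at ha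
    split_ifs at ha with h'
    · exact .inr (.inr ⟨k, h'⟩)
    · exact h.other a ha

lemma Goes.address {S q i k : ℕ} {pc n : ℕ} {mem : ℕ →₀ ℕ}
    (hP : CodeAt P pc (addressCode S q k)) (hk : aux (k + 1) < A) (hA : A ≤ 2 ^ V) (hS : S + 4 ≤ 2 ^ V) (hq : q < S)
    (hi : cell S q i < A) (h₀ : mem (aux k) = i) (h₁ : mem (aux (k + 1)) = 0) :
    Goes E P A V 8 pc mem n 8 (mem.update (aux k) (cell S q i)) := by
  have hk0 : aux k < A := by unfold aux at *; omega
  have hc : 2 * (i * S + q) + 1 < 2 ^ V := by unfold cell at hi; omega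
  simp only [addressCode, CodeAt] at hP
  obtain ⟨p1, p2, p3, p4, p5, p6, p7, p8, -⟩ := hP
  refine Goes.cast ((Goes.const p1 hk (by omega)).trans <|
    (Goes.op (o := .mul) p2 hk0 ?_).trans <|
    (Goes.const p3 hk (by omega)).trans <|
    (Goes.op (o := .add) p4 hk0 ?_).trans <|
    (Goes.op (o := .add) p5 hk0 ?_).trans <|
    (Goes.const p6 hk (by omega)).trans <|
    (Goes.op (o := .add) p7 hk0 ?_).trans <|
    (Goes.const p8 hk (by positivity))) le_rfl (by rfl) ?_
  · simp [Op.eval, h₀]; omega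
  · simp [Op.eval, h₀]; omega
  · simp [Op.eval, h₀]; omega
  · simp [Op.eval, h₀]; omega
  · ext a
    simp only [Finsupp.coe_update, Function.update_apply, Op.eval, h₀]
    split_ifs <;> simp_all
    unfold cell; omega

/-- Compiled expressions write their value to the given auxiliary register and change nothing
else. -/
theorem Expr.goes (L : Layout ι κ) (hA : A ≤ 2 ^ V) (hS : L.S + 4 ≤ 2 ^ V) (hσ : E.σ ≤ 1)
    (st : St ι κ) (e : Expr ι κ) (k pc n : ℕ) (mem : ℕ →₀ ℕ)
    (hP : CodeAt P pc (e.code L k)) (hr : Rep L st k mem) (hok : e.Ok L A V E st) (ht : e.top L k ≤ A) :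
    Goes E P A V e.len pc mem n e.len (mem.update (SubsetSum.aux k) (e.eval E st)) := by
  induction e generalizing k pc mem with
  | const v =>
    refine Goes.const hP.1 ?_ hok
    simp only [Expr.top, aux] at *; omega
  | reg r =>
    have hk : aux k < A := by simp only [Expr.top, aux] at *; omega
    have h0 : mem (aux (k + 1)) = 0 := hr.aux _ (by omega)
    refine Goes.intro fun w => (Goes.op (o := .add) hP.1 hk ?_).cast le_rfl rfl ?_
    · simpa [h0, Op.eval] using w.lt _
    · simp [Op.eval, h0, hr.reg, Expr.eval]
  | bin o a b iha ihb =>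
    simp only [Expr.code, codeAt_append, Expr.code_length, Expr.top, Expr.Ok] at *
    have hk : aux (k + 1) < A := by simp only [aux] at *; omega
    have hk0 : aux k < A := by simp only [aux] at *; omega
    obtain ⟨pa, pb, p1, p2, -⟩ := hP
    refine Goes.cast ((iha k pc mem pa hr hok.1 (by omega)).trans <|
      Goes.intro fun w => (ihb (k + 1) _ _ pb (hr.update_aux _) hok.2.1 (by omega)).trans <|
      (Goes.op (o := o) p1 hk0 ?_).trans <|
      (Goes.const p2 hk (by positivity))) ?_ ?_ ?_
    · simpa [Function.update_apply] using hok.2.2.lt (by simpa using w.lt (aux k))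
    · simp only [Expr.len]; omega
    · simp only [Expr.len]; omega
    · have h0 : mem (aux (k + 1)) = 0 := hr.aux _ (by omega)
      ext x
      simp only [Finsupp.coe_update, Function.update_apply, Expr.eval]
      split_ifs <;> simp_all
  | load q e ih =>
    simp only [Expr.code, codeAt_append, Expr.code_length, addressCode_length, Expr.top,
      Expr.Ok] at *
    have hk : aux (k + 1) < A := by simp only [aux] at *; omega
    have hk0 : aux k < A := by simp only [aux] at *; omega
    obtain ⟨pe, pa, p1, -⟩ := hP
    have h0 : mem (aux (k + 1)) = 0 := hr.aux _ (by omega)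
    refine Goes.cast ((ih k pc mem pe hr hok.1 (by omega)).trans <|
      (Goes.address (i := e.eval E st) pa hk hA hS hok.2.1 hok.2.2 ?_ ?_).trans <|
      (Goes.load p1 hk0)) ?_ ?_ ?_
    · simp
    · simp [h0]
    · simp only [Expr.len]; omega
    · simp only [Expr.len]
    · have := hr.arr q hok.2.1 (e.eval E st)
      ext x
      simp only [Finsupp.coe_update, Function.update_apply, Expr.eval]
      split_ifs <;> simp_all
  | input e ih =>
    simp only [Expr.code, codeAt_append, Expr.code_length, Expr.top, Expr.Ok] at *
    have hk0 : aux k < A := by simp only [aux] at *; omega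
    obtain ⟨pe, p1, -⟩ := hP
    refine Goes.cast ((ih k pc mem pe hr hok.1 (by omega)).trans <|
      (Goes.read p1 hk0 ?_)) ?_ ?_ ?_
    · simpa using hok.2
    · simp only [Expr.len]; omega
    · simp only [Expr.len]
    · ext x
      simp only [Finsupp.coe_update, Function.update_apply, Expr.eval]
      split_ifs <;> simp_all
  | scale e ih =>
    simp only [Expr.code, codeAt_append, Expr.code_length, Expr.top, Expr.Ok] at *
    have hk0 : aux k < A := by simp only [aux] at *; omega
    obtain ⟨pe, p1, -⟩ := hP
    refine Goes.cast ((ih k pc mem pe hr hok (by omega)).trans <|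
      (Goes.scale p1 hk0 hσ)) ?_ ?_ ?_
    · simp only [Expr.len]; omega
    · simp only [Expr.len]
    · ext x
      simp only [Finsupp.coe_update, Function.update_apply, Expr.eval]
      split_ifs <;> simp_all

section

variable {ι κ : Type} {E : Env} {P : Program} {A V : ℕ}

lemma Rep.set [DecidableEq ι] {L : Layout ι κ} {st : St ι κ} {k : ℕ} {mem : ℕ →₀ ℕ} (h : Rep L st k mem) (r : ι)
    (v : ℕ) : Rep L (st.set r v) k (mem.update (4 * L.reg r) v) where
  reg r' := by
    have : 4 * L.reg r' = 4 * L.reg r ↔ r' = r :=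
      ⟨fun e => L.reg_inj (by omega), fun e => by rw [e]⟩
    simp only [Finsupp.coe_update, Function.update_apply, this, St.set]
    split_ifs
    · rfl
    · exact h.reg r'
  arr q hq i := by simpa [Function.update_apply, St.set] using h.arr q hq i
  aux j hj := by simpa [Function.update_apply] using h.aux j hj
  other a ha := by
    simp only [Finsupp.coe_update, Function.update_apply] at ha
    split_ifs at ha with h'
    · exact .inl ⟨r, h'⟩
    · exact h.other a ha

lemma Rep.put [DecidableEq κ] {L : Layout ι κ} {st : St ι κ} {k : ℕ} {mem : ℕ →₀ ℕ} (h : Rep L st k mem) (q : κ)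
    (hq : L.arr q < L.S) (i v : ℕ) :
    Rep L (st.put q i v) k (mem.update (cell L.S (L.arr q) i) v) where
  reg r' := by simpa [Function.update_apply, St.put] using h.reg r'
  arr q' hq' i' := by
    have e : cell L.S (L.arr q') i' = cell L.S (L.arr q) i ↔ q' = q ∧ i' = i := by
      rw [cell_inj hq' hq, L.arr_inj.eq_iff]
    simp only [Finsupp.coe_update, Function.update_apply, e, St.put]
    by_cases h1 : q' = q
    · subst h1
      by_cases h2 : i' = i
      · simp [h2]
      · simpa [h2] using h.arr q' hq' i'
    · simpa [h1] using h.arr q' hq' i'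
  aux j hj := by simpa [Function.update_apply] using h.aux j hj
  other a ha := by
    simp only [Finsupp.coe_update, Function.update_apply] at ha
    split_ifs at ha with h'
    · exact .inr (.inl ⟨q, hq, i, h'⟩)
    · exact h.other a ha

lemma Rep.mono {L : Layout ι κ} {st : St ι κ} {k k' : ℕ} {mem : ℕ →₀ ℕ} (h : Rep L st k mem)
    (hk : k ≤ k') : Rep L st k' mem :=
  ⟨h.reg, h.arr, fun j hj => h.aux j (hk.trans hj), h.other⟩

/-- The content of the control register of a loop after `j` rounds. -/
def countdown (h : Bool) (v j : ℕ) : ℕ := if h then v / 2 ^ j else v - j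

lemma countdown_ne_zero {h : Bool} {v j : ℕ} (hj : j < rounds h v) : countdown h v j ≠ 0 := by
  cases h
  · simp [countdown, rounds] at *; omega
  · simp only [countdown, rounds, if_true] at *
    exact (Nat.div_pos (Nat.lt_size.1 hj) (by positivity)).ne'

lemma countdown_rounds (h : Bool) (v : ℕ) : countdown h v (rounds h v) = 0 := by
  cases h
  · simp [countdown, rounds]
  · simp only [countdown, rounds, if_true]; exact Nat.div_eq_of_lt (Nat.lt_size_self v)

lemma countdown_succ (h : Bool) (v j : ℕ) : countdown h v (j + 1) =
    (if h then Op.div else Op.sub).eval (countdown h v j) (if h then 2 else 1) := by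
  cases h
  · simp [countdown, Op.eval]; omega
  · simp [countdown, Op.eval, Nat.div_div_eq_div_mul, pow_succ]

lemma countdown_le (h : Bool) (v j : ℕ) : countdown h v j ≤ v := by
  cases h
  · simp [countdown]
  · simpa [countdown] using Nat.div_le_self _ _

lemma rounds_le (h : Bool) (v : ℕ) : rounds h v ≤ v := by
  cases h
  · simp [rounds]
  · simpa [rounds] using Nat.size_le.2 Nat.lt_two_pow_self

lemma Reach.jump {pc n t r k : ℕ} {mem : ℕ →₀ ℕ} (hi : P[pc]? = some (.jumpZero r k))
    (hr : mem r = 0) (hw : Within A V mem) :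
    Reach E P A V 1 ⟨pc, mem, n, t⟩ ⟨k, mem, n, t + 1⟩ := by
  refine Reach.single hi ?_ ?_ hw hw
  · simp [Config.exec, hr]
  · simpa using Nat.one_le_pow _ _ (by omega)

/-- The update of the control registers of a loop at the end of a round. -/
lemma Goes.loop_tail {pc n k v j : ℕ} {m : ℕ →₀ ℕ} {h : Bool}
    (hP : CodeAt P pc [.const (aux (k + 2)) 1, .add (aux (k + 1)) (aux (k + 1)) (aux (k + 2)),
        .const (aux (k + 2)) (if h then 2 else 1),
        if h then .div (aux k) (aux k) (aux (k + 2)) else .sub (aux k) (aux k) (aux (k + 2)),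
        .const (aux (k + 2)) 0])
    (hk : aux k < A) (hk1 : aux (k + 1) < A) (hk2 : aux (k + 2) < A) (hV : 4 ≤ 2 ^ V)
    (hv : v < 2 ^ V) (hj : j + 1 < 2 ^ V) (e₀ : m (aux k) = countdown h v j)
    (e₁ : m (aux (k + 1)) = j) (e₂ : m (aux (k + 2)) = 0) :
    Goes E P A V 5 pc m n 5
      ((m.update (aux (k + 1)) (j + 1)).update (aux k) (countdown h v (j + 1))) := by
  obtain ⟨q1, q2, q3, q4, q5, -⟩ := hP
  have hcd : countdown h v (j + 1) < 2 ^ V := lt_of_le_of_lt (countdown_le _ _ _) hv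
  have q4' : P[pc + 1 + 1 + 1]? = some
      ((if h then Op.div else Op.sub).instr (aux k) (aux k) (aux (k + 2))) := by
    rw [q4]
    cases h <;> rfl
  refine Goes.cast ((Goes.const q1 hk2 (by omega)).trans <| (Goes.op (o := .add) q2 hk1 ?_).trans <|
    (Goes.const q3 hk2 ?_).trans <| (Goes.op (o := if h then .div else .sub) q4' hk ?_).trans <|
    (Goes.const q5 hk2 (by positivity))) le_rfl (by rfl) ?_
  · simpa [Op.eval, Function.update_apply, e₁] using hj
  · split_ifs <;> omega
  · rw [countdown_succ] at hcd
    simpa [Function.update_apply, e₀] using hcd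
  · rw [countdown_succ]
    ext x
    by_cases h0 : x = aux k
    · subst h0; simp [e₀]
    by_cases h1 : x = aux (k + 1)
    · subst h1; simp [e₁, Op.eval]
    by_cases h2 : x = aux (k + 2)
    · subst h2; simp [e₂]
    · simp [h0, h1, h2]

/-- Compiled statements have the effect given by `Stmt.denote`, within the given resources. -/
theorem Stmt.run [DecidableEq ι] [DecidableEq κ] (L : Layout ι κ) (hA : A ≤ 2 ^ V) (hS : L.S + 4 ≤ 2 ^ V) (hσ : E.σ ≤ 1)
    (s : Stmt ι κ) (k pc : ℕ) (st : St ι κ) (mem : ℕ →₀ ℕ) (t : ℕ)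
    (hP : CodeAt P pc (s.code L k pc)) (hw : Within A V mem) (hr : Rep L st k mem)
    (hok : s.Ok L A V E st) (ht : s.top L k ≤ A) :
    ∃ mem' t', Reach E P A V (s.steps E st) ⟨pc, mem, st.coins, t⟩
        ⟨pc + s.len, mem', (s.denote E st).coins, t'⟩ ∧
      Rep L (s.denote E st) k mem' ∧ ∀ j < k, mem' (SubsetSum.aux j) = mem (SubsetSum.aux j) := by
  induction s generalizing k pc st mem t with
  | skip => exact ⟨mem, t, Reach.refl hw, hr, fun _ _ => rfl⟩
  | assign r e =>
    simp only [Stmt.code, codeAt_append, Expr.code_length, Stmt.top, Stmt.Ok] at *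
    obtain ⟨pe, p1, p2, -⟩ := hP
    have hk : aux k < A := by simp only [aux] at *; omega
    have h1 : mem (aux (k + 1)) = 0 := hr.aux _ (by omega)
    have h0 : mem (aux k) = 0 := hr.aux _ (by omega)
    have key : Goes E P A V (e.len + 2) pc mem st.coins (e.len + 2)
        (mem.update (4 * L.reg r) (e.eval E st)) := by
      refine Goes.cast ((Expr.goes L hA hS hσ st e k _ _ mem pe hr hok (by omega)).trans <|
        Goes.intro fun w => (Goes.op (o := .add) p1 (by omega) ?_).trans
        (Goes.const p2 hk (by positivity))) (by omega) (by omega) ?_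
      · simpa [Op.eval, Function.update_apply, h1] using w.lt (aux k)
      · ext x
        simp only [Finsupp.coe_update, Function.update_apply, Op.eval]
        split_ifs <;> simp_all
    obtain ⟨t', h⟩ := key hw t
    exact ⟨_, t', h, hr.set r _, fun j hj => by simp⟩
  | store q e₁ e₂ =>
    simp only [Stmt.code, codeAt_append, Expr.code_length, addressCode_length, Stmt.top,
      Stmt.Ok] at *
    obtain ⟨pe, pa, pe', p1, p2, p3, -⟩ := hP
    have hk : aux (k + 1) < A := by simp only [aux] at *; omega
    have hk0 : aux k < A := by simp only [aux] at *; omega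
    have h1 : mem (aux (k + 1)) = 0 := hr.aux _ (by omega)
    have h0 : mem (aux k) = 0 := hr.aux _ (by omega)
    have key : Goes E P A V (e₁.len + e₂.len + 11) pc mem st.coins (e₁.len + e₂.len + 11)
        (mem.update (cell L.S (L.arr q) (e₁.eval E st)) (e₂.eval E st)) := by
      refine Goes.cast ((Expr.goes L hA hS hσ st e₁ k _ _ mem pe hr hok.1 (by omega)).trans <|
        (Goes.address (i := e₁.eval E st) pa hk hA hS hok.2.2.1 hok.2.2.2 (by simp)
          (by simp [h1])).trans <|
        (Expr.goes L hA hS hσ st e₂ (k + 1) _ _ _ pe' ?_ hok.2.1 (by omega)).trans <|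
        (Goes.store p1 ?_).trans <| (Goes.const p2 hk (by positivity)).trans
        (Goes.const p3 hk0 (by positivity))) (by omega) (by omega) ?_
      · simpa using hr.update_aux (cell L.S (L.arr q) (e₁.eval E st))
      · simpa [Function.update_apply, cell] using hok.2.2.2
      · ext x
        simp only [Finsupp.coe_update, Function.update_apply]
        split_ifs <;> simp_all
    obtain ⟨t', h⟩ := key hw t
    exact ⟨_, t', h, hr.put q hok.2.2.1 _ _, fun j hj => by simp⟩
  | flip r =>
    have hrA : 4 * L.reg r < A := by simp only [Stmt.top] at ht; omega
    have hv : (E.ω st.coins).toNat < 2 ^ V := by have := Bool.toNat_lt (E.ω st.coins); omega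
    have hr' := hr.set r (E.ω st.coins).toNat
    refine ⟨mem.update (4 * L.reg r) (E.ω st.coins).toNat, t + 1,
      Reach.single hP.1 rfl ?_ hw (hw.update hrA hv), ⟨hr'.reg, hr'.arr, hr'.aux, hr'.other⟩,
      fun j hj => by simp⟩
    simpa using Nat.one_le_pow _ _ (by omega)
  | seq s₁ s₂ ih₁ ih₂ =>
    simp only [Stmt.code, codeAt_append, Stmt.code_length, Stmt.top, Stmt.Ok] at *
    obtain ⟨m₁, t₁, h₁, r₁, f₁⟩ := ih₁ k pc st mem t hP.1 hw hr hok.1 (by omega)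
    obtain ⟨m₂, t₂, h₂, r₂, f₂⟩ := ih₂ k _ _ m₁ t₁ hP.2 h₁.within r₁ hok.2 (by omega)
    refine ⟨m₂, t₂, ?_, r₂, fun j hj => (f₂ j hj).trans (f₁ j hj)⟩
    have := h₁.trans h₂
    simpa [Stmt.len, Stmt.denote, Stmt.steps, Nat.add_assoc] using this
  | ifz e s₁ s₂ ih₁ ih₂ =>
    simp only [Stmt.code, codeAt_append, Expr.code_length, Stmt.code_length, Stmt.top,
      Stmt.Ok, List.length_cons, List.length_nil] at *
    obtain ⟨pe, ⟨p1, p2, -⟩, ps₂, ⟨p3, -⟩, ps₁⟩ := hP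
    have hk0 : aux k < A := by simp only [aux] at *; omega
    have h0 : mem (aux k) = 0 := hr.aux _ (by omega)
    by_cases hz : e.eval E st = 0
    · have key : Goes E P A V (e.len + 1) pc mem st.coins (e.len + s₂.len + 3) mem := by
        have hm : mem.update (aux k) (e.eval E st) = mem := by
          ext x
          simp only [Finsupp.coe_update, Function.update_apply]
          split_ifs <;> simp_all
        have hg := Expr.goes L hA hS hσ st e k pc st.coins mem pe hr hok.1 (by omega)
        rw [hm] at hg
        refine Goes.cast (hg.trans (Goes.jump (d := s₂.len + 3) p1 ?_)) le_rfl (by omega) rfl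
        rw [if_pos h0]; omega
      obtain ⟨t', h⟩ := key hw t
      have ps : CodeAt P (pc + e.len + s₂.len + 3) (s₁.code L k (pc + e.len + s₂.len + 3)) := by
        convert ps₁ using 1
        omega
      obtain ⟨m₁, t₁, h₁, r₁, f₁⟩ := ih₁ k _ st mem t' ps hw hr (hok.2.1 hz) (by omega)
      refine ⟨m₁, t₁, ?_, by simpa [Stmt.denote, hz] using r₁, f₁⟩
      have hs : e.len + 1 + s₁.steps E st ≤ Stmt.steps E (.ifz e s₁ s₂) st := by
        simp only [Stmt.steps, hz, if_true]; omega
      have hpc : pc + (e.len + s₂.len + 3) = pc + e.len + s₂.len + 3 := by omega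
      rw [hpc] at h
      have h₂ := (h.trans h₁).mono hs
      simp only [Stmt.denote, Stmt.len, hz, if_true]
      convert h₂ using 2
      omega
    · have key : Goes E P A V (e.len + 2) pc mem st.coins (e.len + 2) mem := by
        refine Goes.cast ((Expr.goes L hA hS hσ st e k pc st.coins mem pe hr hok.1 (by omega)).trans <|
          (Goes.jump (d := 1) p1 ?_).trans (Goes.const p2 hk0 (by positivity))) (by omega)
          (by omega) ?_
        · simp [hz]
        · ext x
          simp only [Finsupp.coe_update, Function.update_apply]
          split_ifs <;> simp_all
      obtain ⟨t', h⟩ := key hw t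
      obtain ⟨m₁, t₁, h₁, r₁, f₁⟩ := ih₂ k _ st mem t' ps₂ hw hr (hok.2.2 hz) (by omega)
      have hj : Goes E P A V 1 (pc + (e.len + 2) + s₂.len) m₁ (s₂.denote E st).coins (s₁.len + 1)
          m₁ := by
        refine Goes.jump (r := aux k) (k := pc + e.len + s₂.len + 3 + s₁.len) ?_ ?_
        · rw [← p3]; congr 1
        · rw [if_pos (r₁.aux k le_rfl)]; omega
      obtain ⟨t₂, h₂⟩ := hj h₁.within t₁
      refine ⟨m₁, t₂, ?_, by simpa [Stmt.denote, hz] using r₁, f₁⟩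
      have hs : e.len + 2 + (s₂.steps E st + 1) ≤ Stmt.steps E (.ifz e s₁ s₂) st := by
        simp only [Stmt.steps, hz, if_false]; omega
      have h₃ := (h.trans (h₁.trans h₂)).mono hs
      simp only [Stmt.denote, Stmt.len, hz, if_false]
      convert h₃ using 2
      omega
  | loop h i u s ih =>
    simp only [Stmt.code, codeAt_append, Stmt.code_length, Stmt.top, Stmt.Ok, List.length_cons,
      List.length_nil] at *
    obtain ⟨⟨p1, p2, p3, -⟩, ps, q1, q2, q3, q4, q5, q6, q7, -⟩ := hP
    have hk : aux k < A := by simp only [aux] at *; omega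
    have hk1 : aux (k + 1) < A := by simp only [aux] at *; omega
    have hk2 : aux (k + 2) < A := by simp only [aux] at *; omega
    have h0 : mem (aux k) = 0 := hr.aux _ (by omega)
    have h1 : mem (aux (k + 1)) = 0 := hr.aux _ (by omega)
    have h2 : mem (aux (k + 2)) = 0 := hr.aux _ (by omega)
    have hu : st.reg u < 2 ^ V := by rw [← hr.reg]; exact hw.lt _
    have main : ∀ j ≤ rounds h (st.reg u), ∃ mem' t', Reach E P A V
        (1 + ∑ x ∈ Finset.range j, (s.steps E ((s.iter E i st x).set i x) + 8))
        ⟨pc, mem, st.coins, t⟩ ⟨pc + 1, mem', (s.iter E i st j).coins, t'⟩ ∧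
        Rep L (s.iter E i st j) (k + 2) mem' ∧ mem' (aux k) = countdown h (st.reg u) j ∧
        mem' (aux (k + 1)) = j ∧ ∀ x < k, mem' (aux x) = mem (aux x) := by
      intro j
      induction j with
      | zero =>
        intro _
        have key : Goes E P A V 1 pc mem st.coins 1 (mem.update (aux k) (st.reg u)) := by
          refine Goes.cast (Goes.op (o := .add) p1 hk ?_) le_rfl rfl ?_
          · simpa [Op.eval, hr.reg, h1] using hu
          · simp [Op.eval, hr.reg, h1]
        obtain ⟨t', h'⟩ := key hw t
        refine ⟨_, t', by simpa [Stmt.iter] using h', (hr.update_aux _).mono (by omega), ?_, ?_, ?_⟩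
        · simp [countdown]
        · simp [h1]
        · intro x hx
          simp [show x ≠ k by omega]
      | succ j ihj =>
        intro hj
        obtain ⟨m₁, t₁, r₁, R₁, c₁, d₁, f₁⟩ := ihj (by omega)
        have hjV : j + 1 < 2 ^ V := lt_of_le_of_lt (hj.trans (rounds_le _ _)) hu
        have z₂ : m₁ (aux (k + 2)) = 0 := R₁.aux _ (by omega)
        have enter : Goes E P A V 2 (pc + 1) m₁ (s.iter E i st j).coins 2
            (m₁.update (4 * L.reg i) j) := by
          refine Goes.cast ((Goes.jump (d := 1) p2 ?_).trans
            (Goes.op (o := .add) p3 (by omega) ?_)) le_rfl rfl ?_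
          · rw [if_neg]; rw [c₁]; exact countdown_ne_zero (by omega)
          · simp only [Op.eval, d₁, z₂]; omega
          · simp [Op.eval, d₁, z₂]
        obtain ⟨t₂, r₂⟩ := enter r₁.within t₁
        obtain ⟨m₃, t₃, r₃, R₃, f₃⟩ := ih (k + 2) (pc + 3) ((s.iter E i st j).set i j) _ t₂
          ps r₂.within (R₁.set i j) (hok j (by omega)) (by omega)
        replace R₃ : Rep L (s.iter E i st (j + 1)) (k + 2) m₃ := R₃
        have e₀ : m₃ (aux k) = countdown h (st.reg u) j := by
          rw [f₃ k (by omega)]; simpa [Function.update_apply] using c₁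
        have e₁ : m₃ (aux (k + 1)) = j := by
          rw [f₃ (k + 1) (by omega)]; simpa [Function.update_apply] using d₁
        have e₂ : m₃ (aux (k + 2)) = 0 := R₃.aux _ (by omega)
        have tail := Goes.loop_tail (E := E) (n := (s.iter E i st (j + 1)).coins) (m := m₃) (j := j)
          ⟨q1, q2, q3, q4, q5, trivial⟩ hk hk1 hk2 (by omega) hu hjV e₀ e₁ e₂
        obtain ⟨t₄, r₄⟩ := tail r₃.within t₃
        refine ⟨_, _, (((r₁.trans r₂).trans r₃).trans (r₄.trans (Reach.jump (r := aux (k + 2))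
          (k := pc + 1) ?_ ?_
          r₄.within))).mono ?_, ?_, ?_, ?_, ?_⟩
        · exact q6
        · simpa using e₂
        · rw [Finset.sum_range_succ]; omega
        · refine ⟨fun r => ?_, fun q hq x => ?_, fun x hx => ?_, fun a ha => ?_⟩
          · simpa using R₃.reg r
          · simpa using R₃.arr q hq x
          · simpa [Function.update_apply, show x ≠ k by omega, show x ≠ k + 1 by omega]
              using R₃.aux x hx
          · by_cases hx : ∃ j, a = aux j
            · exact .inr (.inr hx)
            · simp only [not_exists] at hx
              exact R₃.other a (by simpa [Function.update_apply, hx] using ha)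
        · simp
        · simp
        · intro x hx
          rw [← f₁ x hx]
          have := f₃ x (by omega)
          simpa [Function.update_apply, show x ≠ k by omega, show x ≠ k + 1 by omega] using this
    obtain ⟨m₁, t₁, r₁, R₁, c₁, d₁, f₁⟩ := main _ le_rfl
    have fin : Goes E P A V 2 (pc + 1) m₁ (s.iter E i st (rounds h (st.reg u))).coins (s.len + 9)
        (m₁.update (aux (k + 1)) 0) := by
      refine Goes.cast ((Goes.jump (d := s.len + 8) p2 ?_).trans
        (Goes.const (r := aux (k + 1)) (v := 0) ?_ hk1 (by positivity))) le_rfl rfl rfl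
      · rw [if_pos]
        · omega
        · rw [c₁]; exact countdown_rounds _ _
      · rw [← q7]; congr 1; omega
    obtain ⟨t₂, r₂⟩ := fin r₁.within t₁
    have hden : (Stmt.loop h i u s).denote E st = s.iter E i st (rounds h (st.reg u)) := rfl
    rw [hden]
    refine ⟨m₁.update (aux (k + 1)) 0, t₂, ?_, ⟨fun r => ?_, fun q hq x => ?_, fun x hx => ?_,
      fun a ha => ?_⟩, ?_⟩
    · have hs : 1 + ∑ x ∈ Finset.range (rounds h (st.reg u)),
          (s.steps E ((s.iter E i st x).set i x) + 8) + 2 ≤ Stmt.steps E (.loop h i u s) st := by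
        simp only [Stmt.steps]; omega
      have hpc : pc + 1 + (s.len + 9) = pc + (s.len + 10) := by omega
      rw [hpc] at r₂; exact (r₁.trans r₂).mono hs
    · simpa using R₁.reg r
    · simpa using R₁.arr q hq x
    · by_cases h1 : x = k + 1
      · simp [h1]
      · by_cases h2 : x = k
        · subst h2
          simpa [Function.update_apply, c₁] using countdown_rounds _ _
        · simpa [Function.update_apply, h1] using R₁.aux x (by omega)
    · by_cases hx : ∃ j, a = aux j
      · exact .inr (.inr hx)
      · simp only [not_exists] at hx
        exact R₁.other a (by simpa [Function.update_apply, hx] using ha)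
    · intro x hx
      simpa [Function.update_apply, show x ≠ k + 1 by omega] using f₁ x hx

end

/-! ### Reasoning about programs of the loop language -/

section

variable {ι κ : Type}

instance : Add (Expr ι κ) := ⟨.bin .add⟩
instance : Sub (Expr ι κ) := ⟨.bin .sub⟩
instance : Mul (Expr ι κ) := ⟨.bin .mul⟩
instance : Div (Expr ι κ) := ⟨.bin .div⟩
instance : Mod (Expr ι κ) := ⟨fun a b => a - a / b * b⟩

section eval

variable (E : Env) (st : St ι κ) (a b : Expr ι κ)

@[simp] lemma Expr.eval_const (c : ℕ) : (Expr.const c : Expr ι κ).eval E st = c := rfl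
@[simp] lemma Expr.eval_reg (r : ι) : (Expr.reg r : Expr ι κ).eval E st = st.reg r := rfl
@[simp] lemma Expr.eval_load (q : κ) : (Expr.load q a).eval E st = st.arr q (a.eval E st) := rfl
@[simp] lemma Expr.eval_input : (Expr.input a).eval E st = E.inp (a.eval E st) := rfl
@[simp] lemma Expr.eval_add : (a + b).eval E st = a.eval E st + b.eval E st := rfl
@[simp] lemma Expr.eval_sub : (a - b).eval E st = a.eval E st - b.eval E st := rfl
@[simp] lemma Expr.eval_mul : (a * b).eval E st = a.eval E st * b.eval E st := rfl
@[simp] lemma Expr.eval_div : (a / b).eval E st = a.eval E st / b.eval E st := rfl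

@[simp] lemma Expr.eval_mod : (a % b).eval E st = a.eval E st % b.eval E st := by
  change a.eval E st - a.eval E st / b.eval E st * b.eval E st = _
  have := Nat.div_add_mod' (a.eval E st) (b.eval E st); omega

variable (L : Layout ι κ) (A V : ℕ)

@[simp] lemma Expr.ok_const (c : ℕ) : (Expr.const c : Expr ι κ).Ok L A V E st ↔ c < 2 ^ V := Iff.rfl
@[simp] lemma Expr.ok_reg (r : ι) : (Expr.reg r : Expr ι κ).Ok L A V E st ↔ True := Iff.rfl
@[simp] lemma Expr.ok_load (q : κ) : (Expr.load q a).Ok L A V E st ↔ a.Ok L A V E st ∧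
    L.arr q < L.S ∧ 2 * (a.eval E st * L.S + L.arr q) + 1 < A := Iff.rfl
@[simp] lemma Expr.ok_input : (Expr.input a).Ok L A V E st ↔
    a.Ok L A V E st ∧ E.inp (a.eval E st) < 2 ^ V := Iff.rfl
@[simp] lemma Expr.ok_add : (a + b).Ok L A V E st ↔
    a.Ok L A V E st ∧ b.Ok L A V E st ∧ a.eval E st + b.eval E st < 2 ^ V := Iff.rfl
@[simp] lemma Expr.ok_mul : (a * b).Ok L A V E st ↔
    a.Ok L A V E st ∧ b.Ok L A V E st ∧ a.eval E st * b.eval E st < 2 ^ V := Iff.rfl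
@[simp] lemma Expr.ok_sub : (a - b).Ok L A V E st ↔ a.Ok L A V E st ∧ b.Ok L A V E st := by
  change _ ∧ _ ∧ True ↔ _; simp
@[simp] lemma Expr.ok_div : (a / b).Ok L A V E st ↔ a.Ok L A V E st ∧ b.Ok L A V E st := by
  change _ ∧ _ ∧ True ↔ _; simp

variable {E st a b L A V}

lemma Expr.ok_mod (ha : a.Ok L A V E st) (hb : b.Ok L A V E st) (h : a.eval E st < 2 ^ V) :
    (a % b).Ok L A V E st := by
  change (a - a / b * b).Ok L A V E st
  simp only [ok_sub, ok_mul, ok_div, eval_div]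
  exact ⟨ha, ⟨ha, hb⟩, hb, lt_of_le_of_lt (Nat.div_mul_le_self _ _) h⟩

end eval

/-- The statement may assign to the register `r`. -/
def Stmt.Asg : Stmt ι κ → ι → Prop
  | .skip, _ => False
  | .assign r _, x => x = r
  | .store _ _ _, _ => False
  | .flip r, x => x = r
  | .seq s₁ s₂, x => s₁.Asg x ∨ s₂.Asg x
  | .ifz _ s₁ s₂, x => s₁.Asg x ∨ s₂.Asg x
  | .loop _ i _ s, x => x = i ∨ s.Asg x

/-- The statement may write to the array `q`. -/
def Stmt.Wr : Stmt ι κ → κ → Prop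
  | .skip, _ => False
  | .assign _ _, _ => False
  | .store q _ _, x => x = q
  | .flip _, _ => False
  | .seq s₁ s₂, x => s₁.Wr x ∨ s₂.Wr x
  | .ifz _ s₁ s₂, x => s₁.Wr x ∨ s₂.Wr x
  | .loop _ _ _ s, x => s.Wr x

/-- The register `r` bounds a loop of the statement. -/
def Stmt.Bnd : Stmt ι κ → ι → Prop
  | .seq s₁ s₂, x => s₁.Bnd x ∨ s₂.Bnd x
  | .ifz _ s₁ s₂, x => s₁.Bnd x ∨ s₂.Bnd x
  | .loop _ _ u s, x => x = u ∨ s.Bnd x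
  | _, _ => False

/-- The registers not assigned to and the arrays not written to by `s` agree in two states. -/
structure Frame (s : Stmt ι κ) (st st' : St ι κ) : Prop where
  reg : ∀ r, ¬ s.Asg r → st'.reg r = st.reg r
  arr : ∀ q, ¬ s.Wr q → st'.arr q = st.arr q

variable [DecidableEq ι] [DecidableEq κ]

@[simp] lemma St.set_reg (st : St ι κ) (r x : ι) (v : ℕ) :
    (st.set r v).reg x = if x = r then v else st.reg x := by simp [St.set, Function.update_apply]

@[simp] lemma St.set_arr (st : St ι κ) (r : ι) (v : ℕ) : (st.set r v).arr = st.arr := rfl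

@[simp] lemma St.set_coins (st : St ι κ) (r : ι) (v : ℕ) : (st.set r v).coins = st.coins := rfl

@[simp] lemma St.put_reg (st : St ι κ) (q : κ) (i v : ℕ) : (st.put q i v).reg = st.reg := rfl

lemma St.put_arr (st : St ι κ) (q x : κ) (i j v : ℕ) :
    (st.put q i v).arr x j = if x = q ∧ j = i then v else st.arr x j := by
  unfold St.put
  by_cases h : x = q
  · subst h; simp [Function.update_apply]
  · simp [h]

variable {E : Env}

lemma Stmt.iter_frame_of (h : Bool) (i u : ι) (s : Stmt ι κ)
    (hs : ∀ st, Frame s st (s.denote E st)) (st : St ι κ) (n : ℕ) :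
    Frame (.loop h i u s) st (s.iter E i st n) := by
  induction n with
  | zero => exact ⟨fun _ _ => rfl, fun _ _ => rfl⟩
  | succ n ihn =>
    refine ⟨fun x hx => ?_, fun q hq => ?_⟩
    · have := ihn.reg x hx
      simp only [Stmt.Asg, not_or] at hx
      refine ((hs _).reg x hx.2).trans ?_
      rwa [St.set_reg, if_neg hx.1]
    · have := ihn.arr q hq
      simp only [Stmt.Wr] at hq; exact ((hs _).arr q hq).trans this

lemma Stmt.frame (s : Stmt ι κ) (st : St ι κ) : Frame s st (s.denote E st) := by
  induction s generalizing st with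
  | skip => exact ⟨fun _ _ => rfl, fun _ _ => rfl⟩
  | assign r e =>
    refine ⟨fun x hx => ?_, fun q hq => rfl⟩
    simp only [Stmt.Asg] at hx; simp [Stmt.denote, hx]
  | store q e₁ e₂ =>
    refine ⟨fun x hx => rfl, fun x hx => ?_⟩
    simp only [Stmt.Wr] at hx
    ext j
    simp [Stmt.denote, St.put_arr, hx]
  | flip r =>
    refine ⟨fun x hx => ?_, fun q hq => rfl⟩
    simp only [Stmt.Asg] at hx; exact (St.set_reg st r x (E.ω st.coins).toNat).trans (if_neg hx)
  | seq s₁ s₂ ih₁ ih₂ =>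
    refine ⟨fun x hx => ?_, fun q hq => ?_⟩
    · simp only [Stmt.Asg, not_or] at hx; exact ((ih₂ _).reg x hx.2).trans ((ih₁ _).reg x hx.1)
    · simp only [Stmt.Wr, not_or] at hq; exact ((ih₂ _).arr q hq.2).trans ((ih₁ _).arr q hq.1)
  | ifz e s₁ s₂ ih₁ ih₂ =>
    refine ⟨fun x hx => ?_, fun q hq => ?_⟩
    · simp only [Stmt.Asg, not_or] at hx
      simp only [Stmt.denote]
      split_ifs
      · exact (ih₁ _).reg x hx.1
      · exact (ih₂ _).reg x hx.2
    · simp only [Stmt.Wr, not_or] at hq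
      simp only [Stmt.denote]
      split_ifs
      · exact (ih₁ _).arr q hq.1
      · exact (ih₂ _).arr q hq.2
  | loop h i u s ih =>
    exact iter_frame_of h i u s ih st _

lemma Stmt.iter_frame (h : Bool) (i u : ι) (s : Stmt ι κ) (st : St ι κ) (n : ℕ) :
    Frame (.loop h i u s) st (s.iter E i st n) := iter_frame_of h i u s s.frame st n

/-- From the state `st`, the statement runs within the bounds `A` and `V`, and `Q` holds
afterwards. -/
def Stmt.Wp (L : Layout ι κ) (A V : ℕ) (E : Env) (s : Stmt ι κ) (st : St ι κ) (Q : St ι κ → Prop) :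
    Prop := s.Ok L A V E st ∧ Q (s.denote E st)

variable {L : Layout ι κ} {A V : ℕ} {Q Q' : St ι κ → Prop} {st : St ι κ} {s s₁ s₂ : Stmt ι κ}

lemma Stmt.Wp.mono (h : s.Wp L A V E st Q) (hQ : ∀ st', Frame s st st' → Q st' → Q' st') :
    s.Wp L A V E st Q' := ⟨h.1, hQ _ (s.frame st) h.2⟩

@[simp] lemma Stmt.wp_skip : (Stmt.skip).Wp L A V E st Q ↔ Q st := by
  simp [Wp, Ok, denote]

@[simp] lemma Stmt.wp_assign (r : ι) (e : Expr ι κ) : (Stmt.assign r e).Wp L A V E st Q ↔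
    e.Ok L A V E st ∧ Q (st.set r (e.eval E st)) := Iff.rfl

@[simp] lemma Stmt.wp_store (q : κ) (e₁ e₂ : Expr ι κ) : (Stmt.store q e₁ e₂).Wp L A V E st Q ↔
    (e₁.Ok L A V E st ∧ e₂.Ok L A V E st ∧ L.arr q < L.S ∧
      2 * (e₁.eval E st * L.S + L.arr q) + 1 < A) ∧
    Q (st.put q (e₁.eval E st) (e₂.eval E st)) := Iff.rfl

@[simp] lemma Stmt.wp_flip (r : ι) : (Stmt.flip r).Wp L A V E st Q ↔
    Q { st.set r (E.ω st.coins).toNat with coins := st.coins + 1 } := by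
  simp [Wp, Ok, denote]

@[simp] lemma Stmt.wp_seq : (Stmt.seq s₁ s₂).Wp L A V E st Q ↔
    s₁.Wp L A V E st fun st' => s₂.Wp L A V E st' Q := by
  simp [Wp, Ok, denote, and_assoc]

@[simp] lemma Stmt.wp_ifz (e : Expr ι κ) : (Stmt.ifz e s₁ s₂).Wp L A V E st Q ↔
    e.Ok L A V E st ∧ (e.eval E st = 0 → s₁.Wp L A V E st Q) ∧
      (e.eval E st ≠ 0 → s₂.Wp L A V E st Q) := by
  by_cases h : e.eval E st = 0 <;> simp [Wp, Ok, denote, h, and_assoc]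

/-- The rule for loops: an invariant, which may rely on everything that the loop cannot change. -/
lemma Stmt.wp_loop {h : Bool} {i u : ι} (I : ℕ → St ι κ → Prop) (h0 : I 0 st)
    (hs : ∀ k < rounds h (st.reg u), ∀ st', Frame (.loop h i u s) st st' → I k st' →
      s.Wp L A V E (st'.set i k) (I (k + 1)))
    (hQ : ∀ st', Frame (.loop h i u s) st st' → I (rounds h (st.reg u)) st' → Q st') :
    (Stmt.loop h i u s).Wp L A V E st Q := by
  have key : ∀ n ≤ rounds h (st.reg u), I n (s.iter E i st n) := by
    intro n
    induction n with
    | zero => exact fun _ => h0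
    | succ n ih =>
      exact fun hn => (hs n (by omega) _ (iter_frame h i u s st n) (ih (by omega))).2
  exact ⟨fun k hk => (hs k hk _ (iter_frame h i u s st k) (key k hk.le)).1,
    hQ _ (iter_frame h i u s st _) (key _ le_rfl)⟩

/-- A bound on the number of steps if the bounds of all loops have the values given by `ρ`. -/
def Stmt.cost (ρ : ι → ℕ) : Stmt ι κ → ℕ
  | .skip => 0
  | .assign _ e => e.len + 2
  | .store _ e₁ e₂ => e₁.len + e₂.len + 11
  | .flip _ => 1
  | .seq s₁ s₂ => s₁.cost ρ + s₂.cost ρ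
  | .ifz e s₁ s₂ => e.len + 3 + s₁.cost ρ + s₂.cost ρ
  | .loop h _ u s => 3 + rounds h (ρ u) * (s.cost ρ + 8)

lemma Stmt.steps_le_cost {ρ : ι → ℕ} {X : ι → Prop} (s : Stmt ι κ) (hb : ∀ r, s.Bnd r → X r)
    (ha : ∀ r, X r → ¬ s.Asg r) (st : St ι κ) (hst : ∀ r, X r → st.reg r = ρ r) :
    s.steps E st ≤ s.cost ρ := by
  induction s generalizing st with
  | skip => exact le_rfl
  | assign r e => exact le_rfl
  | store q e₁ e₂ => exact le_rfl
  | flip r => exact le_rfl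
  | seq s₁ s₂ ih₁ ih₂ =>
    simp only [Bnd, Asg, not_or] at hb ha
    refine Nat.add_le_add (ih₁ (fun r h => hb r (.inl h)) (fun r h => (ha r h).1) st hst)
      (ih₂ (fun r h => hb r (.inr h)) (fun r h => (ha r h).2) _ fun r h => ?_)
    rw [(s₁.frame st).reg r (ha r h).1, hst r h]
  | ifz e s₁ s₂ ih₁ ih₂ =>
    simp only [Bnd, Asg, not_or] at hb ha
    have h₁ := ih₁ (fun r h => hb r (.inl h)) (fun r h => (ha r h).1) st hst
    have h₂ := ih₂ (fun r h => hb r (.inr h)) (fun r h => (ha r h).2) st hst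
    simp only [steps, cost]
    split_ifs <;> omega
  | loop h i u s ih =>
    have hu : st.reg u = ρ u := hst u (hb u (.inl rfl))
    simp only [steps, cost, hu]
    have : ∀ k ∈ Finset.range (rounds h (ρ u)),
        s.steps E ((s.iter E i st k).set i k) + 8 ≤ s.cost ρ + 8 := by
      intro k _
      refine Nat.add_le_add_right (ih (fun r h => hb r (.inr h))
        (fun r h => fun h' => ha r h (.inr h')) _ fun r hr => ?_) 8
      have h1 : r ≠ i := fun h' => ha r hr (.inl h')
      rw [St.set_reg, if_neg h1, (iter_frame h i u s st k).reg r (ha r hr), hst r hr]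
    have := Finset.sum_le_card_nsmul _ _ _ this
    simpa using this

/-- No loop bound is assigned to. -/
def Stmt.Static (s : Stmt ι κ) : Prop := ∀ r, s.Bnd r → ¬ s.Asg r

lemma Stmt.Static.steps_le (h : s.Static) (st : St ι κ) : s.steps E st ≤ s.cost st.reg :=
  s.steps_le_cost (fun _ hr => hr) h st fun _ _ => rfl

end

/-! ### The program -/

/-- Names of scalar registers: `n` is the number of items, `Q = 2 ^ n`, `P` the capacity of the buckets
of the tables `T j`, `N` the random modulus, `t` the reduced target, `lam` the parameter `param`, `m`
and `c` are the block size and the offset, `T` is the target of the current search, `flag` tells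
whether a solution has been found. -/
inductive Scalar
  | flag | n | Q | P | N | t | lam | r3 | m | c | n1 | b2 | tt | Z | ls | ll | pw | w
  | v | x | y | z | u | h | e | i | k | b | fl | q | d | f | g | a | kk | T
  deriving DecidableEq

/-- Names of families of registers with one member per level: `lenE`, `offE`, `pwE` are the length, the
beginning and the number of subsets of the first part of a block, `lenB`, `offB`, `pwB` those of the
second part; `W` is the capacity of the buckets of `B j`, `p` the prime, `M` the modulus, `s` the
residue class, `acc j` the sum of the residue classes above level `j`, `X j` the value of the blocks
below level `j`. -/
inductive Family
  | lenE | offE | pwE | lenB | offB | pwB | W | p | M | bits | pw | s | acc | X | key | kl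
  deriving DecidableEq

/-- The registers of the program. -/
inductive Rg
  | sc (r : Scalar)
  | lv (f : Family) (j : ℕ)
  deriving DecidableEq

/-- The arrays of the program: the output, the items and two tables per level. -/
inductive Ar
  | out
  | item
  | B (j : ℕ)
  | T (j : ℕ)
  deriving DecidableEq

/-- The number of a register. -/
def Rg.num : Rg → ℕ
  | .sc r => 2 * r.ctorIdx
  | .lv f j => 2 * Nat.pair f.ctorIdx j + 1

/-- The number of an array. -/
def Ar.num : Ar → ℕ
  | .out => 0
  | .item => 1
  | .B j => 2 * j + 2
  | .T j => 2 * j + 3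

lemma Scalar.ctorIdx_injective : Function.Injective Scalar.ctorIdx :=
  Function.LeftInverse.injective (g := Scalar.ofNat) fun r => by cases r <;> rfl

lemma Family.ctorIdx_injective : Function.Injective Family.ctorIdx :=
  Function.LeftInverse.injective (g := Family.ofNat) fun r => by cases r <;> rfl

lemma Rg.num_injective : Function.Injective Rg.num := by
  rintro (r | ⟨f, j⟩) (r' | ⟨f', j'⟩) h
  · simp only [num] at h
    rw [Scalar.ctorIdx_injective (a₁ := r) (a₂ := r') (by omega)]
  · simp only [num] at h; omega
  · simp only [num] at h; omega
  · simp only [num] at h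
    have h' : Nat.pair f.ctorIdx j = Nat.pair f'.ctorIdx j' := by omega
    rw [Nat.pair_eq_pair] at h'
    rw [Family.ctorIdx_injective h'.1, h'.2]

lemma Ar.num_injective : Function.Injective Ar.num := by
  rintro (_ | _ | j | j) (_ | _ | j' | j') h <;> simp only [num] at h <;> first | rfl | omega | skip
  · rw [show j = j' by omega]
  · rw [show j = j' by omega]

/-- The memory layout of the program with levels `0, …, l`. -/
def layout (l : ℕ) : Layout Rg Ar := ⟨Rg.num, Rg.num_injective, Ar.num, Ar.num_injective, 2 * l + 4⟩

/-- Statements of the program. -/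
abbrev Prog := Stmt Rg Ar

infixr:60 " ⨾ " => Stmt.seq

/-- The content of a scalar register. -/
def rg (r : Scalar) : Expr Rg Ar := .reg (.sc r)

/-- The content of a register of level `j`. -/
def lv (f : Family) (j : ℕ) : Expr Rg Ar := .reg (.lv f j)

/-- Assign to a scalar register. -/
def put (r : Scalar) (e : Expr Rg Ar) : Prog := .assign (.sc r) e

/-- A constant. -/
def num (c : ℕ) : Expr Rg Ar := .const c

/-- Execute `s` if `a = b`. -/
def ifeq (a b : Expr Rg Ar) (s : Prog) : Prog := .ifz (a - b) (.ifz (b - a) s .skip) .skip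

/-- Let `v` be the sum of the `len` items from `off` on that are selected by the binary digits
of `x`. -/
def sumItems (len off : Family) (j : ℕ) : Prog :=
  put .v (num 0) ⨾ .loop false (.sc .i) (.lv len j)
    (put .v (rg .v + rg .x % num 2 * .load .item (lv off j + rg .i)) ⨾ put .x (rg .x / num 2))

/-- Insert the value `y` into the `cap` cells of the array `q` from `b` on: `y + 1` is written to the
first empty cell, unless this is preceded by a value with the same sum or there is none. -/
def insert (q : Ar) (cap : Rg) : Prog :=
  put .fl (num 0) ⨾ .loop false (.sc .k) cap
    (.ifz (rg .fl)
      (put .z (.load q (rg .b + rg .k)) ⨾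
        .ifz (rg .z) (.store q (rg .b + rg .k) (rg .y + num 1) ⨾ put .fl (num 1))
          (ifeq ((rg .z - num 1) / rg .Q) (rg .y / rg .Q) (put .fl (num 1))))
      .skip)

/-- Empty the `[u₁] * [u₂]` cells of the array `q`. -/
def clear (q : Ar) (u₁ u₂ : Rg) : Prog :=
  .loop false (.sc .i) u₁ (.loop false (.sc .k) u₂ (.store q (rg .i * .reg u₂ + rg .k) (num 0)))

/-- The register with the number of buckets of the table `B j`. -/
def keyB (j : ℕ) : Rg := .lv .p (max j 1)

/-- The register with the number of buckets of the table `T j`. -/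
def keyT (j : ℕ) : Rg := .lv .p (max j 1 + 1)

/-- Fill the table `B j` with the sums of the second part of block `j`. -/
def buildB (j : ℕ) : Prog :=
  clear (.B j) (keyB j) (.lv .W j) ⨾
  .loop false (.sc .e) (.lv .pwB j)
    (put .x (rg .e) ⨾ sumItems .lenB .offB j ⨾ put .y (rg .v) ⨾
      put .b (rg .v / rg .Q % .reg (keyB j) * lv .W j) ⨾ insert (.B j) (.lv .W j))

/-- Fill the table `T j` with the sums of block `j` in the residue class `s` modulo `M`. -/
def buildT (j : ℕ) : Prog :=
  clear (.T j) (keyT j) (.sc .P) ⨾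
  .loop false (.sc .e) (.lv .pwE j)
    (put .x (rg .e) ⨾ sumItems .lenE .offE j ⨾ put .u (rg .v) ⨾
      put .h ((lv .s j % .reg (keyB j) + (.reg (keyB j) - rg .u / rg .Q % .reg (keyB j))) %
        .reg (keyB j) * lv .W j) ⨾
      .loop false (.sc .g) (.lv .W j)
        (put .z (.load (.B j) (rg .h + rg .g)) ⨾
          .ifz (rg .z) .skip
            (put .y (rg .u + (rg .z - num 1)) ⨾
              ifeq (rg .y / rg .Q % lv .M (max j 1)) (lv .s j)
                (put .b (rg .y / rg .Q % .reg (keyT j) * rg .P) ⨾ insert (.T j) (.sc .P)))))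

/-- Output the subset of the value `X l` if its sum is the target. -/
def output (l : ℕ) : Prog :=
  ifeq (lv .X l / rg .Q) (rg .T) (put .flag (num 1) ⨾ .store .out (num 0) (lv .X l % rg .Q))

/-- Extend the value `X j` of the blocks below level `j` in all ways that the tables of the next `r`
levels admit. -/
def extend : ℕ → ℕ → Prog
  | 0, j => output j
  | r + 1, j =>
      .assign (.lv .key j) ((rg .T % .reg (keyT j) +
        (.reg (keyT j) - (lv .acc j + lv .X j / rg .Q) % .reg (keyT j))) % .reg (keyT j) * rg .P) ⨾
      .loop false (.lv .kl j) (.sc .P)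
        (put .a (.load (.T j) (lv .key j + lv .kl j)) ⨾
          .ifz (rg .a) .skip
            (.assign (.lv .X (j + 1)) (lv .X j + (rg .a - num 1)) ⨾ extend r (j + 1)))

/-- Extend all values in the table `T 0`. -/
def extendAll (l : ℕ) : Prog :=
  .loop false (.lv .key 0) (keyT 0) (.loop false (.lv .kl 0) (.sc .P)
    (put .a (.load (.T 0) (lv .key 0 * rg .P + lv .kl 0)) ⨾
      .ifz (rg .a) .skip (.assign (.lv .X 1) (rg .a - num 1) ⨾ extend l 1)))

/-- Go through all residue classes for the levels `1, …, j`. -/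
def search (l : ℕ) : ℕ → Prog
  | 0 =>
      .assign (.lv .s 0) ((rg .T % lv .p 1 + (lv .p 1 - lv .acc 0 % lv .p 1)) % lv .p 1) ⨾
      buildT 0 ⨾ extendAll l
  | j + 1 =>
      .loop false (.lv .s (j + 1)) (.lv .M (j + 1))
        (buildT (j + 1) ⨾ .assign (.lv .acc j) (lv .acc (j + 1) + lv .s (j + 1)) ⨾ search l j)

/-- Search for the targets `t + k N`. -/
def searchAll (l : ℕ) : Prog :=
  .loop false (.sc .kk) (.sc .n1)
    (put .T (rg .t + rg .kk * rg .N) ⨾ .assign (.lv .acc l) (num 0) ⨾ search l l)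

/-- Fill the tables `B 0, …, B (j - 1)`. -/
def buildAllB : ℕ → Prog
  | 0 => .skip
  | j + 1 => buildAllB j ⨾ buildB j

/-! ### Hash tables with bounded buckets -/

/-- The effect of inserting `y` into the cells `b, …, b + W - 1` of an array. -/
def Inserted (Q W b y : ℕ) (f f' : ℕ → ℕ) : Prop :=
  (f' = f ∧ ∀ k < W, f (b + k) ≠ 0 ∧ (f (b + k) - 1) / Q ≠ y / Q) ∨
  ∃ k < W, (∀ k' < k, f (b + k') ≠ 0 ∧ (f (b + k') - 1) / Q ≠ y / Q) ∧
    ((f (b + k) = 0 ∧ f' = Function.update f (b + k) (y + 1)) ∨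
      (f (b + k) ≠ 0 ∧ (f (b + k) - 1) / Q = y / Q ∧ f' = f))

/-- The array `f` holds a table of `nb` buckets of `W` cells each. A nonzero cell `v + 1` of bucket
`β` stands for a value `v` with `ok β v`; in each bucket the nonzero cells come first, and the values
have distinct sums. -/
structure Table (Q W nb : ℕ) (ok : ℕ → ℕ → Prop) (f : ℕ → ℕ) : Prop where
  valid : ∀ β < nb, ∀ k < W, f (β * W + k) ≠ 0 → ok β (f (β * W + k) - 1)
  inj : ∀ β < nb, ∀ k' < W, ∀ k < k', f (β * W + k') ≠ 0 →
    f (β * W + k) ≠ 0 ∧ (f (β * W + k) - 1) / Q ≠ (f (β * W + k') - 1) / Q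

/-- Bucket `β` holds a value with sum `σ`. -/
def Has (Q W : ℕ) (f : ℕ → ℕ) (β σ : ℕ) : Prop :=
  ∃ k < W, f (β * W + k) ≠ 0 ∧ (f (β * W + k) - 1) / Q = σ

/-- Bucket `β` cannot overflow: the values that belong there have at most `W` distinct sums. -/
def Room (Q W : ℕ) (ok : ℕ → ℕ → Prop) (β : ℕ) : Prop :=
  ∃ U : Finset ℕ, U.card ≤ W ∧ ∀ v, ok β v → v / Q ∈ U

lemma cell_eq {W β β' k k' : ℕ} (hk : k < W) (hk' : k' < W) (h : β * W + k = β' * W + k') :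
    β = β' ∧ k = k' := by
  have h1 : (β * W + k) / W = β := by
    rw [mul_comm, Nat.mul_add_div (by omega), Nat.div_eq_of_lt hk, add_zero]
  have h2 : (β' * W + k') / W = β' := by
    rw [mul_comm, Nat.mul_add_div (by omega), Nat.div_eq_of_lt hk', add_zero]
  have : β = β' := by rw [← h1, h, h2]
  subst this; exact ⟨rfl, by omega⟩

section

variable {Q W nb b y β σ : ℕ} {ok : ℕ → ℕ → Prop} {f f' : ℕ → ℕ}

lemma Table.of_zero (h : ∀ β < nb, ∀ k < W, f (β * W + k) = 0) : Table Q W nb ok f :=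
  ⟨fun β hβ k hk h' => absurd (h β hβ k hk) h',
    fun β hβ k' hk' _ _ h' => absurd (h β hβ k' hk') h'⟩

lemma Table.inserted (h : Table Q W nb ok f) (hβ : β < nb) (hy : ok β y)
    (hi : Inserted Q W (β * W) y f f') : Table Q W nb ok f' := by
  rcases hi with ⟨rfl, -⟩ | ⟨k₀, hk₀, hlt, ⟨h0, rfl⟩ | ⟨-, -, rfl⟩⟩
  · exact h
  · refine ⟨fun β' hβ' k hk => ?_, fun β' hβ' k' hk' k hkk => ?_⟩
    · rw [Function.update_apply]
      split_ifs with he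
      · obtain ⟨rfl, rfl⟩ := cell_eq hk hk₀ he
        simpa using hy
      · exact h.valid β' hβ' k hk
    · rw [Function.update_apply, Function.update_apply]
      by_cases he : β' * W + k' = β * W + k₀
      · obtain ⟨rfl, rfl⟩ := cell_eq hk' hk₀ he
        simpa [hkk.ne] using hlt k hkk
      · rw [if_neg he]
        split_ifs with he'
        · obtain ⟨rfl, rfl⟩ := cell_eq (hkk.trans hk') hk₀ he'
          intro hne
          exact absurd h0 (h.inj β' hβ' k' hk' k hkk hne).1
        · exact h.inj β' hβ' k' hk' k hkk
  · exact h

lemma Has.inserted (h : Has Q W f β σ) {β' : ℕ} (hi : Inserted Q W (β' * W) y f f') :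
    Has Q W f' β σ := by
  rcases hi with ⟨rfl, -⟩ | ⟨k₀, hk₀, hlt, ⟨h0, rfl⟩ | ⟨-, -, rfl⟩⟩
  · exact h
  · obtain ⟨k, hk, hne, hσ⟩ := h
    refine ⟨k, hk, ?_⟩
    rw [Function.update_apply, if_neg]
    · exact ⟨hne, hσ⟩
    · intro he
      rw [he] at hne; exact hne h0
  · exact h

lemma Inserted.has (h : Table Q W nb ok f) (hβ : β < nb) (hy : ok β y) (hr : Room Q W ok β)
    (hi : Inserted Q W (β * W) y f f') : Has Q W f' β (y / Q) := by
  rcases hi with ⟨rfl, hfull⟩ | ⟨k₀, hk₀, hlt, ⟨h0, rfl⟩ | ⟨hne, hσ, rfl⟩⟩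
  · -- a full bucket already holds all possible sums
    exfalso
    obtain ⟨U, hU, hUok⟩ := hr
    have hmaps : ∀ k ∈ Finset.range W, (f' (β * W + k) - 1) / Q ∈ U.erase (y / Q) := by
      intro k hk
      have hk := Finset.mem_range.1 hk
      exact Finset.mem_erase.2 ⟨(hfull k hk).2, hUok _ (h.valid β hβ k hk (hfull k hk).1)⟩
    have hinj : Set.InjOn (fun k => (f' (β * W + k) - 1) / Q) (Finset.range W : Set ℕ) := by
      intro k hk k' hk' he
      have hk := Finset.mem_range.1 (Finset.mem_coe.1 hk)
      have hk' := Finset.mem_range.1 (Finset.mem_coe.1 hk')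
      rcases lt_trichotomy k k' with hlt | rfl | hlt
      · exact absurd he (h.inj β hβ k' hk' k hlt (hfull k' hk').1).2
      · rfl
      · exact absurd he.symm (h.inj β hβ k hk k' hlt (hfull k hk).1).2
    have h1 := Finset.card_le_card_of_injOn _ hmaps hinj
    have h2 := Finset.card_erase_lt_of_mem (hUok y hy)
    rw [Finset.card_range] at h1; omega
  · exact ⟨k₀, hk₀, by simp⟩
  · exact ⟨k₀, hk₀, hne, hσ⟩

end

/-! ### Specifications of the table operations -/

section

variable {l A V : ℕ} {E : Env} {st : St Rg Ar} {Q : St Rg Ar → Prop}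

@[simp] lemma layout_arr (l : ℕ) (q : Ar) : (layout l).arr q = q.num := rfl

@[simp] lemma layout_S (l : ℕ) : (layout l).S = 2 * l + 4 := rfl

@[simp] lemma rounds_false (v : ℕ) : rounds false v = v := rfl

lemma wp_put (r : Scalar) (e : Expr Rg Ar) : (put r e).Wp (layout l) A V E st Q ↔
    e.Ok (layout l) A V E st ∧ Q (st.set (.sc r) (e.eval E st)) := Iff.rfl

lemma wp_ifeq {a b : Expr Rg Ar} {s : Prog} (ha : a.Ok (layout l) A V E st)
    (hb : b.Ok (layout l) A V E st)
    (h : a.eval E st = b.eval E st → s.Wp (layout l) A V E st Q)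
    (h' : a.eval E st ≠ b.eval E st → Q st) : (ifeq a b s).Wp (layout l) A V E st Q := by
  simp only [ifeq, Stmt.wp_ifz, Expr.ok_sub, Stmt.wp_skip, Expr.eval_sub]
  refine ⟨⟨ha, hb⟩, fun h1 => ⟨⟨hb, ha⟩, fun h2 => h (by omega), fun h2 => h' (by omega)⟩,
    fun h2 => h' (by omega)⟩

@[simp] lemma asg_put (r : Scalar) (e : Expr Rg Ar) (x : Rg) : (put r e).Asg x ↔ x = .sc r := Iff.rfl

@[simp] lemma asg_ifeq (a b : Expr Rg Ar) (s : Prog) (x : Rg) : (ifeq a b s).Asg x ↔ s.Asg x := by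
  simp [ifeq, Stmt.Asg]

@[simp] lemma wr_put (r : Scalar) (e : Expr Rg Ar) (x : Ar) : (put r e).Wr x ↔ False := Iff.rfl

@[simp] lemma wr_ifeq (a b : Expr Rg Ar) (s : Prog) (x : Ar) : (ifeq a b s).Wr x ↔ s.Wr x := by
  simp [ifeq, Stmt.Wr]

@[simp] lemma asg_insert (q : Ar) (c x : Rg) :
    (insert q c).Asg x ↔ x = .sc .fl ∨ x = .sc .k ∨ x = .sc .z := by
  simp [insert, Stmt.Asg]
  tauto

@[simp] lemma wr_insert (q : Ar) (c : Rg) (x : Ar) : (insert q c).Wr x ↔ x = q := by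
  simp [insert, Stmt.Wr]

@[simp] lemma asg_clear (q : Ar) (c c' x : Rg) :
    (clear q c c').Asg x ↔ x = .sc .i ∨ x = .sc .k := by
  simp [clear, Stmt.Asg]

@[simp] lemma wr_clear (q : Ar) (c c' : Rg) (x : Ar) : (clear q c c').Wr x ↔ x = q := by
  simp [clear, Stmt.Wr]

@[simp] lemma asg_sumItems (len off : Family) (j : ℕ) (x : Rg) :
    (sumItems len off j).Asg x ↔ x = .sc .v ∨ x = .sc .i ∨ x = .sc .x := by
  simp [sumItems, Stmt.Asg]
  tauto

@[simp] lemma wr_sumItems (len off : Family) (j : ℕ) (x : Ar) :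
    (sumItems len off j).Wr x ↔ False := by
  simp [sumItems, Stmt.Wr]

lemma insert_wp {q : Ar} {c : Rg} (hc : c ≠ .sc .fl) (hq : q.num < 2 * l + 4)
    (hA : ∀ k < st.reg c, 2 * ((st.reg (.sc .b) + k) * (2 * l + 4) + q.num) + 1 < A)
    (hb : st.reg (.sc .b) + st.reg c ≤ 2 ^ V) (hy : st.reg (.sc .y) + 1 < 2 ^ V) :
    (insert q c).Wp (layout l) A V E st fun st' =>
      Inserted (st.reg (.sc .Q)) (st.reg c) (st.reg (.sc .b)) (st.reg (.sc .y))
        (st.arr q) (st'.arr q) := by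
  unfold insert
  rw [Stmt.wp_seq, wp_put]
  refine ⟨by simp [num], ?_⟩
  set f := st.arr q with hf
  set Q := st.reg (.sc .Q) with hQ
  set b := st.reg (.sc .b) with hbb
  set y := st.reg (.sc .y) with hyy
  refine Stmt.wp_loop (fun k st' =>
    (st'.reg (.sc .fl) = 0 ∧ st'.arr q = f ∧
      ∀ k' < k, f (b + k') ≠ 0 ∧ (f (b + k') - 1) / Q ≠ y / Q) ∨
    (st'.reg (.sc .fl) ≠ 0 ∧
      ∃ k₀ < st.reg c, (∀ k' < k₀, f (b + k') ≠ 0 ∧ (f (b + k') - 1) / Q ≠ y / Q) ∧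
        ((f (b + k₀) = 0 ∧ st'.arr q = Function.update f (b + k₀) (y + 1)) ∨
          (f (b + k₀) ≠ 0 ∧ (f (b + k₀) - 1) / Q = y / Q ∧ st'.arr q = f))))
    (by simp [num, hf]) ?_ ?_
  · intro k hk st' fr hI
    have hk : k < st.reg c := by simpa [hc] using hk
    have eb : st'.reg (.sc .b) = b := by rw [fr.reg _ (by simp [Stmt.Asg])]; simp [hbb]
    have ey : st'.reg (.sc .y) = y := by rw [fr.reg _ (by simp [Stmt.Asg])]; simp [hyy]
    have eQ : st'.reg (.sc .Q) = Q := by rw [fr.reg _ (by simp [Stmt.Asg])]; simp [hQ]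
    have hbk : b + k < 2 ^ V := by omega
    have hok : (Expr.Ok (layout l) A V E (st'.set (.sc .k) k) (.load q (rg .b + rg .k))) := by
      simpa [rg, eb, hq, hbk] using hA k hk
    have h1V : 1 < 2 ^ V := by omega
    have hput : ∀ (s : St Rg Ar), (s.put q (b + k) (y + 1)).arr q
        = Function.update (s.arr q) (b + k) (y + 1) := by
      intro s; ext x; simp [St.put_arr, Function.update_apply]
    simp only [Stmt.wp_ifz, Stmt.wp_seq, wp_put, Stmt.wp_skip]
    refine ⟨trivial, fun h0 => ⟨hok, trivial, fun hz => ?_, fun hz => ?_⟩, fun h0 => ?_⟩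
    · have h0 : st'.reg (.sc .fl) = 0 := by simpa [rg] using h0
      rcases hI with ⟨-, ha, hI⟩ | ⟨h, -⟩
      swap; · exact absurd h0 h
      have hz : f (b + k) = 0 := by simpa [rg, eb, ha] using hz
      simp [rg, num, eb, ey, hbk, hy, h1V, hput, ha]
      exact ⟨⟨hq, hA k hk⟩, k, hk, hI, .inl ⟨hz, rfl⟩⟩
    · have h0 : st'.reg (.sc .fl) = 0 := by simpa [rg] using h0
      rcases hI with ⟨-, ha, hI⟩ | ⟨h, -⟩
      swap; · exact absurd h0 h
      have hz : f (b + k) ≠ 0 := by simpa [rg, eb, ha] using hz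
      refine wp_ifeq (by simp [rg, num, h1V]) (by simp [rg]) (fun he => ?_) (fun he => ?_)
      · simp [rg, num, eb, ey, eQ, ha] at he
        simp only [wp_put]
        refine ⟨by simpa [num] using h1V, .inr ⟨by simp [num], k, hk, hI, .inr ⟨hz, he, ?_⟩⟩⟩
        simpa using ha
      · simp [rg, num, eb, ey, eQ, ha] at he
        refine .inl ⟨by simpa using h0, by simpa using ha, fun k' hk' => ?_⟩
        rcases Nat.lt_succ_iff_lt_or_eq.1 hk' with h | rfl
        · exact hI k' h
        · exact ⟨hz, he⟩
    · have h0 : st'.reg (.sc .fl) ≠ 0 := by simpa [rg] using h0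
      rcases hI with ⟨h, -⟩ | h
      · exact absurd h h0
      · exact .inr (by simpa using h)
  · intro st' fr hI
    rcases hI with ⟨-, ha, h⟩ | ⟨-, h⟩
    · exact .inl ⟨ha, by simpa [hc] using h⟩
    · exact .inr h

lemma clear_wp {q : Ar} {u₁ u₂ : Rg} {Q W nb : ℕ} {ok : ℕ → ℕ → Prop}
    (h₂ : u₂ ≠ .sc .k ∧ u₂ ≠ .sc .i)
    (hnb : st.reg u₁ = nb) (hW : st.reg u₂ = W) (hq : q.num < 2 * l + 4)
    (hA : ∀ x < nb * W, 2 * (x * (2 * l + 4) + q.num) + 1 < A) (hV : nb * W < 2 ^ V) :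
    (clear q u₁ u₂).Wp (layout l) A V E st fun st' => Table Q W nb ok (st'.arr q) := by
  have hlt : ∀ i < nb, ∀ k < W, i * W + k < nb * W := fun i hi k hk => by nlinarith
  refine Stmt.wp_loop (fun i st' => ∀ β < i, ∀ k < W, st'.arr q (β * W + k) = 0)
    (fun β hβ => absurd hβ (by omega)) ?_ fun st' fr h => ?_
  · intro i hi st' fr hI
    have hi : i < nb := by simpa [hnb] using hi
    have e₂ : st'.reg u₂ = W := by rw [fr.reg _ (by simp [Stmt.Asg, h₂])]; exact hW
    refine Stmt.wp_loop (fun k st'' => (∀ β < i, ∀ k < W, st''.arr q (β * W + k) = 0) ∧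
      ∀ k' < k, st''.arr q (i * W + k') = 0) ⟨by simpa using hI, fun k hk => absurd hk (by omega)⟩
      ?_ ?_
    · intro k hk st'' fr' hJ
      have hk : k < W := by simpa [h₂, e₂] using hk
      have ei : st''.reg (.sc .i) = i := by rw [fr'.reg _ (by simp [Stmt.Asg])]; simp
      have eW : st''.reg u₂ = W := by rw [fr'.reg _ (by simp [Stmt.Asg, h₂])]; simp [h₂, e₂]
      have hx := hlt i hi k hk
      have hx1 := hA _ hx
      have h2 : i * W < 2 ^ V := by omega
      have h3 : i * W + k < 2 ^ V := by omega
      have h4 : 0 < 2 ^ V := by positivity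
      simp [rg, num, ei, eW, h₂, h2, h3, hq, hx1, St.put_arr]
      exact ⟨fun β hβ k' hk' _ => hJ.1 β hβ k' hk', fun k' hk' h => hJ.2 k' (by omega)⟩
    · intro st'' fr' hJ β hβ k hk
      rcases Nat.lt_succ_iff_lt_or_eq.1 hβ with h | rfl
      · exact hJ.1 β h k hk
      · exact hJ.2 k (by simpa [h₂, e₂] using hk)
  · rw [rounds_false, hnb] at h; exact Table.of_zero h

end

/-! ### Filling the tables -/

/-- The numbers that the search works with: the reduced instance and the parameters of the levels
`0, …, l`. Block `j` consists of a first part of `lenE j` and a second part of `lenB j` items. -/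
structure Data where
  l : ℕ
  n : ℕ
  N : ℕ
  t : ℕ
  P : ℕ
  a : ℕ → ℕ
  lenE : ℕ → ℕ
  lenB : ℕ → ℕ
  W : ℕ → ℕ
  p : ℕ → ℕ
  M : ℕ → ℕ

namespace Data

variable (D : Data)

/-- The weight of the sums in the values: a value is a sum times `Q` plus a set of items, encoded
in binary. -/
def Q : ℕ := 2 ^ D.n

/-- The value of an item. -/
def w (i : ℕ) : ℕ := D.a i * D.Q + 2 ^ i

/-- The first item of block `j`. -/
def off (j : ℕ) : ℕ := ∑ i ∈ Finset.range j, (D.lenE i + D.lenB i)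

/-- The first item of the second part of block `j`. -/
def mid (j : ℕ) : ℕ := D.off j + D.lenE j

/-- The number of buckets of the table `B j`. -/
def pB (j : ℕ) : ℕ := D.p (max j 1)

/-- The number of buckets of the table `T j`. -/
def pT (j : ℕ) : ℕ := D.p (max j 1 + 1)

/-- The modulus of level `j`. -/
def mod (j : ℕ) : ℕ := D.M (max j 1)

/-- The value of the items `i` in `[lo, hi)` with `x i`. -/
def val (x : ℕ → Bool) (lo hi : ℕ) : ℕ := ∑ i ∈ Finset.Ico lo hi, (x i).toNat * D.w i

/-- The sum of the items `i` in `[lo, hi)` with `x i`. -/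
def sum (x : ℕ → Bool) (lo hi : ℕ) : ℕ := ∑ i ∈ Finset.Ico lo hi, (x i).toNat * D.a i

/-- `v` is the value of some of the items in `[lo, hi)`. -/
def Sub (lo hi v : ℕ) : Prop := ∃ x, v = D.val x lo hi

/-- The values that belong to bucket `β` of the table `B j`. -/
def okB (j β v : ℕ) : Prop := D.Sub (D.mid j) (D.off (j + 1)) v ∧ v / D.Q % D.pB j = β

/-- The values that belong to bucket `β` of the table `T j` for the residue class `s`. -/
def okT (j s β v : ℕ) : Prop :=
  D.Sub (D.off j) (D.off (j + 1)) v ∧ v / D.Q % D.mod j = s ∧ v / D.Q % D.pT j = β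

/-- The array `f` holds the complete table `B j`, except for overflowing buckets. -/
structure BDone (j : ℕ) (f : ℕ → ℕ) : Prop where
  table : Table D.Q (D.W j) (D.pB j) (D.okB j) f
  has : ∀ v, D.Sub (D.mid j) (D.off (j + 1)) v → Room D.Q (D.W j) (D.okB j) (v / D.Q % D.pB j) →
    Has D.Q (D.W j) f (v / D.Q % D.pB j) (v / D.Q)

/-- The array `f` holds the table `T j` for the residue class `s`, filled by means of the table `B j`
in the array `g`. -/
structure TDone (j s : ℕ) (g f : ℕ → ℕ) : Prop where
  table : Table D.Q D.P (D.pT j) (D.okT j s) f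
  has : ∀ u v, D.Sub (D.off j) (D.mid j) u → D.Sub (D.mid j) (D.off (j + 1)) v →
    Has D.Q (D.W j) g (v / D.Q % D.pB j) (v / D.Q) → (u + v) / D.Q % D.mod j = s →
    Room D.Q D.P (D.okT j s) ((u + v) / D.Q % D.pT j) →
    Has D.Q D.P f ((u + v) / D.Q % D.pT j) ((u + v) / D.Q)

lemma off_succ (j : ℕ) : D.off (j + 1) = D.mid j + D.lenB j := by
  simp [off, mid, Finset.sum_range_succ]; omega

lemma off_mono {i j : ℕ} (h : i ≤ j) : D.off i ≤ D.off j := by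
  unfold off; exact Finset.sum_le_sum_of_subset (Finset.range_mono h)

lemma Q_pos : 0 < D.Q := by unfold Q; positivity

variable {D}

lemma val_eq (x : ℕ → Bool) (lo hi : ℕ) :
    D.val x lo hi = D.sum x lo hi * D.Q + ∑ i ∈ Finset.Ico lo hi, (x i).toNat * 2 ^ i := by
  simp only [val, sum, w, Finset.sum_mul, ← Finset.sum_add_distrib]
  exact Finset.sum_congr rfl fun i _ => by ring

lemma sum_two_pow_lt (x : ℕ → Bool) {lo hi : ℕ} (h : hi ≤ D.n) :
    ∑ i ∈ Finset.Ico lo hi, (x i).toNat * 2 ^ i < D.Q := by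
  calc _ ≤ ∑ i ∈ Finset.range hi, 2 ^ i := by
        refine (Finset.sum_le_sum fun i _ => ?_).trans (Finset.sum_le_sum_of_subset
          (f := fun i => 2 ^ i) fun i hi => Finset.mem_range.2 (Finset.mem_Ico.1 hi).2)
        exact mul_le_of_le_one_left (Nat.zero_le _) (Bool.toNat_le _)
    _ < 2 ^ hi := by
        have := Nat.geomSum_lt (m := 2) le_rfl (s := Finset.range hi) (n := hi) (by simp)
        exact this
    _ ≤ D.Q := Nat.pow_le_pow_right (by norm_num) h

lemma val_div (x : ℕ → Bool) {lo hi : ℕ} (h : hi ≤ D.n) : D.val x lo hi / D.Q = D.sum x lo hi := by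
  rw [val_eq, mul_comm, Nat.mul_add_div D.Q_pos, Nat.div_eq_of_lt (sum_two_pow_lt x h), add_zero]

lemma val_mod (x : ℕ → Bool) {lo hi : ℕ} (h : hi ≤ D.n) :
    D.val x lo hi % D.Q = ∑ i ∈ Finset.Ico lo hi, (x i).toNat * 2 ^ i := by
  rw [val_eq, mul_comm, Nat.mul_add_mod, Nat.mod_eq_of_lt (sum_two_pow_lt x h)]

lemma val_add (x : ℕ → Bool) {lo mi hi : ℕ} (h₁ : lo ≤ mi) (h₂ : mi ≤ hi) :
    D.val x lo mi + D.val x mi hi = D.val x lo hi := Finset.sum_Ico_consecutive _ h₁ h₂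

lemma sum_add (x : ℕ → Bool) {lo mi hi : ℕ} (h₁ : lo ≤ mi) (h₂ : mi ≤ hi) :
    D.sum x lo mi + D.sum x mi hi = D.sum x lo hi := Finset.sum_Ico_consecutive _ h₁ h₂

lemma Sub.add {lo mi hi u v : ℕ} (hu : D.Sub lo mi u) (hv : D.Sub mi hi v) (h₁ : lo ≤ mi)
    (h₂ : mi ≤ hi) (hn : hi ≤ D.n) :
    D.Sub lo hi (u + v) ∧ (u + v) / D.Q = u / D.Q + v / D.Q := by
  obtain ⟨x, rfl⟩ := hu
  obtain ⟨y, rfl⟩ := hv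
  set z : ℕ → Bool := fun i => if i < mi then x i else y i with hz
  have hx : D.val x lo mi = D.val z lo mi := by
    refine Finset.sum_congr rfl fun i hi => ?_
    rw [hz]; simp [(Finset.mem_Ico.1 hi).2]
  have hy : D.val y mi hi = D.val z mi hi := by
    refine Finset.sum_congr rfl fun i hi => ?_
    rw [hz]; simp [(Finset.mem_Ico.1 hi).1.not_gt]
  rw [hx, hy, val_add z h₁ h₂, val_div z (h₂.trans hn), val_div z hn, val_div z hn,
    sum_add z h₁ h₂]
  exact ⟨⟨z, rfl⟩, rfl⟩

lemma Sub.le {lo hi v : ℕ} (h : D.Sub lo hi v) (hn : hi ≤ D.n) :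
    v ≤ ∑ i ∈ Finset.range D.n, D.w i := by
  obtain ⟨x, rfl⟩ := h
  refine (Finset.sum_le_sum fun i _ => ?_).trans (Finset.sum_le_sum_of_subset
    (f := D.w) fun i hi => Finset.mem_range.2 ((Finset.mem_Ico.1 hi).2.trans_le hn))
  exact mul_le_of_le_one_left (Nat.zero_le _) (Bool.toNat_le _)

/-- The value of the items from `lo` on that are selected by the last `len` binary digits of `e`. -/
def itemSum (D : Data) (lo len e : ℕ) : ℕ := ∑ i ∈ Finset.range len, e / 2 ^ i % 2 * D.w (lo + i)

lemma itemSum_sub (lo len e : ℕ) : D.Sub lo (lo + len) (D.itemSum lo len e) := by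
  refine ⟨fun i => e.testBit (i - lo), ?_⟩
  rw [itemSum, val, Finset.sum_Ico_eq_sum_range, Nat.add_sub_cancel_left]
  refine Finset.sum_congr rfl fun i _ => ?_
  rw [Nat.add_sub_cancel_left, Nat.testBit_eq_decide_div_mod_eq]
  rcases Nat.mod_two_eq_zero_or_one (e / 2 ^ i) with h | h <;> simp [h]

lemma exists_itemSum {lo hi len v : ℕ} (h : D.Sub lo hi v) (hl : hi = lo + len) :
    ∃ e < 2 ^ len, D.itemSum lo len e = v := by
  obtain ⟨x, rfl⟩ := h
  refine ⟨Nat.ofBits fun i : Fin len => x (lo + i), Nat.ofBits_lt_two_pow _, ?_⟩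
  subst hl
  rw [itemSum, val, Finset.sum_Ico_eq_sum_range, Nat.add_sub_cancel_left]
  refine Finset.sum_congr rfl fun i hi => ?_
  have h1 := Nat.testBit_ofBits_lt (fun i : Fin len => x (lo + i)) i (Finset.mem_range.1 hi)
  rw [Nat.testBit_eq_decide_div_mod_eq] at h1
  simp only at h1
  rw [← h1]
  rcases Nat.mod_two_eq_zero_or_one ((Nat.ofBits fun i : Fin len => x (lo + i)) / 2 ^ i) with h | h
    <;> simp [h]

lemma sum_two_pow_eq_ofBits (x : ℕ → Bool) (n : ℕ) :
    ∑ i ∈ Finset.range n, (x i).toNat * 2 ^ i = Nat.ofBits fun i : Fin n => x i := by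
  induction n generalizing x with
  | zero => simp
  | succ n ih =>
    rw [Finset.sum_range_succ', Nat.ofBits_succ]
    have := ih fun i => x (i + 1)
    simp only [Function.comp_def, Fin.val_succ, Fin.val_zero, pow_zero, mul_one, ← this,
      Finset.mul_sum]
    refine congrArg (· + _) (Finset.sum_congr rfl fun i _ => by ring)

lemma testBit_sum (x : ℕ → Bool) {n i : ℕ} (hi : i < n) :
    (∑ i ∈ Finset.Ico 0 n, (x i).toNat * 2 ^ i).testBit i = x i := by
  rw [Nat.Ico_zero_eq_range, sum_two_pow_eq_ofBits, Nat.testBit_ofBits_lt _ _ hi]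

/-- All numbers that occur in the search are small: the basic quantities are at most `K`, the numbers
of cells at most `I`, and `K` and `I` are small with respect to the machine bounds `V` and `A`. -/
structure Fits (D : Data) (A V K I : ℕ) : Prop where
  Q_le : D.Q ≤ K
  n_le : D.n + 1 ≤ K
  l_le : D.l + 2 ≤ K
  tot_le : ∑ i ∈ Finset.range D.n, D.w i < K
  t_le : D.t + D.n * D.N ≤ K
  p_le : ∀ i ≤ D.l + 1, D.p i ≤ K
  M_le : ∀ i ≤ D.l, D.M i ≤ K
  P_le : D.P ≤ K
  W_le : ∀ j ≤ D.l, D.W j ≤ K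
  lenE_le : ∀ j ≤ D.l, 2 ^ D.lenE j ≤ K
  lenB_le : ∀ j ≤ D.l, 2 ^ D.lenB j ≤ K
  K_le : 4 * K * K < 2 ^ V
  I_le : 2 * (I + 1) * (2 * D.l + 4) ≤ A
  A_le : A ≤ 2 ^ V
  n_le_I : D.n ≤ I
  B_le : ∀ j ≤ D.l, D.pB j * D.W j ≤ I
  T_le : ∀ j ≤ D.l, D.pT j * D.P ≤ I

/-- The shape of the data: the blocks exhaust the items, and each modulus is divisible by the primes
of its level and below. -/
structure Shape (D : Data) : Prop where
  l_pos : 1 ≤ D.l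
  off_eq : D.off (D.l + 1) = D.n
  p_pos : ∀ i, 0 < D.p i
  M_one : D.M 1 = D.p 1
  M_pos : ∀ i, 0 < D.M i
  p_dvd : ∀ i ≤ D.l, ∀ k, 1 ≤ k → k ≤ i → D.p k ∣ D.M i

lemma Fits.cell_lt {A V K I : ℕ} (h : D.Fits A V K I) {i q : ℕ} (hi : i ≤ I)
    (hq : q < 2 * D.l + 4) : 2 * (i * (2 * D.l + 4) + q) + 1 < A := by
  have h1 := h.I_le
  have h2 : i * (2 * D.l + 4) ≤ I * (2 * D.l + 4) := Nat.mul_le_mul_right _ hi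
  have h3 : 2 * (I + 1) * (2 * D.l + 4) = 2 * (I * (2 * D.l + 4)) + 2 * (2 * D.l + 4) := by ring
  omega

lemma Fits.lt_of_le_I {A V K I : ℕ} (h : D.Fits A V K I) {i : ℕ} (hi : i ≤ I) : i + 1 < 2 ^ V := by
  have h1 := h.cell_lt hi (q := 0) (by omega)
  have h2 := h.A_le
  have h3 : i * 4 ≤ i * (2 * D.l + 4) := Nat.mul_le_mul_left _ (by omega); omega

lemma Fits.two_le {A V K I : ℕ} (h : D.Fits A V K I) : 2 ≤ K := by
  have := h.l_le; omega

/-- Numbers below `4 K K` are small. -/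
lemma Fits.lt {A V K I : ℕ} (h : D.Fits A V K I) {x : ℕ} (hx : x ≤ 4 * (K * K)) : x < 2 ^ V := by
  have := h.K_le; rw [mul_assoc] at this; omega

lemma Fits.lt_of_le {A V K I : ℕ} (h : D.Fits A V K I) {x : ℕ} (hx : x ≤ 4 * K) : x < 2 ^ V := by
  have h2 := h.two_le; exact h.lt (by nlinarith)

end Data

/-- The parameters of the search: registers that it does not change. -/
def Rg.IsParam : Rg → Bool
  | .sc .Q | .sc .P | .sc .N | .sc .t | .sc .n1 => true
  | .lv .lenE _ | .lv .offE _ | .lv .pwE _ | .lv .lenB _ | .lv .offB _ | .lv .pwB _ => true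
  | .lv .W _ | .lv .p _ | .lv .M _ => true
  | _ => false

/-- The state `st` holds the data `D`. -/
structure Holds (D : Data) (st : St Rg Ar) : Prop where
  Q : st.reg (.sc .Q) = D.Q
  P : st.reg (.sc .P) = D.P
  N : st.reg (.sc .N) = D.N
  t : st.reg (.sc .t) = D.t
  n1 : st.reg (.sc .n1) = D.n + 1
  lenE : ∀ j ≤ D.l, st.reg (.lv .lenE j) = D.lenE j
  offE : ∀ j ≤ D.l, st.reg (.lv .offE j) = D.off j
  pwE : ∀ j ≤ D.l, st.reg (.lv .pwE j) = 2 ^ D.lenE j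
  lenB : ∀ j ≤ D.l, st.reg (.lv .lenB j) = D.lenB j
  offB : ∀ j ≤ D.l, st.reg (.lv .offB j) = D.mid j
  pwB : ∀ j ≤ D.l, st.reg (.lv .pwB j) = 2 ^ D.lenB j
  W : ∀ j ≤ D.l, st.reg (.lv .W j) = D.W j
  p : ∀ i ≤ D.l + 1, st.reg (.lv .p i) = D.p i
  M : ∀ i ≤ D.l, st.reg (.lv .M i) = D.M i
  item : ∀ i < D.n, st.arr .item i = D.w i

lemma Holds.congr {D : Data} {st st' : St Rg Ar} (h : Holds D st)
    (hr : ∀ r : Rg, r.IsParam → st'.reg r = st.reg r) (ha : st'.arr .item = st.arr .item) :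
    Holds D st' where
  Q := (hr _ rfl).trans h.Q
  P := (hr _ rfl).trans h.P
  N := (hr _ rfl).trans h.N
  t := (hr _ rfl).trans h.t
  n1 := (hr _ rfl).trans h.n1
  lenE j hj := (hr _ rfl).trans (h.lenE j hj)
  offE j hj := (hr _ rfl).trans (h.offE j hj)
  pwE j hj := (hr _ rfl).trans (h.pwE j hj)
  lenB j hj := (hr _ rfl).trans (h.lenB j hj)
  offB j hj := (hr _ rfl).trans (h.offB j hj)
  pwB j hj := (hr _ rfl).trans (h.pwB j hj)
  W j hj := (hr _ rfl).trans (h.W j hj)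
  p j hj := (hr _ rfl).trans (h.p j hj)
  M j hj := (hr _ rfl).trans (h.M j hj)
  item i hi := by rw [ha]; exact h.item i hi

/-- The statement changes neither the parameters nor the items. -/
def Stmt.Keeps (s : Prog) : Prop := (∀ r : Rg, r.IsParam → ¬ s.Asg r) ∧ ¬ s.Wr .item

lemma Holds.frame {D : Data} {st st' : St Rg Ar} {s : Prog} (h : Holds D st) (hs : s.Keeps)
    (fr : Frame s st st') : Holds D st' :=
  h.congr (fun r hr => fr.reg r (hs.1 r hr)) (fr.arr _ hs.2)

lemma Holds.set {D : Data} {st : St Rg Ar} {r : Rg} {v : ℕ} (h : Holds D st)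
    (hr : r.IsParam = false) : Holds D (st.set r v) :=
  h.congr (fun x hx => by rw [St.set_reg, if_neg]; rintro rfl; simp [hr] at hx) rfl

lemma Holds.keyB {D : Data} {st : St Rg Ar} (h : Holds D st) (hl : 1 ≤ D.l) {j : ℕ} (hj : j ≤ D.l) :
    st.reg (keyB j) = D.pB j := h.p _ (by omega)

lemma Holds.keyT {D : Data} {st : St Rg Ar} (h : Holds D st) (hl : 1 ≤ D.l) {j : ℕ} (hj : j ≤ D.l) :
    st.reg (keyT j) = D.pT j := h.p _ (by omega)

lemma Holds.mod {D : Data} {st : St Rg Ar} (h : Holds D st) (hl : 1 ≤ D.l) {j : ℕ} (hj : j ≤ D.l) :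
    st.reg (.lv .M (max j 1)) = D.mod j := h.M _ (by omega)

section

variable {D : Data} {A V K I : ℕ} {E : Env} {st : St Rg Ar}

lemma sumItems_wp (hf : D.Fits A V K I) (hh : Holds D st) {len off : Family} {j n o : ℕ}
    (hlen : st.reg (.lv len j) = n) (hoff : st.reg (.lv off j) = o) (hn : o + n ≤ D.n)
    (hx : st.reg (.sc .x) < 2 ^ V) :
    (sumItems len off j).Wp (layout D.l) A V E st fun st' =>
      st'.reg (.sc .v) = D.itemSum o n (st.reg (.sc .x)) := by
  have h2K := hf.two_le
  have h2V : 2 < 2 ^ V := hf.lt_of_le (by omega)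
  unfold sumItems
  rw [Stmt.wp_seq, wp_put]
  refine ⟨by simp [num], ?_⟩
  refine Stmt.wp_loop (fun i st' => st'.reg (.sc .v) = D.itemSum o i (st.reg (.sc .x)) ∧
    st'.reg (.sc .x) = st.reg (.sc .x) / 2 ^ i) (by simp [num, Data.itemSum]) ?_ ?_
  · intro i hi st' fr hI
    have hi : i < n := by simpa [hlen] using hi
    have eo : st'.reg (.lv off j) = o := by rw [fr.reg _ (by simp [Stmt.Asg])]; simp [hoff]
    have ei : st'.arr .item (o + i) = D.w (o + i) := by
      rw [fr.arr _ (by simp [Stmt.Wr])]; exact hh.item _ (by omega)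
    have hoi : o + i ≤ I := by have := hf.n_le_I; omega
    have hoi' := hf.lt_of_le_I hoi
    have hsum : D.itemSum o (i + 1) (st.reg (.sc .x)) = D.itemSum o i (st.reg (.sc .x)) +
        st.reg (.sc .x) / 2 ^ i % 2 * D.w (o + i) := by simp [Data.itemSum, Finset.sum_range_succ]
    have hle := (Data.itemSum_sub (D := D) o (i + 1) (st.reg (.sc .x))).le (by omega)
    have htot := hf.tot_le
    have hv : D.itemSum o (i + 1) (st.reg (.sc .x)) < 2 ^ V := hf.lt_of_le (by omega)
    have hx' : st.reg (.sc .x) / 2 ^ i < 2 ^ V := lt_of_le_of_lt (Nat.div_le_self _ _) hx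
    simp only [Stmt.wp_seq, wp_put]
    refine ⟨?_, ?_, ?_, ?_⟩
    · simp only [Expr.ok_add, Expr.ok_mul, Expr.ok_load, rg, lv, Expr.ok_reg, Expr.eval_reg,
        Expr.eval_mod, Expr.eval_mul, Expr.eval_load, Expr.eval_add, num, Expr.eval_const,
        St.set_reg, St.set_arr]
      simp only [reduceCtorEq, if_false, Rg.sc.injEq, if_true, hI.1, hI.2, eo, ei]
      refine ⟨trivial, ⟨Expr.ok_mod trivial h2V ?_, ⟨⟨trivial, trivial, by omega⟩, ?_, ?_⟩, ?_⟩, ?_⟩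
      · simpa [hI.2] using hx'
      · simp [Ar.num]
      · exact hf.cell_lt hoi (by simp [Ar.num])
      · omega
      · omega
    · simpa [rg, num] using h2V
    · simp [rg, num, lv, hI.1, hI.2, eo, ei, hsum]
    · simp [rg, num, hI.2, Nat.div_div_eq_div_mul, pow_succ]
  · intro st' fr hI
    have := hI.1
    simpa [hlen] using this

end

open Data

section

variable {D : Data} {A V K I : ℕ} {E : Env} {st : St Rg Ar}

lemma keeps_put {r : Scalar} {e : Expr Rg Ar} (h : (Rg.sc r).IsParam = false) : (put r e).Keeps := by
  refine ⟨fun x hx hx' => ?_, by simp⟩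
  rw [asg_put] at hx'
  subst hx'; simp [h] at hx

lemma keeps_seq {s₁ s₂ : Prog} (h₁ : s₁.Keeps) (h₂ : s₂.Keeps) : (s₁ ⨾ s₂).Keeps :=
  ⟨fun r hr h => h.elim (h₁.1 r hr) (h₂.1 r hr), fun h => h.elim h₁.2 h₂.2⟩

lemma keeps_ifz {e : Expr Rg Ar} {s₁ s₂ : Prog} (h₁ : s₁.Keeps) (h₂ : s₂.Keeps) :
    (Stmt.ifz e s₁ s₂).Keeps :=
  ⟨fun r hr h => h.elim (h₁.1 r hr) (h₂.1 r hr), fun h => h.elim h₁.2 h₂.2⟩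

lemma keeps_skip : (Stmt.skip : Prog).Keeps := ⟨fun _ _ h => h, fun h => h⟩

lemma keeps_assign {r : Rg} {e : Expr Rg Ar} (h : r.IsParam = false) :
    (Stmt.assign r e : Prog).Keeps := by
  refine ⟨fun x hx hx' => ?_, id⟩
  have hx' : x = r := hx'
  subst hx'; simp [h] at hx

lemma keeps_ifeq {a b : Expr Rg Ar} {s : Prog} (h : s.Keeps) : (ifeq a b s).Keeps :=
  keeps_ifz (keeps_ifz h keeps_skip) keeps_skip

lemma keeps_loop {h : Bool} {i u : Rg} {s : Prog} (hi : i.IsParam = false) (hs : s.Keeps) :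
    (Stmt.loop h i u s).Keeps := by
  refine ⟨fun x hx hx' => ?_, hs.2⟩
  rcases hx' with rfl | hx'
  · simp [hi] at hx
  · exact hs.1 x hx hx'

lemma keeps_insert {q : Ar} {c : Rg} (hq : q ≠ .item) : (insert q c).Keeps := by
  refine ⟨fun x hx hx' => ?_, by simpa using hq.symm⟩
  rw [asg_insert] at hx'
  rcases hx' with rfl | rfl | rfl <;> simp [Rg.IsParam] at hx

lemma keeps_clear {q : Ar} {c c' : Rg} (hq : q ≠ .item) : (clear q c c').Keeps := by
  refine ⟨fun x hx hx' => ?_, by simpa using hq.symm⟩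
  rw [asg_clear] at hx'
  rcases hx' with rfl | rfl <;> simp [Rg.IsParam] at hx

lemma keeps_sumItems {len off : Family} {j : ℕ} : (sumItems len off j).Keeps := by
  refine ⟨fun x hx hx' => ?_, by simp⟩
  rw [asg_sumItems] at hx'
  rcases hx' with rfl | rfl | rfl <;> simp [Rg.IsParam] at hx

lemma keeps_buildB (j : ℕ) : (buildB j).Keeps :=
  keeps_seq (keeps_clear (by simp)) <| keeps_loop rfl <| keeps_seq (keeps_put rfl) <|
    keeps_seq keeps_sumItems <| keeps_seq (keeps_put rfl) <| keeps_seq (keeps_put rfl) <|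
    keeps_insert (by simp)

lemma keeps_buildT (j : ℕ) : (buildT j).Keeps :=
  keeps_seq (keeps_clear (by simp)) <| keeps_loop rfl <| keeps_seq (keeps_put rfl) <|
    keeps_seq keeps_sumItems <| keeps_seq (keeps_put rfl) <| keeps_seq (keeps_put rfl) <|
    keeps_loop rfl <| keeps_seq (keeps_put rfl) <| keeps_ifz keeps_skip <|
    keeps_seq (keeps_put rfl) <| keeps_ifeq <| keeps_seq (keeps_put rfl) <| keeps_insert (by simp)

lemma keyB_ne (j : ℕ) (r : Scalar) : keyB j ≠ .sc r := by simp [keyB]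

lemma Data.Shape.pB_pos (hs : D.Shape) (j : ℕ) : 0 < D.pB j := hs.p_pos _

lemma Data.Shape.pT_pos (hs : D.Shape) (j : ℕ) : 0 < D.pT j := hs.p_pos _

lemma Data.Shape.off_le (hs : D.Shape) {j : ℕ} (hj : j ≤ D.l) : D.off (j + 1) ≤ D.n := by
  rw [← hs.off_eq]; exact D.off_mono (by omega)

lemma buildB_wp (hs : D.Shape) (hf : D.Fits A V K I) (hh : Holds D st) {j : ℕ} (hj : j ≤ D.l) :
    (buildB j).Wp (layout D.l) A V E st fun st' => D.BDone j (st'.arr (.B j)) := by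
  have hBI := hf.B_le j hj
  have hq : (Ar.B j).num < 2 * D.l + 4 := by simp [Ar.num]; omega
  have hkey : st.reg (keyB j) = D.pB j := hh.keyB hs.l_pos hj
  have hoff := hs.off_le hj
  have hpB := hs.pB_pos j
  have h2K := hf.two_le
  unfold buildB
  rw [Stmt.wp_seq]
  refine (clear_wp (ok := D.okB j) (nb := D.pB j) (W := D.W j) (Q := D.Q)
    (by simp) hkey (hh.W j hj) hq (fun x hx => hf.cell_lt (by omega) hq)
    ((Nat.lt_succ_self _).trans (hf.lt_of_le_I hBI))).mono fun st₁ fr₁ ht₁ => ?_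
  have hh₁ := hh.frame (keeps_clear (by simp)) fr₁
  refine Stmt.wp_loop (fun e st' => Table D.Q (D.W j) (D.pB j) (D.okB j) (st'.arr (.B j)) ∧
    ∀ e' < e, Room D.Q (D.W j) (D.okB j) (D.itemSum (D.mid j) (D.lenB j) e' / D.Q % D.pB j) →
      Has D.Q (D.W j) (st'.arr (.B j)) (D.itemSum (D.mid j) (D.lenB j) e' / D.Q % D.pB j)
        (D.itemSum (D.mid j) (D.lenB j) e' / D.Q)) ⟨ht₁, fun e he => absurd he (by omega)⟩ ?_ ?_
  · intro e he st₂ fr₂ hI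
    have hh₂ := hh₁.frame (keeps_loop rfl <| keeps_seq (keeps_put rfl) <|
      keeps_seq keeps_sumItems <| keeps_seq (keeps_put rfl) <| keeps_seq (keeps_put rfl) <|
      keeps_insert (by simp)) fr₂
    have he : e < 2 ^ D.lenB j := by simpa [hh₁.pwB j hj] using he
    have heV : e < 2 ^ V := hf.lt_of_le (by have := hf.lenB_le j hj; omega)
    simp only [Stmt.wp_seq, wp_put]
    refine ⟨trivial, ?_⟩
    have hh₃ := (hh₂.set (r := .sc .e) (v := e) rfl).set (r := .sc .x) (v := e) rfl
    have hsum := sumItems_wp (E := E) (st := (st₂.set (.sc .e) e).set (.sc .x) e) hf hh₃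
      (hh₃.lenB j hj) (hh₃.offB j hj) (by rw [← D.off_succ]; exact hoff) (by simpa using heV)
    rw [show (rg .e).eval E (st₂.set (.sc .e) e) = e by simp [rg]]
    refine hsum.mono fun st₄ fr₄ hv => ?_
    have hh₄ := hh₃.frame keeps_sumItems fr₄
    simp only [St.set_reg, if_true] at hv
    set v := D.itemSum (D.mid j) (D.lenB j) e with hvdef
    have hsub : D.Sub (D.mid j) (D.off (j + 1)) v := by rw [off_succ]; exact itemSum_sub _ _ _
    have hvK : v < K := lt_of_le_of_lt (hsub.le hoff) hf.tot_le
    set β := v / D.Q % D.pB j with hβdef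
    have hβ : β < D.pB j := Nat.mod_lt _ hpB
    have hβW : β * D.W j + D.W j ≤ D.pB j * D.W j := by
      rw [← Nat.succ_mul]; exact Nat.mul_le_mul_right _ hβ
    have harr : st₄.arr (.B j) = st₂.arr (.B j) := by rw [fr₄.arr _ (by simp)]; rfl
    have hdiv : v / D.Q ≤ v := Nat.div_le_self _ _
    have e1 : (rg .v).eval E st₄ = v := hv
    refine ⟨trivial, ⟨?_, ?_⟩⟩
    · simp only [Expr.ok_mul, lv, Expr.ok_reg, Expr.eval_mod, Expr.eval_div, Expr.eval_reg, true_and]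
      refine ⟨Expr.ok_mod (by simp [rg]) trivial ?_, ?_⟩
      · simp only [Expr.eval_div, rg, Expr.eval_reg, St.set_reg, reduceCtorEq, if_false,
          Rg.sc.injEq, hh₄.Q, hv]
        exact hf.lt_of_le (by omega)
      · simp only [rg, Expr.eval_reg, St.set_reg, reduceCtorEq, if_false, Rg.sc.injEq, keyB_ne,
          hh₄.Q, hv, hh₄.keyB hs.l_pos hj, hh₄.W j hj]
        have := hf.lt_of_le_I hBI
        change β * D.W j < 2 ^ V; omega
    · have e2 : (rg .v / rg .Q % .reg (keyB j) * lv .W j).eval E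
          (st₄.set (.sc .y) ((rg .v).eval E st₄)) = β * D.W j := by
        simp only [Expr.eval_mul, Expr.eval_mod, Expr.eval_div, rg, lv, Expr.eval_reg, St.set_reg,
          reduceCtorEq, if_false, Rg.sc.injEq, keyB_ne, hh₄.Q, hv, hh₄.keyB hs.l_pos hj, hh₄.W j hj]
        rfl
      rw [e1] at e2 ⊢
      rw [e2]
      refine (insert_wp (by simp) hq ?_ ?_ ?_).mono fun st₅ fr₅ hins => ?_
      · simp only [St.set_reg, reduceCtorEq, if_false, if_true, hh₄.W j hj]
        exact fun k hk => hf.cell_lt (by omega) hq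
      · simp only [St.set_reg, reduceCtorEq, if_false, if_true, hh₄.W j hj]
        have := hf.lt_of_le_I hBI; omega
      · simp only [St.set_reg, reduceCtorEq, if_false, if_true, Rg.sc.injEq]
        exact hf.lt_of_le (by omega)
      · simp only [St.set_reg, reduceCtorEq, if_false, if_true, Rg.sc.injEq, hh₄.W j hj, hh₄.Q,
          St.set_arr, harr] at hins
        have hok : D.okB j β v := ⟨hsub, rfl⟩
        refine ⟨hI.1.inserted hβ hok hins, fun e' he' hroom => ?_⟩
        rcases Nat.lt_succ_iff_lt_or_eq.1 he' with h | rfl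
        · exact (hI.2 e' h hroom).inserted hins
        · exact hins.has hI.1 hβ hok hroom
  · intro st₂ fr₂ hI
    refine ⟨hI.1, fun v hv hroom => ?_⟩
    obtain ⟨e, he, rfl⟩ := exists_itemSum hv (D.off_succ j)
    exact hI.2 e (by simpa [hh₁.pwB j hj] using he) hroom

/-- Recovering the residue of one summand from that of the sum. -/
lemma add_mod_sub_mod {k : ℕ} (hk : 0 < k) (u v : ℕ) :
    ((u + v) % k + (k - u % k)) % k = v % k := by
  have h1 := (Nat.mod_lt u hk).le
  refine Nat.ModEq.add_right_cancel' (u % k) ?_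
  rw [add_assoc, Nat.sub_add_cancel h1]
  change ((u + v) % k + k) % k = (v + u % k) % k
  rw [Nat.add_mod_right, Nat.mod_mod, Nat.add_mod_mod, add_comm]

lemma Data.Shape.pB_dvd_mod (hs : D.Shape) {j : ℕ} (hj : j ≤ D.l) : D.pB j ∣ D.mod j :=
  hs.p_dvd _ (by have := hs.l_pos; omega) _ (by omega) le_rfl

/-- The bucket of the table `B j` that the values `v` with `u + v` in the residue class `s` belong
to. -/
lemma bucket_eq (hs : D.Shape) {j : ℕ} (hj : j ≤ D.l) {u v s : ℕ} (h : (u + v) % D.mod j = s) :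
    (s % D.pB j + (D.pB j - u % D.pB j)) % D.pB j = v % D.pB j := by
  rw [← h, Nat.mod_mod_of_dvd _ (hs.pB_dvd_mod hj), add_mod_sub_mod (hs.pB_pos j)]

lemma buildT_wp (hs : D.Shape) (hf : D.Fits A V K I) (hh : Holds D st) {j s : ℕ} (hj : j ≤ D.l)
    (hes : st.reg (.lv .s j) = s) (hsK : s ≤ K)
    (hB : Table D.Q (D.W j) (D.pB j) (D.okB j) (st.arr (.B j))) :
    (buildT j).Wp (layout D.l) A V E st fun st' =>
      D.TDone j s (st.arr (.B j)) (st'.arr (.T j)) := by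
  have hBI := hf.B_le j hj
  have hTI := hf.T_le j hj
  have hqB : (Ar.B j).num < 2 * D.l + 4 := by simp [Ar.num]; omega
  have hqT : (Ar.T j).num < 2 * D.l + 4 := by simp [Ar.num]; omega
  have hkey : st.reg (keyT j) = D.pT j := hh.keyT hs.l_pos hj
  have hoff := hs.off_le hj
  have hpB := hs.pB_pos j
  have hpT := hs.pT_pos j
  have h2K := hf.two_le
  have hBV := hf.lt_of_le_I hBI
  have hTV := hf.lt_of_le_I hTI
  have hpBK : D.pB j ≤ K := hf.p_le _ (by have := hs.l_pos; omega)
  set g := st.arr (.B j) with hg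
  set ok := D.okT j s with hokdef
  unfold buildT
  rw [Stmt.wp_seq]
  refine (clear_wp (ok := ok) (nb := D.pT j) (W := D.P) (Q := D.Q)
    (by simp) hkey hh.P hqT (fun x hx => hf.cell_lt (by omega) hqT)
    (by omega)).mono fun st₁ fr₁ ht₁ => ?_
  have hh₁ := hh.frame (keeps_clear (by simp)) fr₁
  have hg₁ : st₁.arr (.B j) = g := fr₁.arr _ (by simp)
  have hs₁ : st₁.reg (.lv .s j) = s := by rw [fr₁.reg _ (by simp)]; exact hes
  set uu : ℕ → ℕ := fun e => D.itemSum (D.off j) (D.lenE j) e with huu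
  set Hit : (ℕ → ℕ) → ℕ → ℕ → Prop := fun f u k => g ((s % D.pB j + (D.pB j - u / D.Q % D.pB j)) %
    D.pB j * D.W j + k) ≠ 0 →
    (u + (g ((s % D.pB j + (D.pB j - u / D.Q % D.pB j)) % D.pB j * D.W j + k) - 1)) / D.Q %
      D.mod j = s →
    Room D.Q D.P ok ((u + (g ((s % D.pB j + (D.pB j - u / D.Q % D.pB j)) %
      D.pB j * D.W j + k) - 1)) / D.Q % D.pT j) →
    Has D.Q D.P f ((u + (g ((s % D.pB j + (D.pB j - u / D.Q % D.pB j)) %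
      D.pB j * D.W j + k) - 1)) / D.Q % D.pT j)
      ((u + (g ((s % D.pB j + (D.pB j - u / D.Q % D.pB j)) %
      D.pB j * D.W j + k) - 1)) / D.Q) with hHit
  refine Stmt.wp_loop (fun e st' => Table D.Q D.P (D.pT j) ok (st'.arr (.T j)) ∧
    ∀ e' < e, ∀ k < D.W j, Hit (st'.arr (.T j)) (uu e') k) ⟨ht₁, fun e he => absurd he (by omega)⟩
    ?_ ?_
  · intro e he st₂ fr₂ hI
    have hh₂ := hh₁.frame (keeps_loop rfl <| keeps_seq (keeps_put rfl) <|
      keeps_seq keeps_sumItems <| keeps_seq (keeps_put rfl) <| keeps_seq (keeps_put rfl) <|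
      keeps_loop rfl <| keeps_seq (keeps_put rfl) <| keeps_ifz keeps_skip <|
      keeps_seq (keeps_put rfl) <| keeps_ifeq <| keeps_seq (keeps_put rfl) <|
      keeps_insert (by simp)) fr₂
    have hg₂ : st₂.arr (.B j) = g := by rw [fr₂.arr _ (by simp [Stmt.Wr])]; exact hg₁
    have hs₂ : st₂.reg (.lv .s j) = s := by rw [fr₂.reg _ (by simp [Stmt.Asg])]; exact hs₁
    have he : e < 2 ^ D.lenE j := by simpa [hh₁.pwE j hj] using he
    have heV : e < 2 ^ V := hf.lt_of_le (by have := hf.lenE_le j hj; omega)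
    simp only [Stmt.wp_seq, wp_put]
    refine ⟨trivial, ?_⟩
    have hh₃ := (hh₂.set (r := .sc .e) (v := e) rfl).set (r := .sc .x) (v := e) rfl
    have hmid : D.mid j ≤ D.n := by have := D.off_succ j; omega
    have hsum := sumItems_wp (E := E) (st := (st₂.set (.sc .e) e).set (.sc .x) e) hf hh₃
      (hh₃.lenE j hj) (hh₃.offE j hj) hmid (by simpa using heV)
    rw [show (rg .e).eval E (st₂.set (.sc .e) e) = e by simp [rg]]
    refine hsum.mono fun st₄ fr₄ hv => ?_
    have hh₄ := hh₃.frame keeps_sumItems fr₄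
    simp only [St.set_reg, if_true] at hv
    have huueq : D.itemSum (D.off j) (D.lenE j) e = uu e := rfl
    rw [huueq] at hv
    have hsubE : D.Sub (D.off j) (D.mid j) (uu e) := itemSum_sub _ _ _
    have huK : uu e < K := lt_of_le_of_lt (hsubE.le hmid) hf.tot_le
    generalize hudef : uu e = u at *
    have hgg₄ : st₄.arr (.B j) = g := by rw [fr₄.arr _ (by simp)]; exact hg₂
    have hT₄ : st₄.arr (.T j) = st₂.arr (.T j) := by rw [fr₄.arr _ (by simp)]; rfl
    have hs₄ : st₄.reg (.lv .s j) = s := by rw [fr₄.reg _ (by simp)]; simpa using hs₂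
    set h := (s % D.pB j + (D.pB j - u / D.Q % D.pB j)) % D.pB j with hhdef
    have hhlt : h < D.pB j := Nat.mod_lt _ hpB
    have hhW : h * D.W j + D.W j ≤ D.pB j * D.W j := by
      rw [← Nat.succ_mul]; exact Nat.mul_le_mul_right _ hhlt
    have hdivu : u / D.Q ≤ u := Nat.div_le_self _ _
    have e1 : (rg .v).eval E st₄ = u := hv
    rw [e1]
    have hs1 : s % D.pB j < D.pB j := Nat.mod_lt _ hpB
    have e2 : ((lv .s j % .reg (keyB j) + (.reg (keyB j) - rg .u / rg .Q % .reg (keyB j))) %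
        .reg (keyB j) * lv .W j : Expr Rg Ar).eval E (st₄.set (.sc .u) u) = h * D.W j := by
      simp only [Expr.eval_mul, Expr.eval_mod, Expr.eval_add, Expr.eval_sub, Expr.eval_div, rg, lv,
        Expr.eval_reg, St.set_reg, reduceCtorEq, if_false, if_true, keyB_ne, hh₄.Q,
        hh₄.keyB hs.l_pos hj, hh₄.W j hj, hs₄]
      rfl
    refine ⟨trivial, ⟨?_, ?_⟩⟩
    · have hsV : st₄.reg (.lv .s j) < 2 ^ V := by rw [hs₄]; exact hf.lt_of_le (by omega)
      have o1 : ((lv .s j % .reg (keyB j)) : Expr Rg Ar).Ok (layout D.l) A V E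
          (st₄.set (.sc .u) u) := Expr.ok_mod trivial trivial (by simpa [lv] using hsV)
      have o2 : ((rg .u / rg .Q % .reg (keyB j)) : Expr Rg Ar).Ok (layout D.l) A V E
          (st₄.set (.sc .u) u) := by
        refine Expr.ok_mod (by simp [rg]) trivial ?_
        simp only [Expr.eval_div, rg, Expr.eval_reg, St.set_reg, if_true]
        exact lt_of_le_of_lt (Nat.div_le_self _ _) (hf.lt_of_le (by omega))
      have e3 : ((lv .s j % .reg (keyB j) + (.reg (keyB j) - rg .u / rg .Q % .reg (keyB j))) :
          Expr Rg Ar).eval E (st₄.set (.sc .u) u) < 2 ^ V := by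
        simp only [Expr.eval_mod, Expr.eval_add, Expr.eval_sub, Expr.eval_div, rg, lv,
          Expr.eval_reg, St.set_reg, reduceCtorEq, if_false, if_true, keyB_ne, hh₄.Q,
          hh₄.keyB hs.l_pos hj, hs₄]
        exact hf.lt_of_le (by omega)
      refine ⟨Expr.ok_mod ⟨o1, ?_, e3⟩ trivial e3, trivial, ?_⟩
      · rw [Expr.ok_sub]; exact ⟨trivial, o2⟩
      · change (_ : Expr Rg Ar).eval E (st₄.set (.sc .u) u) < 2 ^ V at e3
        have := e2
        rw [Expr.eval_mul] at this
        change Expr.eval E _ _ * Expr.eval E _ _ < 2 ^ V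
        rw [this]; omega
    · rw [e2]
      set st₅ := (st₄.set (.sc .u) u).set (.sc .h) (h * D.W j) with hst₅
      have hh₅ : Holds D st₅ := (hh₄.set rfl).set rfl
      refine Stmt.wp_loop (fun k st' => Table D.Q D.P (D.pT j) ok (st'.arr (.T j)) ∧
        (∀ e' < e, ∀ k < D.W j, Hit (st'.arr (.T j)) (uu e') k) ∧
        ∀ k' < k, Hit (st'.arr (.T j)) u k') ?_ ?_ ?_
      · refine ⟨by simpa [hst₅, hT₄] using hI.1, by simpa [hst₅, hT₄] using hI.2,
          fun k hk => absurd hk (by omega)⟩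
      · intro k hk st₆ fr₆ hJ
        have hk : k < D.W j := by simpa [hh₅.W j hj] using hk
        have hh₆ := hh₅.frame (keeps_loop rfl <| keeps_seq (keeps_put rfl) <| keeps_ifz keeps_skip <|
          keeps_seq (keeps_put rfl) <| keeps_ifeq <| keeps_seq (keeps_put rfl) <|
          keeps_insert (by simp)) fr₆
        have eu : st₆.reg (.sc .u) = u := by rw [fr₆.reg _ (by simp [Stmt.Asg])]; simp [hst₅]
        have eh : st₆.reg (.sc .h) = h * D.W j := by
          rw [fr₆.reg _ (by simp [Stmt.Asg])]; simp [hst₅]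
        have es : st₆.reg (.lv .s j) = s := by
          rw [fr₆.reg _ (by simp [Stmt.Asg])]; simpa [hst₅] using hs₄
        have eg : st₆.arr (.B j) = g := by
          rw [fr₆.arr _ (by simp [Stmt.Wr])]; simpa [hst₅] using hgg₄
        have hx : h * D.W j + k ≤ I := by omega
        have eload : (Expr.load (.B j) (rg .h + rg .g) : Expr Rg Ar).eval E (st₆.set (.sc .g) k) =
            g (h * D.W j + k) := by simp [rg, eh, eg]
        simp only [Stmt.wp_seq, wp_put, Stmt.wp_ifz, Stmt.wp_skip, eload]
        refine ⟨?_, trivial, fun hz => ?_, fun hz => ?_⟩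
        · simp only [Expr.ok_load, Expr.ok_add, rg, Expr.ok_reg, Expr.eval_add, Expr.eval_reg,
            St.set_reg, reduceCtorEq, if_false, if_true, Rg.sc.injEq, eh, true_and]
          have := hf.lt_of_le_I hx; exact ⟨by omega, hqB, hf.cell_lt hx hqB⟩
        · have hz : g (h * D.W j + k) = 0 := by simpa [rg] using hz
          refine ⟨hJ.1, hJ.2.1, fun k' hk' => ?_⟩
          rcases Nat.lt_succ_iff_lt_or_eq.1 hk' with h | rfl
          · exact hJ.2.2 k' h
          · exact fun h' => absurd hz h'
        · have hz : g (h * D.W j + k) ≠ 0 := by simpa [rg] using hz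
          set v := g (h * D.W j + k) - 1 with hvdef
          have hokv : D.okB j h v := hB.valid h hhlt k hk hz
          obtain ⟨hsubY, hdivY⟩ := hsubE.add hokv.1 (by simp [Data.mid]) (by
            have := D.off_succ j; omega) hoff
          have hyK : u + v < K := lt_of_le_of_lt (hsubY.le hoff) hf.tot_le
          have hvz : g (h * D.W j + k) = v + 1 := by omega
          have ey : (rg .u + (rg .z - num 1) : Expr Rg Ar).eval E
              ((st₆.set (.sc .g) k).set (.sc .z) (g (h * D.W j + k))) = u + v := by
            simp [rg, num, eu, hvz]
          rw [ey]
          have hYdiv : (u + v) / D.Q ≤ u + v := Nat.div_le_self _ _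
          set st₇ := ((st₆.set (.sc .g) k).set (.sc .z) (g (h * D.W j + k))).set (.sc .y) (u + v)
            with hst₇
          have hh₇ : Holds D st₇ := ((hh₆.set rfl).set rfl).set rfl
          have h1V : 1 < 2 ^ V := hf.lt_of_le (by omega)
          have hdone : ∀ f', (∀ f β σ, f = st₆.arr (.T j) → Has D.Q D.P f β σ →
              Has D.Q D.P f' β σ) → Hit f' u k →
              (∀ e' < e, ∀ k < D.W j, Hit f' (uu e') k) ∧ ∀ k' < k + 1, Hit f' u k' := by
            intro f' hmono hnew
            refine ⟨fun e' he' k' hk' h1 h2 h3 => hmono _ _ _ rfl (hJ.2.1 e' he' k' hk' h1 h2 h3),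
              fun k' hk' => ?_⟩
            rcases Nat.lt_succ_iff_lt_or_eq.1 hk' with h | rfl
            · exact fun h1 h2 h3 => hmono _ _ _ rfl (hJ.2.2 k' h h1 h2 h3)
            · exact hnew
          have em : (rg .y / rg .Q % lv .M (max j 1) : Expr Rg Ar).eval E st₇ =
              (u + v) / D.Q % D.mod j := by
            simp only [Expr.eval_mod, Expr.eval_div, rg, lv, Expr.eval_reg, hh₇.Q,
              hh₇.mod hs.l_pos hj]
            simp [hst₇]
          have es₇ : (lv .s j : Expr Rg Ar).eval E st₇ = s := by simpa [hst₇, lv] using es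
          refine ⟨?_, wp_ifeq ?_ trivial (fun heq => ?_) (fun hne => ?_)⟩
          · simp only [Expr.ok_add, Expr.ok_sub, rg, num, Expr.ok_reg, Expr.ok_const, h1V,
              true_and, and_true]
            have := ey
            simp only [Expr.eval_add, Expr.eval_sub, rg, num] at this
            simp only [Expr.eval_sub]
            rw [this]; exact hf.lt_of_le (by omega)
          · refine Expr.ok_mod (by simp [rg]) trivial ?_
            simp only [Expr.eval_div, rg, Expr.eval_reg, hh₇.Q]
            rw [show st₇.reg (.sc .y) = u + v by simp [hst₇]]; exact hf.lt_of_le (by omega)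
          · rw [em, es₇] at heq
            have hokY : D.okT j s ((u + v) / D.Q % D.pT j) (u + v) := ⟨hsubY, heq, rfl⟩
            set β := (u + v) / D.Q % D.pT j with hβdef
            have hβ : β < D.pT j := Nat.mod_lt _ hpT
            have hβP : β * D.P + D.P ≤ D.pT j * D.P := by
              rw [← Nat.succ_mul]; exact Nat.mul_le_mul_right _ hβ
            have eb : (rg .y / rg .Q % .reg (keyT j) * rg .P : Expr Rg Ar).eval E st₇ = β * D.P := by
              simp only [Expr.eval_mod, Expr.eval_div, Expr.eval_mul, rg, Expr.eval_reg, hh₇.Q,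
                hh₇.P, hh₇.keyT hs.l_pos hj]
              simp [hst₇, hβdef]
            simp only [Stmt.wp_seq, wp_put]
            rw [eb]
            refine ⟨⟨Expr.ok_mod (by simp [rg]) trivial ?_, trivial, ?_⟩, ?_⟩
            · simp only [Expr.eval_div, rg, Expr.eval_reg, hh₇.Q]
              rw [show st₇.reg (.sc .y) = u + v by simp [hst₇]]; exact hf.lt_of_le (by omega)
            · have := eb
              rw [Expr.eval_mul] at this
              change Expr.eval E _ _ * Expr.eval E _ _ < 2 ^ V
              rw [this]; omega
            · have hP : (st₇.set (.sc .b) (β * D.P)).reg (.sc .P) = D.P :=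
                (hh₇.set (r := .sc .b) rfl).P
              have hQ' : (st₇.set (.sc .b) (β * D.P)).reg (.sc .Q) = D.Q :=
                (hh₇.set (r := .sc .b) rfl).Q
              have hb' : (st₇.set (.sc .b) (β * D.P)).reg (.sc .b) = β * D.P := by simp
              have hy' : (st₇.set (.sc .b) (β * D.P)).reg (.sc .y) = u + v := by simp [hst₇]
              refine (insert_wp (by simp) hqT ?_ ?_ ?_).mono fun st₈ fr₈ hins => ?_
              · rw [hP, hb']; exact fun k hk => hf.cell_lt (by omega) hqT
              · rw [hP, hb']; omega
              · rw [hy']; exact hf.lt_of_le (by omega)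
              · rw [hP, hb', hQ', hy'] at hins
                have harr : (st₇.set (.sc .b) (β * D.P)).arr (.T j) = st₆.arr (.T j) := rfl
                rw [harr] at hins
                refine ⟨hJ.1.inserted hβ hokY hins, hdone _ ?_ ?_⟩
                · rintro f β σ rfl hhas
                  exact hhas.inserted hins
                · exact fun _ _ hroom => hins.has hJ.1 hβ hokY hroom
          · rw [em, es₇] at hne
            exact ⟨hJ.1, hdone _ (fun f β σ hf h => hf ▸ h) fun _ h2 => absurd h2 hne⟩
      · intro st₆ fr₆ hJ
        refine ⟨hJ.1, fun e' he' => ?_⟩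
        rcases Nat.lt_succ_iff_lt_or_eq.1 he' with h | rfl
        · exact hJ.2.1 e' h
        · intro k hk
          rw [hudef]; exact hJ.2.2 k (by simpa [hh₅.W j hj] using hk)
  · intro st₂ fr₂ hI
    refine ⟨hI.1, fun u v hu hv hhas hmod hroom => ?_⟩
    obtain ⟨e, he, rfl⟩ := exists_itemSum hu (show D.mid j = D.off j + D.lenE j from rfl)
    obtain ⟨k, hk, hne, hkv⟩ := hhas
    have hmid : D.mid j ≤ D.off (j + 1) := by have := D.off_succ j; omega
    obtain ⟨-, hd⟩ := hu.add hv (by simp [Data.mid]) hmid hoff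
    have hbk := bucket_eq hs hj (u := D.itemSum (D.off j) (D.lenE j) e / D.Q) (v := v / D.Q)
      (s := s) (by rw [← hd]; exact hmod)
    have hokv := hB.valid _ (Nat.mod_lt _ hpB) k hk hne
    obtain ⟨-, hd'⟩ := hu.add hokv.1 (by simp [Data.mid]) hmid hoff
    have key := hI.2 e (by simpa [hh₁.pwE j hj] using he) k hk
    simp only [hHit, huu] at key
    rw [hbk, hd', hkv, ← hd] at key; exact key hne hmod hroom

end

/-! ### The search -/

/-- If the flag is set, the output is a set of items whose sum is one of the targets `t + k N`. -/
def Sound (D : Data) (st : St Rg Ar) : Prop := st.reg (.sc .flag) ≠ 0 →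
  ∃ X, D.Sub 0 D.n X ∧ (∃ k ≤ D.n, X / D.Q = D.t + k * D.N) ∧ st.arr .out 0 = X % D.Q

/-- What is maintained between the states `st` and `st'`: the output stays sound, and the flag, once
set, stays set; it is set if `C` holds. -/
def Progress (D : Data) (st st' : St Rg Ar) (C : Prop) : Prop :=
  Sound D st' ∧ (st.reg (.sc .flag) ≠ 0 ∨ C → st'.reg (.sc .flag) ≠ 0)

/-- The target `T` is searched for, all tables `B i` are filled, and for the levels `i ≥ j`, residue
classes have been chosen and the tables `T i` are filled. -/
structure Ready (D : Data) (K j T : ℕ) (st : St Rg Ar) : Prop where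
  holds : Holds D st
  target : st.reg (.sc .T) = T
  acc : ∀ i ≤ D.l, j ≤ i + 1 →
    st.reg (.lv .acc i) = ∑ i' ∈ Finset.Ioc i D.l, st.reg (.lv .s i')
  s_le : ∀ i ≤ D.l, j ≤ i → st.reg (.lv .s i) ≤ K
  bDone : ∀ i ≤ D.l, D.BDone i (st.arr (.B i))
  tDone : ∀ i ≤ D.l, j ≤ i → D.TDone i (st.reg (.lv .s i)) (st.arr (.B i)) (st.arr (.T i))

lemma Ready.congr {D : Data} {K j T : ℕ} {st st' : St Rg Ar} (h : Ready D K j T st)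
    (hh : Holds D st') (hT : st'.reg (.sc .T) = T)
    (hacc : ∀ i ≤ D.l, j ≤ i + 1 → st'.reg (.lv .acc i) = st.reg (.lv .acc i))
    (hs : ∀ i ≤ D.l, j ≤ i → st'.reg (.lv .s i) = st.reg (.lv .s i))
    (hB : ∀ i, st'.arr (.B i) = st.arr (.B i))
    (hT' : ∀ i ≤ D.l, j ≤ i → st'.arr (.T i) = st.arr (.T i)) : Ready D K j T st' where
  holds := hh
  target := hT
  acc i hi hj := by
    rw [hacc i hi hj, h.acc i hi hj]
    refine Finset.sum_congr rfl fun i' hi' => (hs i' ?_ ?_).symm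
    · exact (Finset.mem_Ioc.1 hi').2
    · have := (Finset.mem_Ioc.1 hi').1; omega
  s_le i hi hj := by rw [hs i hi hj]; exact h.s_le i hi hj
  bDone i hi := by rw [hB i]; exact h.bDone i hi
  tDone i hi hj := by rw [hs i hi hj, hB i, hT' i hi hj]; exact h.tDone i hi hj

/-- The numbers `σ i` in the tables `T i` add up to the target `T`. -/
structure Path (D : Data) (T : ℕ) (st : St Rg Ar) (σ : ℕ → ℕ) : Prop where
  sum_eq : ∑ i ∈ Finset.range (D.l + 1), σ i = T
  s_eq : ∀ i ≤ D.l, st.reg (.lv .s i) = σ i % D.mod i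
  has : ∀ i ≤ D.l, Has D.Q D.P (st.arr (.T i)) (σ i % D.pT i) (σ i)

lemma Path.congr {D : Data} {T : ℕ} {st st' : St Rg Ar} {σ : ℕ → ℕ} (h : Path D T st σ)
    (hs : ∀ i, st'.reg (.lv .s i) = st.reg (.lv .s i))
    (hT : ∀ i, st'.arr (.T i) = st.arr (.T i)) : Path D T st' σ :=
  ⟨h.sum_eq, fun i hi => by rw [hs, h.s_eq i hi], fun i hi => by rw [hT]; exact h.has i hi⟩

/-- The registers that the search for a given residue class changes. -/
def Rg.IsTemp : Rg → Bool
  | .sc .flag | .sc .a | .lv .key _ | .lv .kl _ | .lv .X _ => true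
  | _ => false

lemma asg_output {l : ℕ} {x : Rg} (h : (output l).Asg x) : x = .sc .flag := by
  simpa [output, Stmt.Asg] using h

lemma wr_output {l : ℕ} {x : Ar} (h : (output l).Wr x) : x = .out := by
  simpa [output, Stmt.Wr] using h

lemma asg_extend (r j : ℕ) {x : Rg} (h : (extend r j).Asg x) :
    x = .sc .a ∨ x = .sc .flag ∨ ∃ i, j ≤ i ∧ (x = .lv .key i ∨ x = .lv .kl i ∨ x = .lv .X (i + 1)) := by
  induction r generalizing j with
  | zero => exact .inr (.inl (asg_output h))
  | succ r ih =>
    rcases h with h | h | h | h | h | h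
    · exact .inr (.inr ⟨j, le_rfl, .inl h⟩)
    · exact .inr (.inr ⟨j, le_rfl, .inr (.inl h)⟩)
    · exact .inl h
    · exact h.elim
    · exact .inr (.inr ⟨j, le_rfl, .inr (.inr h)⟩)
    · rcases ih _ h with h | h | ⟨i, hi, h⟩
      · exact .inl h
      · exact .inr (.inl h)
      · exact .inr (.inr ⟨i, by omega, h⟩)

lemma asg_extend_isTemp {r j : ℕ} {x : Rg} (h : (extend r j).Asg x) : x.IsTemp = true := by
  rcases asg_extend r j h with rfl | rfl | ⟨i, -, rfl | rfl | rfl⟩ <;> rfl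

lemma wr_extend (r j : ℕ) {x : Ar} (h : (extend r j).Wr x) : x = .out := by
  induction r generalizing j with
  | zero => exact wr_output h
  | succ r ih =>
    rcases h with h | h | h | h | h
    · exact h.elim
    · exact h.elim
    · exact h.elim
    · exact h.elim
    · exact ih _ h

lemma asg_extendAll {l : ℕ} {x : Rg} (h : (extendAll l).Asg x) : x.IsTemp = true := by
  rcases h with rfl | rfl | rfl | h | rfl | h
  · rfl
  · rfl
  · rfl
  · exact h.elim
  · rfl
  · exact asg_extend_isTemp h

lemma wr_extendAll {l : ℕ} {x : Ar} (h : (extendAll l).Wr x) : x = .out := by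
  rcases h with h | h | h | h
  · exact h.elim
  · exact h.elim
  · exact h.elim
  · exact wr_extend _ _ h

/-- A state that differs only in temporary registers and in the output is still ready. -/
lemma Ready.temp {D : Data} {K j T : ℕ} {st st' : St Rg Ar} (h : Ready D K j T st)
    (hr : ∀ x : Rg, x.IsTemp = false → st'.reg x = st.reg x)
    (ha : ∀ x, x ≠ .out → st'.arr x = st.arr x) : Ready D K j T st' := by
  refine h.congr (h.holds.congr (fun r hr' => hr r ?_) (ha _ (by simp)))
    ((hr _ rfl).trans h.target) (fun i _ _ => hr _ rfl) (fun i _ _ => hr _ rfl)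
    (fun i => ha _ (by simp)) (fun i _ _ => ha _ (by simp))
  rcases r with r | ⟨f, j⟩
  · cases r <;> simp_all [Rg.IsTemp, Rg.IsParam]
  · cases f <;> simp_all [Rg.IsTemp, Rg.IsParam]

lemma Ready.set {D : Data} {K j T : ℕ} {st : St Rg Ar} {r : Rg} {v : ℕ} (h : Ready D K j T st)
    (hr : r.IsTemp = true) : Ready D K j T (st.set r v) := by
  refine h.temp (fun x hx => ?_) fun _ _ => rfl
  rw [St.set_reg, if_neg]
  rintro rfl
  simp [hr] at hx

lemma Path.temp {D : Data} {T : ℕ} {st st' : St Rg Ar} {σ : ℕ → ℕ} (h : Path D T st σ)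
    (hr : ∀ x : Rg, x.IsTemp = false → st'.reg x = st.reg x)
    (ha : ∀ x, x ≠ .out → st'.arr x = st.arr x) : Path D T st' σ :=
  h.congr (fun i => hr _ rfl) (fun i => ha _ (by simp))

section

variable {D : Data} {A V K I : ℕ} {E : Env} {st : St Rg Ar}

/-- Recovering the residue of the summand `b` of `T`. -/
lemma sub_mod_eq {k T acc a b : ℕ} (hk : 0 < k) (hT : a + b = T) (h : acc % k = a % k) :
    (T % k + (k - acc % k)) % k = b % k := by
  rw [h, ← hT, add_mod_sub_mod hk]

lemma Ready.acc_le {j T : ℕ} (h : Ready D K j T st) {i : ℕ} (hi : i ≤ D.l)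
    (hj : j ≤ i + 1) : st.reg (.lv .acc i) ≤ (D.l - i) * K := by
  rw [h.acc i hi hj]
  have : ∀ i' ∈ Finset.Ioc i D.l, st.reg (.lv .s i') ≤ K := fun i' hi' =>
    h.s_le i' (Finset.mem_Ioc.1 hi').2 (by have := (Finset.mem_Ioc.1 hi').1; omega)
  simpa using Finset.sum_le_card_nsmul _ _ _ this

lemma output_wp (hf : D.Fits A V K I) (hh : Holds D st) {l T : ℕ}
    (hT : st.reg (.sc .T) = T) (hk : ∃ k ≤ D.n, T = D.t + k * D.N)
    (hX : D.Sub 0 D.n (st.reg (.lv .X l))) (hS : Sound D st) :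
    (output l).Wp (layout D.l) A V E st fun st' =>
      Progress D st st' (st.reg (.lv .X l) / D.Q = T) := by
  have h1 : 1 < 2 ^ V := hf.lt_of_le (by have := hf.two_le; omega)
  refine wp_ifeq (by simp [lv, rg]) (by simp [rg]) (fun h => ?_) (fun h => ?_)
  · have h : st.reg (.lv .X l) / D.Q = T := by simpa [lv, rg, hh.Q, hT] using h
    have hXK : st.reg (.lv .X l) < 2 ^ V := by
      have := hX.le le_rfl
      have := hf.tot_le; exact hf.lt_of_le (by omega)
    simp only [Stmt.wp_seq, wp_put, Stmt.wp_store]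
    refine ⟨h1, ⟨?_, Expr.ok_mod trivial trivial hXK, ?_, ?_⟩, ?_, ?_⟩
    · simp [num]
    · simp [Ar.num]
    · exact hf.cell_lt (Nat.zero_le _) (by simp [Ar.num])
    · intro _
      obtain ⟨k, hk, rfl⟩ := hk
      refine ⟨_, hX, ⟨k, hk, h⟩, ?_⟩
      simp [St.put_arr, num, lv, rg, hh.Q]
    · intro _
      simp [num]
  · have h : st.reg (.lv .X l) / D.Q ≠ T := by simpa [lv, rg, hh.Q, hT] using h
    exact ⟨hS, fun h' => h'.elim id fun h' => absurd h' h⟩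

/-- From values of the blocks below `j`, the matching of the tables of the levels from `j` on sets
the flag if some path agrees with them. -/
lemma extend_wp (hs : D.Shape) (hf : D.Fits A V K I) {T : ℕ} (hk : ∃ k ≤ D.n, T = D.t + k * D.N)
    (r : ℕ) {j : ℕ} (hj : 1 ≤ j) (hjr : j + r = D.l + 1) (st : St Rg Ar) (hr : Ready D K 0 T st)
    (hX : D.Sub 0 (D.off j) (st.reg (.lv .X j))) (hS : Sound D st) :
    (extend r j).Wp (layout D.l) A V E st fun st' =>
      Progress D st st' (∃ σ, Path D T st σ ∧
        st.reg (.lv .X j) / D.Q = ∑ i ∈ Finset.range j, σ i) := by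
  have hTK : T ≤ K := by
    obtain ⟨k, hk, rfl⟩ := hk
    exact le_trans (by gcongr) hf.t_le
  have h2K := hf.two_le
  induction r generalizing j st with
  | zero =>
    have hjl : j = D.l + 1 := by omega
    subst hjl
    rw [hs.off_eq] at hX
    refine (output_wp hf hr.holds hr.target hk hX hS).mono fun st' fr h => ⟨h.1, fun h' => ?_⟩
    refine h.2 (h'.imp id ?_)
    rintro ⟨σ, hσ, hsum⟩
    rw [hsum, hσ.sum_eq]
  | succ r ih =>
    have hjl : j ≤ D.l := by omega
    have hpT := hs.pT_pos j
    have hoff := hs.off_le hjl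
    have hTI := hf.T_le j hjl
    have hTV := hf.lt_of_le_I hTI
    have hqT : (Ar.T j).num < 2 * D.l + 4 := by simp [Ar.num]; omega
    have hXK : st.reg (.lv .X j) < K :=
      lt_of_le_of_lt (hX.le ((D.off_mono (by omega)).trans hoff)) hf.tot_le
    have hXQ : st.reg (.lv .X j) / D.Q ≤ st.reg (.lv .X j) := Nat.div_le_self _ _
    set κ := (T % D.pT j + (D.pT j - (st.reg (.lv .acc j) + st.reg (.lv .X j) / D.Q) % D.pT j)) %
      D.pT j with hκ
    have hκlt : κ < D.pT j := Nat.mod_lt _ hpT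
    have hκP : κ * D.P + D.P ≤ D.pT j * D.P := by
      rw [← Nat.succ_mul]; exact Nat.mul_le_mul_right _ hκlt
    have hpTK : D.pT j ≤ K := hf.p_le _ (by omega)
    have hacc := hr.acc_le hjl (by omega)
    have haccK : st.reg (.lv .acc j) ≤ K * K := hacc.trans (Nat.mul_le_mul_right _ (by
      have := hf.l_le; omega))
    have hKK : K ≤ K * K := Nat.le_mul_of_pos_left _ (by omega)
    have ekey : ((rg .T % .reg (keyT j) +
        (.reg (keyT j) - (lv .acc j + lv .X j / rg .Q) % .reg (keyT j))) % .reg (keyT j) *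
        rg .P : Expr Rg Ar).eval E st = κ * D.P := by
      simp only [Expr.eval_mul, Expr.eval_mod, Expr.eval_add, Expr.eval_sub, Expr.eval_div, rg, lv,
        Expr.eval_reg, hr.holds.Q, hr.holds.P, hr.holds.keyT hs.l_pos hjl, hr.target]
      rfl
    rw [extend, Stmt.wp_seq, Stmt.wp_assign, ekey]
    refine ⟨⟨?_, trivial, ?_⟩, ?_⟩
    · have o1 : ((rg .T % .reg (keyT j)) : Expr Rg Ar).Ok (layout D.l) A V E st :=
        Expr.ok_mod trivial trivial (by
          simp only [rg, Expr.eval_reg, hr.target]; exact hf.lt_of_le (by omega))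
      have e2 : (lv .acc j + lv .X j / rg .Q : Expr Rg Ar).eval E st < 2 ^ V := by
        simp only [Expr.eval_add, Expr.eval_div, lv, rg, Expr.eval_reg, hr.holds.Q]
        exact hf.lt (by omega)
      have o2 : ((lv .acc j + lv .X j / rg .Q) % .reg (keyT j) : Expr Rg Ar).Ok (layout D.l) A V E
          st := Expr.ok_mod ⟨trivial, by simp [lv, rg], e2⟩ trivial e2
      have e3 : (rg .T % .reg (keyT j) +
          (.reg (keyT j) - (lv .acc j + lv .X j / rg .Q) % .reg (keyT j)) : Expr Rg Ar).eval E st <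
          2 ^ V := by
        simp only [Expr.eval_mod, Expr.eval_add, Expr.eval_sub, Expr.eval_div, rg, lv,
          Expr.eval_reg, hr.holds.Q, hr.holds.keyT hs.l_pos hjl, hr.target]
        have := Nat.mod_lt T hpT; exact hf.lt_of_le (by omega)
      refine Expr.ok_mod ⟨o1, ?_, e3⟩ trivial e3
      rw [Expr.ok_sub]; exact ⟨trivial, o2⟩
    · rw [Expr.eval_mul] at ekey
      change Expr.eval E _ _ * Expr.eval E _ _ < 2 ^ V
      rw [ekey]; omega
    · set st₁ := st.set (.lv .key j) (κ * D.P) with hst₁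
      have hr₁ : Ready D K 0 T st₁ := hr.set rfl
      refine Stmt.wp_loop (fun k st' => Sound D st' ∧ (st.reg (.sc .flag) ≠ 0 ∨
        (∃ σ, Path D T st σ ∧ st.reg (.lv .X j) / D.Q = ∑ i ∈ Finset.range j, σ i ∧
          ∃ k' < k, st.arr (.T j) (κ * D.P + k') ≠ 0 ∧
            (st.arr (.T j) (κ * D.P + k') - 1) / D.Q = σ j) → st'.reg (.sc .flag) ≠ 0)) ?_ ?_ ?_
      · refine ⟨hS, ?_⟩
        rintro (h | ⟨-, -, -, k', h, -⟩)
        · simpa [hst₁] using h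
        · omega
      · intro k hk' st₂ fr₂ hI
        have hkP : k < D.P := by simpa [hr₁.holds.P] using hk'
        have hx : κ * D.P + k ≤ I := by omega
        have htemp₁ : ∀ x : Rg, x.IsTemp = false → st₁.reg x = st.reg x := by
          intro x hx
          rw [hst₁, St.set_reg, if_neg]
          rintro rfl
          simp [Rg.IsTemp] at hx
        have htemp : ∀ x : Rg, x.IsTemp = false → st₂.reg x = st.reg x := by
          intro x hx
          rw [fr₂.reg, htemp₁ x hx]
          rintro (rfl | rfl | h | rfl | h)
          · simp [Rg.IsTemp] at hx
          · simp [Rg.IsTemp] at hx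
          · exact h.elim
          · simp [Rg.IsTemp] at hx
          · rw [asg_extend_isTemp h] at hx; simp at hx
        have harr : ∀ x, x ≠ .out → st₂.arr x = st.arr x := by
          intro x hx
          rw [fr₂.arr]
          · rfl
          rintro (h | h | h | h)
          · exact h.elim
          · exact h.elim
          · exact h.elim
          · exact hx (wr_extend _ _ h)
        have hr₂ : Ready D K 0 T st₂ := hr.temp htemp harr
        have hkeep : ∀ x : Rg, (x = .lv .key j ∨ x = .lv .X j) → st₂.reg x = st₁.reg x := by
          intro x hx
          rw [fr₂.reg]
          rintro (rfl | rfl | h | rfl | h)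
          · simp at hx
          · simp at hx
          · exact h.elim
          · simp at hx
          · rcases asg_extend _ _ h with rfl | rfl | ⟨i, hi, rfl | rfl | rfl⟩
            · simp at hx
            · simp at hx
            · simp only [Rg.lv.injEq, true_and, reduceCtorEq, false_and, or_false] at hx; omega
            · simp at hx
            · simp only [Rg.lv.injEq, true_and, reduceCtorEq, false_and, false_or] at hx; omega
        have ek : st₂.reg (.lv .key j) = κ * D.P := by rw [hkeep _ (.inl rfl)]; simp [hst₁]
        have eX : st₂.reg (.lv .X j) = st.reg (.lv .X j) := by rw [hkeep _ (.inr rfl)]; simp [hst₁]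
        have eT : st₂.arr (.T j) = st.arr (.T j) := harr _ (by simp)
        set f := st.arr (.T j) with hf'
        have eload : (Expr.load (.T j) (lv .key j + lv .kl j) : Expr Rg Ar).eval E
            (st₂.set (.lv .kl j) k) = f (κ * D.P + k) := by simp [lv, ek, eT]
        simp only [Stmt.wp_seq, wp_put, Stmt.wp_ifz, Stmt.wp_skip, eload]
        refine ⟨?_, trivial, fun hz => ?_, fun hz => ?_⟩
        · simp only [Expr.ok_load, Expr.ok_add, lv, Expr.ok_reg, Expr.eval_add, Expr.eval_reg,
            St.set_reg, Rg.lv.injEq, reduceCtorEq, false_and, if_false, if_true, ek, true_and]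
          have := hf.lt_of_le_I hx; exact ⟨by omega, hqT, hf.cell_lt hx hqT⟩
        · have hz : f (κ * D.P + k) = 0 := by simpa [rg] using hz
          refine ⟨hI.1, fun h => ?_⟩
          rcases h with h | ⟨σ, h1, h2, k', hk', h3, h4⟩
          · exact hI.2 (.inl h)
          · rcases Nat.lt_succ_iff_lt_or_eq.1 hk' with h | rfl
            · exact hI.2 (.inr ⟨σ, h1, h2, k', h, h3, h4⟩)
            · exact absurd hz h3
        · have hz : f (κ * D.P + k) ≠ 0 := by simpa [rg] using hz
          set v := f (κ * D.P + k) - 1 with hv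
          have hok : D.okT j _ κ v := (hr.tDone j hjl (by omega)).table.valid κ hκlt k hkP hz
          obtain ⟨hsub, hdiv⟩ := hX.add hok.1 (Nat.zero_le _) (D.off_mono (by omega)) hoff
          have hvK : st.reg (.lv .X j) + v < K := lt_of_le_of_lt (hsub.le hoff) hf.tot_le
          set st₃ := (st₂.set (.lv .kl j) k).set (.sc .a) (f (κ * D.P + k)) with hst₃
          have eX' : (lv .X j + (rg .a - num 1) : Expr Rg Ar).eval E st₃ = st.reg (.lv .X j) + v := by
            simp [hst₃, lv, rg, num, eX, hv]
          simp only [Stmt.wp_assign]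
          rw [eX']
          refine ⟨?_, ?_⟩
          · simp only [Expr.ok_add, Expr.ok_sub, lv, rg, num, Expr.ok_reg, Expr.ok_const, true_and]
            refine ⟨hf.lt_of_le (by omega), ?_⟩
            rw [Expr.eval_add] at eX'
            simp only [lv, rg, num] at eX'
            rw [eX']; exact hf.lt_of_le (by omega)
          · set st₄ := st₃.set (.lv .X (j + 1)) (st.reg (.lv .X j) + v) with hst₄
            have hr₄ : Ready D K 0 T st₄ := ((hr₂.set rfl).set rfl).set rfl
            have hX₄ : st₄.reg (.lv .X (j + 1)) = st.reg (.lv .X j) + v := by simp [hst₄]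
            have hfl : st₄.reg (.sc .flag) = st₂.reg (.sc .flag) := by simp [hst₄, hst₃]
            have hS₄ : Sound D st₄ := by
              unfold Sound
              rw [hfl]; exact hI.1
            refine (ih (by omega) (by omega) st₄ hr₄ (by rw [hX₄]; exact hsub) hS₄).mono
              fun st₅ fr₅ hp => ⟨hp.1, fun h => hp.2 ?_⟩
            rw [hfl]
            rcases h with h | ⟨σ, h1, h2, k', hk', h3, h4⟩
            · exact .inl (hI.2 (.inl h))
            · rcases Nat.lt_succ_iff_lt_or_eq.1 hk' with h | rfl
              · exact .inl (hI.2 (.inr ⟨σ, h1, h2, k', h, h3, h4⟩))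
              · refine .inr ⟨σ, h1.temp (fun x hx => ?_) (fun x hx => ?_), ?_⟩
                · rw [← htemp x hx, hst₄, hst₃]
                  simp only [St.set_reg]
                  rw [if_neg, if_neg, if_neg] <;> rintro rfl <;> simp [Rg.IsTemp] at hx
                · exact harr x hx
                · rw [hX₄, hdiv, h2, Finset.sum_range_succ, h4]
      · intro st₂ fr₂ hI
        refine ⟨hI.1, fun h => hI.2 (h.imp id ?_)⟩
        rintro ⟨σ, h1, h2⟩
        refine ⟨σ, h1, h2, ?_⟩
        have hP : st₁.reg (.sc .P) = D.P := hr₁.holds.P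
        rw [rounds_false, hP]
        have hb : κ = σ j % D.pT j := by
          refine sub_mod_eq hpT (a := (∑ i ∈ Finset.Ioc j D.l, σ i) + ∑ i ∈ Finset.range j, σ i) ?_ ?_
          · have h3 := Finset.sum_range_add_sum_Ico σ (m := j + 1) (n := D.l + 1) (by omega)
            rw [Finset.sum_range_succ, h1.sum_eq] at h3
            rw [← h3, ← Finset.Ico_succ_succ_eq_Ioc]
            simp only [Nat.succ_eq_succ, Nat.succ_eq_add_one]; ring
          · rw [h2]
            refine Nat.ModEq.add_right _ ?_
            rw [hr.acc j hjl (by omega)]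
            refine (Nat.ModEq.sum fun i hi => ?_)
            have hi := Finset.mem_Ioc.1 hi
            rw [h1.s_eq i hi.2]
            refine (Nat.mod_modEq _ _).of_dvd ?_
            exact hs.p_dvd _ (by omega) _ (by omega) (by omega)
        rw [hb]; exact h1.has j hjl

end

/-- No bucket that a part of the selection `x` falls into overflows. -/
structure Rooms (D : Data) (x : ℕ → Bool) : Prop where
  roomB : ∀ j ≤ D.l, Room D.Q (D.W j) (D.okB j) (D.sum x (D.mid j) (D.off (j + 1)) % D.pB j)
  roomT : ∀ j ≤ D.l, Room D.Q D.P (D.okT j (D.sum x (D.off j) (D.off (j + 1)) % D.mod j))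
    (D.sum x (D.off j) (D.off (j + 1)) % D.pT j)

/-- The items `x` have sum `T`, and the search finds them. -/
structure Star (D : Data) (T : ℕ) (x : ℕ → Bool) : Prop extends Rooms D x where
  sum_eq : D.sum x 0 D.n = T

lemma sum_off {D : Data} (x : ℕ → Bool) (j : ℕ) :
    ∑ i ∈ Finset.range j, D.sum x (D.off i) (D.off (i + 1)) = D.sum x 0 (D.off j) := by
  induction j with
  | zero => simp [sum, off]
  | succ j ih => rw [Finset.sum_range_succ, ih, sum_add x (Nat.zero_le _) (D.off_mono (by omega))]

section

variable {D : Data} {A V K I : ℕ} {E : Env} {st : St Rg Ar}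

/-- If no relevant bucket overflows and the residue classes are those of the parts of `x`, then the
sums of the parts of `x` are in the tables. -/
lemma Star.path (hs : D.Shape) {T : ℕ} {x : ℕ → Bool} (h : Star D T x) (hr : Ready D K 0 T st)
    (hx : ∀ j ≤ D.l, st.reg (.lv .s j) = D.sum x (D.off j) (D.off (j + 1)) % D.mod j) :
    Path D T st fun j => D.sum x (D.off j) (D.off (j + 1)) where
  sum_eq := by rw [sum_off, hs.off_eq, h.sum_eq]
  s_eq := hx
  has j hj := by
    have ht := hr.tDone j hj (Nat.zero_le _)
    rw [hx j hj] at ht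
    have hoff := hs.off_le hj
    have hlm : D.off j ≤ D.mid j := by simp [Data.mid]
    have hmo : D.mid j ≤ D.off (j + 1) := by have := D.off_succ j; omega
    have hB := (hr.bDone j hj).has (D.val x (D.mid j) (D.off (j + 1))) ⟨x, rfl⟩
    rw [val_div x hoff] at hB
    have hT := ht.has (D.val x (D.off j) (D.mid j)) (D.val x (D.mid j) (D.off (j + 1))) ⟨x, rfl⟩
      ⟨x, rfl⟩
    rw [val_add x hlm hmo, val_div x hoff, val_div x hoff] at hT
    exact hT (hB (h.roomB j hj)) rfl (h.roomT j hj)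

lemma extendAll_wp (hs : D.Shape) (hf : D.Fits A V K I) {T : ℕ}
    (hk : ∃ k ≤ D.n, T = D.t + k * D.N) (hr : Ready D K 0 T st) (hS : Sound D st) :
    (extendAll D.l).Wp (layout D.l) A V E st fun st' =>
      Progress D st st' (∃ σ, Path D T st σ) := by
  have hpT := hs.pT_pos 0
  have hoff := hs.off_le (Nat.zero_le _)
  have hTI := hf.T_le 0 (Nat.zero_le _)
  have hTV := hf.lt_of_le_I hTI
  have hqT : (Ar.T 0).num < 2 * D.l + 4 := by simp [Ar.num]
  have h2K := hf.two_le
  set f := st.arr (.T 0) with hf'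
  refine Stmt.wp_loop (fun β st' => Sound D st' ∧ (st.reg (.sc .flag) ≠ 0 ∨
    (∃ σ, Path D T st σ ∧ σ 0 % D.pT 0 < β) → st'.reg (.sc .flag) ≠ 0)) ?_ ?_ ?_
  · exact ⟨hS, fun h => h.elim id fun h => by omega⟩
  · intro β hβ' st₁ fr₁ hI
    have hβ : β < D.pT 0 := by rw [hr.holds.keyT hs.l_pos (Nat.zero_le _)] at hβ'; exact hβ'
    have hβP : β * D.P + D.P ≤ D.pT 0 * D.P := by
      rw [← Nat.succ_mul]; exact Nat.mul_le_mul_right _ hβ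
    have htemp₁ : ∀ x : Rg, x.IsTemp = false → (st₁.set (.lv .key 0) β).reg x = st.reg x := by
      intro x hx
      have : x ≠ .lv .key 0 := by rintro rfl; simp [Rg.IsTemp] at hx
      rw [St.set_reg, if_neg this, fr₁.reg _ fun h => ?_]
      rw [asg_extendAll h] at hx; simp at hx
    have harr₁ : ∀ x, x ≠ .out → (st₁.set (.lv .key 0) β).arr x = st.arr x := fun x hx =>
      fr₁.arr _ fun h => hx (wr_extendAll h)
    have hP₁ : (st₁.set (.lv .key 0) β).reg (.sc .P) = D.P := by rw [htemp₁ _ rfl]; exact hr.holds.P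
    refine Stmt.wp_loop (fun k st' => Sound D st' ∧ (st.reg (.sc .flag) ≠ 0 ∨
      (∃ σ, Path D T st σ ∧ (σ 0 % D.pT 0 < β ∨ σ 0 % D.pT 0 = β ∧
        ∃ k' < k, f (β * D.P + k') ≠ 0 ∧ (f (β * D.P + k') - 1) / D.Q = σ 0)) →
      st'.reg (.sc .flag) ≠ 0)) ?_ ?_ ?_
    · refine ⟨hI.1, fun h => hI.2 (h.imp id ?_)⟩
      rintro ⟨σ, h1, h2 | ⟨-, k, hk, -⟩⟩
      · exact ⟨σ, h1, h2⟩
      · omega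
    · intro k hk' st₂ fr₂ hJ
      have hkP : k < D.P := by rw [hP₁] at hk'; exact hk'
      have hx : β * D.P + k ≤ I := by omega
      have htemp : ∀ x : Rg, x.IsTemp = false → st₂.reg x = st.reg x := by
        intro x hx
        rw [fr₂.reg x fun h => ?_, htemp₁ x hx]
        rw [asg_extendAll (.inr h)] at hx; simp at hx
      have harr : ∀ x, x ≠ .out → st₂.arr x = st.arr x := by
        intro x hx
        rw [fr₂.arr x fun h => hx (wr_extendAll h), harr₁ x hx]
      have hr₂ : Ready D K 0 T st₂ := hr.temp htemp harr
      have ek : st₂.reg (.lv .key 0) = β := by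
        rw [fr₂.reg]
        · simp
        rintro (h | h | h | h | h)
        · simp at h
        · simp at h
        · exact h
        · cases (h : Rg.lv .key 0 = .lv .X 1)
        · rcases asg_extend _ _ h with h | h | ⟨i, hi, h | h | h⟩
          · simp at h
          · simp at h
          · simp only [Rg.lv.injEq, true_and] at h; omega
          · simp at h
          · simp at h
      have eT : st₂.arr (.T 0) = f := harr _ (by simp)
      have eload : (Expr.load (.T 0) (lv .key 0 * rg .P + lv .kl 0) : Expr Rg Ar).eval E
          (st₂.set (.lv .kl 0) k) = f (β * D.P + k) := by simp [lv, rg, ek, eT, hr₂.holds.P]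
      simp only [Stmt.wp_seq, wp_put, Stmt.wp_ifz, Stmt.wp_skip, eload]
      refine ⟨?_, trivial, fun hz => ?_, fun hz => ?_⟩
      · simp only [Expr.ok_load, Expr.ok_add, Expr.ok_mul, lv, rg, Expr.ok_reg, Expr.eval_add,
          Expr.eval_mul, Expr.eval_reg, St.set_reg, Rg.lv.injEq, reduceCtorEq, false_and, if_false,
          if_true, ek, true_and, hr₂.holds.P]
        exact ⟨⟨by omega, by omega⟩, hqT, hf.cell_lt hx hqT⟩
      · have hz : f (β * D.P + k) = 0 := by simpa [rg] using hz
        refine ⟨hJ.1, fun h => hJ.2 (h.imp id ?_)⟩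
        rintro ⟨σ, h1, h2 | ⟨h2, k', hk', h3, h4⟩⟩
        · exact ⟨σ, h1, .inl h2⟩
        · rcases Nat.lt_succ_iff_lt_or_eq.1 hk' with h | rfl
          · exact ⟨σ, h1, .inr ⟨h2, k', h, h3, h4⟩⟩
          · exact absurd hz h3
      · have hz : f (β * D.P + k) ≠ 0 := by simpa [rg] using hz
        set v := f (β * D.P + k) - 1 with hv
        have hok : D.okT 0 _ β v := (hr.tDone 0 (Nat.zero_le _) le_rfl).table.valid β hβ k hkP hz
        have hsub : D.Sub 0 (D.off 1) v := hok.1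
        set st₃ := (st₂.set (.lv .kl 0) k).set (.sc .a) (f (β * D.P + k)) with hst₃
        have eX' : (rg .a - num 1 : Expr Rg Ar).eval E st₃ = v := by simp [hst₃, rg, num, hv]
        simp only [Stmt.wp_assign]
        rw [eX']
        refine ⟨?_, ?_⟩
        · simp only [Expr.ok_sub, rg, num, Expr.ok_reg, Expr.ok_const, true_and]
          exact hf.lt_of_le (by omega)
        · set st₄ := st₃.set (.lv .X 1) v with hst₄
          have hr₄ : Ready D K 0 T st₄ := ((hr₂.set rfl).set rfl).set rfl
          have hX₄ : st₄.reg (.lv .X 1) = v := by simp [hst₄]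
          have hfl : st₄.reg (.sc .flag) = st₂.reg (.sc .flag) := by simp [hst₄, hst₃]
          have hS₄ : Sound D st₄ := by
            unfold Sound
            rw [hfl]; exact hJ.1
          refine (extend_wp hs hf hk D.l le_rfl (by omega) st₄ hr₄
            (by rw [hX₄]; exact hsub) hS₄).mono fun st₅ fr₅ hp => ⟨hp.1, fun h => hp.2 ?_⟩
          rw [hfl]
          rcases h with h | ⟨σ, h1, h2 | ⟨h2, k', hk', h3, h4⟩⟩
          · exact .inl (hJ.2 (.inl h))
          · exact .inl (hJ.2 (.inr ⟨σ, h1, .inl h2⟩))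
          · rcases Nat.lt_succ_iff_lt_or_eq.1 hk' with h | rfl
            · exact .inl (hJ.2 (.inr ⟨σ, h1, .inr ⟨h2, k', h, h3, h4⟩⟩))
            · refine .inr ⟨σ, h1.temp (fun x hx => ?_) (fun x hx => ?_), ?_⟩
              · rw [← htemp x hx, hst₄, hst₃]
                simp only [St.set_reg]
                rw [if_neg, if_neg, if_neg] <;> rintro rfl <;> simp [Rg.IsTemp] at hx
              · exact harr x hx
              · rw [hX₄, Finset.sum_range_one, h4]
    · intro st₂ fr₂ hJ
      refine ⟨hJ.1, fun h => hJ.2 (h.imp id ?_)⟩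
      rintro ⟨σ, h1, h2⟩
      refine ⟨σ, h1, ?_⟩
      rcases Nat.lt_succ_iff_lt_or_eq.1 h2 with h | h
      · exact .inl h
      · refine .inr ⟨h, ?_⟩
        rw [rounds_false, hP₁, ← h]; exact h1.has 0 (Nat.zero_le _)
  · intro st₁ fr₁ hI
    refine ⟨hI.1, fun h => hI.2 (h.imp id ?_)⟩
    rintro ⟨σ, h1⟩
    refine ⟨σ, h1, ?_⟩
    rw [rounds_false, hr.holds.keyT hs.l_pos (Nat.zero_le _)]; exact Nat.mod_lt _ hpT

/-- The scalar registers that the search for a given target changes. -/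
def Scalar.IsLocal : Scalar → Bool
  | .v | .x | .y | .z | .u | .h | .e | .i | .k | .b | .fl | .g | .a | .flag => true
  | _ => false

lemma asg_buildT {j : ℕ} {x : Rg} (h : (buildT j).Asg x) : ∃ r : Scalar, r.IsLocal ∧ x = .sc r := by
  simp only [buildT, Stmt.Asg, asg_clear, asg_put, asg_sumItems, asg_insert, asg_ifeq] at h
  rcases h with (rfl | rfl) | rfl | rfl | (rfl | rfl | rfl) | rfl | rfl | rfl | rfl | h | rfl | rfl |
    rfl | rfl | rfl
  all_goals first | exact ⟨_, rfl, rfl⟩ | exact h.elim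

lemma wr_buildT {j : ℕ} {x : Ar} (h : (buildT j).Wr x) : x = .T j := by
  simp only [buildT, Stmt.Wr, wr_clear, wr_put, wr_sumItems, wr_insert, wr_ifeq] at h
  simpa using h

lemma asg_search {l j : ℕ} {x : Rg} (h : (search l j).Asg x) :
    (∃ r : Scalar, r.IsLocal ∧ x = .sc r) ∨
    (∃ i, x = .lv .key i ∨ x = .lv .kl i ∨ x = .lv .X i) ∨ (∃ i ≤ j, x = .lv .s i) ∨
    ∃ i < j, x = .lv .acc i := by
  induction j with
  | zero =>
    rcases h with h | h | h
    · exact .inr (.inr (.inl ⟨0, le_rfl, h⟩))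
    · exact .inl (asg_buildT h)
    · rcases h with rfl | rfl | rfl | h | rfl | h
      · exact .inr (.inl ⟨_, .inl rfl⟩)
      · exact .inr (.inl ⟨_, .inr (.inl rfl)⟩)
      · exact .inl ⟨_, rfl, rfl⟩
      · exact h.elim
      · exact .inr (.inl ⟨_, .inr (.inr rfl)⟩)
      · rcases asg_extend _ _ h with rfl | rfl | ⟨i, -, rfl | rfl | rfl⟩
        · exact .inl ⟨_, rfl, rfl⟩
        · exact .inl ⟨_, rfl, rfl⟩
        · exact .inr (.inl ⟨_, .inl rfl⟩)
        · exact .inr (.inl ⟨_, .inr (.inl rfl)⟩)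
        · exact .inr (.inl ⟨_, .inr (.inr rfl)⟩)
  | succ j ih =>
    rcases h with rfl | h | rfl | h
    · exact .inr (.inr (.inl ⟨_, le_rfl, rfl⟩))
    · exact .inl (asg_buildT h)
    · exact .inr (.inr (.inr ⟨_, by omega, rfl⟩))
    · rcases ih h with h | h | ⟨i, hi, h⟩ | ⟨i, hi, h⟩
      · exact .inl h
      · exact .inr (.inl h)
      · exact .inr (.inr (.inl ⟨i, by omega, h⟩))
      · exact .inr (.inr (.inr ⟨i, by omega, h⟩))

lemma wr_search {l j : ℕ} {x : Ar} (h : (search l j).Wr x) : x = .out ∨ ∃ i ≤ j, x = .T i := by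
  induction j with
  | zero =>
    rcases h with h | h | h
    · exact h.elim
    · exact .inr ⟨0, le_rfl, wr_buildT h⟩
    · exact .inl (wr_extendAll h)
  | succ j ih =>
    rcases h with h | h | h
    · exact .inr ⟨_, le_rfl, wr_buildT h⟩
    · exact h.elim
    · rcases ih h with h | ⟨i, hi, h⟩
      · exact .inl h
      · exact .inr ⟨i, by omega, h⟩

lemma keeps_search (l j : ℕ) : (search l j).Keeps := by
  refine ⟨fun r hr h => ?_, fun h => ?_⟩
  · rcases asg_search h with ⟨s, hs, rfl⟩ | ⟨i, rfl | rfl | rfl⟩ | ⟨i, -, rfl⟩ | ⟨i, -, rfl⟩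
    · cases s <;> simp_all [Scalar.IsLocal, Rg.IsParam]
    all_goals simp [Rg.IsParam] at hr
  · rcases wr_search h with h | ⟨i, -, h⟩ <;> simp at h

/-- The search for a given target, in a state where the classes of the levels above `j` have been
chosen. -/
lemma search_wp (hs : D.Shape) (hf : D.Fits A V K I) {T : ℕ} (hk : ∃ k ≤ D.n, T = D.t + k * D.N)
    (j : ℕ) (hj : j ≤ D.l) (st : St Rg Ar) (hr : Ready D K (j + 1) T st) (hS : Sound D st) :
    (search D.l j).Wp (layout D.l) A V E st fun st' =>
      Progress D st st' (∃ x, Star D T x ∧ ∀ i ≤ D.l, j < i →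
        st.reg (.lv .s i) = D.sum x (D.off i) (D.off (i + 1)) % D.mod i) := by
  have h2K := hf.two_le
  have hTK : T ≤ K := by
    obtain ⟨k, hk, rfl⟩ := hk
    exact le_trans (by gcongr) hf.t_le
  have hKK : K ≤ K * K := Nat.le_mul_of_pos_left _ (by omega)
  have hlK : D.l ≤ K := by have := hf.l_le; omega
  have build : ∀ (i : ℕ) (hi : i ≤ D.l) (st : St Rg Ar), Ready D K (i + 1) T st →
      st.reg (.lv .acc i) = ∑ i' ∈ Finset.Ioc i D.l, st.reg (.lv .s i') →
      st.reg (.lv .s i) ≤ K → Sound D st →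
      (buildT i).Wp (layout D.l) A V E st fun st' => Sound D st' ∧ Frame (buildT i) st st' ∧
        st'.reg (.sc .flag) = st.reg (.sc .flag) ∧
        (∀ i, st'.reg (.lv .s i) = st.reg (.lv .s i)) ∧
        (∀ i, st'.reg (.lv .acc i) = st.reg (.lv .acc i)) ∧ st'.reg (.sc .T) = T ∧
        (∀ x, x ≠ .T i → st'.arr x = st.arr x) ∧
        D.TDone i (st.reg (.lv .s i)) (st.arr (.B i)) (st'.arr (.T i)) := by
    intro i hi st hr hacc hsK hS
    refine (buildT_wp hs hf hr.holds hi rfl hsK (hr.bDone i hi).table).mono fun st' fr ht => ?_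
    have hreg : ∀ x, (∀ r : Scalar, r.IsLocal → r ≠ .flag → x ≠ .sc r) → st'.reg x = st.reg x := by
      intro x hx
      refine fr.reg _ fun h => ?_
      have hfl : x ≠ .sc .flag := by
        rintro rfl
        simp [buildT, Stmt.Asg] at h
      obtain ⟨r, hr, rfl⟩ := asg_buildT h
      exact hx r hr (fun h => hfl (by rw [h])) rfl
    have hfl : st'.reg (.sc .flag) = st.reg (.sc .flag) := hreg _ fun r _ h' => by
      simpa using h'.symm
    have harr : ∀ x, x ≠ .T i → st'.arr x = st.arr x := fun x hx => fr.arr _ fun h => hx (wr_buildT h)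
    refine ⟨?_, fr, hfl, fun i => hreg _ (by simp), fun i => hreg _ (by simp), ?_, harr, ht⟩
    · unfold Sound
      rw [hfl, harr _ (by simp)]; exact hS
    · rw [hreg _ fun r h _ => ?_, hr.target]
      simp only [ne_eq, Rg.sc.injEq]
      rintro rfl
      simp [Scalar.IsLocal] at h
  induction j generalizing st with
  | zero =>
    have hp := hs.p_pos 1
    have hpK : D.p 1 ≤ K := hf.p_le 1 (by omega)
    have hacc := hr.acc_le (Nat.zero_le _) le_rfl
    have haccK : st.reg (.lv .acc 0) ≤ K * K := hacc.trans (Nat.mul_le_mul_right _ (by omega))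
    have hpe : st.reg (.lv .p 1) = D.p 1 := hr.holds.p 1 (by omega)
    set v := (T % D.p 1 + (D.p 1 - st.reg (.lv .acc 0) % D.p 1)) % D.p 1 with hv
    have ev : ((rg .T % lv .p 1 + (lv .p 1 - lv .acc 0 % lv .p 1)) % lv .p 1 : Expr Rg Ar).eval E st
        = v := by
      simp only [Expr.eval_mod, Expr.eval_add, Expr.eval_sub, rg, lv, Expr.eval_reg, hpe, hr.target]
      rfl
    have hvlt : v < D.p 1 := Nat.mod_lt _ hp
    rw [search, Stmt.wp_seq, Stmt.wp_assign, ev]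
    refine ⟨?_, ?_⟩
    · have o1 : (rg .T % lv .p 1 : Expr Rg Ar).Ok (layout D.l) A V E st :=
        Expr.ok_mod trivial trivial (by
          simp only [rg, Expr.eval_reg, hr.target]; exact hf.lt_of_le (by omega))
      have o2 : (lv .acc 0 % lv .p 1 : Expr Rg Ar).Ok (layout D.l) A V E st :=
        Expr.ok_mod trivial trivial (by
          simp only [lv, Expr.eval_reg]; exact hf.lt (by omega))
      have e3 : (rg .T % lv .p 1 + (lv .p 1 - lv .acc 0 % lv .p 1) : Expr Rg Ar).eval E st < 2 ^ V := by
        simp only [Expr.eval_mod, Expr.eval_add, Expr.eval_sub, rg, lv, Expr.eval_reg, hpe,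
          hr.target]
        have := Nat.mod_lt T hp; exact hf.lt_of_le (by omega)
      refine Expr.ok_mod ⟨o1, ?_, e3⟩ trivial e3
      rw [Expr.ok_sub]; exact ⟨trivial, o2⟩
    · set st₁ := st.set (.lv .s 0) v with hst₁
      have hs₁ : ∀ i, 0 < i → st₁.reg (.lv .s i) = st.reg (.lv .s i) := by
        intro i hi
        rw [hst₁, St.set_reg, if_neg (by simp; omega)]
      have hs₀ : st₁.reg (.lv .s 0) = v := by simp [hst₁]
      have hr₁ : Ready D K 1 T st₁ := hr.congr (hr.holds.set rfl) hr.target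
        (fun i _ _ => by simp [hst₁]) (fun i _ hi => hs₁ i hi) (fun _ => rfl) (fun _ _ _ => rfl)
      rw [Stmt.wp_seq]
      refine (build 0 (Nat.zero_le _) st₁ hr₁ (hr₁.acc 0 (Nat.zero_le _) le_rfl)
        (by rw [hs₀]; omega) hS).mono
        fun st₂ fr₂ ⟨hS₂, _, hfl, hs₂, hacc₂, hT₂, harr₂, htd⟩ => ?_
      have hr₂ : Ready D K 0 T st₂ := by
        have h := hr₁.congr (hr₁.holds.frame (keeps_buildT 0) fr₂) hT₂
          (fun i _ _ => hacc₂ i) (fun i _ _ => hs₂ i) (fun i => harr₂ _ (by simp))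
          (fun i _ hi => harr₂ _ (by simp; omega))
        refine ⟨h.holds, h.target, fun i hi _ => h.acc i hi (by omega), fun i hi _ => ?_, h.bDone,
          fun i hi _ => ?_⟩
        · rcases Nat.eq_zero_or_pos i with rfl | hi'
          · rw [hs₂, hs₀]; omega
          · exact h.s_le i hi hi'
        · rcases Nat.eq_zero_or_pos i with rfl | hi'
          · rw [hs₂, harr₂ _ (by simp)]; exact htd
          · exact h.tDone i hi hi'
      refine (extendAll_wp hs hf hk hr₂ hS₂).mono fun st₃ fr₃ hp => ⟨hp.1, fun h => hp.2 ?_⟩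
      rcases h with h | ⟨x, hx, hxs⟩
      · left
        rw [hfl]
        simpa [hst₁] using h
      · refine .inr ⟨_, hx.path hs hr₂ fun i hi => ?_⟩
        rw [hs₂]
        rcases Nat.eq_zero_or_pos i with rfl | hi'
        · rw [hs₀, show D.mod 0 = D.p 1 from hs.M_one]
          refine sub_mod_eq (a := ∑ i ∈ Finset.Ioc 0 D.l, D.sum x (D.off i) (D.off (i + 1))) (hs.p_pos 1)
            ?_ ?_
          · have h3 := Finset.sum_range_add_sum_Ico
              (fun i => D.sum x (D.off i) (D.off (i + 1))) (m := 1) (n := D.l + 1) (by omega)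
            rw [Finset.sum_range_one] at h3
            rw [← hx.sum_eq, ← hs.off_eq, ← sum_off, ← h3, ← Finset.Ico_succ_succ_eq_Ioc]
            simp only [Nat.succ_eq_succ, Nat.succ_eq_add_one]; ring
          · rw [hr.acc 0 (Nat.zero_le _) le_rfl]
            refine (Nat.ModEq.sum fun i hi => ?_)
            have hi := Finset.mem_Ioc.1 hi
            rw [hxs i hi.2 hi.1]
            exact (Nat.mod_modEq _ _).of_dvd (hs.p_dvd _ (by omega) _ le_rfl (by omega))
        · rw [hs₁ i hi']; exact hxs i hi hi'
  | succ j ih =>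
    rw [search]
    have hM : st.reg (.lv .M (j + 1)) = D.M (j + 1) := hr.holds.M _ hj
    have hMK := hf.M_le _ hj
    refine Stmt.wp_loop (fun c st' => Sound D st' ∧ (st.reg (.sc .flag) ≠ 0 ∨
      (∃ x, (Star D T x ∧ ∀ i ≤ D.l, j + 1 < i →
        st.reg (.lv .s i) = D.sum x (D.off i) (D.off (i + 1)) % D.mod i) ∧
        D.sum x (D.off (j + 1)) (D.off (j + 1 + 1)) % D.mod (j + 1) < c) →
      st'.reg (.sc .flag) ≠ 0)) ?_ ?_ ?_
    · exact ⟨hS, fun h => h.elim id fun h => by omega⟩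
    · intro c hc' st₁ fr₁ hI
      have hc : c < D.M (j + 1) := by rw [hM] at hc'; exact hc'
      rw [← search] at fr₁
      have hreg : ∀ x, ((∃ i, j + 1 < i ∧ x = .lv .s i) ∨ (∃ i, j + 1 ≤ i ∧ x = .lv .acc i) ∨
          x = .sc .T) → st₁.reg x = st.reg x := by
        intro x hx
        refine fr₁.reg x fun h => ?_
        rcases asg_search h with ⟨r, hr, rfl⟩ | ⟨i, rfl | rfl | rfl⟩ | ⟨i, hi, rfl⟩ | ⟨i, hi, rfl⟩
        · rcases hx with ⟨i, _, h⟩ | ⟨i, _, h⟩ | h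
          · simp at h
          · simp at h
          · simp only [Rg.sc.injEq] at h; subst h; simp [Scalar.IsLocal] at hr
        · simp at hx
        · simp at hx
        · simp at hx
        · rcases hx with ⟨i', _, h⟩ | ⟨i', _, h⟩ | h
          · simp only [Rg.lv.injEq, true_and] at h; omega
          · simp at h
          · simp at h
        · rcases hx with ⟨i', _, h⟩ | ⟨i', _, h⟩ | h
          · simp at h
          · simp only [Rg.lv.injEq, true_and] at h; omega
          · simp at h
      have harr : ∀ x, ((∃ i, x = .B i) ∨ ∃ i, j + 1 < i ∧ x = .T i) → st₁.arr x = st.arr x := by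
        intro x hx
        refine fr₁.arr x fun h => ?_
        rcases wr_search h with rfl | ⟨i, hi, rfl⟩
        · simp at hx
        · rcases hx with ⟨i', h⟩ | ⟨i', _, h⟩
          · simp at h
          · simp only [Ar.T.injEq] at h; omega
      set st₂ := st₁.set (.lv .s (j + 1)) c with hst₂
      have hs₂ : ∀ i, j + 1 < i → st₂.reg (.lv .s i) = st.reg (.lv .s i) := by
        intro i hi
        rw [hst₂, St.set_reg, if_neg (by simp; omega), hreg _ (.inl ⟨i, hi, rfl⟩)]
      have hsj : st₂.reg (.lv .s (j + 1)) = c := by simp [hst₂]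
      have hr₂ : Ready D K (j + 1 + 1) T st₂ := by
        refine hr.congr ((hr.holds.frame (keeps_search _ _) fr₁).set rfl) ?_ ?_ ?_ ?_ ?_
        · rw [hst₂, St.set_reg, if_neg (by simp), hreg _ (.inr (.inr rfl)), hr.target]
        · intro i _ hi
          rw [hst₂, St.set_reg, if_neg (by simp), hreg _ (.inr (.inl ⟨i, by omega, rfl⟩))]
        · exact fun i _ hi => hs₂ i (by omega)
        · exact fun i => harr _ (.inl ⟨i, rfl⟩)
        · exact fun i _ hi => harr _ (.inr ⟨i, by omega, rfl⟩)
      have hfl₂ : st₂.reg (.sc .flag) = st₁.reg (.sc .flag) := by simp [hst₂]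
      have hS₂ : Sound D st₂ := by
        unfold Sound
        rw [hfl₂]; exact hI.1
      rw [Stmt.wp_seq]
      refine (build (j + 1) hj st₂ hr₂ (hr₂.acc _ hj le_rfl) (by rw [hsj]; omega) hS₂).mono
        fun st₃ fr₃ ⟨hS₃, _, hfl, hs₃, hacc₃, hT₃, harr₃, htd⟩ => ?_
      have hr₃ : Ready D K (j + 1 + 1) T st₃ := hr₂.congr (hr₂.holds.frame (keeps_buildT _) fr₃) hT₃
        (fun i _ _ => hacc₃ i) (fun i _ _ => hs₃ i) (fun i => harr₃ _ (by simp))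
        (fun i _ hi => harr₃ _ (by simp; omega))
      have hs₃j : st₃.reg (.lv .s (j + 1)) = c := by rw [hs₃, hsj]
      have hacc := hr₃.acc_le hj le_rfl
      have haccs : st₃.reg (.lv .acc (j + 1)) + st₃.reg (.lv .s (j + 1)) < 2 ^ V := by
        rw [hs₃j]
        have := Nat.mul_le_mul_right K (show D.l - (j + 1) ≤ K by omega)
        exact hf.lt (by omega)
      rw [Stmt.wp_seq, Stmt.wp_assign]
      refine ⟨⟨trivial, trivial, haccs⟩, ?_⟩
      have eacc : (lv .acc (j + 1) + lv .s (j + 1) : Expr Rg Ar).eval E st₃ =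
          ∑ i' ∈ Finset.Ioc j D.l, st₃.reg (.lv .s i') := by
        simp only [Expr.eval_add, lv, Expr.eval_reg]
        rw [hr₃.acc _ hj le_rfl, ← Finset.sum_Ioc_consecutive _ (show j ≤ j + 1 by omega) hj, add_comm]
        simp
      rw [eacc]
      set st₄ := st₃.set (.lv .acc j) (∑ i' ∈ Finset.Ioc j D.l, st₃.reg (.lv .s i')) with hst₄
      have hs₄ : ∀ i, st₄.reg (.lv .s i) = st₃.reg (.lv .s i) := fun i => by simp [hst₄]
      have hr₄ : Ready D K (j + 1) T st₄ := by
        refine ⟨hr₃.holds.set rfl, hr₃.target, fun i hi hji => ?_, fun i hi hji => ?_, hr₃.bDone,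
          fun i hi hji => ?_⟩
        · simp only [hs₄]
          rcases Nat.lt_or_ge j i with h | h
          · rw [hst₄, St.set_reg, if_neg (by simp; omega), hr₃.acc i hi (by omega)]
          · obtain rfl : i = j := by omega
            simp [hst₄]
        · rw [hs₄]
          rcases Nat.lt_or_ge (j + 1) i with h | h
          · exact hr₃.s_le i hi h
          · obtain rfl : i = j + 1 := by omega
            rw [hs₃j]; omega
        · rw [hs₄]
          rcases Nat.lt_or_ge (j + 1) i with h | h
          · exact hr₃.tDone i hi h
          · obtain rfl : i = j + 1 := by omega
            rw [hs₃]
            change D.TDone _ _ (st₃.arr _) _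
            rw [harr₃ _ (by simp)]; exact htd
      have hfl₄ : st₄.reg (.sc .flag) = st₁.reg (.sc .flag) := by
        rw [hst₄, St.set_reg, if_neg (by simp), hfl, hfl₂]
      have hS₄ : Sound D st₄ := by
        have := hS₃
        unfold Sound at this ⊢
        rw [hfl₄, ← hfl₂, ← hfl]; exact this
      refine (ih (by omega) st₄ hr₄ hS₄).mono fun st₅ fr₅ hp => ⟨hp.1, fun h => hp.2 ?_⟩
      rw [hfl₄]
      rcases h with h | ⟨x, ⟨hx, hxs⟩, hlt⟩
      · exact .inl (hI.2 (.inl h))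
      · rcases Nat.lt_succ_iff_lt_or_eq.1 hlt with h | h
        · exact .inl (hI.2 (.inr ⟨x, ⟨hx, hxs⟩, h⟩))
        · refine .inr ⟨x, hx, fun i hi hji => ?_⟩
          rw [hs₄]
          rcases Nat.lt_or_ge (j + 1) i with h' | h'
          · rw [hs₃, hs₂ i h', hxs i hi h']
          · obtain rfl : i = j + 1 := by omega
            rw [hs₃j, h]
    · intro st₁ fr₁ hI
      refine ⟨hI.1, fun h => hI.2 (h.imp id ?_)⟩
      rintro ⟨x, hx⟩
      refine ⟨x, hx, ?_⟩
      have hmod : D.mod (j + 1) = D.M (j + 1) := by rw [Data.mod, max_eq_left (by omega)]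
      rw [rounds_false, hM, hmod]; exact Nat.mod_lt _ (hs.M_pos _)

/-- The whole search, for filled tables `B i`. -/
lemma searchAll_wp (hs : D.Shape) (hf : D.Fits A V K I) (hh : Holds D st)
    (hB : ∀ i ≤ D.l, D.BDone i (st.arr (.B i))) (hfl : st.reg (.sc .flag) = 0) :
    (searchAll D.l).Wp (layout D.l) A V E st fun st' => Sound D st' ∧
      ((∃ k ≤ D.n, ∃ x, Star D (D.t + k * D.N) x) → st'.reg (.sc .flag) ≠ 0) := by
  have h2K := hf.two_le
  have hkeeps : (searchAll D.l).Keeps := keeps_loop rfl <| keeps_seq (keeps_put rfl) <|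
    keeps_seq (keeps_assign rfl) (keeps_search _ _)
  have hwr : ∀ i, ¬ (searchAll D.l).Wr (.B i) := by
    rintro i (h | h | h)
    · exact h
    · exact h
    · rcases wr_search h with h | ⟨i', -, h⟩ <;> simp at h
  refine Stmt.wp_loop (fun k st' => Sound D st' ∧ ((∃ k' < k, ∃ x, Star D (D.t + k' * D.N) x) →
    st'.reg (.sc .flag) ≠ 0)) ⟨fun h => absurd hfl h, fun ⟨_, h, _⟩ => absurd h (by omega)⟩ ?_ ?_
  · intro k hk st₁ fr₁ hI
    have hk : k ≤ D.n := by rw [hh.n1] at hk; exact Nat.lt_succ_iff.1 hk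
    have hh₁ := (hh.frame hkeeps fr₁).set (r := .sc .kk) (v := k) rfl
    have hTK : D.t + k * D.N ≤ K := le_trans (by gcongr) hf.t_le
    have eT : (rg .t + rg .kk * rg .N : Expr Rg Ar).eval E (st₁.set (.sc .kk) k) = D.t + k * D.N := by
      simp only [Expr.eval_add, Expr.eval_mul, rg, Expr.eval_reg, hh₁.t, hh₁.N]; simp
    simp only [Stmt.wp_seq, wp_put, Stmt.wp_assign]
    rw [eT]
    refine ⟨?_, by simp [num], ?_⟩
    · rw [Expr.eval_add] at eT
      rw [Expr.ok_add, eT]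
      refine ⟨trivial, ?_, hf.lt_of_le (by omega)⟩
      rw [Expr.ok_mul]
      refine ⟨trivial, trivial, lt_of_le_of_lt ?_ (hf.lt_of_le (x := D.t + k * D.N) (by omega))⟩
      have := eT
      simp only [rg, Expr.eval_reg, Expr.eval_mul] at this ⊢; omega
    · set st₂ := ((st₁.set (.sc .kk) k).set (.sc .T) (D.t + k * D.N)).set (.lv .acc D.l)
        ((num 0 : Expr Rg Ar).eval E ((st₁.set (.sc .kk) k).set (.sc .T) (D.t + k * D.N))) with hst₂
      have hr₂ : Ready D K (D.l + 1) (D.t + k * D.N) st₂ := by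
        refine ⟨(hh₁.set rfl).set rfl, by simp [hst₂], fun i hi hi' => ?_, fun i hi hi' => by omega,
          fun i hi => ?_, fun i hi hi' => by omega⟩
        · obtain rfl : i = D.l := by omega
          simp [hst₂, num]
        · change D.BDone i (st₁.arr (.B i))
          rw [fr₁.arr _ (hwr i)]; exact hB i hi
      have hfl₂ : st₂.reg (.sc .flag) = st₁.reg (.sc .flag) := by simp [hst₂]
      have hS₂ : Sound D st₂ := by
        unfold Sound
        rw [hfl₂]; exact hI.1
      refine (search_wp hs hf ⟨k, hk, rfl⟩ D.l le_rfl st₂ hr₂ hS₂).mono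
        fun st₃ fr₃ hp => ⟨hp.1, fun ⟨k', hk', hx⟩ => hp.2 ?_⟩
      rw [hfl₂]
      rcases Nat.lt_succ_iff_lt_or_eq.1 hk' with h | rfl
      · exact .inl (hI.2 ⟨k', h, hx⟩)
      · obtain ⟨x, hx⟩ := hx
        exact .inr ⟨x, hx, fun i hi hi' => by omega⟩
  · intro st₁ fr₁ hI
    refine ⟨hI.1, fun ⟨k, hk, hx⟩ => hI.2 ⟨k, ?_, hx⟩⟩
    rw [rounds_false, hh.n1]; omega

lemma asg_buildB {j : ℕ} {x : Rg} (h : (buildB j).Asg x) : ∃ r : Scalar, r.IsLocal ∧ r ≠ .flag ∧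
    x = .sc r := by
  simp only [buildB, Stmt.Asg, asg_clear, asg_put, asg_sumItems, asg_insert] at h
  rcases h with (rfl | rfl) | rfl | rfl | (rfl | rfl | rfl) | rfl | rfl | rfl | rfl | rfl
  all_goals exact ⟨_, rfl, by simp, rfl⟩

lemma wr_buildB {j : ℕ} {x : Ar} (h : (buildB j).Wr x) : x = .B j := by
  simp only [buildB, Stmt.Wr, wr_clear, wr_put, wr_sumItems, wr_insert] at h
  simpa using h

lemma buildAllB_wp (hs : D.Shape) (hf : D.Fits A V K I) (hh : Holds D st) (j : ℕ)
    (hj : j ≤ D.l + 1) : (buildAllB j).Wp (layout D.l) A V E st fun st' => Holds D st' ∧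
      st'.reg (.sc .flag) = st.reg (.sc .flag) ∧ ∀ i < j, D.BDone i (st'.arr (.B i)) := by
  induction j with
  | zero => simpa [buildAllB] using hh
  | succ j ih =>
    rw [buildAllB, Stmt.wp_seq]
    refine (ih (by omega)).mono fun st₁ _ ⟨hh₁, hfl, h⟩ => ?_
    refine (buildB_wp hs hf hh₁ (by omega)).mono fun st₂ fr₂ h₂ => ?_
    refine ⟨hh₁.frame (keeps_buildB j) fr₂, ?_, fun i hi => ?_⟩
    · rw [fr₂.reg, hfl]
      intro h
      obtain ⟨r, -, h1, h2⟩ := asg_buildB h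
      simp only [Rg.sc.injEq] at h2; exact h1 h2.symm
    · rcases Nat.lt_succ_iff_lt_or_eq.1 hi with h' | rfl
      · rw [fr₂.arr]
        · exact h i h'
        intro h
        have := wr_buildB h
        simp only [Ar.B.injEq] at this; omega
      · exact h₂

end

/-! ### The running time of the search -/

/-- Fill all tables `B j` and search. -/
def solve (l : ℕ) : Prog := buildAllB (l + 1) ⨾ searchAll l

lemma bnd_buildB {j : ℕ} {r : Rg} (h : (buildB j).Bnd r) : r.IsParam = true := by
  simp only [buildB, clear, sumItems, insert, Stmt.Bnd, ifeq, put, keyB, or_false, false_or] at h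
  rcases h with (h | h) | h | h | h <;> (subst h; rfl)

lemma bnd_buildT {j : ℕ} {r : Rg} (h : (buildT j).Bnd r) : r.IsParam = true := by
  simp only [buildT, clear, sumItems, insert, Stmt.Bnd, ifeq, put, keyT, or_false, false_or] at h
  rcases h with (h | h) | h | h | h | h <;> (subst h; rfl)

lemma bnd_extend (s j : ℕ) {r : Rg} (h : (extend s j).Bnd r) : r.IsParam = true := by
  induction s generalizing j with
  | zero => simp [extend, output, Stmt.Bnd, ifeq, put] at h
  | succ s ih =>
    simp only [extend, Stmt.Bnd, put, false_or] at h
    rcases h with rfl | h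
    · rfl
    · exact ih _ h

lemma bnd_search (l j : ℕ) {r : Rg} (h : (search l j).Bnd r) : r.IsParam = true := by
  induction j with
  | zero =>
    simp only [search, extendAll, Stmt.Bnd, put, keyT, false_or] at h
    rcases h with h | rfl | rfl | h
    · exact bnd_buildT h
    · rfl
    · rfl
    · exact bnd_extend _ _ h
  | succ j ih =>
    simp only [search, Stmt.Bnd, false_or] at h
    rcases h with rfl | h | h
    · rfl
    · exact bnd_buildT h
    · exact ih h

lemma bnd_solve (l : ℕ) {r : Rg} (h : (solve l).Bnd r) : r.IsParam = true := by
  simp only [solve, searchAll, Stmt.Bnd, put, false_or] at h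
  rcases h with h | rfl | h
  · generalize l + 1 = j at h
    induction j with
    | zero => exact h.elim
    | succ j ih => exact h.elim ih bnd_buildB
  · rfl
  · exact bnd_search _ _ h

lemma keeps_solve (l : ℕ) : (solve l).Keeps := by
  refine keeps_seq ?_ <| keeps_loop rfl <| keeps_seq (keeps_put rfl) <|
    keeps_seq (keeps_assign rfl) (keeps_search _ _)
  generalize l + 1 = j
  induction j with
  | zero => exact keeps_skip
  | succ j ih => exact keeps_seq ih (keeps_buildB j)

lemma solve_static (l : ℕ) : (solve l).Static := fun _ hr => (keeps_solve l).1 _ (bnd_solve l hr)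

lemma solve_wp {D : Data} {A V K I : ℕ} {E : Env} {st : St Rg Ar} (hs : D.Shape)
    (hf : D.Fits A V K I) (hh : Holds D st) (hfl : st.reg (.sc .flag) = 0) :
    (solve D.l).Wp (layout D.l) A V E st fun st' => Sound D st' ∧
      ((∃ k ≤ D.n, ∃ x, Star D (D.t + k * D.N) x) → st'.reg (.sc .flag) ≠ 0) := by
  rw [solve, Stmt.wp_seq]
  refine (buildAllB_wp hs hf hh (D.l + 1) le_rfl).mono fun st₁ _ ⟨hh₁, hfl₁, h⟩ => ?_
  exact searchAll_wp hs hf hh₁ (fun i hi => h i (by omega)) (by rw [hfl₁, hfl])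

section cost

variable (ρ : Rg → ℕ)

lemma cost_insert (q : Ar) (c : Rg) : (insert q c).cost ρ = 6 + ρ c * 88 := by
  have : (insert q c).cost ρ = 3 + (3 + ρ c * 88) := rfl
  rw [this]; ring

lemma cost_clear (q : Ar) (c c' : Rg) : (clear q c c').cost ρ = 3 + ρ c * (11 + ρ c' * 27) := by
  have : (clear q c c').cost ρ = 3 + ρ c * (3 + ρ c' * (19 + 8) + 8) := rfl
  rw [this]; ring

lemma cost_sumItems (len off : Family) (j : ℕ) :
    (sumItems len off j).cost ρ = 6 + ρ (.lv len j) * 44 := by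
  have : (sumItems len off j).cost ρ = 3 + (3 + ρ (.lv len j) * 44) := rfl
  rw [this]; ring

lemma cost_buildB (j : ℕ) : (buildB j).cost ρ = 6 + ρ (keyB j) * (11 + ρ (.lv .W j) * 27) +
    ρ (.lv .pwB j) * (47 + ρ (.lv .lenB j) * 44 + ρ (.lv .W j) * 88) := by
  have : (buildB j).cost ρ = (clear (.B j) (keyB j) (.lv .W j)).cost ρ + (3 + ρ (.lv .pwB j) *
    (3 + ((sumItems .lenB .offB j).cost ρ + (3 + (21 + (insert (.B j) (.lv .W j)).cost ρ))) + 8)) := rfl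
  rw [this, cost_clear, cost_sumItems, cost_insert]; ring

lemma cost_buildT (j : ℕ) : (buildT j).cost ρ ≤ 6 + ρ (keyT j) * (11 + ρ (.sc .P) * 27) +
    ρ (.lv .pwE j) * (200 + ρ (.lv .lenE j) * 44 + ρ (.lv .W j) * (200 + ρ (.sc .P) * 88)) := by
  have : (buildT j).cost ρ = (clear (.T j) (keyT j) (.sc .P)).cost ρ + (3 + ρ (.lv .pwE j) *
    (3 + ((sumItems .lenE .offE j).cost ρ + (3 + (75 + (3 + ρ (.lv .W j) * (15 + (4 + 0 +
    (9 + (22 + (22 + (21 + (insert (.T j) (.sc .P)).cost ρ) + 0) + 0))) + 8))))) + 8)) := rfl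
  rw [this, cost_clear, cost_sumItems, cost_insert]
  nlinarith [Nat.zero_le (ρ (.lv .pwE j) * ρ (.lv .W j)), Nat.zero_le (ρ (.lv .pwE j))]

lemma cost_output (j : ℕ) : (output j).cost ρ = 45 := rfl

lemma cost_extend_succ (r j : ℕ) :
    (extend (r + 1) j).cost ρ = 90 + ρ (.sc .P) * (36 + (extend r (j + 1)).cost ρ) := by
  have : (extend (r + 1) j).cost ρ = 87 + (3 + ρ (.sc .P) *
    (15 + (4 + 0 + (9 + (extend r (j + 1)).cost ρ)) + 8)) := rfl
  rw [this]; ring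

lemma cost_extendAll (l : ℕ) : (extendAll l).cost ρ =
    3 + ρ (keyT 0) * (11 + ρ (.sc .P) * (36 + (extend l 1).cost ρ)) := by
  have : (extendAll l).cost ρ = 3 + ρ (keyT 0) * (3 + ρ (.sc .P) *
    (18 + (4 + 0 + (6 + (extend l 1).cost ρ)) + 8) + 8) := rfl
  rw [this]; ring

lemma cost_search_zero (l : ℕ) : (search l 0).cost ρ ≤
    100 + (buildT 0).cost ρ + (extendAll l).cost ρ := by
  have : (search l 0).cost ρ = 60 + ((buildT 0).cost ρ + (extendAll l).cost ρ) := rfl; omega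

lemma cost_search_succ (l j : ℕ) : (search l (j + 1)).cost ρ =
    3 + ρ (.lv .M (j + 1)) * (14 + (buildT (j + 1)).cost ρ + (search l j).cost ρ) := by
  have : (search l (j + 1)).cost ρ = 3 + ρ (.lv .M (j + 1)) * ((buildT (j + 1)).cost ρ +
    (6 + (search l j).cost ρ) + 8) := rfl
  rw [this]; ring

lemma cost_solve (l : ℕ) : (solve l).cost ρ ≤ (buildAllB (l + 1)).cost ρ +
    (3 + ρ (.sc .n1) * (30 + (search l l).cost ρ)) := by
  have : (solve l).cost ρ = (buildAllB (l + 1)).cost ρ +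
    (3 + ρ (.sc .n1) * (9 + (3 + (search l l).cost ρ) + 8)) := rfl
  rw [this, show 9 + (3 + (search l l).cost ρ) + 8 = 20 + (search l l).cost ρ by ring]
  gcongr
  omega

lemma cost_extend_le {P : ℕ} (hP : ρ (.sc .P) = P) (hP' : 1000 ≤ P) (r j : ℕ) :
    (extend r j).cost ρ ≤ P ^ (2 * r + 1) := by
  induction r generalizing j with
  | zero => rw [extend, cost_output]; simp; omega
  | succ r ih =>
    rw [cost_extend_succ, hP]
    have h1 := ih (j + 1)
    have h2 : 1 ≤ P ^ (2 * r + 1) := Nat.one_le_pow _ _ (by omega)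
    calc 90 + P * (36 + (extend r (j + 1)).cost ρ)
        ≤ (90 + P * (36 + 1)) * P ^ (2 * r + 1) := by nlinarith
      _ ≤ (P * P) * P ^ (2 * r + 1) := by gcongr; nlinarith
      _ = P ^ (2 * (r + 1) + 1) := by ring

/-- Writing `g` for the work of filling `T j` once, the total work at level `j` is bounded by `H`. -/
structure CostBound (D : Data) (H : ℕ) : Prop where
  P_le : 1000 ≤ D.P
  n_le : D.n + 1 ≤ D.P
  l_le : D.l + 1 ≤ D.P
  W_pos : ∀ j ≤ D.l, 1 ≤ D.W j
  buildB : ∀ j ≤ D.l, D.pB j * D.W j + 2 ^ D.lenB j * D.W j ≤ H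
  buildT : ∀ j ≤ D.l, (∏ i ∈ Finset.Ioc (j - 1) D.l, D.M i) *
    (D.pT j + 2 ^ D.lenE j * D.W j) ≤ H

end cost

section

variable {D : Data} {st : St Rg Ar}

lemma Data.Shape.len_le (hs : D.Shape) {j : ℕ} (hj : j ≤ D.l) : D.lenE j + D.lenB j ≤ D.n := by
  have h1 := hs.off_le hj
  have h2 := D.off_succ j
  unfold Data.mid at h2; omega

lemma cost_buildB_le (hs : D.Shape) (hh : Holds D st) {H : ℕ} (hb : CostBound D H) {j : ℕ}
    (hj : j ≤ D.l) : (buildB j).cost st.reg ≤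
      D.P ^ 2 * (D.pB j * D.W j + 2 ^ D.lenB j * D.W j) := by
  rw [cost_buildB, hh.keyB hs.l_pos hj, hh.W j hj, hh.pwB j hj, hh.lenB j hj]
  have h1 := hs.len_le hj
  have h2 := hb.n_le
  have h3 := hb.P_le
  have hW := hb.W_pos j hj
  have hp := hs.pB_pos j
  have h4 : 1 ≤ 2 ^ D.lenB j := Nat.one_le_two_pow
  have e1 : 6 + D.pB j * (11 + D.W j * 27) ≤ 44 * (D.pB j * D.W j) := by
    have : D.pB j ≤ D.pB j * D.W j := Nat.le_mul_of_pos_right _ hW; nlinarith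
  have e2 : 47 + D.lenB j * 44 + D.W j * 88 ≤ 200 * D.P * D.W j := by
    have : D.P ≤ D.P * D.W j := Nat.le_mul_of_pos_right _ hW
    have : D.W j ≤ D.P * D.W j := Nat.le_mul_of_pos_left _ (by omega); nlinarith
  have e3 : 200 * D.P ≤ D.P ^ 2 := by nlinarith
  calc _ ≤ 44 * (D.pB j * D.W j) + 2 ^ D.lenB j * (200 * D.P * D.W j) := by gcongr
    _ = 44 * (D.pB j * D.W j) + (200 * D.P) * (2 ^ D.lenB j * D.W j) := by ring
    _ ≤ D.P ^ 2 * (D.pB j * D.W j) + D.P ^ 2 * (2 ^ D.lenB j * D.W j) := by gcongr; omega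
    _ = _ := by ring

lemma cost_buildT_le (hs : D.Shape) (hh : Holds D st) {H : ℕ} (hb : CostBound D H) {j : ℕ}
    (hj : j ≤ D.l) : (buildT j).cost st.reg ≤
      D.P ^ 2 * (D.pT j + 2 ^ D.lenE j * D.W j) := by
  refine (cost_buildT _ j).trans ?_
  rw [hh.keyT hs.l_pos hj, hh.W j hj, hh.pwE j hj, hh.lenE j hj, hh.P]
  have h1 := hs.len_le hj
  have h2 := hb.n_le
  have h3 := hb.P_le
  have hW := hb.W_pos j hj
  have hp := hs.pT_pos j
  have h4 : 1 ≤ 2 ^ D.lenE j := Nat.one_le_two_pow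
  have e1 : 6 + D.pT j * (11 + D.P * 27) ≤ 44 * D.P * D.pT j := by nlinarith
  have e2 : 200 + D.lenE j * 44 + D.W j * (200 + D.P * 88) ≤ 600 * D.P * D.W j := by
    have : D.P ≤ D.P * D.W j := Nat.le_mul_of_pos_right _ hW
    have : D.W j ≤ D.P * D.W j := Nat.le_mul_of_pos_left _ (by omega); nlinarith
  have e3 : 600 * D.P ≤ D.P ^ 2 := by nlinarith
  calc _ ≤ 44 * D.P * D.pT j + 2 ^ D.lenE j * (600 * D.P * D.W j) := by gcongr
    _ = 44 * D.P * D.pT j + (600 * D.P) * (2 ^ D.lenE j * D.W j) := by ring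
    _ ≤ D.P ^ 2 * D.pT j + D.P ^ 2 * (2 ^ D.lenE j * D.W j) := by gcongr; omega
    _ = _ := by ring

lemma cost_search_le (hs : D.Shape) (hh : Holds D st) {H : ℕ} (hb : CostBound D H) (j : ℕ)
    (hj : j ≤ D.l) : (∏ i ∈ Finset.Ioc j D.l, D.M i) * (search D.l j).cost st.reg ≤
      (j + 1) * (D.P ^ (2 * D.l + 4) * H) := by
  have h3 := hb.P_le
  have hP : 1 ≤ D.P := by omega
  have hprod : ∀ j, 1 ≤ ∏ i ∈ Finset.Ioc j D.l, D.M i := fun j =>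
    Nat.one_le_iff_ne_zero.2 (Finset.prod_ne_zero_iff.2 fun i _ => (hs.M_pos i).ne')
  have hpow : ∀ {a b : ℕ}, a ≤ b → D.P ^ a ≤ D.P ^ b := fun h => Nat.pow_le_pow_right hP h
  induction j with
  | zero =>
    have h5 : (search D.l 0).cost st.reg ≤
        D.P ^ (2 * D.l + 4) * (D.pT 0 + 2 ^ D.lenE 0 * D.W 0) := by
      refine (cost_search_zero _ _).trans ?_
      have h6 := cost_buildT_le hs hh hb hj
      have h7 := cost_extend_le st.reg hh.P h3 D.l 1
      rw [cost_extendAll, hh.keyT hs.l_pos hj, hh.P]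
      have hp := hs.pT_pos 0
      set g := 2 ^ D.lenE 0 * D.W 0
      set x := D.P ^ (2 * D.l + 1) with hx
      have hx1 : 1 ≤ x := Nat.one_le_pow _ _ hP
      have e : D.P ^ (2 * D.l + 4) = x * D.P ^ 3 := by rw [hx]; ring
      have h8 : D.P ^ 2 ≤ x * D.P ^ 2 := Nat.le_mul_of_pos_left _ hx1
      rw [e]
      have h9 : 100 + (3 + D.pT 0 * (11 + D.P * (36 + (extend D.l 1).cost st.reg))) ≤
          x * D.P ^ 2 * D.pT 0 := by
        have h10 : 100 + (3 + D.pT 0 * (11 + D.P * (36 + x))) ≤ D.pT 0 * x * (114 + 37 * D.P) := by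
          have a1 : 1 ≤ D.pT 0 * x := Nat.mul_pos hp hx1
          have a2 : D.pT 0 ≤ D.pT 0 * x := Nat.le_mul_of_pos_right _ hx1
          have a3 := Nat.mul_le_mul_right D.P a2; nlinarith
        calc _ ≤ 100 + (3 + D.pT 0 * (11 + D.P * (36 + x))) := by gcongr
          _ ≤ D.pT 0 * x * (114 + 37 * D.P) := h10
          _ ≤ D.pT 0 * x * D.P ^ 2 := by gcongr; nlinarith
          _ = _ := by ring
      calc _ ≤ D.P ^ 2 * (D.pT 0 + g) + x * D.P ^ 2 * D.pT 0 := by omega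
        _ ≤ x * D.P ^ 2 * (D.pT 0 + g) + x * D.P ^ 2 * (D.pT 0 + g) := by gcongr; omega
        _ = x * D.P ^ 2 * 2 * (D.pT 0 + g) := by ring
        _ ≤ x * D.P ^ 2 * D.P * (D.pT 0 + g) := by gcongr; omega
        _ = _ := by ring
    have h6 := hb.buildT 0 (Nat.zero_le _)
    rw [Nat.zero_sub] at h6
    calc _ ≤ (∏ i ∈ Finset.Ioc 0 D.l, D.M i) *
        (D.P ^ (2 * D.l + 4) * (D.pT 0 + 2 ^ D.lenE 0 * D.W 0)) := by gcongr
      _ = D.P ^ (2 * D.l + 4) * ((∏ i ∈ Finset.Ioc 0 D.l, D.M i) *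
        (D.pT 0 + 2 ^ D.lenE 0 * D.W 0)) := by ring
      _ ≤ _ := by rw [zero_add, one_mul]; gcongr
  | succ j ih =>
    have h5 := hb.buildT (j + 1) hj
    rw [Nat.add_sub_cancel] at h5
    have h6 := cost_buildT_le hs hh hb hj
    have h7 := ih (by omega)
    have hsplit : ∏ i ∈ Finset.Ioc j D.l, D.M i =
        D.M (j + 1) * ∏ i ∈ Finset.Ioc (j + 1) D.l, D.M i := by
      rw [← Finset.prod_Ioc_consecutive _ (show j ≤ j + 1 by omega) hj]; simp
    rw [cost_search_succ, hh.M _ hj]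
    set R' := ∏ i ∈ Finset.Ioc (j + 1) D.l, D.M i
    set R := ∏ i ∈ Finset.Ioc j D.l, D.M i
    set g := D.pT (j + 1) + 2 ^ D.lenE (j + 1) * D.W (j + 1) with hg
    have hg1 : 1 ≤ g := by have := hs.pT_pos (j + 1); omega
    have hR : R' ≤ R := by rw [hsplit]; exact Nat.le_mul_of_pos_left _ (hs.M_pos _)
    have hRH : R ≤ H := (Nat.le_mul_of_pos_right _ hg1).trans h5
    calc R' * (3 + D.M (j + 1) * (14 + (buildT (j + 1)).cost st.reg + (search D.l j).cost st.reg))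
        = 3 * R' + 14 * R + R * (buildT (j + 1)).cost st.reg +
          R * (search D.l j).cost st.reg := by rw [hsplit]; ring
      _ ≤ 3 * H + 14 * H + D.P ^ 2 * H + (j + 1) * (D.P ^ (2 * D.l + 4) * H) := by
        have h8 : R * (buildT (j + 1)).cost st.reg ≤ D.P ^ 2 * H := calc
          _ ≤ R * (D.P ^ 2 * g) := Nat.mul_le_mul_left _ h6
          _ = D.P ^ 2 * (R * g) := by ring
          _ ≤ _ := Nat.mul_le_mul_left _ h5
        omega
      _ = (17 + D.P ^ 2) * H + (j + 1) * (D.P ^ (2 * D.l + 4) * H) := by ring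
      _ ≤ D.P ^ (2 * D.l + 4) * H + (j + 1) * (D.P ^ (2 * D.l + 4) * H) := by
        gcongr
        refine le_trans ?_ (hpow (show 3 ≤ 2 * D.l + 4 by omega))
        nlinarith
      _ = _ := by ring

/-- The work of the whole search is `H` up to a power of `P`. -/
lemma steps_solve_le (hs : D.Shape) (hh : Holds D st) {H : ℕ} (hb : CostBound D H) (E : Env) :
    (solve D.l).steps E st ≤ D.P ^ (2 * D.l + 8) * H := by
  refine ((solve_static D.l).steps_le st).trans ((cost_solve _ _).trans ?_)
  have h3 := hb.P_le
  have hP : 1 ≤ D.P := by omega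
  have h1 : ∀ j ≤ D.l + 1, (buildAllB j).cost st.reg ≤ j * (D.P ^ 2 * H) := by
    intro j hj
    induction j with
    | zero => simp [buildAllB, Stmt.cost]
    | succ j ih =>
      have h4 := cost_buildB_le hs hh hb (show j ≤ D.l by omega)
      have h5 := Nat.mul_le_mul_left (D.P ^ 2) (hb.buildB j (by omega))
      have h6 := ih (by omega)
      change (buildAllB j).cost st.reg + (buildB j).cost st.reg ≤ _
      rw [add_mul, one_mul]; omega
  have h2 := cost_search_le hs hh hb D.l le_rfl
  rw [Finset.Ioc_self, Finset.prod_empty, one_mul] at h2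
  have h4 := h1 (D.l + 1) le_rfl
  rw [hh.n1]
  have hH : 1 ≤ H := by
    refine le_trans ?_ (hb.buildB 0 (Nat.zero_le _))
    have := hb.W_pos 0 (Nat.zero_le _)
    have := hs.pB_pos 0
    have := Nat.mul_pos this ‹1 ≤ D.W 0›; omega
  have hn := hb.n_le
  have hl := hb.l_le
  set x := D.P ^ (2 * D.l + 4) with hx
  have hPx : D.P ^ 2 ≤ x := Nat.pow_le_pow_right hP (by omega)
  have hPx' : D.P ≤ x := (Nat.le_self_pow (by norm_num) _).trans hPx
  have hxH : x ≤ x * H := Nat.le_mul_of_pos_right _ hH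
  calc _ ≤ (D.l + 1) * (D.P ^ 2 * H) + (3 + (D.n + 1) * (30 + (D.l + 1) * (x * H))) := by gcongr
    _ ≤ D.P * (x * H) + (x * H + D.P * (x * H + D.P * (x * H))) := by gcongr <;> omega
    _ = (2 * D.P + 1 + D.P * D.P) * (x * H) := by ring
    _ ≤ D.P ^ 4 * (x * H) := by
      gcongr
      nlinarith [Nat.mul_le_mul hP hP, Nat.pow_le_pow_right hP (show 3 ≤ 4 by omega),
        pow_succ D.P 2, pow_two D.P]
    _ = _ := by rw [hx]; ring

end

/-! ### Random numbers and random primes -/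

/-- The number whose `b` binary digits are the coin flips from number `s` on. -/
def draw (ω : ℕ → Bool) (s : ℕ) : ℕ → ℕ
  | 0 => 0
  | b + 1 => 2 * draw ω s b + (ω (s + b)).toNat

lemma draw_lt (ω : ℕ → Bool) (s b : ℕ) : draw ω s b < 2 ^ b := by
  induction b with
  | zero => simp [draw]
  | succ b ih =>
    have := Bool.toNat_lt (ω (s + b))
    rw [draw, pow_succ]; omega

/-- The last prime among `r` random numbers of `b` bits, and `2` if there is none. -/
def lastPrime (ω : ℕ → Bool) (s b : ℕ) : ℕ → ℕ
  | 0 => 2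
  | r + 1 => if (draw ω (s + r * b) b).Prime then draw ω (s + r * b) b else lastPrime ω s b r

lemma lastPrime_prime (ω : ℕ → Bool) (s b r : ℕ) : (lastPrime ω s b r).Prime := by
  induction r with
  | zero => exact Nat.prime_two
  | succ r ih =>
    rw [lastPrime]
    split_ifs with h
    · exact h
    · exact ih

lemma lastPrime_le (ω : ℕ → Bool) (s b r : ℕ) (hb : 1 ≤ b) : lastPrime ω s b r ≤ 2 ^ b := by
  induction r with
  | zero => exact Nat.pow_le_pow_right (n := 2) (by norm_num) hb
  | succ r ih =>
    rw [lastPrime]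
    split_ifs with h
    · exact (draw_lt ω _ b).le
    · exact ih

/-- Let `q` be a random number with `[u]` bits. -/
def drawBits (u : Rg) : Prog :=
  put .q (num 0) ⨾ .loop false (.sc .i) u (.flip (.sc .f) ⨾ put .q (rg .q + rg .q + rg .f))

/-- Let `r` be `2` to the power `u`. -/
def powTwo (r u : Rg) : Prog :=
  .assign r (num 1) ⨾ .loop false (.sc .i) u (.assign r (.reg r + .reg r))

/-- Let `g` be nonzero if and only if `q` is prime, where `q` is at most `[u]`. -/
def testPrime (u : Rg) : Prog :=
  put .g (num 1 - (num 2 - rg .q)) ⨾ .loop false (.sc .d) u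
    (.ifz (num 2 - rg .d) (.ifz (rg .d + num 1 - rg .q)
      (.ifz (rg .q % rg .d) (put .g (num 0)) .skip) .skip) .skip)

/-- Let `r` be the last prime among `[r3]` random numbers of `[b]` bits, where `u` is `2` to the
power `b`. -/
def drawPrime (r b u : Rg) : Prog :=
  .assign r (num 2) ⨾ .loop false (.sc .k) (.sc .r3)
    (drawBits b ⨾ testPrime u ⨾ .ifz (rg .g) .skip (.assign r (rg .q)))

section

variable {l A V : ℕ} {E : Env} {st : St Rg Ar}

lemma powTwo_wp {r u : Rg} (hr : r ≠ .sc .i) (hru : u ≠ r)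
    (hV : st.reg u < V) : (powTwo r u).Wp (layout l) A V E st fun st' =>
      st'.reg r = 2 ^ st.reg u ∧ st'.coins = st.coins := by
  have h1 : 1 < 2 ^ V := Nat.one_lt_two_pow (by omega)
  rw [powTwo, Stmt.wp_seq, Stmt.wp_assign]
  refine ⟨h1, ?_⟩
  refine Stmt.wp_loop (fun k st' => st'.reg r = 2 ^ k ∧ st'.coins = st.coins)
    (by simp [num]) ?_ ?_
  · intro k hk st' fr hI
    have hk : k < st.reg u := by simpa [hru] using hk
    have h2 : 2 ^ k + 2 ^ k < 2 ^ V := by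
      rw [← two_mul, ← pow_succ']; exact Nat.pow_lt_pow_right (by norm_num) (by omega)
    simp [hr, hI.1, hI.2, h2]
    rw [pow_succ]; omega
  · intro st' fr hI
    simpa [hru] using hI

lemma drawBits_wp {u : Rg} (huq : u ≠ .sc .q) (hV : st.reg u < V) :
    (drawBits u).Wp (layout l) A V E st fun st' =>
      st'.reg (.sc .q) = draw E.ω st.coins (st.reg u) ∧ st'.coins = st.coins + st.reg u := by
  rw [drawBits, Stmt.wp_seq, wp_put]
  refine ⟨by simp [num], ?_⟩
  refine Stmt.wp_loop (fun k st' => st'.reg (.sc .q) = draw E.ω st.coins k ∧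
    st'.coins = st.coins + k) (by simp [num, draw]) ?_ ?_
  · intro k hk st' fr hI
    have hk : k < st.reg u := by simpa [huq] using hk
    have h3 := draw_lt E.ω st.coins (k + 1)
    have h4 : 2 ^ (k + 1) ≤ 2 ^ V := Nat.pow_le_pow_right (by norm_num) (by omega)
    rw [draw] at h3
    simp [wp_put, rg, hI.1, hI.2, draw]
    refine ⟨⟨by omega, by omega⟩, by omega, by omega⟩
  · intro st' fr hI
    simpa [huq] using hI

lemma testPrime_wp {u : Rg} (hg : u ≠ .sc .g)
    (hq : st.reg (.sc .q) ≤ st.reg u) (hV : st.reg u < 2 ^ V) (hV2 : 2 < 2 ^ V) :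
    (testPrime u).Wp (layout l) A V E st fun st' =>
      (st'.reg (.sc .g) ≠ 0 ↔ (st.reg (.sc .q)).Prime) ∧ st'.coins = st.coins := by
  rw [testPrime, Stmt.wp_seq, wp_put]
  have h1V : 1 < 2 ^ V := by omega
  refine ⟨by simp [num, rg, h1V, hV2], ?_⟩
  set q := st.reg (.sc .q) with hqd
  refine Stmt.wp_loop (fun k st' => (st'.reg (.sc .g) ≠ 0 ↔
    2 ≤ q ∧ ∀ d, 2 ≤ d → d < q → d < k → ¬ d ∣ q) ∧ st'.coins = st.coins) ?_ ?_ ?_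
  · simp only [num, rg, St.set_reg, if_true, St.set_coins, Expr.eval_sub, Expr.eval_const,
      Expr.eval_reg, ← hqd, and_true]
    constructor
    · exact fun h => ⟨by omega, fun d _ _ h => by omega⟩
    · exact fun h => by omega
  · intro k hk st' fr hI
    have hk : k < st.reg u := by simpa [hg] using hk
    have eq : st'.reg (.sc .q) = q := by rw [fr.reg _ (by simp [Stmt.Asg])]; simp [hqd]
    have hstep : (∀ d, 2 ≤ d → d < q → d < k + 1 → ¬ d ∣ q) ↔
        (∀ d, 2 ≤ d → d < q → d < k → ¬ d ∣ q) ∧ (2 ≤ k → k < q → ¬ k ∣ q) := by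
      refine ⟨fun h => ⟨fun d h1 h2 h3 => h d h1 h2 (by omega), fun h1 h2 => h k h1 h2 (by omega)⟩,
        fun h d h1 h2 h3 => ?_⟩
      rcases Nat.lt_succ_iff_lt_or_eq.1 h3 with h4 | rfl
      · exact h.1 d h1 h2 h4
      · exact h.2 h1 h2
    have keep : (2 ≤ k → k < q → ¬ k ∣ q) → ((st'.set (.sc .d) k).reg (.sc .g) ≠ 0 ↔
        2 ≤ q ∧ ∀ d, 2 ≤ d → d < q → d < k + 1 → ¬ d ∣ q) ∧
        (st'.set (.sc .d) k).coins = st.coins := by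
      intro h
      rw [hstep]
      refine ⟨?_, by simpa using hI.2⟩
      rw [St.set_reg, if_neg (by simp), hI.1]
      tauto
    simp only [Stmt.wp_ifz, Stmt.wp_skip, wp_put]
    refine ⟨by simp [num, rg, hV2], fun h1 => ⟨?_, fun h2 => ⟨?_, fun h3 => ⟨?_, ?_, ?_⟩,
      fun h3 => keep ?_⟩, fun h2 => keep ?_⟩, fun h1 => keep ?_⟩
    · simp [num, rg, h1V]; omega
    · refine Expr.ok_mod (by simp [rg]) (by simp [rg]) ?_
      simp [rg, eq]; omega
    · simp [num]
    · simp [num, rg, eq] at h1 h2 h3 ⊢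
      intro _
      exact ⟨k, by omega, by omega, by omega, Nat.dvd_of_mod_eq_zero h3⟩
    · simpa using hI.2
    · simp [rg, eq] at h3
      exact fun _ _ h => h3 (Nat.mod_eq_zero_of_dvd h)
    · simp [num, rg, eq] at h2; omega
    · simp [num, rg] at h1; omega
  · intro st' fr hI
    refine ⟨?_, hI.2⟩
    rw [hI.1, Nat.prime_def_lt']
    simp only [rounds_false, St.set_reg, hg, if_false]
    refine and_congr_right fun _ => ⟨fun h d h1 h2 => h d h1 h2 (by omega), fun h d h1 h2 _ => h d h1 h2⟩

@[simp] lemma asg_drawBits (u x : Rg) : (drawBits u).Asg x ↔ x = .sc .q ∨ x = .sc .i ∨ x = .sc .f := by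
  simp [drawBits, Stmt.Asg]; tauto

@[simp] lemma wr_drawBits (u : Rg) (x : Ar) : (drawBits u).Wr x ↔ False := by
  simp [drawBits, Stmt.Wr]

@[simp] lemma asg_testPrime (u x : Rg) : (testPrime u).Asg x ↔ x = .sc .g ∨ x = .sc .d := by
  simp [testPrime, Stmt.Asg]; tauto

@[simp] lemma wr_testPrime (u : Rg) (x : Ar) : (testPrime u).Wr x ↔ False := by
  simp [testPrime, Stmt.Wr]

@[simp] lemma asg_powTwo (r u x : Rg) : (powTwo r u).Asg x ↔ x = r ∨ x = .sc .i := by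
  simp [powTwo, Stmt.Asg]; tauto

@[simp] lemma wr_powTwo (r u : Rg) (x : Ar) : (powTwo r u).Wr x ↔ False := by
  simp [powTwo, Stmt.Wr]

/-- The scalar registers used for drawing random primes. -/
def Scalar.IsDraw : Scalar → Bool
  | .q | .i | .f | .g | .d | .k => true
  | _ => false

lemma asg_drawPrime {r b u x : Rg} (h : (drawPrime r b u).Asg x) :
    x = r ∨ ∃ x' : Scalar, x'.IsDraw = true ∧ x = .sc x' := by
  simp only [drawPrime, Stmt.Asg, asg_drawBits, asg_testPrime] at h
  rcases h with rfl | rfl | (rfl | rfl | rfl) | (rfl | rfl) | h | rfl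
  · exact .inl rfl
  · exact .inr ⟨_, rfl, rfl⟩
  · exact .inr ⟨_, rfl, rfl⟩
  · exact .inr ⟨_, rfl, rfl⟩
  · exact .inr ⟨_, rfl, rfl⟩
  · exact .inr ⟨_, rfl, rfl⟩
  · exact .inr ⟨_, rfl, rfl⟩
  · exact h.elim
  · exact .inl rfl

@[simp] lemma wr_drawPrime (r b u : Rg) (x : Ar) : (drawPrime r b u).Wr x ↔ False := by
  simp [drawPrime, Stmt.Wr]

lemma drawPrime_wp {r b u : Rg} (hr : ∀ x', r ≠ .sc x') (hb : ∀ x', b ≠ .sc x') (hu : ∀ x', u ≠ .sc x')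
    (hbr : b ≠ r) (hur : u ≠ r) (hub : st.reg u = 2 ^ st.reg b) (hV : st.reg b < V) (hV2 : 1 < V) :
    (drawPrime r b u).Wp (layout l) A V E st fun st' =>
      st'.reg r = lastPrime E.ω st.coins (st.reg b) (st.reg (.sc .r3)) ∧
        st'.coins = st.coins + st.reg (.sc .r3) * st.reg b := by
  have h2V : 2 < 2 ^ V := by
    calc 2 = 2 ^ 1 := rfl
      _ < 2 ^ V := Nat.pow_lt_pow_right (by norm_num) hV2
  have hr' : ∀ x', ¬ Rg.sc x' = r := fun x' h => hr x' h.symm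
  rw [drawPrime, Stmt.wp_seq, Stmt.wp_assign]
  refine ⟨h2V, ?_⟩
  refine Stmt.wp_loop (fun k st' => st'.reg r = lastPrime E.ω st.coins (st.reg b) k ∧
    st'.coins = st.coins + k * st.reg b) ?_ ?_ ?_
  · simp [num, lastPrime]
  · intro k hk st' fr hI
    have eb : (st'.set (.sc .k) k).reg b = st.reg b := by
      rw [St.set_reg, if_neg (hb _), fr.reg _ (by simp [Stmt.Asg, hb, hbr])]; simp [hbr]
    have eu : (st'.set (.sc .k) k).reg u = st.reg u := by
      rw [St.set_reg, if_neg (hu _), fr.reg _ (by simp [Stmt.Asg, hu, hur])]; simp [hur]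
    rw [Stmt.wp_seq]
    refine (drawBits_wp (hb _) (by rw [eb]; exact hV)).mono fun st₁ fr₁ ⟨h1, h1c⟩ => ?_
    rw [eb] at h1 h1c
    rw [St.set_coins, hI.2] at h1 h1c
    have eu₁ : st₁.reg u = 2 ^ st.reg b := by rw [fr₁.reg _ (by simp [hu]), eu, hub]
    rw [Stmt.wp_seq]
    refine (testPrime_wp (hu _) ?_ ?_ h2V).mono fun st₂ fr₂ ⟨h2, h2c⟩ => ?_
    · rw [h1, eu₁]; exact (draw_lt _ _ _).le
    · rw [eu₁]; exact Nat.pow_lt_pow_right (by norm_num) hV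
    · have er : st₂.reg r = lastPrime E.ω st.coins (st.reg b) k := by
        rw [fr₂.reg _ (by simp [hr]), fr₁.reg _ (by simp [hr]), St.set_reg, if_neg (hr _), hI.1]
      have eq : st₂.reg (.sc .q) = draw E.ω (st.coins + k * st.reg b) (st.reg b) := by
        rw [fr₂.reg _ (by simp), h1]
      rw [h1] at h2
      have hc : st₂.coins = st.coins + (k + 1) * st.reg b := by rw [h2c, h1c]; ring
      simp only [Stmt.wp_ifz, Stmt.wp_skip, Stmt.wp_assign, rg, Expr.ok_reg, Expr.eval_reg, true_and,
        St.set_reg, if_true, St.set_coins, lastPrime]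
      refine ⟨fun h0 => ⟨?_, hc⟩, fun h0 => ⟨?_, hc⟩⟩
      · rw [if_neg (fun hp => h2.2 hp h0), er]
      · rw [if_pos (h2.1 h0), eq]
  · intro st' fr hI
    simpa [hr'] using hI

end

/-! ### The parameters of the search -/

/-- The number of items in the second part of block `j`. -/
def secondPart (m c j : ℕ) : ℕ := if j ≤ 1 then (m + c) / 2 else m

/-- The number of items in the first part of block `j`: together with the second part, these are
`j m + c` items, except that block `0` takes all the items that the other blocks leave. -/
def firstPart (l n m c j : ℕ) : ℕ :=
  if j = 0 then n - l * (l + 1) / 2 * m - l * c - (m + c) / 2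
  else if j = 1 then m + c - (m + c) / 2 else (j - 1) * m + c

/-- The number of bits of the prime of level `i`. -/
def primeBits (m c i : ℕ) : ℕ := if i ≤ 1 then c + 2 else m + 2

/-- The primes, drawn with the coin flips from number `s` on, with `r` trials for each. -/
def primes (ω : ℕ → Bool) (s r m c : ℕ) : ℕ → ℕ
  | 0 => 2
  | i + 1 => lastPrime ω (s + ∑ k ∈ Finset.range i, r * primeBits m c (k + 1))
      (primeBits m c (i + 1)) r

/-- The parameters for `n` items, block size `m`, offset `c`, and primes `p`. In the blocks `0` and `1`,
the second part has `(m + c) / 2` items, but `p 1` has only `c + 2` bits; hence the larger capacity. -/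
def params (l n N t lam m c : ℕ) (a p : ℕ → ℕ) : Data where
  l := l
  n := n
  N := N
  t := t
  P := lam ^ (9 * l + 9)
  a := a
  lenE := firstPart l n m c
  lenB := secondPart m c
  W j := if j ≤ 1 then lam ^ (9 * l + 9) * 2 ^ ((m - c) / 2) else lam ^ (9 * l + 9)
  p := p
  M j := ∏ k ∈ Finset.range j, p (k + 1)

section

variable {l n N t lam m c : ℕ} {a p : ℕ → ℕ}

lemma half_succ (l : ℕ) : (l + 1) * (l + 1 + 1) / 2 = l * (l + 1) / 2 + (l + 1) := by
  have : (l + 1) * (l + 1 + 1) = l * (l + 1) + 2 * (l + 1) := by ring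
  omega

lemma firstPart_add_secondPart {j : ℕ} (hj : 1 ≤ j) :
    firstPart l n m c j + secondPart m c j = j * m + c := by
  unfold firstPart secondPart
  rw [if_neg (by omega)]
  split_ifs with h1 h2
  · subst h1; omega
  · omega
  · omega
  · obtain ⟨i, rfl⟩ : ∃ i, j = i + 1 := ⟨j - 1, by omega⟩
    rw [Nat.add_sub_cancel]; ring

lemma c_mul_le (hm : (1 + l * (l + 1) / 2) * m ≤ n) (hc : c = (n - (1 + l * (l + 1) / 2) * m) / (l + 1)) :
    l * (l + 1) / 2 * m + l * c + (m + c) ≤ n := by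
  have h1 : c * (l + 1) ≤ n - (1 + l * (l + 1) / 2) * m := by rw [hc]; exact Nat.div_mul_le_self _ _
  have h2 : (1 + l * (l + 1) / 2) * m = m + l * (l + 1) / 2 * m := by ring
  have h3 : c * (l + 1) = l * c + c := by ring
  omega

lemma off_params (hm : (1 + l * (l + 1) / 2) * m ≤ n)
    (hc : c = (n - (1 + l * (l + 1) / 2) * m) / (l + 1)) :
    (params l n N t lam m c a p).off (l + 1) = n := by
  have h0 := c_mul_le hm hc
  have h1 : ∀ j, ∑ i ∈ Finset.range j, (firstPart l n m c (i + 1) + secondPart m c (i + 1)) =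
      j * (j + 1) / 2 * m + j * c := by
    intro j
    induction j with
    | zero => simp
    | succ j ih =>
      rw [Finset.sum_range_succ, ih, firstPart_add_secondPart (by omega), half_succ]; ring
  change ∑ i ∈ Finset.range (l + 1), (firstPart l n m c i + secondPart m c i) = n
  rw [Finset.sum_range_succ', h1]
  simp only [firstPart, secondPart, if_true, Nat.zero_le]; omega

lemma params_shape (hl : 1 ≤ l) (hm : (1 + l * (l + 1) / 2) * m ≤ n)
    (hc : c = (n - (1 + l * (l + 1) / 2) * m) / (l + 1)) (hp : ∀ i, 0 < p i) :
    (params l n N t lam m c a p).Shape where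
  l_pos := hl
  off_eq := off_params hm hc
  p_pos := hp
  M_one := by simp [params]
  M_pos i := (Finset.prod_pos fun k _ => hp (k + 1) : 0 < ∏ k ∈ Finset.range i, p (k + 1))
  p_dvd i _ k hk hki := by
    have := Finset.dvd_prod_of_mem (fun k => p (k + 1)) (a := k - 1) (s := Finset.range i)
      (Finset.mem_range.2 (by omega))
    simpa [params, Nat.sub_add_cancel hk] using this

lemma firstPart_le (hm : (1 + l * (l + 1) / 2) * m ≤ n)
    (hc : c = (n - (1 + l * (l + 1) / 2) * m) / (l + 1)) {j : ℕ} (hj : j ≤ l) :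
    firstPart l n m c j ≤ n := by
  have h0 := c_mul_le hm hc
  unfold firstPart
  split_ifs with h1 h2
  · omega
  · omega
  · have : (j - 1) * m ≤ l * (l + 1) / 2 * m := Nat.mul_le_mul_right _ (by
      have := Nat.mul_le_mul_left l (show 2 ≤ l + 1 by omega)
      omega)
    omega

lemma secondPart_le (hm : (1 + l * (l + 1) / 2) * m ≤ n)
    (hc : c = (n - (1 + l * (l + 1) / 2) * m) / (l + 1)) (j : ℕ) : secondPart m c j ≤ n := by
  have h0 := c_mul_le hm hc
  unfold secondPart
  split_ifs <;> omega

end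

/-- The length of the first part of block `j`. -/
def firstPartExpr (l j : ℕ) : Expr Rg Ar :=
  if j = 0 then rg .n - num (l * (l + 1) / 2) * rg .m - num l * rg .c - (rg .m + rg .c) / num 2
  else if j = 1 then rg .m + rg .c - (rg .m + rg .c) / num 2 else num (j - 1) * rg .m + rg .c

/-- Set the registers of level `j` that describe the block and the tables. -/
def setLevel (l j : ℕ) : Prog :=
  .assign (.lv .lenE j) (firstPartExpr l j) ⨾
  .assign (.lv .lenB j) (if j ≤ 1 then (rg .m + rg .c) / num 2 else rg .m) ⨾
  .assign (.lv .offE j) (if j = 0 then num 0 else lv .offB (j - 1) + lv .lenB (j - 1)) ⨾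
  .assign (.lv .offB j) (lv .offE j + lv .lenE j) ⨾
  powTwo (.lv .pwE j) (.lv .lenE j) ⨾ powTwo (.lv .pwB j) (.lv .lenB j) ⨾
  .assign (.lv .W j) (if j ≤ 1 then rg .P * rg .pw else rg .P)

/-- Set the registers of the levels below `j`. -/
def setLevels (l : ℕ) : ℕ → Prog
  | 0 => .skip
  | j + 1 => setLevels l j ⨾ setLevel l j

/-- Draw the prime of level `i` and compute the modulus. -/
def setPrime (i : ℕ) : Prog :=
  .assign (.lv .bits i) (if i ≤ 1 then rg .c + num 2 else rg .m + num 2) ⨾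
  powTwo (.lv .pw i) (.lv .bits i) ⨾ drawPrime (.lv .p i) (.lv .bits i) (.lv .pw i) ⨾
  .assign (.lv .M i) (lv .M (i - 1) * lv .p i)

/-- Draw the primes of the levels up to `i`. -/
def setPrimes : ℕ → Prog
  | 0 => .assign (.lv .p 0) (num 2) ⨾ .assign (.lv .M 0) (num 1)
  | i + 1 => setPrimes i ⨾ setPrime (i + 1)

/-- A power of a register. -/
def powExpr (r : Scalar) : ℕ → Expr Rg Ar
  | 0 => num 1
  | k + 1 => powExpr r k * rg r

/-- Set all parameters of the search. The expression `e` stands for the block size `m`. The expected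
load of a bucket has a factor `lam ^ 8` for each of up to `l + 1` primes and a factor `2 ^ l` from
rounding; the exponent `9 l + 9` lets the capacity `P` exceed it by a factor `lam`. -/
def setParams (l : ℕ) (e : Expr Rg Ar) : Prog :=
  put .m e ⨾ put .c ((rg .n - num (1 + l * (l + 1) / 2) * rg .m) / num (l + 1)) ⨾
  put .w ((rg .m - rg .c) / num 2) ⨾ powTwo (.sc .pw) (.sc .w) ⨾
  put .P (powExpr .lam (9 * l + 9)) ⨾ setLevels l (l + 1) ⨾ setPrimes (l + 1)

/-- The registers that the parameters are computed from. -/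
structure Basis (D : Data) (m c r : ℕ) (st : St Rg Ar) : Prop where
  Q : st.reg (.sc .Q) = D.Q
  N : st.reg (.sc .N) = D.N
  t : st.reg (.sc .t) = D.t
  n1 : st.reg (.sc .n1) = D.n + 1
  item : ∀ i < D.n, st.arr .item i = D.w i
  n : st.reg (.sc .n) = D.n
  P : st.reg (.sc .P) = D.P
  pw : st.reg (.sc .pw) = 2 ^ ((m - c) / 2)
  m : st.reg (.sc .m) = m
  c : st.reg (.sc .c) = c
  r3 : st.reg (.sc .r3) = r
  flag : st.reg (.sc .flag) = 0

/-- The registers of the levels below `j` are set. -/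
structure LevelsSet (D : Data) (j : ℕ) (st : St Rg Ar) : Prop where
  lenE : ∀ i < j, st.reg (.lv .lenE i) = D.lenE i
  offE : ∀ i < j, st.reg (.lv .offE i) = D.off i
  pwE : ∀ i < j, st.reg (.lv .pwE i) = 2 ^ D.lenE i
  lenB : ∀ i < j, st.reg (.lv .lenB i) = D.lenB i
  offB : ∀ i < j, st.reg (.lv .offB i) = D.mid i
  pwB : ∀ i < j, st.reg (.lv .pwB i) = 2 ^ D.lenB i
  W : ∀ i < j, st.reg (.lv .W i) = D.W i

/-- The primes and moduli of the levels up to `i` are set. -/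
structure PrimesSet (D : Data) (i : ℕ) (st : St Rg Ar) : Prop where
  p : ∀ k ≤ i, st.reg (.lv .p k) = D.p k
  M : ∀ k ≤ i, st.reg (.lv .M k) = D.M k

lemma Basis.congr {D : Data} {m c r : ℕ} {st st' : St Rg Ar} (h : Basis D m c r st)
    (hr : ∀ x' : Scalar, x'.IsDraw = false → st'.reg (.sc x') = st.reg (.sc x'))
    (ha : st'.arr .item = st.arr .item) : Basis D m c r st' where
  Q := (hr _ rfl).trans h.Q
  N := (hr _ rfl).trans h.N
  t := (hr _ rfl).trans h.t
  n1 := (hr _ rfl).trans h.n1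
  item i hi := by rw [ha]; exact h.item i hi
  n := (hr _ rfl).trans h.n
  P := (hr _ rfl).trans h.P
  m := (hr _ rfl).trans h.m
  c := (hr _ rfl).trans h.c
  pw := (hr _ rfl).trans h.pw
  r3 := (hr _ rfl).trans h.r3
  flag := (hr _ rfl).trans h.flag

section

variable {l n N t lam m c r A V : ℕ} {a p : ℕ → ℕ} {E : Env} {st : St Rg Ar}

/-- The bounds that the computation of the parameters needs. -/
structure ParamFits (l n lam m c V : ℕ) : Prop where
  m_le : (1 + l * (l + 1) / 2) * m ≤ n
  c_eq : c = (n - (1 + l * (l + 1) / 2) * m) / (l + 1)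
  n_lt : (n + 2) * (l + 2) < V
  P_lt : lam ^ (9 * l + 9) * 2 ^ n < 2 ^ V
  l_lt : 1 + l * (l + 1) / 2 < 2 ^ V
  lam_pos : 1 ≤ lam

lemma asg_setLevel {l j : ℕ} {x : Rg} (h : (setLevel l j).Asg x) : x = .sc .i ∨
    ∃ f, (f = .lenE ∨ f = .lenB ∨ f = .offE ∨ f = .offB ∨ f = .pwE ∨ f = .pwB ∨ f = .W) ∧
      x = .lv f j := by
  simp only [setLevel, Stmt.Asg, asg_powTwo] at h
  rcases h with h | h | h | h | (h | h) | (h | h) | h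
  all_goals first | exact .inl h | exact .inr ⟨_, by simp, h⟩

lemma setLevel_wp (hf : ParamFits l n lam m c V) {j : ℕ} (hj : j ≤ l)
    (hb : Basis (params l n N t lam m c a p) m c r st)
    (hl : LevelsSet (params l n N t lam m c a p) j st) :
    (setLevel l j).Wp (layout l) A V E st fun st' =>
      Basis (params l n N t lam m c a p) m c r st' ∧
      LevelsSet (params l n N t lam m c a p) (j + 1) st' ∧ st'.coins = st.coins := by
  set D := params l n N t lam m c a p with hD
  have h0 := c_mul_le hf.m_le hf.c_eq
  have hnV : n < 2 ^ V := lt_of_lt_of_le (by have := hf.n_lt; nlinarith) Nat.lt_two_pow_self.le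
  have hn : n < V := by have := hf.n_lt; nlinarith
  have hlV := hf.l_lt
  have hll : l ≤ l * (l + 1) / 2 := by
    rcases Nat.eq_zero_or_pos l with rfl | h
    · simp
    · have : 2 * l ≤ l * (l + 1) := by nlinarith
      omega
  have h2V : 2 < 2 ^ V := by
    have h3 : (0 + 2) * (0 + 2) ≤ (n + 2) * (l + 2) := by gcongr <;> omega
    have := hf.n_lt
    calc 2 < 2 ^ 2 := by norm_num
      _ ≤ 2 ^ V := Nat.pow_le_pow_right (by norm_num) (by omega)
  have hlm : l * m ≤ l * (l + 1) / 2 * m := Nat.mul_le_mul_right _ hll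
  have hjm : (j - 1) * m ≤ l * m := Nat.mul_le_mul_right _ (by omega)
  have hE : D.lenE j = firstPart l n m c j := rfl
  have hB : D.lenB j = secondPart m c j := rfl
  have hEn := firstPart_le hf.m_le hf.c_eq hj
  have hBn := secondPart_le hf.m_le hf.c_eq j
  have hoff : ∀ i ≤ l, D.off (i + 1) ≤ n := by
    intro i hi
    have := D.off_mono (show i + 1 ≤ l + 1 by omega)
    rwa [hD, off_params hf.m_le hf.c_eq] at this
  rw [setLevel, Stmt.wp_seq, Stmt.wp_assign]
  have e1 : (firstPartExpr l j).eval E st = D.lenE j := by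
    rw [hE]
    unfold firstPart firstPartExpr
    split_ifs <;> simp [rg, num, hb.n, hb.m, hb.c, hD, params]
  have o1 : (firstPartExpr l j).Ok (layout l) A V E st := by
    unfold firstPartExpr; split_ifs <;> simp [rg, num, hb.m, hb.c, h2V] <;> omega
  refine ⟨o1, ?_⟩
  rw [e1]
  set st₁ := st.set (.lv .lenE j) (D.lenE j) with hst₁
  have hb₁ : Basis D m c r st₁ := hb.congr (fun _ _ => by simp [hst₁]) rfl
  have e2 : (if j ≤ 1 then (rg .m + rg .c) / num 2 else rg .m : Expr Rg Ar).eval E st₁ =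
      D.lenB j := by
    rw [hB]
    unfold secondPart
    split_ifs <;> simp [rg, num, hb₁.m, hb₁.c]
  rw [Stmt.wp_seq, Stmt.wp_assign, e2]
  refine ⟨by split_ifs <;> simp [rg, num, hb₁.m, hb₁.c, h2V]; omega, ?_⟩
  set st₂ := st₁.set (.lv .lenB j) (D.lenB j) with hst₂
  have e3 : (if j = 0 then num 0 else lv .offB (j - 1) + lv .lenB (j - 1) : Expr Rg Ar).eval E st₂ =
      D.off j := by
    split_ifs with h
    · subst h; simp [num, Data.off]
    · obtain ⟨i, rfl⟩ : ∃ i, j = i + 1 := ⟨j - 1, by omega⟩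
      rw [D.off_succ]; simp [lv, hst₂, hst₁, hl.offB i (by omega), hl.lenB i (by omega)]
  have o3 : (if j = 0 then num 0 else lv .offB (j - 1) + lv .lenB (j - 1) : Expr Rg Ar).Ok
      (layout l) A V E st₂ := by
    split_ifs with h
    · simp [num]
    · rw [if_neg h] at e3
      refine ⟨trivial, trivial, ?_⟩
      change (lv .offB (j - 1) + lv .lenB (j - 1) : Expr Rg Ar).eval E st₂ < 2 ^ V
      rw [e3]; exact lt_of_le_of_lt ((D.off_mono (by omega)).trans (hoff j hj)) hnV
  rw [Stmt.wp_seq, Stmt.wp_assign, e3]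
  refine ⟨o3, ?_⟩
  set st₃ := st₂.set (.lv .offE j) (D.off j) with hst₃
  have e4 : (lv .offE j + lv .lenE j : Expr Rg Ar).eval E st₃ = D.mid j := by
    simp [lv, hst₃, hst₂, hst₁, Data.mid]
  rw [Stmt.wp_seq, Stmt.wp_assign]
  refine ⟨⟨trivial, trivial, ?_⟩, ?_⟩
  · change (lv .offE j + lv .lenE j : Expr Rg Ar).eval E st₃ < 2 ^ V
    rw [e4]
    have := hoff j hj
    have := D.off_succ j; omega
  rw [e4]
  set st₄ := st₃.set (.lv .offB j) (D.mid j) with hst₄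
  have r1 : st₄.reg (.lv .lenE j) = D.lenE j := by simp [hst₄, hst₃, hst₂, hst₁]
  rw [Stmt.wp_seq]
  refine (powTwo_wp (by simp) (by simp) (by rw [r1]; omega)).mono fun st₅ fr₅ ⟨h5, c5⟩ => ?_
  have r2 : st₅.reg (.lv .lenB j) = D.lenB j := by
    rw [fr₅.reg _ (by simp)]; simp [hst₄, hst₃, hst₂, hst₁]
  rw [Stmt.wp_seq]
  refine (powTwo_wp (by simp) (by simp) (by rw [r2]; omega)).mono fun st₆ fr₆ ⟨h6, c6⟩ => ?_
  have hsc : ∀ x' : Scalar, x'.IsDraw = false → st₆.reg (.sc x') = st.reg (.sc x') := by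
    intro x' hx
    have : Rg.sc x' ≠ .sc .i := by rintro h; cases h; simp [Scalar.IsDraw] at hx
    rw [fr₆.reg _ (by simpa using this), fr₅.reg _ (by simpa using this)]
    simp [hst₄, hst₃, hst₂, hst₁]
  have hitem : st₆.arr .item = st.arr .item := by rw [fr₆.arr _ (by simp), fr₅.arr _ (by simp)]; rfl
  have hb₆ : Basis D m c r st₆ := hb.congr hsc hitem
  have e7 : (if j ≤ 1 then rg .P * rg .pw else rg .P : Expr Rg Ar).eval E st₆ = D.W j := by
    change _ = if j ≤ 1 then _ else _
    split_ifs
    · simp only [Expr.eval_mul, rg, Expr.eval_reg, hb₆.P, hb₆.pw]; rfl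
    · simp only [rg, Expr.eval_reg, hb₆.P]; rfl
  have hregs : ∀ x, x ≠ .lv .W j → x ≠ .lv .pwB j → x ≠ .lv .pwE j → x ≠ .sc .i →
      (st₆.set (.lv .W j) (D.W j)).reg x = st₄.reg x := by
    intro x hx1 hx2 hx3 hx4
    rw [St.set_reg, if_neg hx1, fr₆.reg _ (by simp [hx2, hx4]), fr₅.reg _ (by simp [hx3, hx4])]
  rw [Stmt.wp_assign, e7]
  refine ⟨?_, hb₆.congr (fun _ _ => by simp) rfl, ?_, ?_⟩
  · split_ifs with h
    · refine ⟨trivial, trivial, ?_⟩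
      change (rg .P * rg .pw : Expr Rg Ar).eval E st₆ < 2 ^ V
      rw [if_pos h] at e7
      rw [e7]
      refine lt_of_le_of_lt ?_ hf.P_lt
      change (if j ≤ 1 then _ else _) ≤ _
      rw [if_pos h]
      gcongr
      · norm_num
      · omega
    · trivial
  · have new : ∀ i < j + 1, i ≠ j → i < j := fun i _ _ => by omega
    have old : ∀ f i, i ≠ j → (st₆.set (.lv .W j) (D.W j)).reg (.lv f i) = st.reg (.lv f i) := by
      intro f i h
      rw [hregs _ (by simp [h]) (by simp [h]) (by simp [h]) (by simp)]
      simp [hst₄, hst₃, hst₂, hst₁, h]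
    have case : ∀ (f : Family) (g : ℕ → ℕ), (∀ i < j, st.reg (.lv f i) = g i) →
        (st₆.set (.lv .W j) (D.W j)).reg (.lv f j) = g j →
        ∀ i < j + 1, (st₆.set (.lv .W j) (D.W j)).reg (.lv f i) = g i := by
      intro f g h h' i hi
      by_cases hij : i = j
      · rw [hij, h']
      · rw [old f i hij, h i (new i hi hij)]
    refine ⟨case _ _ hl.lenE ?_, case _ _ hl.offE ?_, case _ (fun i => 2 ^ D.lenE i) hl.pwE ?_,
      case _ _ hl.lenB ?_, case _ _ hl.offB ?_, case _ (fun i => 2 ^ D.lenB i) hl.pwB ?_,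
      case _ _ hl.W (by simp)⟩
    · rw [hregs _ (by simp) (by simp) (by simp) (by simp), r1]
    · rw [hregs _ (by simp) (by simp) (by simp) (by simp)]; simp [hst₄, hst₃]
    · rw [St.set_reg, if_neg (by simp), fr₆.reg _ (by simp), h5, r1]
    · rw [hregs _ (by simp) (by simp) (by simp) (by simp)]; simp [hst₄, hst₃, hst₂]
    · rw [hregs _ (by simp) (by simp) (by simp) (by simp)]; simp [hst₄]
    · rw [St.set_reg, if_neg (by simp), h6, r2]
  · simp [c6, c5, hst₄, hst₃, hst₂, hst₁]

lemma setLevels_wp (hf : ParamFits l n lam m c V)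
    (hb : Basis (params l n N t lam m c a p) m c r st) (j : ℕ) (hj : j ≤ l + 1) :
    (setLevels l j).Wp (layout l) A V E st fun st' =>
      Basis (params l n N t lam m c a p) m c r st' ∧
      LevelsSet (params l n N t lam m c a p) j st' ∧ st'.coins = st.coins := by
  induction j with
  | zero =>
    rw [setLevels, Stmt.wp_skip]
    refine ⟨hb, ⟨?_, ?_, ?_, ?_, ?_, ?_, ?_⟩, rfl⟩ <;> exact fun i hi => absurd hi (by omega)
  | succ j ih =>
    rw [setLevels, Stmt.wp_seq]
    refine (ih (by omega)).mono fun st₁ _ ⟨hb₁, hl₁, hc₁⟩ => ?_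
    refine (setLevel_wp hf (by omega) hb₁ hl₁).mono fun st₂ _ ⟨hb₂, hl₂, hc₂⟩ => ?_
    exact ⟨hb₂, hl₂, hc₂.trans hc₁⟩

end

section

variable {l n N t lam m c r A V : ℕ} {a p : ℕ → ℕ} {E : Env} {st : St Rg Ar}

/-- The registers that describe the primes of the levels `1, …, i` are set. -/
structure BitsSet (m c i : ℕ) (st : St Rg Ar) : Prop where
  bits : ∀ k, 1 ≤ k → k ≤ i → st.reg (.lv .bits k) = primeBits m c k
  pw : ∀ k, 1 ≤ k → k ≤ i → st.reg (.lv .pw k) = 2 ^ primeBits m c k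

lemma asg_setPrime {i : ℕ} {x : Rg} (h : (setPrime i).Asg x) :
    (∃ x' : Scalar, x'.IsDraw = true ∧ x = .sc x') ∨
    ∃ f, (f = .bits ∨ f = .pw ∨ f = .p ∨ f = .M) ∧ x = .lv f i := by
  simp only [setPrime, Stmt.Asg, asg_powTwo] at h
  rcases h with h | (h | h) | h | h
  · exact .inr ⟨_, by simp, h⟩
  · exact .inr ⟨_, by simp, h⟩
  · exact .inl ⟨_, rfl, h⟩
  · rcases asg_drawPrime h with h | h
    · exact .inr ⟨_, by simp, h⟩
    · exact .inl h
  · exact .inr ⟨_, by simp, h⟩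

lemma asg_setPrimes {i : ℕ} {x : Rg} (h : (setPrimes i).Asg x) :
    (∃ x' : Scalar, x'.IsDraw = true ∧ x = .sc x') ∨
    ∃ f, (f = .bits ∨ f = .pw ∨ f = .p ∨ f = .M) ∧ ∃ k ≤ i, x = .lv f k := by
  induction i with
  | zero =>
    rcases h with h | h
    · exact .inr ⟨_, by simp, 0, le_rfl, h⟩
    · exact .inr ⟨_, by simp, 0, le_rfl, h⟩
  | succ i ih =>
    rcases h with h | h
    · rcases ih h with h | ⟨f, hf, k, hk, h⟩
      · exact .inl h
      · exact .inr ⟨f, hf, k, by omega, h⟩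
    · rcases asg_setPrime h with h | ⟨f, hf, h⟩
      · exact .inl h
      · exact .inr ⟨f, hf, _, le_rfl, h⟩

lemma primeBits_pos (m c i : ℕ) : 2 ≤ primeBits m c i := by
  unfold primeBits; split_ifs <;> omega

lemma primes_pos (ω : ℕ → Bool) (s r m c i : ℕ) : (primes ω s r m c i).Prime := by
  cases i with
  | zero => exact Nat.prime_two
  | succ i => exact lastPrime_prime _ _ _ _

lemma primes_le (ω : ℕ → Bool) (s r m c i : ℕ) : primes ω s r m c i ≤ 2 ^ primeBits m c i := by
  cases i with
  | zero =>
    have := primeBits_pos m c 0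
    exact Nat.pow_le_pow_right (n := 2) (i := 1) (by norm_num) (by omega)
  | succ i =>
    have := primeBits_pos m c (i + 1); exact lastPrime_le _ _ _ _ (by omega)

lemma primeBits_le (hf : ParamFits l n lam m c V) (i : ℕ) : primeBits m c i ≤ n + 2 := by
  have h0 := c_mul_le hf.m_le hf.c_eq
  unfold primeBits; split_ifs <;> omega

lemma prod_primes_le (hf : ParamFits l n lam m c V) (ω : ℕ → Bool) (s r i : ℕ) :
    ∏ k ∈ Finset.range i, primes ω s r m c (k + 1) ≤ 2 ^ ((n + 2) * i) := by
  rw [pow_mul]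
  refine (Finset.prod_le_pow_card _ _ (2 ^ (n + 2)) fun k _ => ?_).trans (by simp)
  exact (primes_le ω s r m c _).trans (Nat.pow_le_pow_right (by norm_num) (primeBits_le hf _))

lemma setPrimes_wp (hf : ParamFits l n lam m c V) {s : ℕ} (hs : st.coins = s)
    (hp : p = primes E.ω s r m c) (hb : Basis (params l n N t lam m c a p) m c r st) (i : ℕ)
    (hi : i ≤ l + 1) : (setPrimes i).Wp (layout l) A V E st fun st' =>
      Basis (params l n N t lam m c a p) m c r st' ∧
      PrimesSet (params l n N t lam m c a p) i st' ∧ BitsSet m c i st' ∧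
      st'.coins = s + ∑ k ∈ Finset.range i, r * primeBits m c (k + 1) := by
  set D := params l n N t lam m c a p with hD
  have h0 := c_mul_le hf.m_le hf.c_eq
  have hn : n + 2 < V := lt_of_le_of_lt (by nlinarith) hf.n_lt
  have h2V : 2 < 2 ^ V := lt_of_lt_of_le (by omega : 2 < V) Nat.lt_two_pow_self.le
  have hnV : n + 2 < 2 ^ V := lt_of_lt_of_le hn Nat.lt_two_pow_self.le
  induction i with
  | zero =>
    rw [setPrimes, Stmt.wp_seq, Stmt.wp_assign, Stmt.wp_assign]
    refine ⟨h2V, by simp [num]; omega, hb.congr (fun x' _ => by simp) rfl, ⟨?_, ?_⟩, ⟨?_, ?_⟩, ?_⟩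
    · intro k hk
      obtain rfl : k = 0 := by omega
      simp [num, hD, params, hp, primes]
    · intro k hk
      obtain rfl : k = 0 := by omega
      simp [num, hD, params]
    · intro k h1 h2; omega
    · intro k h1 h2; omega
    · simp [hs]
  | succ i ih =>
    rw [setPrimes, Stmt.wp_seq]
    refine (ih (by omega)).mono fun st₁ _ ⟨hb₁, hp₁, hl₁, hc₁⟩ => ?_
    have hbits := primeBits_le hf (i + 1)
    have e1 : (if i + 1 ≤ 1 then rg .c + num 2 else rg .m + num 2 : Expr Rg Ar).eval E st₁ =
        primeBits m c (i + 1) := by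
      unfold primeBits
      split_ifs <;> simp [rg, num, hb₁.m, hb₁.c]
    rw [setPrime, Stmt.wp_seq, Stmt.wp_assign, e1]
    refine ⟨by split_ifs <;> simp [rg, num, hb₁.m, hb₁.c, h2V] <;> omega, ?_⟩
    set st₂ := st₁.set (.lv .bits (i + 1)) (primeBits m c (i + 1)) with hst₂
    have r2 : st₂.reg (.lv .bits (i + 1)) = primeBits m c (i + 1) := by simp [hst₂]
    rw [Stmt.wp_seq]
    refine (powTwo_wp (by simp) (by simp) (by rw [r2]; omega)).mono fun st₃ fr₃ ⟨h3, c3⟩ => ?_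
    rw [r2] at h3
    have r3 : st₃.reg (.lv .bits (i + 1)) = primeBits m c (i + 1) := by rw [fr₃.reg _ (by simp), r2]
    rw [Stmt.wp_seq]
    refine (drawPrime_wp (by simp) (by simp) (by simp) (by simp) (by simp) (by rw [h3, r3])
      (by rw [r3]; omega) (by omega)).mono fun st₄ fr₄ ⟨h4, c4⟩ => ?_
    have h13 : ∀ x : Rg, (x ≠ .sc .i ∧ x ≠ .lv .bits (i + 1) ∧ x ≠ .lv .pw (i + 1)) →
        st₃.reg x = st₁.reg x := by
      intro x ⟨hx1, hx2, hx3⟩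
      rw [fr₃.reg _ (by simp [hx1, hx3]), hst₂, St.set_reg, if_neg hx2]
    have er : st₃.reg (.sc .r3) = r := by rw [h13 _ (by simp), hb₁.r3]
    rw [r3, er, c3] at h4 c4
    have hc₂ : st₂.coins = s + ∑ k ∈ Finset.range i, r * primeBits m c (k + 1) := hc₁
    rw [hc₂] at h4 c4
    have h14 : ∀ x : Rg, (∀ x' : Scalar, x'.IsDraw = true → x ≠ .sc x') →
        x ≠ .lv .bits (i + 1) → x ≠ .lv .pw (i + 1) → x ≠ .lv .p (i + 1) → st₄.reg x = st₁.reg x := by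
      intro x hx1 hx2 hx3 hx4
      rw [fr₄.reg _ fun h => ?_, h13 _ ⟨hx1 _ rfl, hx2, hx3⟩]
      rcases asg_drawPrime h with h | ⟨x', h1, h⟩
      · exact hx4 h
      · exact hx1 x' h1 h
    have hpi : p (i + 1) = st₄.reg (.lv .p (i + 1)) := by rw [h4, hp]; rfl
    have eM : (lv .M (i + 1 - 1) * lv .p (i + 1) : Expr Rg Ar).eval E st₄ = D.M (i + 1) := by
      simp only [Expr.eval_mul, lv, Expr.eval_reg, Nat.add_sub_cancel]
      rw [h14 _ (by simp) (by simp) (by simp) (by simp), hp₁.M i le_rfl, ← hpi]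
      exact (Finset.prod_range_succ _ _).symm
    have hMle : D.M (i + 1) < 2 ^ V := by
      have h5 := prod_primes_le hf E.ω s r (i + 1)
      rw [← hp] at h5
      refine lt_of_le_of_lt h5 (Nat.pow_lt_pow_right (by norm_num) (lt_of_le_of_lt ?_ hf.n_lt))
      exact Nat.mul_le_mul_left _ (by omega)
    rw [Stmt.wp_assign]
    refine ⟨⟨trivial, trivial, ?_⟩, ?_⟩
    · change (lv .M (i + 1 - 1) * lv .p (i + 1) : Expr Rg Ar).eval E st₄ < 2 ^ V
      rw [eM]; exact hMle
    · rw [eM]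
      refine ⟨hb₁.congr (fun x' hx => ?_) ?_, ⟨fun k hk => ?_, fun k hk => ?_⟩,
        ⟨fun k h1 hk => ?_, fun k h1 hk => ?_⟩, ?_⟩
      · rw [St.set_reg, if_neg (by simp), h14 _ _ (by simp) (by simp) (by simp)]
        rintro x'' hx'' h
        cases h
        simp [hx] at hx''
      · change st₄.arr .item = _
        rw [fr₄.arr _ (by simp), fr₃.arr _ (by simp)]; rfl
      · rw [St.set_reg, if_neg (by simp)]
        by_cases h : k = i + 1
        · subst h; exact hpi.symm
        · rw [h14 _ (by simp) (by simp) (by simp) (by simp [h]), hp₁.p k (by omega)]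
      · by_cases h : k = i + 1
        · subst h; simp
        · rw [St.set_reg, if_neg (by simp [h]), h14 _ (by simp) (by simp) (by simp) (by simp),
            hp₁.M k (by omega)]
      · rw [St.set_reg, if_neg (by simp)]
        by_cases h : k = i + 1
        · subst h
          rw [fr₄.reg, r3]
          intro h
          rcases asg_drawPrime h with h | ⟨x', h1, h⟩ <;> simp at h
        · rw [h14 _ (by simp) (by simp [h]) (by simp) (by simp), hl₁.bits k h1 (by omega)]
      · rw [St.set_reg, if_neg (by simp)]
        by_cases h : k = i + 1
        · subst h
          rw [fr₄.reg, h3]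
          intro h
          rcases asg_drawPrime h with h | ⟨x', h1, h⟩ <;> simp at h
        · rw [h14 _ (by simp) (by simp) (by simp [h]) (by simp), hl₁.pw k h1 (by omega)]
      · rw [St.set_coins, c4, Finset.sum_range_succ]; ring

@[simp] lemma eval_powExpr (x' : Scalar) (k : ℕ) : (powExpr x' k).eval E st = st.reg (.sc x') ^ k := by
  induction k with
  | zero => simp [powExpr, num]
  | succ k ih => simp [powExpr, rg, ih, pow_succ]

lemma ok_powExpr {x' : Scalar} {k : ℕ} (h1 : 1 ≤ st.reg (.sc x')) (hV : st.reg (.sc x') ^ k < 2 ^ V) :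
    (powExpr x' k).Ok (layout l) A V E st := by
  induction k with
  | zero => simpa [powExpr, num] using hV
  | succ k ih =>
    refine ⟨ih (lt_of_le_of_lt (Nat.pow_le_pow_right h1 (by omega)) hV), trivial, ?_⟩
    change (powExpr x' k * rg x').eval E st < 2 ^ V
    have := eval_powExpr (E := E) (st := st) x' (k + 1)
    rw [powExpr] at this
    rw [this]; exact hV

/-- The registers that the first phase sets for the second one. -/
structure Start (D : Data) (lam r : ℕ) (st : St Rg Ar) : Prop where
  Q : st.reg (.sc .Q) = D.Q
  N : st.reg (.sc .N) = D.N
  t : st.reg (.sc .t) = D.t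
  n1 : st.reg (.sc .n1) = D.n + 1
  item : ∀ i < D.n, st.arr .item i = D.w i
  n : st.reg (.sc .n) = D.n
  lam : st.reg (.sc .lam) = lam
  r3 : st.reg (.sc .r3) = r
  flag : st.reg (.sc .flag) = 0

lemma setParams_wp (hf : ParamFits l n lam m c V) (hp : p = primes E.ω st.coins r m c)
    (hs : Start (params l n N t lam m c a p) lam r st) {e : Expr Rg Ar}
    (he : e.Ok (layout l) A V E st) (hem : e.eval E st = m) :
    (setParams l e).Wp (layout l) A V E st fun st' =>
      Basis (params l n N t lam m c a p) m c r st' ∧ Holds (params l n N t lam m c a p) st' ∧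
      BitsSet m c (l + 1) st' ∧ st'.reg (.sc .w) = (m - c) / 2 := by
  set D := params l n N t lam m c a p with hD
  have h0 := c_mul_le hf.m_le hf.c_eq
  have hn : n + 2 < V := lt_of_le_of_lt (by nlinarith) hf.n_lt
  have h2V : 2 < 2 ^ V := lt_of_lt_of_le (by omega : 2 < V) Nat.lt_two_pow_self.le
  have hnV : n + 2 < 2 ^ V := lt_of_lt_of_le hn Nat.lt_two_pow_self.le
  have hlV : l + 1 < 2 ^ V := lt_of_le_of_lt (by nlinarith)
    (lt_of_lt_of_le hf.n_lt Nat.lt_two_pow_self.le)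
  rw [setParams, Stmt.wp_seq, wp_put, hem]
  refine ⟨he, ?_⟩
  set st₁ := st.set (.sc .m) m with hst₁
  have e2 : ((rg .n - num (1 + l * (l + 1) / 2) * rg .m) / num (l + 1) : Expr Rg Ar).eval E st₁ =
      c := by rw [hf.c_eq]; simp [rg, num, hst₁, hs.n, hD, params]
  rw [Stmt.wp_seq, wp_put, e2]
  refine ⟨?_, ?_⟩
  · have := hf.m_le
    have := hf.l_lt
    simp [rg, num, hst₁]
    exact ⟨⟨by omega, by omega⟩, hlV⟩
  set st₂ := st₁.set (.sc .c) c with hst₂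
  have e3 : ((rg .m - rg .c) / num 2 : Expr Rg Ar).eval E st₂ = (m - c) / 2 := by
    simp [rg, num, hst₂, hst₁]
  rw [Stmt.wp_seq, wp_put, e3]
  refine ⟨by simp [rg, num, h2V], ?_⟩
  set st₃ := st₂.set (.sc .w) ((m - c) / 2) with hst₃
  have r3 : st₃.reg (.sc .w) = (m - c) / 2 := by simp [hst₃]
  rw [Stmt.wp_seq]
  refine (powTwo_wp (by simp) (by simp) (by rw [r3]; omega)).mono fun st₄ fr₄ ⟨h4, c4⟩ => ?_
  rw [r3] at h4
  have h14 : ∀ x' ∉ ([.m, .c, .w, .pw, .i] : List Scalar),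
      st₄.reg (.sc x') = st.reg (.sc x') := by
    intro x' hx
    simp only [List.mem_cons, List.not_mem_nil, or_false, not_or] at hx
    rw [fr₄.reg _ (by simp [hx])]; simp [hst₃, hst₂, hst₁, hx]
  have elam : st₄.reg (.sc .lam) = lam := by
    rw [h14 _ (by simp), hs.lam]
  have hPV : lam ^ (9 * l + 9) < 2 ^ V :=
    lt_of_le_of_lt (Nat.le_mul_of_pos_right _ (by positivity)) hf.P_lt
  rw [Stmt.wp_seq, wp_put]
  refine ⟨ok_powExpr (by rw [elam]; exact hf.lam_pos) (by rw [elam]; exact hPV), ?_⟩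
  rw [eval_powExpr, elam]
  have harr : st₄.arr .item = st.arr .item := by rw [fr₄.arr _ (by simp)]; rfl
  have hb : Basis D m c r (st₄.set (.sc .P) (lam ^ (9 * l + 9))) := by
    have h15 : ∀ x' ∉ ([.m, .c, .w, .pw, .i, .P] : List Scalar),
        (st₄.set (.sc .P) (lam ^ (9 * l + 9))).reg (.sc x') = st.reg (.sc x') := by
      intro x' hx
      rw [St.set_reg, if_neg (by simp_all), h14 _ (by simp_all)]
    refine ⟨?_, ?_, ?_, ?_, fun i hi => ?_, ?_, ?_, ?_, ?_, ?_, ?_, ?_⟩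
    · rw [h15 _ (by simp), hs.Q]
    · rw [h15 _ (by simp), hs.N]
    · rw [h15 _ (by simp), hs.t]
    · rw [h15 _ (by simp), hs.n1]
    · exact (congrFun harr i).trans (hs.item i hi)
    · rw [h15 _ (by simp), hs.n]
    · rw [St.set_reg, if_pos rfl]; rfl
    · rw [St.set_reg, if_neg (by simp), h4]
    · rw [St.set_reg, if_neg (by simp), fr₄.reg _ (by simp)]; simp [hst₃, hst₂, hst₁]
    · rw [St.set_reg, if_neg (by simp), fr₄.reg _ (by simp)]; simp [hst₃, hst₂]
    · rw [h15 _ (by simp), hs.r3]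
    · rw [h15 _ (by simp), hs.flag]
  have r5 : (st₄.set (.sc .P) (lam ^ (9 * l + 9))).reg (.sc .w) = (m - c) / 2 := by
    rw [St.set_reg, if_neg (by simp), fr₄.reg _ (by simp), r3]
  rw [Stmt.wp_seq]
  refine (setLevels_wp hf hb (l + 1) le_rfl).mono fun st₅ fr₅ ⟨hb₅, hl₅, c5⟩ => ?_
  refine (setPrimes_wp hf ?_ hp hb₅ (l + 1) le_rfl).mono fun st₆ fr₆ ⟨hb₆, hp₆, hbits, _⟩ => ?_
  · rw [c5, St.set_coins, c4]; rfl
  have asgL : ∀ j x, (setLevels l j).Asg x → x = .sc .i ∨ ∃ f i, x = .lv f i := by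
    intro j
    induction j with
    | zero => intro x h; exact h.elim
    | succ j ih =>
      intro x h
      rcases h with h | h
      · exact ih x h
      · rcases asg_setLevel h with h | ⟨f, -, h⟩
        · exact .inl h
        · exact .inr ⟨f, j, h⟩
  have h56 : ∀ f j, (f ≠ .bits ∧ f ≠ .pw ∧ f ≠ .p ∧ f ≠ .M) →
      st₆.reg (.lv f j) = st₅.reg (.lv f j) := by
    rintro f j ⟨h1, h2, h3, h4⟩
    refine fr₆.reg _ fun h => ?_
    rcases asg_setPrimes h with ⟨x', -, h⟩ | ⟨f', hf', k, -, h⟩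
    · simp at h
    · simp only [Rg.lv.injEq] at h
      obtain ⟨rfl, -⟩ := h
      tauto
  refine ⟨hb₆, ?_, hbits, ?_⟩
  · exact {
      Q := hb₆.Q
      P := hb₆.P
      N := hb₆.N
      t := hb₆.t
      n1 := hb₆.n1
      lenE := fun j hj => by rw [h56 _ _ (by simp)]; exact hl₅.lenE j (Nat.lt_succ_of_le hj)
      offE := fun j hj => by rw [h56 _ _ (by simp)]; exact hl₅.offE j (Nat.lt_succ_of_le hj)
      pwE := fun j hj => by rw [h56 _ _ (by simp)]; exact hl₅.pwE j (Nat.lt_succ_of_le hj)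
      lenB := fun j hj => by rw [h56 _ _ (by simp)]; exact hl₅.lenB j (Nat.lt_succ_of_le hj)
      offB := fun j hj => by rw [h56 _ _ (by simp)]; exact hl₅.offB j (Nat.lt_succ_of_le hj)
      pwB := fun j hj => by rw [h56 _ _ (by simp)]; exact hl₅.pwB j (Nat.lt_succ_of_le hj)
      W := fun j hj => by rw [h56 _ _ (by simp)]; exact hl₅.W j (Nat.lt_succ_of_le hj)
      p := hp₆.p
      M := fun i hi => hp₆.M i (Nat.le_succ_of_le hi)
      item := hb₆.item }
  · rw [fr₆.reg, fr₅.reg, r5]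
    · intro h
      rcases asgL _ _ h with h | ⟨f, i, h⟩ <;> simp at h
    · intro h
      rcases asg_setPrimes h with ⟨x', h1, h⟩ | ⟨f', -, k, -, h⟩
      · cases h; simp [Scalar.IsDraw] at h1
      · simp at h

end

/-! ### The running time of the computation of the parameters -/

section

variable {ι κ : Type}

/-- No register that bounds a loop is assigned to after that loop has been entered. -/
def Stmt.Settled : Stmt ι κ → Prop
  | .seq s₁ s₂ => s₁.Settled ∧ s₂.Settled ∧ ∀ r, s₁.Bnd r → ¬ s₂.Asg r
  | .ifz e s₁ s₂ => (Stmt.ifz e s₁ s₂).Static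
  | .loop h i u s => (Stmt.loop h i u s).Static
  | _ => True

variable [DecidableEq ι] [DecidableEq κ]

lemma Stmt.cost_congr {ρ ρ' : ι → ℕ} (s : Stmt ι κ) (h : ∀ r, s.Bnd r → ρ r = ρ' r) :
    s.cost ρ = s.cost ρ' := by
  induction s with
  | seq s₁ s₂ ih₁ ih₂ =>
    rw [cost, cost, ih₁ fun r hr => h r (.inl hr), ih₂ fun r hr => h r (.inr hr)]
  | ifz e s₁ s₂ ih₁ ih₂ =>
    rw [cost, cost, ih₁ fun r hr => h r (.inl hr), ih₂ fun r hr => h r (.inr hr)]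
  | loop b i u s ih => rw [cost, cost, ih fun r hr => h r (.inr hr), h u (.inl rfl)]
  | _ => rfl

lemma Stmt.Static.steps_le_final {E : Env} {s : Stmt ι κ} (h : s.Static) (st : St ι κ) :
    s.steps E st ≤ s.cost (s.denote E st).reg := by
  rw [s.cost_congr (ρ' := st.reg) fun r hr => (s.frame st).reg r (h r hr)]; exact h.steps_le st

/-- The number of steps is bounded in terms of the final values of the loop bounds. -/
lemma Stmt.Settled.steps_le {E : Env} (s : Stmt ι κ) (h : s.Settled) (st : St ι κ) :
    s.steps E st ≤ s.cost (s.denote E st).reg := by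
  induction s generalizing st with
  | seq s₁ s₂ ih₁ ih₂ =>
    refine Nat.add_le_add ((ih₁ h.1 st).trans_eq (s₁.cost_congr fun r hr => ?_)) (ih₂ h.2.1 _)
    exact ((s₂.frame _).reg r (h.2.2 r hr)).symm
  | ifz e s₁ s₂ ih₁ ih₂ => exact Stmt.Static.steps_le_final (s := .ifz e s₁ s₂) h st
  | loop b i u s ih => exact Stmt.Static.steps_le_final (s := .loop b i u s) h st
  | _ => exact le_rfl

end

@[simp] lemma bnd_powTwo (r u x : Rg) : (powTwo r u).Bnd x ↔ x = u := by
  simp [powTwo, Stmt.Bnd]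

@[simp] lemma bnd_drawBits (u x : Rg) : (drawBits u).Bnd x ↔ x = u := by
  simp [drawBits, put, Stmt.Bnd]

@[simp] lemma bnd_drawPrime (r b u x : Rg) :
    (drawPrime r b u).Bnd x ↔ x = .sc .r3 ∨ x = b ∨ x = u := by
  simp [drawPrime, testPrime, put, Stmt.Bnd]

lemma bnd_setLevels {l j : ℕ} {x : Rg} (h : (setLevels l j).Bnd x) :
    ∃ i < j, x = .lv .lenE i ∨ x = .lv .lenB i := by
  induction j with
  | zero => exact h.elim
  | succ j ih =>
    rcases h with h | h
    · obtain ⟨i, hi, h⟩ := ih h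
      exact ⟨i, by omega, h⟩
    · simp only [setLevel, Stmt.Bnd, bnd_powTwo, false_or, or_false] at h; exact ⟨j, by omega, h⟩

lemma bnd_setPrimes {i : ℕ} {x : Rg} (h : (setPrimes i).Bnd x) :
    x = .sc .r3 ∨ ∃ k ≤ i, x = .lv .bits k ∨ x = .lv .pw k := by
  induction i with
  | zero => simp [setPrimes, Stmt.Bnd] at h
  | succ i ih =>
    rcases h with h | h
    · rcases ih h with h | ⟨k, hk, h⟩
      · exact .inl h
      · exact .inr ⟨k, by omega, h⟩
    · simp only [setPrime, Stmt.Bnd, bnd_powTwo, bnd_drawPrime, false_or, or_false] at h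
      rcases h with h | h | h
      · exact .inr ⟨_, le_rfl, .inl h⟩
      · exact .inl h
      · exact .inr ⟨_, le_rfl, h⟩

lemma settled_powTwo {r u : Rg} (h : u ≠ r) (hu : u ≠ .sc .i) : (powTwo r u).Settled := by
  simp [powTwo, Stmt.Settled, Stmt.Static, Stmt.Bnd, Stmt.Asg, h, hu]

lemma settled_setLevels (l j : ℕ) : (setLevels l j).Settled := by
  induction j with
  | zero => trivial
  | succ j ih =>
    refine ⟨ih, ?_, fun r hr h => ?_⟩
    · have h1 := settled_powTwo (r := .lv .pwE j) (u := .lv .lenE j) (by simp) (by simp)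
      have h2 := settled_powTwo (r := .lv .pwB j) (u := .lv .lenB j) (by simp) (by simp)
      simp [setLevel, Stmt.Settled, h1, h2, Stmt.Bnd, Stmt.Asg]
    · obtain ⟨i, hi, h'⟩ := bnd_setLevels hr
      have hij : i ≠ j := by omega
      rcases asg_setLevel h with h | ⟨f, hf, h⟩ <;> rcases h' with rfl | rfl <;> simp [hij] at h

lemma settled_setPrimes (i : ℕ) : (setPrimes i).Settled := by
  induction i with
  | zero => simp [setPrimes, Stmt.Settled, Stmt.Bnd]
  | succ i ih =>
    refine ⟨ih, ?_, fun r hr h => ?_⟩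
    · have h1 := settled_powTwo (r := .lv .pw (i + 1)) (u := .lv .bits (i + 1)) (by simp) (by simp)
      have h2 : (drawPrime (.lv .p (i + 1)) (.lv .bits (i + 1)) (.lv .pw (i + 1))).Settled := by
        simp only [drawPrime, Stmt.Settled, Stmt.Static, Stmt.Bnd]
        refine ⟨trivial, fun r hr h => ?_, by simp⟩
        have hr' : (drawPrime (.lv .p (i + 1)) (.lv .bits (i + 1)) (.lv .pw (i + 1))).Bnd r :=
          .inr hr
        rw [bnd_drawPrime] at hr'
        have := asg_drawPrime (.inr h : (drawPrime (.lv .p (i + 1)) (.lv .bits (i + 1))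
          (.lv .pw (i + 1))).Asg r)
        rcases hr' with rfl | rfl | rfl <;> rcases this with h | ⟨x, hx, h⟩ <;> simp at h
        subst h; simp [Scalar.IsDraw] at hx
      refine ⟨trivial, ⟨h1, ⟨h2, trivial, fun r hr h => ?_⟩, fun r hr h => ?_⟩, by simp [Stmt.Bnd]⟩
      · simp only [bnd_drawPrime] at hr
        rcases hr with rfl | rfl | rfl <;> simp [Stmt.Asg] at h
      · rw [bnd_powTwo] at hr
        subst hr
        rcases h with h | h
        · rcases asg_drawPrime h with h | ⟨x, hx, h⟩ <;> simp at h
        · simp [Stmt.Asg] at h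
    · rcases bnd_setPrimes hr with rfl | ⟨k, hk, h'⟩
      · rcases asg_setPrime h with ⟨x, hx, h⟩ | ⟨f, hf, h⟩
        · cases h; simp [Scalar.IsDraw] at hx
        · simp at h
      · have hki : k ≠ i + 1 := by omega
        rcases asg_setPrime h with ⟨x, hx, h⟩ | ⟨f, hf, h⟩ <;> rcases h' with rfl | rfl <;>
          simp [hki] at h

lemma settled_setParams (l : ℕ) (e : Expr Rg Ar) : (setParams l e).Settled := by
  have asgL : ∀ j x, (setLevels l j).Asg x → x = .sc .i ∨ ∃ f i, x = .lv f i ∧ f ≠ .bits ∧ f ≠ .pw := by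
    intro j
    induction j with
    | zero => intro x h; exact h.elim
    | succ j ih =>
      intro x h
      rcases h with h | h
      · exact ih x h
      · rcases asg_setLevel h with h | ⟨f, hf, h⟩
        · exact .inl h
        · exact .inr ⟨f, j, h, by rcases hf with rfl | rfl | rfl | rfl | rfl | rfl | rfl <;> simp⟩
  refine ⟨trivial, ⟨trivial, ⟨trivial, ⟨settled_powTwo (by simp) (by simp), ⟨trivial,
    ⟨settled_setLevels _ _, settled_setPrimes _, fun r hr h => ?_⟩, fun _ hr => hr.elim⟩,
    fun r hr h => ?_⟩, fun _ hr => hr.elim⟩, fun _ hr => hr.elim⟩, fun _ hr => hr.elim⟩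
  · obtain ⟨i, hi, h'⟩ := bnd_setLevels hr
    rcases asg_setPrimes h with ⟨x, -, h⟩ | ⟨f, hf, k, -, h⟩ <;> rcases h' with rfl | rfl <;>
      simp at h
    all_goals (obtain ⟨rfl, -⟩ := h; simp at hf)
  · rw [bnd_powTwo] at hr
    subst hr
    rcases h with h | h | h
    · simp at h
    · rcases asgL _ _ h with h | ⟨f, i, h, -⟩ <;> simp at h
    · rcases asg_setPrimes h with ⟨x, hx, h⟩ | ⟨f, hf, k, -, h⟩
      · cases h; simp [Scalar.IsDraw] at hx
      · simp at h

section cost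

variable (ρ : Rg → ℕ)

lemma cost_powTwo (r u : Rg) : (powTwo r u).cost ρ = 6 + ρ u * 14 := by
  have : (powTwo r u).cost ρ = 3 + (3 + ρ u * 14) := rfl
  rw [this]; ring

lemma cost_drawBits (u : Rg) : (drawBits u).cost ρ = 6 + ρ u * 18 := by
  have : (drawBits u).cost ρ = 3 + (3 + ρ u * 18) := rfl
  rw [this]; ring

lemma cost_drawPrime (r b u : Rg) : (drawPrime r b u).cost ρ ≤
    6 + ρ (.sc .r3) * (50 + ρ b * 18 + ρ u * 60) := by
  have h : (drawPrime r b u).cost ρ = 3 + (3 + ρ (.sc .r3) * ((drawBits b).cost ρ +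
    ((9 + (3 + ρ u * (7 + (10 + (13 + 3 + 0) + 0) + 0 + 8))) + (4 + 0 + 3)) + 8)) := rfl
  rw [h, cost_drawBits]
  have : ρ (.sc .r3) * (6 + ρ b * 18 + (9 + (3 + ρ u * (7 + (10 + (13 + 3 + 0) + 0) + 0 + 8)) + (4 + 0 + 3)) + 8)
    ≤ ρ (.sc .r3) * (50 + ρ b * 18 + ρ u * 60) := Nat.mul_le_mul_left _ (by omega)
  omega

lemma len_powExpr (x : Scalar) (k : ℕ) : (powExpr x k).len = 3 * k + 1 := by
  induction k with
  | zero => rfl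
  | succ k ih =>
    have : (powExpr x (k + 1)).len = (powExpr x k).len + 1 + 2 := rfl
    rw [this, ih]; ring

lemma cost_setParams_le {l n r b : ℕ} (e : Expr Rg Ar) (hr : ρ (.sc .r3) ≤ r)
    (hw : ρ (.sc .w) ≤ n) (hE : ∀ j ≤ l, ρ (.lv .lenE j) ≤ n) (hB : ∀ j ≤ l, ρ (.lv .lenB j) ≤ n)
    (hbits : ∀ k, 1 ≤ k → k ≤ l + 1 → ρ (.lv .bits k) ≤ b)
    (hpw : ∀ k, 1 ≤ k → k ≤ l + 1 → ρ (.lv .pw k) ≤ 2 ^ b) :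
    (setParams l e).cost ρ ≤ e.len + 1000 * (l + 2) * (n + 1) * ((r + 1) * 2 ^ b) := by
  have h1 : ∀ j ≤ l + 1, (setLevels l j).cost ρ ≤ j * (200 * (n + 1)) := by
    intro j
    induction j with
    | zero => intro _; exact le_of_eq (Nat.zero_mul _).symm
    | succ j ih =>
      intro hj
      have h2 : (setLevel l j).cost ρ ≤ 84 + (6 + ρ (.lv .lenE j) * 14) + (6 + ρ (.lv .lenB j) * 14) := by
        simp only [setLevel, Stmt.cost, cost_powTwo]
        have e1 : (firstPartExpr l j).len ≤ 40 := by
          unfold firstPartExpr; split_ifs <;> exact Nat.le_of_ble_eq_true rfl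
        have e2 : (if j ≤ 1 then (rg .m + rg .c) / num 2 else rg .m : Expr Rg Ar).len ≤ 7 := by
          split_ifs <;> exact Nat.le_of_ble_eq_true rfl
        have e3 : (if j = 0 then num 0 else lv .offB (j - 1) + lv .lenB (j - 1) : Expr Rg Ar).len ≤ 4 := by
          split_ifs <;> exact Nat.le_of_ble_eq_true rfl
        have e4 : (lv .offE j + lv .lenE j : Expr Rg Ar).len = 4 := rfl
        have e5 : (if j ≤ 1 then rg .P * rg .pw else rg .P : Expr Rg Ar).len ≤ 4 := by
          split_ifs <;> exact Nat.le_of_ble_eq_true rfl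
        omega
      have := ih (by omega)
      have := hE j (by omega)
      have := hB j (by omega)
      rw [setLevels, Stmt.cost, add_mul]; omega
  have hb1 : 1 ≤ 2 ^ b := Nat.one_le_two_pow
  have hbb : b ≤ 2 ^ b := Nat.lt_two_pow_self.le
  have h2 : ∀ i ≤ l + 1, (setPrimes i).cost ρ ≤ (i + 1) * (200 * ((r + 1) * 2 ^ b)) := by
    intro i
    induction i with
    | zero =>
      intro _
      have : (setPrimes 0).cost ρ = 6 := rfl
      rw [this]; nlinarith
    | succ i ih =>
      intro hi
      have e1 : (if i + 1 ≤ 1 then rg .c + num 2 else rg .m + num 2 : Expr Rg Ar).len ≤ 4 := by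
        split_ifs <;> exact Nat.le_of_ble_eq_true rfl
      have e4 : (lv .M i * lv .p (i + 1) : Expr Rg Ar).len = 4 := rfl
      have h3 : (setPrime (i + 1)).cost ρ ≤ 24 + ρ (.lv .bits (i + 1)) * 14 +
          ρ (.sc .r3) * (50 + ρ (.lv .bits (i + 1)) * 18 + ρ (.lv .pw (i + 1)) * 60) := by
        have := cost_drawPrime ρ (.lv .p (i + 1)) (.lv .bits (i + 1)) (.lv .pw (i + 1))
        simp only [setPrime, Stmt.cost, cost_powTwo, Nat.add_sub_cancel]; omega
      have h4 := hbits (i + 1) (by omega) hi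
      have h5 := hpw (i + 1) (by omega) hi
      have h6 : ρ (.sc .r3) * (50 + ρ (.lv .bits (i + 1)) * 18 + ρ (.lv .pw (i + 1)) * 60) ≤
          r * (128 * 2 ^ b) := Nat.mul_le_mul hr (by omega)
      have h7 := ih (by omega)
      rw [setPrimes, Stmt.cost, add_mul (i + 1)]; nlinarith
  have h3 := h1 (l + 1) le_rfl
  have h4 := h2 (l + 1) le_rfl
  have hc : (setParams l e).cost ρ = e.len + 2 + (12 + (9 + ((powTwo (.sc .pw) (.sc .w)).cost ρ +
    ((powExpr .lam (9 * l + 9)).len + 2 + ((setLevels l (l + 1)).cost ρ +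
      (setPrimes (l + 1)).cost ρ))))) := rfl
  rw [hc, cost_powTwo, len_powExpr]
  have h5 : 1 ≤ (r + 1) * 2 ^ b := by nlinarith
  set x := (r + 1) * 2 ^ b
  have h6 : n + 1 ≤ (n + 1) * x := Nat.le_mul_of_pos_right _ h5
  have h7 : x ≤ (n + 1) * x := Nat.le_mul_of_pos_left _ (by omega)
  have h8 : (l + 1) * (200 * (n + 1)) ≤ (l + 1) * (200 * ((n + 1) * x)) := by gcongr
  have h9 : (l + 1 + 1) * (200 * x) ≤ (l + 1 + 1) * (200 * ((n + 1) * x)) := by gcongr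
  have h10 : l * (n + 1) ≤ l * ((n + 1) * x) := Nat.mul_le_mul_left _ h6; nlinarith

end cost

/-! ### Reducing the numbers modulo a random number -/

/-- The sum of the number of items, the target and all items. -/
def total (inp : ℕ → ℕ) : ℕ := inp 0 + inp 1 + ∑ i ∈ Finset.range (inp 0), inp (i + 2)

/-- The parameter in which all factors other than powers `2 ^ (e n)` are polynomial. -/
def param (C : ℕ) (inp : ℕ → ℕ) : ℕ := inp 0 + Nat.size (Nat.size (total inp)) + C

/-- The random modulus: a product of `r` random numbers of `b` bits, each increased by one. -/
def modulus (ω : ℕ → Bool) (b r : ℕ) : ℕ := ∏ k ∈ Finset.range r, (draw ω (k * b) b + 1)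

lemma modulus_pos (ω : ℕ → Bool) (b r : ℕ) : 0 < modulus ω b r :=
  Finset.prod_pos fun _ _ => Nat.succ_pos _

lemma modulus_le (ω : ℕ → Bool) (b r : ℕ) : modulus ω b r ≤ 2 ^ (b * r) := by
  rw [pow_mul]; exact (Finset.prod_le_pow_card _ _ (2 ^ b) fun k _ => draw_lt _ _ _).trans (by simp)

/-- Compute the sum of the input and its iterated bit length. -/
def gauge : Prog :=
  put .n (.input (num 0)) ⨾ put .tt (.input (num 1)) ⨾ put .Z (rg .n + rg .tt) ⨾
  .loop false (.sc .i) (.sc .n) (put .Z (rg .Z + .input (rg .i + num 2))) ⨾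
  put .ls (num 0) ⨾ .loop true (.sc .i) (.sc .Z) (put .ls (rg .ls + num 1)) ⨾
  put .ll (num 0) ⨾ .loop true (.sc .i) (.sc .ls) (put .ll (rg .ll + num 1))

/-- Draw the modulus. -/
def drawModulus (C : ℕ) : Prog :=
  put .lam (rg .n + rg .ll + num C) ⨾ put .r3 (rg .lam * rg .lam * rg .lam) ⨾
  put .b2 (rg .lam + rg .lam) ⨾ put .N (num 1) ⨾
  .loop false (.sc .k) (.sc .r3) (drawBits (.sc .b2) ⨾ put .N (rg .N * (rg .q + num 1)))

/-- Store the packed residues of the items, and erase what is not needed any more. -/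
def packItems : Prog :=
  powTwo (.sc .Q) (.sc .n) ⨾ put .v (num 1) ⨾
  .loop false (.sc .i) (.sc .n)
    (.store .item (rg .i) (.input (rg .i + num 2) % rg .N * rg .Q + rg .v) ⨾
      put .v (rg .v + rg .v)) ⨾
  put .t (rg .tt % rg .N) ⨾ put .n1 (rg .n + num 1) ⨾ put .tt (num 0) ⨾ put .Z (num 0) ⨾
  put .i (num 0) ⨾ put .k (num 0) ⨾ put .q (num 0) ⨾ put .f (num 0)

/-- The state at the start: everything is zero. -/
def St.zero : St Rg Ar := ⟨fun _ => 0, fun _ _ => 0, 0⟩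

section

variable {l A V : ℕ} {E : Env} {st : St Rg Ar}

lemma input_le_total {inp : ℕ → ℕ} {i : ℕ} (hi : i < inp 0) : inp (i + 2) ≤ total inp := by
  have := Finset.single_le_sum (f := fun i => inp (i + 2)) (fun _ _ => Nat.zero_le _)
    (Finset.mem_range.2 hi)
  unfold total; omega

/-- The values that `gauge` computes. -/
structure Gauged (inp : ℕ → ℕ) (st : St Rg Ar) : Prop where
  n : st.reg (.sc .n) = inp 0
  tt : st.reg (.sc .tt) = inp 1
  Z : st.reg (.sc .Z) = total inp
  ls : st.reg (.sc .ls) = Nat.size (total inp)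
  ll : st.reg (.sc .ll) = Nat.size (Nat.size (total inp))

lemma gauge_wp (hV : Nat.size (total E.inp) + 10 ≤ V) :
    gauge.Wp (layout l) A V E st fun st' => Gauged E.inp st' ∧ st'.coins = st.coins := by
  have hT : total E.inp < 2 ^ V := Nat.size_le.1 (by omega)
  have h2 : 10 < 2 ^ V := lt_of_le_of_lt (by omega) (Nat.lt_two_pow_self (n := V))
  have hVV : V < 2 ^ V := Nat.lt_two_pow_self
  have h4 : 4 * total E.inp < 2 ^ V := by
    have h1 : total E.inp < 2 ^ (V - 2) := Nat.size_le.1 (by omega)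
    have : 2 ^ V = 4 * 2 ^ (V - 2) := by
      rw [show (4 : ℕ) = 2 ^ 2 by norm_num, ← pow_add]; congr 1; omega
    omega
  have h0 : E.inp 0 ≤ total E.inp := by unfold total; omega
  have h1 : E.inp 1 ≤ total E.inp := by unfold total; omega
  have h01 : E.inp 0 + E.inp 1 ≤ total E.inp := by unfold total; omega
  rw [gauge, Stmt.wp_seq, wp_put]
  refine ⟨by simp [num]; omega, ?_⟩
  rw [Stmt.wp_seq, wp_put]
  refine ⟨by simp [num]; omega, ?_⟩
  rw [Stmt.wp_seq, wp_put]
  refine ⟨by simp [num, rg]; omega, ?_⟩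
  rw [Stmt.wp_seq]
  refine Stmt.wp_loop (fun k st' => st'.reg (.sc .Z) =
      E.inp 0 + E.inp 1 + ∑ i ∈ Finset.range k, E.inp (i + 2) ∧ st'.reg (.sc .n) = E.inp 0 ∧
      st'.reg (.sc .tt) = E.inp 1 ∧ st'.coins = st.coins) (by simp [num, rg]) ?_ ?_
  · intro k hk st' fr ⟨hI1, hI2, hI3, hI4⟩
    have hk : k < E.inp 0 := by simpa [num] using hk
    have hle : E.inp 0 + E.inp 1 + ∑ i ∈ Finset.range (k + 1), E.inp (i + 2) ≤ total E.inp := by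
      unfold total
      have := Finset.sum_le_sum_of_subset (f := fun i => E.inp (i + 2))
        (Finset.range_mono (show k + 1 ≤ E.inp 0 by omega))
      omega
    rw [Finset.sum_range_succ] at hle
    rw [wp_put]
    refine ⟨?_, ?_, ?_, ?_, ?_⟩
    · simp [rg, num, hI1]; omega
    · simp [rg, num, hI1, Finset.sum_range_succ]; ring
    · simpa using hI2
    · simpa using hI3
    · simpa using hI4
  intro st₁ fr₁ ⟨z₁, n₁, t₁, c₁⟩
  have z₁ : st₁.reg (.sc .Z) = total E.inp := by simpa [num, total] using z₁
  rw [Stmt.wp_seq, wp_put]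
  refine ⟨by simp [num], ?_⟩
  rw [Stmt.wp_seq]
  refine Stmt.wp_loop (fun k st' => st'.reg (.sc .ls) = k ∧ st'.reg (.sc .Z) = total E.inp ∧
      st'.reg (.sc .n) = E.inp 0 ∧ st'.reg (.sc .tt) = E.inp 1 ∧ st'.coins = st.coins)
      (by simp [num, z₁, n₁, t₁, c₁]) ?_ ?_
  · intro k hk st' fr ⟨hI, hI1, hI2, hI3, hI4⟩
    have hk : k < Nat.size (total E.inp) := by simpa [z₁, rounds] using hk
    simp [wp_put, rg, num, hI, hI1, hI2, hI3, hI4]; omega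
  intro st₂ fr₂ ⟨s₂, z₂, n₂, t₂, c₂⟩
  have s₂ : st₂.reg (.sc .ls) = Nat.size (total E.inp) := by simpa [z₁, rounds] using s₂
  rw [Stmt.wp_seq, wp_put]
  refine ⟨by simp [num], ?_⟩
  have hss : Nat.size (Nat.size (total E.inp)) ≤ Nat.size (total E.inp) :=
    Nat.size_le.2 Nat.lt_two_pow_self
  refine Stmt.wp_loop (fun k st' => st'.reg (.sc .ll) = k ∧ st'.reg (.sc .Z) = total E.inp ∧
      st'.reg (.sc .ls) = Nat.size (total E.inp) ∧
      st'.reg (.sc .n) = E.inp 0 ∧ st'.reg (.sc .tt) = E.inp 1 ∧ st'.coins = st.coins)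
      (by simp [num, z₂, n₂, t₂, c₂, s₂]) ?_ ?_
  · intro k hk st' fr ⟨hI, hI1, hI2, hI3, hI4, hI5⟩
    have hk : k < Nat.size (Nat.size (total E.inp)) := by simpa [s₂, rounds] using hk
    simp [wp_put, rg, num, hI, hI1, hI2, hI3, hI4, hI5]; omega
  intro st₃ fr₃ ⟨l₃, z₃, s₃, n₃, t₃, c₃⟩
  exact ⟨⟨n₃, t₃, z₃, s₃, by simpa [s₂, rounds] using l₃⟩, c₃⟩

lemma drawModulus_wp {C : ℕ} (hC : 10 ≤ C) (hV : 4 * param C E.inp ^ 4 ≤ V)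
    (hg : Gauged E.inp st) (hc : st.coins = 0) :
    (drawModulus C).Wp (layout l) A V E st fun st' => Gauged E.inp st' ∧
      st'.reg (.sc .lam) = param C E.inp ∧ st'.reg (.sc .r3) = param C E.inp ^ 3 ∧
      st'.reg (.sc .b2) = 2 * param C E.inp ∧
      st'.reg (.sc .N) = modulus E.ω (2 * param C E.inp) (param C E.inp ^ 3) ∧
      st'.coins = param C E.inp ^ 3 * (2 * param C E.inp) := by
  set p := param C E.inp with hp
  have hp0 : p = E.inp 0 + Nat.size (Nat.size (total E.inp)) + C := hp
  have hp1 : 10 ≤ p := by omega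
  have hp4 : p ^ 4 = p ^ 3 * p := by ring
  have hp3 : p ^ 3 = p * p * p := by ring
  have h3 : p ≤ p ^ 3 := Nat.le_self_pow (by norm_num) p
  have h34 : p ^ 3 ≤ p ^ 4 := Nat.pow_le_pow_right (by omega) (by norm_num)
  have h2 : p * p ≤ p ^ 3 := by rw [hp3]; exact Nat.le_mul_of_pos_right _ (by omega)
  have hVV : V < 2 ^ V := Nat.lt_two_pow_self
  rw [drawModulus, Stmt.wp_seq, wp_put]
  refine ⟨by simp [rg, num, hg.n, hg.ll]; omega, ?_⟩
  have e1 : (rg .n + rg .ll + num C : Expr Rg Ar).eval E st = p := by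
    simp [rg, num, hg.n, hg.ll, hp0]
  rw [e1, Stmt.wp_seq, wp_put]
  refine ⟨by simp [rg]; omega, ?_⟩
  rw [Stmt.wp_seq, wp_put]
  refine ⟨by simp [rg]; omega, ?_⟩
  rw [Stmt.wp_seq, wp_put]
  refine ⟨by simp [num]; omega, ?_⟩
  refine Stmt.wp_loop (fun k st' => st'.reg (.sc .N) = modulus E.ω (2 * p) k ∧
      st'.coins = k * (2 * p)) (by simp [num, modulus, hc]) ?_ ?_
  · intro k hk st' fr ⟨hI1, hI2⟩
    have hk : k < p ^ 3 := by simpa [rg, num, hp3] using hk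
    have eb : (st'.set (.sc .k) k).reg (.sc .b2) = 2 * p := by
      rw [St.set_reg, if_neg (by simp), fr.reg _ (by simp [Stmt.Asg, put])]; simp [rg]; omega
    rw [Stmt.wp_seq]
    refine (drawBits_wp (by simp) (by rw [eb]; omega)).mono fun st₁ fr₁ ⟨q₁, c₁⟩ => ?_
    rw [eb, St.set_coins, hI2] at q₁ c₁
    have en : st₁.reg (.sc .N) = modulus E.ω (2 * p) k := by
      rw [fr₁.reg _ (by simp), St.set_reg, if_neg (by simp), hI1]
    have hm : modulus E.ω (2 * p) k * (draw E.ω (k * (2 * p)) (2 * p) + 1) =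
        modulus E.ω (2 * p) (k + 1) := (Finset.prod_range_succ _ _).symm
    have hlt : modulus E.ω (2 * p) (k + 1) < 2 ^ V := by
      refine lt_of_le_of_lt (modulus_le _ _ _) (Nat.pow_lt_pow_right (by norm_num) ?_)
      have : 2 * p * (k + 1) ≤ 2 * p * p ^ 3 := Nat.mul_le_mul_left _ hk; nlinarith
    have hd : draw E.ω (k * (2 * p)) (2 * p) + 1 < 2 ^ V :=
      lt_of_le_of_lt (draw_lt _ _ _) (Nat.pow_lt_pow_right (by norm_num) (by omega))
    rw [wp_put]
    refine ⟨?_, ?_, ?_⟩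
    · simp only [rg, num, Expr.ok_mul, Expr.ok_add, Expr.ok_reg, Expr.ok_const, Expr.eval_add,
        Expr.eval_reg, Expr.eval_const, q₁, en, hm, true_and]
      exact ⟨⟨by omega, hd⟩, hlt⟩
    · simp [rg, num, q₁, en, hm]
    · simp [c₁]; ring
  · intro st₂ fr₂ ⟨n₂, c₂⟩
    have hr : ∀ x ∉ ([.sc .N, .sc .k, .sc .q, .sc .i, .sc .f, .sc .lam, .sc .r3, .sc .b2] : List Rg),
        st₂.reg x = st.reg x := by
      intro x hx
      simp only [List.mem_cons, List.not_mem_nil, or_false, not_or] at hx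
      rw [fr₂.reg _ (by simp [Stmt.Asg, put, hx])]; simp [hx]
    have hr' : ∀ x ∈ ([.sc .lam, .sc .r3, .sc .b2] : List Rg), ¬ (Stmt.loop false (.sc .k) (.sc .r3)
        (drawBits (.sc .b2) ⨾ put .N (rg .N * (rg .q + num 1)))).Asg x := by
      simp [Stmt.Asg, put]
    have e3 : p * p * p = p ^ 3 := hp3.symm
    refine ⟨⟨?_, ?_, ?_, ?_, ?_⟩, ?_, ?_, ?_, ?_, ?_⟩
    · rw [hr _ (by simp), hg.n]
    · rw [hr _ (by simp), hg.tt]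
    · rw [hr _ (by simp), hg.Z]
    · rw [hr _ (by simp), hg.ls]
    · rw [hr _ (by simp), hg.ll]
    · rw [fr₂.reg _ (hr' _ (by simp))]; simp
    · rw [fr₂.reg _ (hr' _ (by simp))]; simp [rg, e3]
    · rw [fr₂.reg _ (hr' _ (by simp))]; simp [rg]; omega
    · simpa [rg, num, e3] using n₂
    · simpa [rg, num, e3] using c₂

end

/-- The first phase of the program. -/
def reduce (C : ℕ) : Prog := gauge ⨾ drawModulus C ⨾ packItems

/-- The state after the first phase is small: no number that depends on the size of the input is
left. -/
structure Small (n B : ℕ) (st : St Rg Ar) : Prop where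
  reg : ∀ x, st.reg x < 2 ^ B
  scalar : ∀ x, st.reg x ≠ 0 → ∃ s, x = .sc s
  item : ∀ i, st.arr .item i < 2 ^ B
  index : ∀ q i, st.arr q i ≠ 0 → q = .item ∧ i < n

section

variable {l A V : ℕ} {E : Env} {st : St Rg Ar}

lemma packItems_wp {p N : ℕ} (hA : 2 * (E.inp 0 + 1) * (2 * l + 4) ≤ A)
    (hl : 1 ≤ l) (hp : E.inp 0 ≤ p) (hp1 : 10 ≤ p) (hN : 0 < N) (hNp : N ≤ 2 ^ (2 * p ^ 4))
    (hV : 4 * p ^ 4 + Nat.size (total E.inp) ≤ V) (hg : Gauged E.inp st) (hNst : st.reg (.sc .N) = N) :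
    packItems.Wp (layout l) A V E st fun st' =>
      st'.reg (.sc .Q) = 2 ^ E.inp 0 ∧ st'.reg (.sc .v) = 2 ^ E.inp 0 ∧
      st'.reg (.sc .t) = E.inp 1 % N ∧ st'.reg (.sc .n1) = E.inp 0 + 1 ∧
      st'.reg (.sc .tt) = 0 ∧ st'.reg (.sc .Z) = 0 ∧ st'.reg (.sc .i) = 0 ∧
      st'.reg (.sc .k) = 0 ∧ st'.reg (.sc .q) = 0 ∧ st'.reg (.sc .f) = 0 ∧
      (∀ i < E.inp 0, st'.arr .item i = E.inp (i + 2) % N * 2 ^ E.inp 0 + 2 ^ i) ∧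
      (∀ i, E.inp 0 ≤ i → st'.arr .item i = st.arr .item i) ∧
      st'.coins = st.coins := by
  set n := E.inp 0 with hn
  have hp4 : p ≤ p ^ 4 := Nat.le_self_pow (by norm_num) p
  have hVV : V < 2 ^ V := Nat.lt_two_pow_self
  have hnV : n + 1 < V := by omega
  have hT : total E.inp < 2 ^ V := Nat.size_le.1 (by omega)
  have h1 : E.inp 1 ≤ total E.inp := by unfold total; omega
  have hQ : 2 * (N * 2 ^ n) < 2 ^ V := by
    calc 2 * (N * 2 ^ n) ≤ 2 ^ 1 * (2 ^ (2 * p ^ 4) * 2 ^ p) := by gcongr <;> norm_num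
      _ = 2 ^ (1 + (2 * p ^ 4 + p)) := by rw [pow_add, pow_add]
      _ < 2 ^ V := Nat.pow_lt_pow_right (by norm_num) (by omega)
  have hQ1 : 2 ^ n ≤ N * 2 ^ n := Nat.le_mul_of_pos_left _ hN
  rw [packItems, Stmt.wp_seq]
  refine (powTwo_wp (by simp) (by simp) (by rw [hg.n]; omega)).mono fun st₁ fr₁ ⟨q₁, c₁⟩ => ?_
  rw [hg.n, ← hn] at q₁
  have hr₁ : ∀ x : Scalar, x ≠ .Q → x ≠ .i → st₁.reg (.sc x) = st.reg (.sc x) := by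
    intro x h1 h2
    exact fr₁.reg _ (by simp [h1, h2])
  have n₁ := (hr₁ .n (by simp) (by simp)).trans hg.n
  have t₁ := (hr₁ .tt (by simp) (by simp)).trans hg.tt
  have N₁ := (hr₁ .N (by simp) (by simp)).trans hNst
  have a₁ : st₁.arr .item = st.arr .item := fr₁.arr _ (by simp)
  rw [Stmt.wp_seq, wp_put]
  refine ⟨by simp [num]; omega, ?_⟩
  rw [Stmt.wp_seq]
  refine Stmt.wp_loop (fun k st' => st'.reg (.sc .v) = 2 ^ k ∧
      (∀ i < k, st'.arr .item i = E.inp (i + 2) % N * 2 ^ n + 2 ^ i) ∧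
      (∀ i, k ≤ i → st'.arr .item i = st.arr .item i) ∧ st'.coins = st.coins) ?_ ?_ ?_
  · simp [num, a₁, c₁]
  · intro k hk st' fr ⟨hI1, hI2, hI3, hI4⟩
    have hk : k < n := by simpa [n₁] using hk
    have hr : ∀ x : Scalar, x ≠ .i → x ≠ .v →
        (st'.set (.sc .i) k).reg (.sc x) = st₁.reg (.sc x) := by
      intro x h1 h2
      rw [St.set_reg, if_neg (by simp [h1]), fr.reg _ (by simp [Stmt.Asg, put, h1, h2]),
        St.set_reg, if_neg (by simp [h2])]
    have rQ := (hr .Q (by simp) (by simp)).trans q₁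
    have rN := (hr .N (by simp) (by simp)).trans N₁
    have ri : (st'.set (.sc .i) k).reg (.sc .i) = k := by simp
    have rv : (st'.set (.sc .i) k).reg (.sc .v) = 2 ^ k := by simp [hI1]
    have hin := input_le_total (inp := E.inp) (i := k) hk
    have hpow : 2 ^ k + 2 ^ k ≤ 2 ^ n := by
      rw [← two_mul, ← pow_succ']; exact Nat.pow_le_pow_right (by norm_num) hk
    have hmod : E.inp (k + 2) % N * 2 ^ n ≤ N * 2 ^ n :=
      Nat.mul_le_mul_right _ (Nat.mod_lt _ hN).le
    rw [Stmt.wp_seq, Stmt.wp_store]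
    have e1 : (.input (rg .i + num 2) % rg .N * rg .Q + rg .v : Expr Rg Ar).eval E
        (st'.set (.sc .i) k) = E.inp (k + 2) % N * 2 ^ n + 2 ^ k := by
      simp only [rg, num, Expr.eval_add, Expr.eval_mul, Expr.eval_mod, Expr.eval_input,
        Expr.eval_reg, Expr.eval_const, ri, rN, rQ, rv]
    refine ⟨⟨trivial, ⟨⟨?_, trivial, ?_⟩, trivial, ?_⟩, ?_, ?_⟩, ?_⟩
    · refine Expr.ok_mod ?_ trivial ?_
      · simp [rg, num]; omega
      · simp [rg, num]; omega
    · simp only [Op.Ok, rg, num, Expr.eval_add, Expr.eval_mod, Expr.eval_input, Expr.eval_reg,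
        Expr.eval_const, ri, rN, rQ]
      omega
    · change (.input (rg .i + num 2) % rg .N * rg .Q + rg .v : Expr Rg Ar).eval E
        (st'.set (.sc .i) k) < 2 ^ V
      rw [e1]; omega
    · simp [layout, Ar.num]
    · simp only [layout, Ar.num, rg, Expr.eval_reg, ri]; nlinarith
    rw [e1, wp_put]
    simp only [rg, Expr.eval_reg, ri, Expr.ok_add, Expr.ok_reg, Expr.eval_add, St.put_reg, rv]
    refine ⟨⟨trivial, trivial, by omega⟩, ?_, fun i hi => ?_, fun i hi => ?_, hI4⟩
    · rw [St.set_reg, if_pos rfl, pow_succ]; ring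
    · rw [St.set_arr, St.put_arr]
      by_cases h : i = k
      · rw [if_pos ⟨rfl, h⟩, h]
      · rw [if_neg (fun h' => h h'.2), St.set_arr, hI2 i (by omega)]
    · rw [St.set_arr, St.put_arr, if_neg (fun h' => by omega), St.set_arr, hI3 i (by omega)]
  intro st₂ fr₂ ⟨v₂, i₂, a₂, c₂⟩
  simp only [rounds_false, St.set_reg, n₁, reduceCtorEq, Rg.sc.injEq, if_false] at v₂ i₂ a₂
  have hr₂ : ∀ x : Scalar, x ≠ .i → x ≠ .v → st₂.reg (.sc x) = st₁.reg (.sc x) := by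
    intro x h1 h2
    rw [fr₂.reg _ (by simp [Stmt.Asg, put, h1, h2]), St.set_reg, if_neg (by simp [h2])]
  have n₂ := (hr₂ .n (by simp) (by simp)).trans n₁
  have t₂ := (hr₂ .tt (by simp) (by simp)).trans t₁
  have N₂ := (hr₂ .N (by simp) (by simp)).trans N₁
  have q₂ := (hr₂ .Q (by simp) (by simp)).trans q₁
  rw [Stmt.wp_seq, wp_put]
  refine ⟨Expr.ok_mod trivial trivial (by simp [rg, t₂]; omega), ?_⟩
  simp only [Stmt.wp_seq, wp_put]
  simp [rg, num, n₂, t₂, N₂, q₂, v₂, c₂]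
  exact ⟨by omega, rfl, i₂, a₂⟩

lemma two_mul_le_pow_four {p : ℕ} (hp : 2 ≤ p) : 2 * p ≤ p ^ 4 := by
  have h1 : p ≤ p ^ 3 := Nat.le_self_pow (by norm_num) p
  calc 2 * p ≤ p ^ 3 * p := Nat.mul_le_mul_right p (by omega)
    _ = p ^ 4 := by ring

lemma asg_reduce {C : ℕ} {x : Rg} (h : (reduce C).Asg x) : ∃ s, x = .sc s := by
  simp only [reduce, gauge, drawModulus, packItems, put, Stmt.Asg, asg_powTwo, asg_drawBits] at h
  rcases x with s | ⟨f, j⟩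
  · exact ⟨s, rfl⟩
  · simp at h

lemma reduce_wp {C : ℕ} (m c : ℕ) (pr : ℕ → ℕ) (hC : 10 ≤ C) (hl : 1 ≤ l)
    (hA : 2 * (E.inp 0 + 1) * (2 * l + 4) ≤ A)
    (hV : 4 * param C E.inp ^ 4 + Nat.size (total E.inp) ≤ V) :
    (reduce C).Wp (layout l) A V E St.zero fun st' =>
      Start (params l (E.inp 0) (modulus E.ω (2 * param C E.inp) (param C E.inp ^ 3))
        (E.inp 1 % modulus E.ω (2 * param C E.inp) (param C E.inp ^ 3)) (param C E.inp) m c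
        (fun i => E.inp (i + 2) % modulus E.ω (2 * param C E.inp) (param C E.inp ^ 3)) pr)
        (param C E.inp) (param C E.inp ^ 3) st' ∧
      Small (E.inp 0) (3 * param C E.inp ^ 4) st' ∧
      st'.coins = param C E.inp ^ 3 * (2 * param C E.inp) ∧
      st'.reg (.sc .b2) = 2 * param C E.inp := by
  set p := param C E.inp with hp
  set N := modulus E.ω (2 * p) (p ^ 3) with hN
  have hp0 : p = E.inp 0 + Nat.size (Nat.size (total E.inp)) + C := hp
  have hp4 : p ≤ p ^ 4 := Nat.le_self_pow (by norm_num) p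
  have hp34 : p ^ 3 ≤ p ^ 4 := Nat.pow_le_pow_right (by omega) (by norm_num)
  have hNp : N ≤ 2 ^ (2 * p ^ 4) := by
    refine (modulus_le _ _ _).trans (le_of_eq ?_)
    congr 1; ring
  have hN0 : 0 < N := modulus_pos _ _ _
  rw [reduce, Stmt.wp_seq]
  refine (gauge_wp (by omega)).mono fun st₁ fr₁ ⟨g₁, c₁⟩ => ?_
  rw [Stmt.wp_seq]
  refine (drawModulus_wp hC (by rw [← hp]; omega) g₁ c₁).mono fun st₂ fr₂ ⟨g₂, l₂, r₂, b₂, N₂, c₂⟩ => ?_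
  refine (packItems_wp hA hl (by omega) (by omega) hN0 hNp hV g₂ N₂).mono
    fun st₃ fr₃ ⟨Q₃, v₃, t₃, n₃, tt₃, Z₃, i₃, k₃, q₃, f₃, item₃, rest₃, c₃⟩ => ?_
  have hr : ∀ x, (∀ s, x = .sc s → s ≠ .Q ∧ s ≠ .v ∧ s ≠ .t ∧ s ≠ .n1 ∧ s ≠ .tt ∧ s ≠ .Z ∧
      s ≠ .i ∧ s ≠ .k ∧ s ≠ .q ∧ s ≠ .f) → st₃.reg x = st₂.reg x := by
    intro x hx
    refine fr₃.reg _ fun h => ?_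
    simp only [packItems, put, Stmt.Asg, asg_powTwo] at h
    rcases h with (h | h) | h | (h | h | h) | h | h | h | h | h | h | h | h
    all_goals first | exact h.elim | (have := hx _ h; simp at this)
  have hn := (hr (.sc .n) (by simp)).trans g₂.n
  have hls := (hr (.sc .ls) (by simp)).trans g₂.ls
  have hll := (hr (.sc .ll) (by simp)).trans g₂.ll
  have hlam := (hr (.sc .lam) (by simp)).trans l₂
  have hr3 : st₃.reg (.sc .r3) = p ^ 3 := (hr (.sc .r3) (by simp)).trans r₂
  have hb2 : st₃.reg (.sc .b2) = 2 * p := (hr (.sc .b2) (by simp)).trans b₂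
  have hNN : st₃.reg (.sc .N) = N := (hr (.sc .N) (by simp)).trans N₂
  have hz : ∀ x, ¬ (reduce C).Asg x → st₃.reg x = 0 := by
    intro x hx
    simp only [reduce, Stmt.Asg, not_or] at hx
    rw [fr₃.reg x hx.2.2, fr₂.reg x hx.2.1, fr₁.reg x hx.1]; rfl
  have ha : ∀ q, q ≠ .item → st₃.arr q = fun _ => 0 := by
    intro q hq
    rw [fr₃.arr q (by simp [packItems, put, Stmt.Wr, hq]),
      fr₂.arr q (by simp [drawModulus, put, Stmt.Wr]), fr₁.arr q (by simp [gauge, put, Stmt.Wr])]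
    rfl
  have hi2 : ∀ i, st₂.arr .item i = 0 := by
    intro i
    rw [fr₂.arr _ (by simp [drawModulus, put, Stmt.Wr]), fr₁.arr _ (by simp [gauge, put, Stmt.Wr])]
    rfl
  have hB : p ^ 4 < 2 ^ (3 * p ^ 4) := lt_of_lt_of_le Nat.lt_two_pow_self
    (Nat.pow_le_pow_right (by norm_num) (by omega))
  have hQB : 2 ^ E.inp 0 < 2 ^ (3 * p ^ 4) := Nat.pow_lt_pow_right (by norm_num) (by omega)
  have hNB : N < 2 ^ (3 * p ^ 4) := lt_of_le_of_lt hNp (Nat.pow_lt_pow_right (by norm_num) (by omega))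
  have htB : E.inp 1 % N < 2 ^ (3 * p ^ 4) := (Nat.mod_lt _ hN0).trans hNB
  have h2p : 2 * p < 2 ^ (3 * p ^ 4) := by
    have := two_mul_le_pow_four (show 2 ≤ p by omega)
    omega
  have hlsB : Nat.size (total E.inp) < 2 ^ (3 * p ^ 4) :=
    lt_of_lt_of_le (Nat.lt_size_self _) (Nat.pow_le_pow_right (by norm_num) (by omega))
  refine ⟨⟨Q₃, hNN, t₃, n₃, ?_, hn, hlam, hr3, ?_⟩, ⟨?_, ?_, ?_, ?_⟩, by rw [c₃, c₂], hb2⟩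
  · intro i hi
    exact item₃ i hi
  · exact hz _ (by simp [reduce, gauge, drawModulus, packItems, put, Stmt.Asg])
  · intro x
    by_cases hx : (reduce C).Asg x
    · simp only [reduce, gauge, drawModulus, packItems, put, Stmt.Asg, asg_powTwo, asg_drawBits] at hx
      repeat' (rcases hx with hx | hx)
      all_goals
        simp only [hn, tt₃, Z₃, i₃, hls, hll, hlam, hr3, hb2, hNN, k₃, q₃, f₃, Q₃, v₃, t₃, n₃]
        omega
    · rw [hz x hx]; positivity
  · intro x hx
    by_contra h
    exact hx (hz x fun h' => h (asg_reduce h'))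
  · intro i
    by_cases h : i < E.inp 0
    · rw [item₃ i h]
      calc E.inp (i + 2) % N * 2 ^ E.inp 0 + 2 ^ i
          ≤ E.inp (i + 2) % N * 2 ^ E.inp 0 + 2 ^ E.inp 0 := by gcongr; norm_num
        _ = (E.inp (i + 2) % N + 1) * 2 ^ E.inp 0 := by ring
        _ ≤ 2 ^ (2 * p ^ 4) * 2 ^ E.inp 0 := by
          gcongr
          exact (Nat.mod_lt _ hN0).trans_le hNp
        _ = 2 ^ (2 * p ^ 4 + E.inp 0) := (pow_add _ _ _).symm
        _ < _ := Nat.pow_lt_pow_right (by norm_num) (by omega)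
    · rw [rest₃ i (by omega), hi2]; positivity
  · intro q i hq
    by_cases h : q = .item
    · subst h
      refine ⟨rfl, ?_⟩
      by_contra h
      exact hq (by rw [rest₃ i (by omega), hi2])
    · rw [ha q h] at hq; exact absurd rfl hq

/-- The first phase is polynomial in the bit length of the input. -/
lemma steps_reduce_le {C : ℕ} (hC : 10 ≤ C) (hl : 1 ≤ l)
    (hA : 2 * (E.inp 0 + 1) * (2 * l + 4) ≤ A)
    (hV : 4 * param C E.inp ^ 4 + Nat.size (total E.inp) ≤ V) :
    (reduce C).steps E St.zero ≤ 1000 * (param C E.inp ^ 4 + Nat.size (total E.inp)) := by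
  set p := param C E.inp with hp
  have hp0 : p = E.inp 0 + Nat.size (Nat.size (total E.inp)) + C := hp
  have hp4 : p ≤ p ^ 4 := Nat.le_self_pow (by norm_num) p
  have s1 : gauge.Settled := by simp [gauge, put, Stmt.Settled, Stmt.Static, Stmt.Bnd, Stmt.Asg]
  have s2 : (drawModulus C ⨾ packItems).Settled := by
    have h2 := settled_powTwo (r := .sc .Q) (u := .sc .n) (by simp) (by simp)
    simp [drawModulus, packItems, put, Stmt.Settled, Stmt.Static, Stmt.Bnd, Stmt.Asg, h2]
  obtain ⟨-, g₁, -⟩ := gauge_wp (l := l) (A := A) (V := V) (E := E) (st := St.zero) (by omega)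
  obtain ⟨-, h₃, -, hc, hb⟩ := reduce_wp (l := l) (A := A) (V := V) (E := E) 0 0 (fun _ => 0) hC hl hA hV
  have c1 := s1.steps_le (E := E) gauge St.zero
  have c2 := s2.steps_le (E := E) _ (gauge.denote E St.zero)
  have e1 : gauge.cost (gauge.denote E St.zero).reg = 29 + E.inp 0 * 18 + Nat.size (total E.inp) * 14 +
      Nat.size (Nat.size (total E.inp)) * 14 := by
    have : ∀ ρ : Rg → ℕ, gauge.cost ρ = 4 + (4 + (6 + ((3 + ρ (.sc .n) * 18) + (3 + ((3 + Nat.size (ρ (.sc .Z)) * 14) +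
      (3 + (3 + Nat.size (ρ (.sc .ls)) * 14))))))) := fun ρ => rfl
    rw [this, g₁.n, g₁.Z, g₁.ls]; ring
  have e2 : ∀ ρ : Rg → ℕ, (drawModulus C ⨾ packItems).cost ρ =
      78 + ρ (.sc .n) * 64 + ρ (.sc .r3) * (23 + ρ (.sc .b2) * 18) := fun ρ => by
    have : (drawModulus C ⨾ packItems).cost ρ = (9 + (9 + (6 + (3 + (3 + ρ (.sc .r3) *
      ((drawBits (.sc .b2)).cost ρ + 9 + 8)))))) + ((powTwo (.sc .Q) (.sc .n)).cost ρ + (3 +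
      ((3 + ρ (.sc .n) * (36 + 6 + 8)) + (12 + (6 + (3 + (3 + (3 + (3 + (3 + 3)))))))))) := rfl
    rw [this, cost_drawBits, cost_powTwo]; ring
  have e3 : (reduce C).steps E St.zero = gauge.steps E St.zero +
    (drawModulus C ⨾ packItems).steps E (gauge.denote E St.zero) := rfl
  have e4 : (drawModulus C ⨾ packItems).denote E (gauge.denote E St.zero) =
    (reduce C).denote E St.zero := rfl
  rw [e4, e2, h₃.n, h₃.r3, hb, ← hp] at c2
  have e5 : (params l (E.inp 0) (modulus E.ω (2 * p) (p ^ 3)) (E.inp 1 % modulus E.ω (2 * p) (p ^ 3))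
    p 0 0 (fun i => E.inp (i + 2) % modulus E.ω (2 * p) (p ^ 3)) fun _ => 0).n = E.inp 0 := rfl
  rw [e5] at c2
  have e6 : p ^ 3 * (23 + 2 * p * 18) = 23 * p ^ 3 + 36 * p ^ 4 := by ring
  have e7 : p ^ 3 ≤ p ^ 4 := Nat.pow_le_pow_right (by omega) (by norm_num); omega

end

/-! ### The size of the search -/

/-- The block size `m` and the offset `c` suit `n` items and `l + 1` blocks, `c` exceeds `m` by at
most `c₀`, and `lam` is large. -/
structure Sizes (l c₀ n m c lam : ℕ) : Prop where
  l_pos : 1 ≤ l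
  m_le : (1 + l * (l + 1) / 2) * m ≤ n
  c_eq : c = (n - (1 + l * (l + 1) / 2) * m) / (l + 1)
  c_le : c ≤ m + c₀
  le_lam : n + 100 * (l + c₀ + 10) ≤ lam

/-- A bound on the number of cells of each table. -/
def cells (l c₀ m lam : ℕ) : ℕ := lam ^ (9 * l + 9) * 2 ^ (m + c₀ + 4)

/-- A bound on the addresses in use during the search. -/
def addresses (l c₀ m lam : ℕ) : ℕ := 2 * (cells l c₀ m lam + 1) * (2 * l + 4)

/-- The work of the search, up to a power of `lam`. -/
def work (l c₀ m c lam : ℕ) : ℕ :=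
  lam ^ (9 * l + 9) * 2 ^ ((1 + l * (l - 1) / 2) * m + l * c + (l * (l + 1) + l + c₀ + 6))

section

variable {l c₀ n m c lam N t : ℕ} {a p : ℕ → ℕ}

lemma Sizes.thousand_le (h : Sizes l c₀ n m c lam) : 1000 ≤ lam := by
  have h1 := h.le_lam; linarith [Nat.zero_le n, Nat.zero_le l, Nat.zero_le c₀]

lemma Sizes.pow_le (h : Sizes l c₀ n m c lam) : lam ^ (9 * l + 9) ≤ 2 ^ (lam * lam) := by
  rw [pow_mul]
  have := h.le_lam
  exact (Nat.pow_le_pow_left Nat.lt_two_pow_self.le _).trans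
    (Nat.pow_le_pow_right (Nat.one_le_two_pow) (by omega))

lemma Sizes.lam_sq (h : Sizes l c₀ n m c lam) : 1000 * lam ≤ lam * lam := by
  have h1 := h.le_lam
  have h2 := h.thousand_le; exact Nat.mul_le_mul h2 le_rfl

lemma Sizes.lam_cube (h : Sizes l c₀ n m c lam) : 1000 * (lam * lam) ≤ lam * lam * lam := by
  have h1 := h.le_lam
  have h2 := h.thousand_le
  rw [mul_comm 1000]; exact Nat.mul_le_mul le_rfl h2

lemma Sizes.lam_five (h : Sizes l c₀ n m c lam) :
    1000 * lam ^ 4 ≤ lam ^ 5 ∧ lam * lam * lam ≤ lam ^ 4 := by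
  have h1 := h.le_lam
  have h2 := h.thousand_le
  have e5 : lam ^ 5 = lam * lam ^ 4 := by ring
  have e4 : lam ^ 4 = lam * lam * lam * lam := by ring
  rw [e5]; exact ⟨Nat.mul_le_mul h2 le_rfl, by rw [e4]; exact Nat.le_mul_of_pos_right _ (by omega)⟩

lemma Sizes.m_le_n (h : Sizes l c₀ n m c lam) : m ≤ n := by
  have := h.m_le
  have : m ≤ (1 + l * (l + 1) / 2) * m := Nat.le_mul_of_pos_left _ (by omega); omega

lemma Sizes.n_mul_le (h : Sizes l c₀ n m c lam) : (n + 2) * (l + 2) ≤ lam * lam := by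
  have := h.le_lam; exact Nat.mul_le_mul (by omega) (by omega)

lemma Sizes.paramFits (h : Sizes l c₀ n m c lam) :
    ParamFits l n lam m c (2 * lam ^ 5 + 3) where
  m_le := h.m_le
  c_eq := h.c_eq
  n_lt := by
    have h1 := h.n_mul_le
    have h2 := h.lam_sq
    have h3 := h.lam_cube
    have h4 := h.lam_five; omega
  P_lt := by
    have h2 := h.lam_sq
    have h3 := h.lam_cube
    have h4 := h.lam_five
    have h5 := h.le_lam
    calc lam ^ (9 * l + 9) * 2 ^ n ≤ 2 ^ (lam * lam) * 2 ^ n := Nat.mul_le_mul_right _ h.pow_le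
      _ = 2 ^ (lam * lam + n) := (pow_add _ _ _).symm
      _ < _ := Nat.pow_lt_pow_right (by norm_num) (by omega)
  l_lt := by
    have h2 := h.lam_sq
    have h3 := h.lam_cube
    have h4 := h.lam_five
    have h5 := h.le_lam
    have h6 : l * (l + 1) ≤ lam * lam := Nat.mul_le_mul (by omega) (by omega)
    exact lt_of_le_of_lt (b := 2 * lam ^ 5 + 3) (by omega) Nat.lt_two_pow_self
  lam_pos := by have := h.le_lam; omega

lemma Sizes.cells_le (h : Sizes l c₀ n m c lam) :
    addresses l c₀ m lam < 2 ^ (lam * lam * lam) ∧ lam ≤ cells l c₀ m lam := by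
  have h2 := h.lam_sq
  have h3 := h.lam_cube
  have h5 := h.le_lam
  have h6 := h.m_le_n
  constructor
  · have h7 : cells l c₀ m lam ≤ 2 ^ (lam * lam + (m + c₀ + 4)) := by
      rw [pow_add]; exact Nat.mul_le_mul_right _ h.pow_le
    have h8 : 2 * l + 4 ≤ 2 ^ lam := le_trans (by omega) Nat.lt_two_pow_self.le
    have h9 : 1 ≤ 2 ^ (lam * lam + (m + c₀ + 4)) := Nat.one_le_two_pow
    calc addresses l c₀ m lam
        ≤ 2 * (2 ^ (lam * lam + (m + c₀ + 4)) + 2 ^ (lam * lam + (m + c₀ + 4))) * 2 ^ lam :=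
          Nat.mul_le_mul (Nat.mul_le_mul_left _ (by omega)) h8
      _ = 2 ^ (2 + (lam * lam + (m + c₀ + 4)) + lam) := by rw [pow_add 2 (2 + _), pow_add 2 2]; ring
      _ < _ := Nat.pow_lt_pow_right (by norm_num) (by omega)
  · calc lam ≤ lam ^ (9 * l + 9) := Nat.le_self_pow (by omega) lam
      _ ≤ _ := Nat.le_mul_of_pos_right _ (by positivity)

lemma Sizes.addresses_le (h : Sizes l c₀ n m c lam) :
    addresses l c₀ m lam ≤ 2 ^ (2 * lam ^ 5 + 3) := by
  have h2 := h.lam_sq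
  have h3 := h.lam_cube
  have h4 := h.lam_five; exact h.cells_le.1.le.trans (Nat.pow_le_pow_right (by norm_num) (by omega))

lemma Sizes.le_addresses (h : Sizes l c₀ n m c lam) :
    2 * (n + 1) * (2 * l + 4) ≤ addresses l c₀ m lam ∧ 1000 ≤ addresses l c₀ m lam ∧
    2 * l + 8 ≤ addresses l c₀ m lam ∧ lam ≤ addresses l c₀ m lam := by
  have h5 := h.le_lam
  have h6 := h.thousand_le
  have h7 := h.cells_le.2
  have h8 : 2 * (n + 1) * (2 * l + 4) ≤ addresses l c₀ m lam :=
    Nat.mul_le_mul_right _ (Nat.mul_le_mul_left _ (by omega))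
  have h9 : 2 * (cells l c₀ m lam + 1) * 4 ≤ addresses l c₀ m lam :=
    Nat.mul_le_mul_left _ (by omega)
  have h10 : 2 * 1 * (2 * l + 4) ≤ addresses l c₀ m lam :=
    Nat.mul_le_mul_right _ (Nat.mul_le_mul_left _ (by omega))
  exact ⟨h8, by linarith, by omega, by omega⟩

/-- The random primes have the right number of bits. -/
structure PrimesFit (m c : ℕ) (p : ℕ → ℕ) : Prop where
  pos : ∀ i, 0 < p i
  le : ∀ i, p i ≤ 2 ^ primeBits m c i

variable (hs : Sizes l c₀ n m c lam) (hp : PrimesFit m c p)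
include hs hp

omit hs in
lemma PrimesFit.prod_le {i : ℕ} (hi : 1 ≤ i) :
    ∏ k ∈ Finset.range i, p (k + 1) ≤ 2 ^ (c + 2 * i + (i - 1) * m) := by
  induction i, hi using Nat.le_induction with
  | base => simpa [primeBits] using hp.le 1
  | succ i hi ih =>
    have h1 := hp.le (i + 1)
    rw [primeBits, if_neg (by omega)] at h1
    rw [Finset.prod_range_succ]
    refine (Nat.mul_le_mul ih h1).trans (le_of_eq ?_)
    rw [← pow_add]
    obtain ⟨k, rfl⟩ := Nat.exists_eq_add_of_le hi
    congr 1
    rw [show 1 + k - 1 = k by omega, show 1 + k + 1 - 1 = k + 1 by omega]; ring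

lemma Sizes.keyB_mul_W_le {j : ℕ} :
    (params l n N t lam m c a p).pB j * (params l n N t lam m c a p).W j ≤ cells l c₀ m lam := by
  have h1 := hp.le (max j 1)
  have hc := hs.c_le
  change p (max j 1) * (if j ≤ 1 then _ else _) ≤ _
  unfold primeBits at h1
  unfold cells
  split_ifs with h
  · rw [if_pos (by omega)] at h1
    calc _ ≤ 2 ^ (c + 2) * (lam ^ (9 * l + 9) * 2 ^ ((m - c) / 2)) := Nat.mul_le_mul_right _ h1
      _ = lam ^ (9 * l + 9) * 2 ^ (c + 2 + (m - c) / 2) := by rw [pow_add 2 (c + 2)]; ring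
      _ ≤ _ := Nat.mul_le_mul_left _ (Nat.pow_le_pow_right (by norm_num) (by omega))
  · rw [if_neg (by omega)] at h1
    calc _ ≤ 2 ^ (m + 2) * lam ^ (9 * l + 9) := Nat.mul_le_mul_right _ h1
      _ = lam ^ (9 * l + 9) * 2 ^ (m + 2) := mul_comm _ _
      _ ≤ _ := Nat.mul_le_mul_left _ (Nat.pow_le_pow_right (by norm_num) (by omega))

omit hs in
lemma PrimesFit.keyT_le (j : ℕ) : (params l n N t lam m c a p).pT j ≤ 2 ^ (m + 2) := by
  have h1 := hp.le (max j 1 + 1)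
  unfold primeBits at h1
  rwa [if_neg (by omega)] at h1

lemma Sizes.fits (hN : 0 < N) (hN' : N ≤ 2 ^ (2 * lam ^ 4)) (ht : t < N) (ha : ∀ i, a i < N) {A : ℕ}
    (hA : A = addresses l c₀ m lam) :
    (params l n N t lam m c a p).Fits A (2 * lam ^ 5 + 3) (2 ^ lam ^ 5) (cells l c₀ m lam) := by
  set D := params l n N t lam m c a p with hD
  have h2 := hs.lam_sq
  have h3 := hs.lam_cube
  have h4 := hs.lam_five
  have h5 := hs.le_lam
  have hmn := hs.m_le_n
  have hpow : ∀ {x y : ℕ}, x ≤ y → 2 ^ x ≤ 2 ^ y := fun h => Nat.pow_le_pow_right (by norm_num) h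
  have hself : ∀ x : ℕ, x ≤ 2 ^ x := fun x => Nat.lt_two_pow_self.le
  have hP : D.P ≤ 2 ^ (lam * lam) := hs.pow_le
  have hnN : n * (N * 2 ^ n) < 2 ^ lam ^ 5 := by
    calc n * (N * 2 ^ n) < 2 ^ n * (N * 2 ^ n) :=
          Nat.mul_lt_mul_of_pos_right Nat.lt_two_pow_self (by positivity)
      _ ≤ 2 ^ n * (2 ^ (2 * lam ^ 4) * 2 ^ n) := by gcongr
      _ = 2 ^ (n + (2 * lam ^ 4 + n)) := by rw [pow_add, pow_add]
      _ ≤ _ := hpow (by omega)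
  exact {
    Q_le := hpow (show n ≤ _ by omega)
    n_le := le_trans (show n + 1 ≤ lam ^ 5 by omega) (hself _)
    l_le := le_trans (show l + 2 ≤ lam ^ 5 by omega) (hself _)
    tot_le := by
      refine lt_of_le_of_lt ?_ hnN
      have : ∀ i ∈ Finset.range n, D.w i ≤ N * 2 ^ n := by
        intro i hi
        have h6 : 2 ^ i ≤ 2 ^ n := hpow (Finset.mem_range.1 hi).le
        have h7 : a i + 1 ≤ N := ha i
        calc D.w i = a i * 2 ^ n + 2 ^ i := rfl
          _ ≤ (a i + 1) * 2 ^ n := by rw [add_mul]; omega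
          _ ≤ _ := Nat.mul_le_mul_right _ h7
      have h8 := Finset.sum_le_card_nsmul _ _ _ this
      rwa [Finset.card_range, smul_eq_mul] at h8
    t_le := by
      change t + n * N ≤ _
      calc t + n * N ≤ (n + 1) * N := by rw [add_mul]; omega
        _ ≤ 2 ^ lam * 2 ^ (2 * lam ^ 4) := Nat.mul_le_mul ((hself _).trans (hpow (by omega))) hN'
        _ = 2 ^ (lam + 2 * lam ^ 4) := (pow_add _ _ _).symm
        _ ≤ _ := hpow (by omega)
    p_le := fun i _ => (hp.le i).trans (hpow ((primeBits_le hs.paramFits i).trans (by omega)))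
    M_le := by
      intro i hi
      change ∏ k ∈ Finset.range i, p (k + 1) ≤ _
      refine (Finset.prod_le_pow_card _ _ (2 ^ (n + 2)) fun k _ =>
        (hp.le _).trans (hpow (primeBits_le hs.paramFits _))).trans ?_
      rw [Finset.card_range, ← pow_mul]
      refine hpow (le_trans ?_ (show lam * lam ≤ lam ^ 5 by omega))
      exact (Nat.mul_le_mul_left _ (show i ≤ l + 2 from le_trans hi (Nat.le_add_right _ _))).trans
        hs.n_mul_le
    P_le := hP.trans (hpow (by omega))
    W_le := by
      intro j _
      change (if j ≤ 1 then _ else _) ≤ _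
      split_ifs
      · calc _ ≤ 2 ^ (lam * lam) * 2 ^ lam := Nat.mul_le_mul hP (hpow (by omega))
          _ = 2 ^ (lam * lam + lam) := (pow_add _ _ _).symm
          _ ≤ _ := hpow (by omega)
      · exact hP.trans (hpow (by omega))
    lenE_le := fun j hj => hpow ((firstPart_le hs.m_le hs.c_eq hj).trans (by omega))
    lenB_le := fun j hj => hpow ((secondPart_le hs.m_le hs.c_eq j).trans (by omega))
    K_le := by
      have : 4 * 2 ^ lam ^ 5 * 2 ^ lam ^ 5 = 2 ^ (2 * lam ^ 5 + 2) := by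
        rw [pow_add, two_mul, pow_add]; ring
      rw [this]; exact Nat.pow_lt_pow_right (by norm_num) (by omega)
    I_le := hA.symm.le
    A_le := by
      rw [hA]; exact hs.cells_le.1.le.trans (hpow (by omega))
    n_le_I := le_trans (show n ≤ lam by omega) hs.cells_le.2
    B_le := fun j _ => hs.keyB_mul_W_le hp
    T_le := by
      intro j _
      calc D.pT j * D.P ≤ 2 ^ (m + 2) * lam ^ (9 * l + 9) := Nat.mul_le_mul_right _ (hp.keyT_le j)
        _ = lam ^ (9 * l + 9) * 2 ^ (m + 2) := mul_comm _ _
        _ ≤ _ := Nat.mul_le_mul_left _ (hpow (by omega)) }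

omit hs hp in
lemma sum_levels (l m c : ℕ) : ∑ i ∈ Finset.Ioc 0 l, (c + 2 * i + (i - 1) * m) =
    l * c + l * (l + 1) + l * (l - 1) / 2 * m := by
  induction l with
  | zero => simp
  | succ l ih =>
    rw [Finset.sum_Ioc_succ_top (by omega), ih, Nat.add_sub_cancel]
    have : (l + 1) * l / 2 = l * (l - 1) / 2 + l := by
      cases l with
      | zero => rfl
      | succ l =>
        rw [Nat.add_sub_cancel, mul_comm (l + 1) l, mul_comm (l + 1 + 1), half_succ]
    rw [this]; ring

omit hs hp in
/-- The residue classes for the levels from `j` on, together with the first part of block `j`, are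
not more than those for all levels and `2 ^ m`. -/
lemma sum_levels_le {l j : ℕ} (m c : ℕ) (hj : 2 ≤ j) (hjl : j ≤ l) :
    ∑ i ∈ Finset.Ioc (j - 1) l, (c + 2 * i + (i - 1) * m) + ((j - 1) * m + c) ≤
      l * c + l * (l + 1) + l * (l - 1) / 2 * m + m := by
  rw [← sum_levels, ← Finset.sum_Ioc_consecutive _ (Nat.zero_le (j - 1)) (by omega)]
  have h := Finset.single_le_sum (f := fun i => c + 2 * i + (i - 1) * m) (fun _ _ => Nat.zero_le _)
    (Finset.mem_Ioc.2 ⟨by omega, le_rfl⟩ : j - 1 ∈ Finset.Ioc 0 (j - 1))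
  obtain ⟨k, rfl⟩ := Nat.exists_eq_add_of_le hj
  rw [show 2 + k - 1 = k + 1 by omega] at *
  simp only [Nat.add_sub_cancel] at h
  have : (k + 1) * m = k * m + m := by ring
  omega

omit hs in
lemma PrimesFit.prod_M_le (j : ℕ) : ∏ i ∈ Finset.Ioc (j - 1) l, (params l n N t lam m c a p).M i ≤
    2 ^ ∑ i ∈ Finset.Ioc (j - 1) l, (c + 2 * i + (i - 1) * m) := by
  rw [← Finset.prod_pow_eq_pow_sum]
  exact Finset.prod_le_prod' fun i hi => hp.prod_le (by have := Finset.mem_Ioc.1 hi; omega)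

/-- The work of the search, for all choices of residue classes together. -/
lemma Sizes.costBound : CostBound (params l n N t lam m c a p) (work l c₀ m c lam) := by
  set D := params l n N t lam m c a p with hD
  have h5 := hs.le_lam
  have hc := hs.c_le
  have hP : lam ≤ D.P := Nat.le_self_pow (by omega) lam
  have hP1 : 1 ≤ lam ^ (9 * l + 9) := Nat.one_le_pow _ _ (by omega)
  have hpow : ∀ {x y : ℕ}, x ≤ y → 2 ^ x ≤ 2 ^ y := fun h => Nat.pow_le_pow_right (by norm_num) h
  have hW : ∀ j, D.W j = if j ≤ 1 then lam ^ (9 * l + 9) * 2 ^ ((m - c) / 2)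
    else lam ^ (9 * l + 9) := fun _ => rfl
  have hm1 : m ≤ (1 + l * (l - 1) / 2) * m := Nat.le_mul_of_pos_left _ (by omega)
  have hm2 : (1 + l * (l - 1) / 2) * m = m + l * (l - 1) / 2 * m := by ring
  refine ⟨hs.thousand_le.trans hP, show n + 1 ≤ _ by omega, show l + 1 ≤ _ by omega, ?_, ?_, ?_⟩
  · intro j _
    rw [hW]
    split_ifs
    · exact Nat.mul_pos hP1 (by positivity)
    · exact hP1
  · intro j _
    have h1 : D.pB j * D.W j ≤ lam ^ (9 * l + 9) * 2 ^ (m + c₀ + 4) := hs.keyB_mul_W_le hp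
    have h2 : 2 ^ D.lenB j * D.W j ≤ lam ^ (9 * l + 9) * 2 ^ (m + c₀ + 4) := by
      rw [hW, mul_comm]
      change _ * 2 ^ secondPart m c j ≤ _
      unfold secondPart
      split_ifs
      · rw [mul_assoc, ← pow_add]; exact Nat.mul_le_mul_left _ (hpow (by omega))
      · exact Nat.mul_le_mul_left _ (hpow (by omega))
    calc _ ≤ lam ^ (9 * l + 9) * 2 ^ (m + c₀ + 4 + 1) := by rw [pow_succ 2, ← mul_assoc]; omega
      _ ≤ _ := Nat.mul_le_mul_left _ (hpow (by omega))
  · intro j hj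
    have h1 := hp.prod_M_le (l := l) (n := n) (N := N) (t := t) (lam := lam) (a := a) j
    have h2 := hp.keyT_le (l := l) (n := n) (N := N) (t := t) (lam := lam) (a := a) j
    -- the work for one residue class
    have h3 : D.pT j + 2 ^ D.lenE j * D.W j ≤ lam ^ (9 * l + 9) *
        2 ^ ((if j ≤ 1 then m else (j - 1) * m + c) + (l + c₀ + 4)) := by
      have hle : D.lenE j = firstPart l n m c j := rfl
      have h4 : 2 ^ (m + 2) ≤ lam ^ (9 * l + 9) *
          2 ^ ((if j ≤ 1 then m else (j - 1) * m + c) + (l + c₀ + 3)) := by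
        refine (hpow ?_).trans (Nat.le_mul_of_pos_left _ hP1)
        split_ifs with h
        · omega
        · have : m ≤ (j - 1) * m := Nat.le_mul_of_pos_left _ (by omega); omega
      have h6 : 2 ^ D.lenE j * D.W j ≤ lam ^ (9 * l + 9) *
          2 ^ ((if j ≤ 1 then m else (j - 1) * m + c) + (l + c₀ + 3)) := by
        rw [hW, mul_comm, hle]
        have hfirst : j ≤ 1 → firstPart l n m c j ≤ m + c + l - (m + c) / 2 := by
          intro h
          have hd := Nat.lt_div_mul_add (a := n - (1 + l * (l + 1) / 2) * m) (b := l + 1) (by omega)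
          rw [← hs.c_eq] at hd
          have e1 : (1 + l * (l + 1) / 2) * m = m + l * (l + 1) / 2 * m := by ring
          have e2 : c * (l + 1) = l * c + c := by ring
          unfold firstPart
          split_ifs <;> omega
        split_ifs with h
        · rw [mul_assoc, ← pow_add]
          have := hfirst h; exact Nat.mul_le_mul_left _ (hpow (by omega))
        · unfold firstPart
          rw [if_neg (by omega), if_neg (by omega)]; exact Nat.mul_le_mul_left _ (hpow (by omega))
      have h8 := Nat.add_le_add (h2.trans h4) h6
      rw [← two_mul] at h8
      refine h8.trans (le_of_eq ?_)
      rw [← Nat.add_assoc _ (l + c₀ + 3) 1, pow_succ 2]; ring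
    have h7 : ∑ i ∈ Finset.Ioc (j - 1) l, (c + 2 * i + (i - 1) * m) +
        (if j ≤ 1 then m else (j - 1) * m + c) ≤ l * c + l * (l + 1) + l * (l - 1) / 2 * m + m := by
      split_ifs with h
      · rw [show j - 1 = 0 by omega, sum_levels]
      · exact sum_levels_le m c (by omega) hj
    calc _ ≤ 2 ^ (∑ i ∈ Finset.Ioc (j - 1) l, (c + 2 * i + (i - 1) * m)) * (lam ^ (9 * l + 9) *
          2 ^ ((if j ≤ 1 then m else (j - 1) * m + c) + (l + c₀ + 4))) := Nat.mul_le_mul h1 h3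
      _ = lam ^ (9 * l + 9) * 2 ^ (∑ i ∈ Finset.Ioc (j - 1) l, (c + 2 * i + (i - 1) * m) +
          ((if j ≤ 1 then m else (j - 1) * m + c) + (l + c₀ + 4))) := by
        rw [pow_add 2 (Finset.sum _ _)]; ring
      _ ≤ _ := Nat.mul_le_mul_left _ (hpow (by omega))

end

/-! ### The program as a program of the machine -/

section plain

variable {ι κ : Type}

/-- The expression does not use the space parameter. -/
def Expr.Plain : Expr ι κ → Prop
  | .const _ => True
  | .reg _ => True
  | .bin _ a b => a.Plain ∧ b.Plain
  | .load _ e => e.Plain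
  | .input e => e.Plain
  | .scale _ => False

/-- The statement does not use the space parameter. -/
def Stmt.Plain : Stmt ι κ → Prop
  | .skip => True
  | .assign _ e => e.Plain
  | .store _ e₁ e₂ => e₁.Plain ∧ e₂.Plain
  | .flip _ => True
  | .seq s₁ s₂ => s₁.Plain ∧ s₂.Plain
  | .ifz e s₁ s₂ => e.Plain ∧ s₁.Plain ∧ s₂.Plain
  | .loop _ _ _ s => s.Plain

lemma Expr.Plain.scale_notMem {L : Layout ι κ} {e : Expr ι κ} (h : e.Plain) (k r s : ℕ) :
    Instr.scale r s ∉ e.code L k := by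
  induction e generalizing k with
  | bin o a b iha ihb =>
    cases o <;> simp [code, iha h.1, ihb h.2, Op.instr]
  | scale e ih => exact h.elim
  | _ => simp_all [code, addressCode, Plain]

lemma Stmt.Plain.scale_notMem {L : Layout ι κ} {s : Stmt ι κ} (h : s.Plain) (k pc r u : ℕ) :
    Instr.scale r u ∉ s.code L k pc := by
  induction s generalizing k pc with
  | skip => simp [code]
  | assign r e => simp [code, Expr.Plain.scale_notMem (show e.Plain from h)]
  | store q e₁ e₂ => simp [code, addressCode, h.1.scale_notMem, h.2.scale_notMem]
  | flip r => simp [code]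
  | seq s₁ s₂ ih₁ ih₂ => simp [code, ih₁ h.1, ih₂ h.2]
  | ifz e s₁ s₂ ih₁ ih₂ => simp [code, h.1.scale_notMem, ih₁ h.2.1, ih₂ h.2.2]
  | loop b i v s ih => cases b <;> simp [code, ih h]

@[simp] lemma plain_sub (a b : Expr ι κ) : (a - b).Plain ↔ a.Plain ∧ b.Plain := Iff.rfl
@[simp] lemma plain_div (a b : Expr ι κ) : (a / b).Plain ↔ a.Plain ∧ b.Plain := Iff.rfl
@[simp] lemma plain_mod (a b : Expr ι κ) : (a % b).Plain ↔ a.Plain ∧ (a.Plain ∧ b.Plain) ∧ b.Plain :=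
  Iff.rfl

end plain

lemma plain_buildB (j : ℕ) : (buildB j).Plain := by
  simp [buildB, clear, sumItems, insert, ifeq, put, num, rg, lv, keyB, Stmt.Plain, Expr.Plain]

lemma plain_buildT (j : ℕ) : (buildT j).Plain := by
  simp [buildT, clear, sumItems, insert, ifeq, put, num, rg, lv, keyB, keyT, Stmt.Plain, Expr.Plain]

lemma plain_extend (r j : ℕ) : (extend r j).Plain := by
  induction r generalizing j with
  | zero => simp [extend, output, ifeq, put, num, rg, lv, Stmt.Plain, Expr.Plain]
  | succ r ih => simp [extend, put, num, rg, lv, keyT, Stmt.Plain, Expr.Plain, ih]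

lemma plain_search (l j : ℕ) : (search l j).Plain := by
  induction j with
  | zero =>
    simp [search, extendAll, put, num, rg, lv, Stmt.Plain, Expr.Plain, plain_extend, plain_buildT]
  | succ j ih => simp [search, lv, Stmt.Plain, Expr.Plain, plain_buildT, ih]

lemma plain_solve (l : ℕ) : (solve l).Plain := by
  have h : ∀ j, (buildAllB j).Plain := by
    intro j
    induction j with
    | zero => trivial
    | succ j ih => exact ⟨ih, plain_buildB j⟩
  simp [solve, searchAll, put, num, rg, Stmt.Plain, Expr.Plain, plain_search, h]

lemma plain_powTwo (r u : Rg) : (powTwo r u).Plain := by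
  simp [powTwo, num, Stmt.Plain, Expr.Plain]

lemma plain_drawBits (u : Rg) : (drawBits u).Plain := by
  simp [drawBits, put, num, rg, Stmt.Plain, Expr.Plain]

lemma plain_reduce (C : ℕ) : (reduce C).Plain := by
  simp [reduce, gauge, drawModulus, packItems, put, num, rg, Stmt.Plain, Expr.Plain,
    plain_powTwo, plain_drawBits]

lemma plain_setParams (l : ℕ) {e : Expr Rg Ar} (he : e.Plain) : (setParams l e).Plain := by
  have h1 : ∀ j, (setLevels l j).Plain := by
    intro j
    induction j with
    | zero => trivial
    | succ j ih =>
      refine ⟨ih, ?_⟩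
      simp only [setLevel, firstPartExpr, num, rg, lv, Stmt.Plain, plain_powTwo, true_and]
      split_ifs <;> simp [Expr.Plain]
  have h2 : ∀ i, (setPrimes i).Plain := by
    intro i
    induction i with
    | zero => simp [setPrimes, num, Stmt.Plain, Expr.Plain]
    | succ i ih =>
      refine ⟨ih, ?_⟩
      simp only [setPrime, drawPrime, testPrime, put, num, rg, lv, Stmt.Plain, plain_powTwo,
        plain_drawBits, true_and]
      split_ifs <;> simp [Expr.Plain]
  have h3 : ∀ k, (powExpr .lam k).Plain := by
    intro k
    induction k with
    | zero => trivial
    | succ k ih => exact ⟨ih, trivial⟩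
  simp [setParams, put, num, rg, Stmt.Plain, Expr.Plain, plain_powTwo, h1, h2, h3, he]

/-- The second phase of the program. -/
def mainPhase (l : ℕ) (e : Expr Rg Ar) : Prog := setParams l e ⨾ solve l

/-- The program. The expression `e` computes the block size. -/
def program (l C : ℕ) (e : Expr Rg Ar) : Program :=
  (reduce C).code (layout l) 0 0 ++ (mainPhase l e).code (layout l) 0 (reduce C).len

lemma program_plain {l C : ℕ} {e : Expr Rg Ar} (he : e.Plain) (r s : ℕ) :
    Instr.scale r s ∉ program l C e := by
  have h : (mainPhase l e).Plain := ⟨plain_setParams l he, plain_solve l⟩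
  simp [program, (plain_reduce C).scale_notMem, h.scale_notMem]

/-- The random modulus on input `inp`. -/
def theModulus (C : ℕ) (inp : ℕ → ℕ) (ω : ℕ → Bool) : ℕ :=
  modulus ω (2 * param C inp) (param C inp ^ 3)

/-- The random primes on input `inp`. -/
def thePrimes (C m c : ℕ) (inp : ℕ → ℕ) (ω : ℕ → Bool) : ℕ → ℕ :=
  primes ω (param C inp ^ 3 * (2 * param C inp)) (param C inp ^ 3) m c

/-- The data of the search on input `inp`. -/
def theData (l C m c : ℕ) (inp : ℕ → ℕ) (ω : ℕ → Bool) : Data :=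
  params l (inp 0) (theModulus C inp ω) (inp 1 % theModulus C inp ω) (param C inp) m c
    (fun i => inp (i + 2) % theModulus C inp ω) (thePrimes C m c inp ω)

lemma ctorIdx_lt (s : Scalar) : s.ctorIdx < 37 := by cases s <;> decide

lemma Rep.within_of_small {l n B A : ℕ} {st : St Rg Ar} {mem : ℕ →₀ ℕ} (h : Rep (layout l) st 0 mem)
    (hs : Small n B st) (hA : 1000 ≤ A) (hA' : 2 * (n + 1) * (2 * l + 4) ≤ A) {V : ℕ} (hV : B ≤ V) :
    Within A V mem := by
  have hB : 2 ^ B ≤ 2 ^ V := Nat.pow_le_pow_right (by norm_num) hV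
  intro a ha
  rcases h.other a ha with ⟨r, rfl⟩ | ⟨q, hq, i, rfl⟩ | ⟨j, rfl⟩
  · rw [h.reg] at ha ⊢
    obtain ⟨s, rfl⟩ := hs.scalar r ha
    refine ⟨?_, (hs.reg _).trans_le hB⟩
    have := ctorIdx_lt s
    simp only [layout, Rg.num]; omega
  · rw [h.arr q hq] at ha ⊢
    obtain ⟨rfl, hi⟩ := hs.index q i ha
    refine ⟨?_, (hs.item i).trans_le hB⟩
    simp only [layout, Ar.num, cell]
    have : (i + 1) * (2 * l + 4) ≤ (n + 1) * (2 * l + 4) := Nat.mul_le_mul_right _ (by omega)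
    have e : 2 * (n + 1) * (2 * l + 4) = 2 * ((n + 1) * (2 * l + 4)) := by ring
    have e2 : (i + 1) * (2 * l + 4) = i * (2 * l + 4) + (2 * l + 4) := by ring
    omega
  · exact absurd (h.aux j (Nat.zero_le _)) ha

lemma rep_zero (L : Layout Rg Ar) : Rep L St.zero 0 0 :=
  ⟨fun _ => rfl, fun _ _ _ => rfl, fun _ _ => rfl, fun _ h => absurd rfl h⟩

lemma thePrimesFit (C m c : ℕ) (inp : ℕ → ℕ) (ω : ℕ → Bool) : PrimesFit m c (thePrimes C m c inp ω) :=
  ⟨fun _ => (primes_pos _ _ _ _ _ _).pos, fun _ => primes_le _ _ _ _ _ _⟩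

/-- The bounds of the first phase. -/
def addresses₁ (l n : ℕ) : ℕ := 2 * (n + 1) * (2 * l + 4) + (reduce 0).top (layout l) 0

/-- A bound on the bit length of the numbers in the first phase. -/
def bits₁ (l C : ℕ) (inp : ℕ → ℕ) : ℕ :=
  4 * param C inp ^ 4 + Nat.size (total inp) + addresses₁ l (inp 0)

/-- A bound on the number of steps of the second phase. -/
def steps₂ (l c₀ m c lam : ℕ) (e : Expr Rg Ar) : ℕ :=
  e.len + 1000 * (l + 2) * (lam + 1) * ((lam ^ 3 + 1) * 2 ^ (m + c₀ + 2)) +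
    (lam ^ (9 * l + 9)) ^ (2 * l + 8) * work l c₀ m c lam

section

variable {l c₀ C m c : ℕ} {E : Env} {e : Expr Rg Ar}

set_option maxHeartbeats 1000000 in
/-- The run of the program. -/
theorem exec_program (hσ : E.σ ≤ 1) (hs : Sizes l c₀ (E.inp 0) m c (param C E.inp))
    (htop : (mainPhase l e).top (layout l) 0 ≤ C)
    (he : ∀ st : St Rg Ar, st.reg (.sc .n) = E.inp 0 → e.eval E st = m ∧
      e.Ok (layout l) (addresses l c₀ m (param C E.inp)) (2 * param C E.inp ^ 5 + 3) E st) :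
    ∃ (c₁ c₂ : Config) (st : St Rg Ar),
      Reach E (program l C e) (addresses₁ l (E.inp 0)) (bits₁ l C E.inp)
        (1000 * (param C E.inp ^ 4 + Nat.size (total E.inp))) Config.start c₁ ∧
      Reach E (program l C e) (addresses l c₀ m (param C E.inp)) (2 * param C E.inp ^ 5 + 3)
        (steps₂ l c₀ m c (param C E.inp) e) c₁ c₂ ∧
      c₂.Halted (program l C e) ∧ c₂.mem 0 = st.reg (.sc .flag) ∧ c₂.mem 1 = st.arr .out 0 ∧
      Sound (theData l C m c E.inp E.ω) st ∧
      ((∃ k ≤ E.inp 0, ∃ x, Star (theData l C m c E.inp E.ω)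
        ((theData l C m c E.inp E.ω).t + k * theModulus C E.inp E.ω) x) →
          st.reg (.sc .flag) ≠ 0) := by
  set p := param C E.inp with hp
  set D := theData l C m c E.inp E.ω with hD
  have hl := hs.l_pos
  have h5 := hs.le_lam
  have hCp : C ≤ p := Nat.le_add_left _ _
  have hp3 := hs.lam_sq
  have hp4 := hs.lam_cube
  have hp5 := hs.lam_five
  have hC : 10 ≤ C := by
    refine le_trans ?_ htop
    have h1 : aux 2 ≤ (mainPhase l e).top (layout l) 0 := by
      simp only [mainPhase, setParams, put, Stmt.top, Nat.zero_add]; omega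
    exact h1
  have hVV₁ : bits₁ l C E.inp < 2 ^ bits₁ l C E.inp := Nat.lt_two_pow_self
  have hA₁ : addresses₁ l (E.inp 0) ≤ bits₁ l C E.inp := Nat.le_add_left _ _
  have hS₁ : 2 * l + 8 ≤ addresses₁ l (E.inp 0) := by
    have h1 : 2 * (0 + 1) * (2 * l + 4) ≤ 2 * (E.inp 0 + 1) * (2 * l + 4) := by gcongr; omega
    unfold addresses₁; omega
  have hA₁' : 2 * (E.inp 0 + 1) * (2 * l + 4) ≤ addresses₁ l (E.inp 0) := Nat.le_add_right _ _
  have hV₁ : 4 * p ^ 4 + Nat.size (total E.inp) ≤ bits₁ l C E.inp := Nat.le_add_right _ _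
  obtain ⟨ok₁, start₁, small₁, coins₁, -⟩ := reduce_wp (l := l) m c (thePrimes C m c E.inp E.ω)
    hC hl hA₁' hV₁
  have code₁ : CodeAt (program l C e) 0 ((reduce C).code (layout l) 0 0) :=
    codeAt_self [] ((reduce C).code (layout l) 0 0)
      ((mainPhase l e).code (layout l) 0 (reduce C).len)
  have code₂ : CodeAt (program l C e) (0 + (reduce C).len)
      ((mainPhase l e).code (layout l) 0 (0 + (reduce C).len)) := by
    have := codeAt_self ((reduce C).code (layout l) 0 0)
      ((mainPhase l e).code (layout l) 0 (reduce C).len) []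
    rw [List.append_nil, Stmt.code_length] at this
    rwa [zero_add]
  obtain ⟨mem₁, t₁, reach₁, rep₁, -⟩ := Stmt.run (E := E) (P := program l C e)
    (A := addresses₁ l (E.inp 0)) (V := bits₁ l C E.inp) (layout l) (by omega)
    (show 2 * l + 4 + 4 ≤ _ by omega) hσ (reduce C) 0 0 St.zero 0 0 code₁
    (fun a ha => absurd rfl ha) (rep_zero _) ok₁ (Nat.le_add_left _ _)
  set st₁ := (reduce C).denote E St.zero with hst₁
  -- the second phase
  set A := addresses l c₀ m p with hA
  set V := 2 * p ^ 5 + 3 with hV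
  obtain ⟨hsmall, hthou, hS, hlA⟩ := hs.le_addresses
  have hAV : A ≤ 2 ^ V := hs.addresses_le
  have hBV : 3 * p ^ 4 ≤ V := by omega
  have hw₁ : Within A V mem₁ := rep₁.within_of_small small₁ hthou hsmall hBV
  have hpr := thePrimesFit C m c E.inp E.ω
  have hN : 0 < theModulus C E.inp E.ω := modulus_pos _ _ _
  have hN' : theModulus C E.inp E.ω ≤ 2 ^ (2 * p ^ 4) := by
    refine (modulus_le _ _ _).trans (le_of_eq ?_)
    rw [← hp]; congr 1; ring
  have hfits : D.Fits A V (2 ^ p ^ 5) (cells l c₀ m p) :=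
    hs.fits hpr hN hN' (Nat.mod_lt _ hN) (fun i => Nat.mod_lt _ hN) rfl
  have hshape : D.Shape := params_shape hl hs.m_le hs.c_eq hpr.pos
  obtain ⟨hem, heok⟩ := he st₁ start₁.n
  obtain ⟨ok₂, basis₂, holds₂, bits₂, w₂⟩ := setParams_wp (l := l) (A := A) (V := V) (E := E)
    (st := st₁) hs.paramFits (by rw [coins₁]; rfl) start₁ heok hem
  obtain ⟨ok₃, sound₃, star₃⟩ := solve_wp (E := E) hshape hfits holds₂ basis₂.flag
  set st₂ := (setParams l e).denote E st₁ with hst₂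
  have hS₂ : (layout l).S + 4 ≤ 2 ^ V := le_trans hS hAV
  have htop₂ : (mainPhase l e).top (layout l) 0 ≤ A := (htop.trans hCp).trans hlA
  have ok₂₃ : (mainPhase l e).Ok (layout l) A V E st₁ := ⟨ok₂, ok₃⟩
  obtain ⟨mem₃, t₃, reach₃, rep₃, -⟩ := Stmt.run (E := E) (P := program l C e)
    (A := A) (V := V) (layout l) hAV
    hS₂ hσ (mainPhase l e) 0 _ st₁ mem₁ t₁ code₂ hw₁ rep₁ ok₂₃ htop₂
  have hsteps : (mainPhase l e).steps E st₁ ≤ steps₂ l c₀ m c p e := by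
    refine Nat.add_le_add ?_ ?_
    · refine ((settled_setParams l e).steps_le _ st₁).trans ?_
      have hb : ∀ k, primeBits m c k ≤ m + c₀ + 2 := by
        intro k
        have := hs.c_le
        unfold primeBits; split_ifs <;> omega
      refine (cost_setParams_le (l := l) (n := E.inp 0) (r := p ^ 3) (b := m + c₀ + 2) _ e ?_ ?_ ?_
        ?_ ?_ ?_).trans ?_
      · exact basis₂.r3.le
      · rw [w₂]; have := hs.m_le_n; omega
      · intro j hj
        rw [holds₂.lenE j hj]; exact firstPart_le hs.m_le hs.c_eq hj
      · intro j hj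
        rw [holds₂.lenB j hj]; exact secondPart_le hs.m_le hs.c_eq j
      · intro k h1 h2
        rw [bits₂.bits k h1 h2]; exact hb k
      · intro k h1 h2
        rw [bits₂.pw k h1 h2]; exact Nat.pow_le_pow_right (by norm_num) (hb k)
      · gcongr; omega
    · exact steps_solve_le hshape holds₂ (hs.costBound hpr) E
  refine ⟨_, _, (mainPhase l e).denote E st₁, reach₁.mono (steps_reduce_le hC hl hA₁' hV₁),
    reach₃.mono hsteps, ?_, ?_, ?_, sound₃, star₃⟩
  · change (program l C e)[_]? = none
    rw [List.getElem?_eq_none_iff]; simp [program]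
  · exact rep₃.reg (.sc .flag)
  · have := rep₃.arr .out (by simp [layout, Ar.num]) 0
    simpa [layout, Ar.num, cell] using this

end

/-! ### Time, space and the answer -/

/-- What the program runs in, on the instance `I` with coin flips `ω`. -/
def env (σ : ℝ) (I : Instance) (ω : ℕ → Bool) : Env := ⟨σ, I.input, ω⟩

section

variable {σ : ℝ} {P : Program} {I : Instance} {ω : ℕ → Bool}

lemma Config.Halted.iterate {c : Config} (h : c.Halted P) (k : ℕ) :
    (Config.step σ P I.input ω)^[k] c = c := by
  have h1 : c.step σ P I.input ω = c := by
    unfold Config.step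
    rw [show P[c.pc]? = none from h]
  induction k with
  | zero => rfl
  | succ k ih => rw [Function.iterate_succ_apply', ih, h1]

lemma bounds_of_reach {A₁ V₁ N₁ A₂ V₂ N₂ : ℕ} {c₁ c₂ : Config}
    (h₁ : Reach (env σ I ω) P A₁ V₁ N₁ Config.start c₁) (h₂ : Reach (env σ I ω) P A₂ V₂ N₂ c₁ c₂)
    (h : c₂.Halted P) :
    (∃ k, run σ P I ω k = c₂) ∧ c₂.time ≤ N₁ * (1 + V₁) ^ 2 + N₂ * (1 + V₂) ^ 2 ∧
    ∀ k, (run σ P I ω k).space ≤ A₁ * (Nat.size A₁ + V₁) + A₂ * (Nat.size A₂ + V₂) := by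
  obtain ⟨k₁, hk₁, e₁, t₁, w₁⟩ := h₁
  obtain ⟨k₂, hk₂, e₂, t₂, w₂⟩ := h₂
  have hrun : ∀ j, run σ P I ω (j + k₁) = (Config.step σ P I.input ω)^[j] c₁ := by
    intro j
    change (Config.step σ P I.input ω)^[j + k₁] Config.start = _
    rw [Function.iterate_add_apply]; exact congrArg _ e₁
  refine ⟨⟨k₂ + k₁, (hrun _).trans e₂⟩, ?_, fun k => ?_⟩
  · have := Nat.mul_le_mul_right ((1 + V₁) ^ 2) hk₁
    have := Nat.mul_le_mul_right ((1 + V₂) ^ 2) hk₂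
    have h0 : Config.start.time = 0 := rfl; omega
  · rcases le_total k k₁ with hk | hk
    · exact (w₁ k hk).space_le.trans (Nat.le_add_right _ _)
    · obtain ⟨j, rfl⟩ := Nat.exists_eq_add_of_le' hk
      rw [hrun]
      rcases le_total j k₂ with hj | hj
      · exact (w₂ j hj).space_le.trans (Nat.le_add_left _ _)
      · obtain ⟨i, rfl⟩ := Nat.exists_eq_add_of_le' hj
        rw [Function.iterate_add_apply, show (Config.step σ P I.input ω)^[k₂] c₁ = c₂ from e₂,
          h.iterate, ← e₂]
        exact (w₂ k₂ le_rfl).space_le.trans (Nat.le_add_left _ _)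

end

/-- The sum of the items selected by `x`. -/
def selected (inp : ℕ → ℕ) (x : ℕ → Bool) : ℕ :=
  ∑ i ∈ Finset.range (inp 0), (x i).toNat * inp (i + 2)

/-- Modulo `N`, only the selections with sum `t` have sum `t`. -/
def GoodModulus (inp : ℕ → ℕ) (N : ℕ) : Prop :=
  ∀ x, selected inp x ≡ inp 1 [MOD N] → selected inp x = inp 1

section

variable {l C m c : ℕ} {I : Instance} {ω : ℕ → Bool}

/-- The selection of items that belongs to a vector. -/
def extension {n : ℕ} (y : Fin n → Bool) (i : ℕ) : Bool := if h : i < n then y ⟨i, h⟩ else false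

lemma selected_eq (I : Instance) (x : ℕ → Bool) :
    selected I.input x = ∑ i : Fin I.n, I.a i * (x i).toNat := by
  change ∑ i ∈ Finset.range I.n, _ = _
  rw [Finset.sum_range]
  refine Finset.sum_congr rfl fun i _ => ?_
  rw [mul_comm]; simp [Instance.input]

lemma isSolution_iff {x : ℕ → Bool} :
    (I.IsSolution fun i => x i) ↔ selected I.input x = I.input 1 := by
  rw [selected_eq]; rfl

lemma isSolution_extension {y : Fin I.n → Bool} (h : I.IsSolution y) :
    selected I.input (extension y) = I.input 1 := by
  rw [← isSolution_iff]
  convert h using 1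
  ext i
  simp [extension]

lemma sum_modEq (x : ℕ → Bool) : (theData l C m c I.input ω).sum x 0 I.n ≡ selected I.input x
    [MOD theModulus C I.input ω] := by
  change ∑ i ∈ Finset.Ico 0 I.n, (x i).toNat * (I.input (i + 2) % theModulus C I.input ω) ≡
    ∑ i ∈ Finset.range I.n, (x i).toNat * I.input (i + 2) [MOD _]
  rw [Nat.Ico_zero_eq_range]
  induction Finset.range I.n using Finset.induction_on with
  | empty => rfl
  | insert i s hi ih =>
    rw [Finset.sum_insert hi, Finset.sum_insert hi]; exact ((Nat.mod_modEq _ _).mul_left _).add ih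

lemma exists_star {x : ℕ → Bool} (h : selected I.input x = I.input 1)
    (hr : Rooms (theData l C m c I.input ω) x) :
    ∃ k ≤ I.input 0, ∃ x, Star (theData l C m c I.input ω)
      ((theData l C m c I.input ω).t + k * theModulus C I.input ω) x := by
  set D := theData l C m c I.input ω with hD
  set N := theModulus C I.input ω with hN
  have hN0 : 0 < N := modulus_pos _ _ _
  have h1 : D.sum x 0 I.n % N = I.input 1 % N := by rw [← h]; exact sum_modEq x
  refine ⟨D.sum x 0 I.n / N, ?_, x, hr, ?_⟩
  · have h2 : D.sum x 0 I.n ≤ I.n * N := by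
      refine (Finset.sum_le_card_nsmul _ _ N fun i _ => ?_).trans (by simp)
      exact (mul_le_of_le_one_left (Nat.zero_le _) (Bool.toNat_le _)).trans (Nat.mod_lt _ hN0).le
    exact Nat.div_le_of_le_mul (by rwa [mul_comm])
  · change D.sum x 0 I.n = I.input 1 % N + _
    rw [← h1, Nat.mod_add_div']

lemma isCorrectAnswer {c₂ : Config} {st : St Rg Ar} (h₀ : c₂.mem 0 = st.reg (.sc .flag))
    (h₁ : c₂.mem 1 = st.arr .out 0) (hs : Sound (theData l C m c I.input ω) st)
    (hc : (∃ k ≤ I.input 0, ∃ x, Star (theData l C m c I.input ω)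
      ((theData l C m c I.input ω).t + k * theModulus C I.input ω) x) → st.reg (.sc .flag) ≠ 0)
    (hN : GoodModulus I.input (theModulus C I.input ω))
    (hr : ∀ y, I.IsSolution y → ∃ y', I.IsSolution y' ∧
      Rooms (theData l C m c I.input ω) (extension y')) :
    I.IsCorrectAnswer (c₂.answer I.n) := by
  unfold Config.answer
  split_ifs with h
  · intro y hy
    obtain ⟨y', hy', hr⟩ := hr y hy
    exact hc (exists_star (isSolution_extension hy') hr) (by rw [← h₀, h])
  · obtain ⟨X, ⟨x, hx⟩, ⟨k, -, hk⟩, ho⟩ := hs (by rwa [h₀] at h)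
    have hn : (theData l C m c I.input ω).n ≤ (theData l C m c I.input ω).n := le_rfl
    rw [hx, val_div x hn] at hk
    rw [hx, val_mod x hn] at ho
    have h2 : selected I.input x = I.input 1 := by
      refine hN x ((sum_modEq (l := l) (m := m) (c := c) x).symm.trans ?_)
      change (theData l C m c I.input ω).sum x 0 I.n = _ at hk
      rw [hk]
      change (I.input 1 % theModulus C I.input ω + k * theModulus C I.input ω) % _ = _
      rw [Nat.add_mul_mod_self_right, Nat.mod_mod]
    have h3 : (fun i : Fin I.n => (c₂.mem 1).testBit i) = fun i : Fin I.n => x i := by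
      funext i
      rw [h₁, ho]; exact testBit_sum x i.2
    change I.IsSolution _
    rw [h3]; exact isSolution_iff.2 h2

end

section

variable {σ : ℝ} {l c₀ C m c : ℕ} {I : Instance} {e : Expr Rg Ar}

/-- The hypotheses on the program: `C` is large, and `e` computes the block size `m`. -/
structure Suits (σ : ℝ) (l c₀ C m c : ℕ) (I : Instance) (e : Expr Rg Ar) : Prop where
  le_one : σ ≤ 1
  sizes : Sizes l c₀ I.n m c (param C I.input)
  top_le : (mainPhase l e).top (layout l) 0 ≤ C
  eval : ∀ ω, ∀ st : St Rg Ar, st.reg (.sc .n) = I.input 0 → e.eval (env σ I ω) st = m ∧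
    e.Ok (layout l) (addresses l c₀ m (param C I.input)) (2 * param C I.input ^ 5 + 3) (env σ I ω) st

lemma Suits.runsWithin (h : Suits σ l c₀ C m c I e) (ω : ℕ → Bool) :
    (∃ k, (run σ (program l C e) I ω k).Halted (program l C e) ∧
      (run σ (program l C e) I ω k).time ≤
        1000 * (param C I.input ^ 4 + Nat.size (total I.input)) * (1 + bits₁ l C I.input) ^ 2 +
        steps₂ l c₀ m c (param C I.input) e * (1 + (2 * param C I.input ^ 5 + 3)) ^ 2) ∧
    ∀ k, (run σ (program l C e) I ω k).space ≤
      addresses₁ l I.n * (Nat.size (addresses₁ l I.n) + bits₁ l C I.input) +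
      addresses l c₀ m (param C I.input) * (Nat.size (addresses l c₀ m (param C I.input)) +
        (2 * param C I.input ^ 5 + 3)) := by
  obtain ⟨c₁, c₂, st, r₁, r₂, hh, -⟩ := exec_program (E := env σ I ω) h.le_one h.sizes h.top_le
    (h.eval ω)
  obtain ⟨⟨k, hk⟩, ht, hsp⟩ := bounds_of_reach r₁ r₂ hh
  exact ⟨⟨k, by rwa [hk], by rwa [hk]⟩, hsp⟩

lemma Suits.answersCorrectly (h : Suits σ l c₀ C m c I e) {ω : ℕ → Bool}
    (hN : GoodModulus I.input (theModulus C I.input ω))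
    (hr : ∀ y, I.IsSolution y → ∃ y', I.IsSolution y' ∧
      Rooms (theData l C m c I.input ω) (extension y')) :
    AnswersCorrectly σ (program l C e) I ω := by
  obtain ⟨c₁, c₂, st, r₁, r₂, hh, h₀, h₁, hs, hc⟩ := exec_program (E := env σ I ω) h.le_one h.sizes
    h.top_le (h.eval ω)
  obtain ⟨⟨k, hk⟩, -⟩ := bounds_of_reach r₁ r₂ hh
  exact ⟨k, by rwa [hk], by rw [hk]; exact isCorrectAnswer h₀ h₁ hs hc hN hr⟩

end

/-! ### Probabilities of coin flips -/

open MeasureTheory ProbabilityTheory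

instance : IsProbabilityMeasure coinLaw := by unfold coinLaw; infer_instance

/-- The event `A` depends on the coins before number `s` only. -/
def Before (s : ℕ) (A : Set (ℕ → Bool)) : Prop :=
  ∀ ω ω' : ℕ → Bool, (∀ i < s, ω i = ω' i) → ω ∈ A → ω' ∈ A

variable {s b r k : ℕ} {A : Set (ℕ → Bool)} {F : (ℕ → Bool) → Finset ℕ}

lemma Before.preimage (h : Before s A) : A = (Finset.range s).restrict ⁻¹'
    ((Finset.range s).restrict '' A : Set ((i : Finset.range s) → Bool)) := by
  refine Set.Subset.antisymm (Set.subset_preimage_image _ _) ?_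
  rintro ω ⟨ω', h', e⟩
  exact h ω' ω (fun i hi => congrFun e ⟨i, Finset.mem_range.2 hi⟩) h'

lemma Before.measurableSet (h : Before s A) : MeasurableSet A := by
  rw [h.preimage]; exact (Finset.measurable_restrict _) (Set.toFinite _).measurableSet

lemma Before.mono (h : Before s A) {s' : ℕ} (hs : s ≤ s') : Before s' A :=
  fun ω ω' e => h ω ω' fun i hi => e i (by omega)

lemma draw_congr {ω ω' : ℕ → Bool} (h : ∀ i < s + b, ω i = ω' i) : draw ω s b = draw ω' s b := by
  induction b with
  | zero => rfl
  | succ b ih => rw [draw, draw, ih fun i hi => h i (by omega), h (s + b) (by omega)]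

lemma measure_bit (h : Before s A) (β : Bool) :
    coinLaw.real (A ∩ {ω | ω s = β}) = coinLaw.real A / 2 := by
  have hi : iIndepFun (fun (i : ℕ) (ω : ℕ → Bool) => ω i) coinLaw :=
    iIndepFun_infinitePi (X := fun _ => id) fun _ => measurable_id
  have h2 := hi.indepFun_finset (Finset.range s) {s} (by simp) fun i => measurable_pi_apply i
  have h3 := congrArg ENNReal.toReal (h2.measure_inter_preimage_eq_mul
    ((Finset.range s).restrict '' A) {f | f ⟨s, by simp⟩ = β} (Set.toFinite _).measurableSet
    (Set.toFinite _).measurableSet)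
  rw [ENNReal.toReal_mul] at h3
  have h4 : coinLaw.real {ω | ω s = β} = 1 / 2 := by
    have := Measure.infinitePi_map_eval (fun _ : ℕ => (PMF.uniformOfFintype Bool).toMeasure) s
    have h5 : coinLaw.real {ω | ω s = β} = (PMF.uniformOfFintype Bool).toMeasure.real {β} := by
      rw [← this, map_measureReal_apply (measurable_pi_apply s) (measurableSet_singleton β)]; rfl
    rw [h5, Measure.real, PMF.toMeasure_apply_singleton _ _ (measurableSet_singleton β)]; simp
  change coinLaw.real ((Finset.range s).restrict ⁻¹' _ ∩ {ω | ω s = β}) =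
    coinLaw.real ((Finset.range s).restrict ⁻¹' _) * coinLaw.real {ω | ω s = β} at h3
  rw [← h.preimage, h4] at h3
  rw [h3]; ring

lemma measure_draw (h : Before s A) {v : ℕ} (hv : v < 2 ^ b) :
    coinLaw.real (A ∩ {ω | draw ω s b = v}) = coinLaw.real A / 2 ^ b := by
  induction b generalizing v with
  | zero =>
    obtain rfl : v = 0 := by simpa using hv
    simp [draw]
  | succ b ih =>
    have e : A ∩ {ω | draw ω s (b + 1) = v} =
        (A ∩ {ω | draw ω s b = v / 2}) ∩ {ω | ω (s + b) = (v % 2 == 1)} := by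
      ext ω
      simp only [draw, Set.mem_inter_iff, Set.mem_ofPred_eq, and_assoc]
      refine and_congr_right fun _ => ?_
      rcases Nat.mod_two_eq_zero_or_one v with h0 | h0 <;> cases ω (s + b) <;> simp [h0] <;> omega
    have hB : Before (s + b) (A ∩ {ω | draw ω s b = v / 2}) := fun ω ω' e hω =>
      ⟨h ω ω' (fun i hi => e i (by omega)) hω.1, (draw_congr e).symm.trans hω.2⟩
    rw [e, measure_bit hB, ih (by rw [pow_succ] at hv; omega), pow_succ]; ring

/-- Double counting: the sum of the probabilities of some events is the expected number of those that
happen. -/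
lemma sum_measure {ι : Type*} (S : Finset ι) {B : ι → Set (ℕ → Bool)}
    (hB : ∀ i ∈ S, MeasurableSet (B i)) [∀ ω, DecidablePred fun i => ω ∈ B i] :
    ∑ i ∈ S, coinLaw.real (B i) = ∫ ω, ((S.filter fun i => ω ∈ B i).card : ℝ) ∂coinLaw ∧
    Integrable (fun ω => ((S.filter fun i => ω ∈ B i).card : ℝ)) coinLaw := by
  have e : (fun ω => ((S.filter fun i => ω ∈ B i).card : ℝ)) =
      fun ω => ∑ i ∈ S, (B i).indicator 1 ω := by
    ext ω
    rw [Finset.card_filter, Nat.cast_sum]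
    refine Finset.sum_congr rfl fun i _ => ?_
    by_cases h : ω ∈ B i <;> simp [h]
  have hi : ∀ i ∈ S, Integrable ((B i).indicator (1 : (ℕ → Bool) → ℝ)) coinLaw := fun i hiS =>
    (integrable_const (1 : ℝ)).indicator (hB i hiS)
  rw [e]
  refine ⟨?_, integrable_finsetSum _ hi⟩
  rw [integral_finsetSum _ hi]
  exact Finset.sum_congr rfl fun i hiS => (integral_indicator_one (hB i hiS)).symm

/-- If at most `k` of some subevents of `A` happen at a time, their probabilities add up to at most `k`
times that of `A`. -/
lemma sum_measure_le {ι : Type*} {S : Finset ι} {B : ι → Set (ℕ → Bool)}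
    (hB : ∀ i ∈ S, MeasurableSet (B i)) (hA : MeasurableSet A) (hBA : ∀ i ∈ S, B i ⊆ A)
    (h : ∀ ω ∈ A, ∀ T ⊆ S, (∀ i ∈ T, ω ∈ B i) → T.card ≤ k) :
    ∑ i ∈ S, coinLaw.real (B i) ≤ k * coinLaw.real A := by
  classical
  obtain ⟨h1, h2⟩ := sum_measure S hB
  rw [h1, ← integral_indicator_one hA, ← integral_const_mul]
  refine integral_mono h2 (((integrable_const (1 : ℝ)).indicator hA).const_mul _) fun ω => ?_
  by_cases hω : ω ∈ A
  · simpa [hω] using h ω hω _ (Finset.filter_subset _ _) fun i hi => (Finset.mem_filter.1 hi).2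
  · have : S.filter (fun i => ω ∈ B i) = ∅ := Finset.filter_eq_empty_iff.2 fun i hi h' =>
      hω (hBA i hi h')
    simp [hω, this]

/-- Markov's inequality for the number of events that happen. -/
lemma le_sum_measure {ι : Type*} {S : Finset ι} {B : ι → Set (ℕ → Bool)}
    (hB : ∀ i ∈ S, MeasurableSet (B i)) (hA : MeasurableSet A)
    (h : ∀ ω ∈ A, ∃ T ⊆ S, (∀ i ∈ T, ω ∈ B i) ∧ k ≤ T.card) :
    k * coinLaw.real A ≤ ∑ i ∈ S, coinLaw.real (B i) := by
  classical
  obtain ⟨h1, h2⟩ := sum_measure S hB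
  rw [h1, ← integral_indicator_one hA, ← integral_const_mul]
  refine integral_mono (((integrable_const (1 : ℝ)).indicator hA).const_mul _) h2 fun ω => ?_
  by_cases hω : ω ∈ A
  · obtain ⟨T, hT, hT', hk⟩ := h ω hω
    have := hk.trans (Finset.card_le_card fun i hi => Finset.mem_filter.2 ⟨hT hi, hT' i hi⟩)
    simpa [hω] using this
  · simp [hω]

/-- A draw hits a set `F` of at most `k` numbers, which may depend on the earlier coins, with probability
at most `k / 2 ^ b`, also given an event `A` that depends on the earlier coins. -/
lemma measure_draw_mem (h : Before s A) (hF : ∀ ω ω', (∀ i < s, ω i = ω' i) → F ω = F ω')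
    (hk : ∀ ω, (F ω).card ≤ k) :
    coinLaw.real (A ∩ {ω | draw ω s b ∈ F ω}) ≤ k / 2 ^ b * coinLaw.real A := by
  have hB : ∀ v, Before s (A ∩ {ω | v ∈ F ω}) := fun v ω ω' e hω =>
    ⟨h ω ω' e hω.1, show v ∈ F ω' from hF ω ω' e ▸ hω.2⟩
  have h1 : A ∩ {ω | draw ω s b ∈ F ω} ⊆
      ⋃ v ∈ Finset.range (2 ^ b), (A ∩ {ω | v ∈ F ω}) ∩ {ω | draw ω s b = v} := by
    intro ω hω
    simp only [Set.mem_iUnion]; exact ⟨_, Finset.mem_range.2 (draw_lt ω s b), hω, rfl⟩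
  calc _ ≤ ∑ v ∈ Finset.range (2 ^ b), coinLaw.real ((A ∩ {ω | v ∈ F ω}) ∩ {ω | draw ω s b = v}) :=
        (measureReal_mono h1 (measure_ne_top _ _)).trans (measureReal_biUnion_finset_le _ _)
    _ = (∑ v ∈ Finset.range (2 ^ b), coinLaw.real (A ∩ {ω | v ∈ F ω})) / 2 ^ b := by
        rw [Finset.sum_div]
        exact Finset.sum_congr rfl fun v hv => measure_draw (hB v) (Finset.mem_range.1 hv)
    _ ≤ k * coinLaw.real A / 2 ^ b := by
        gcongr
        exact sum_measure_le (fun v _ => (hB v).measurableSet) h.measurableSet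
          (fun v _ => Set.inter_subset_left) fun ω _ T _ hT =>
            (Finset.card_le_card fun v hv => (hT v hv).2).trans (hk ω)
    _ = _ := by ring

/-- Some of `r` draws hits a small set. -/
lemma measure_exists_draw (h : Before s A) (hF : ∀ ω ω', (∀ i < s, ω i = ω' i) → F ω = F ω')
    (hk : ∀ ω, (F ω).card ≤ k) :
    coinLaw.real (A ∩ {ω | ∃ j < r, draw ω (s + j * b) b ∈ F ω}) ≤
      r * k / 2 ^ b * coinLaw.real A := by
  have h1 : A ∩ {ω | ∃ j < r, draw ω (s + j * b) b ∈ F ω} ⊆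
      ⋃ j ∈ Finset.range r, A ∩ {ω | draw ω (s + j * b) b ∈ F ω} := by
    rintro ω ⟨hω, j, hj, h'⟩
    simp only [Set.mem_iUnion]; exact ⟨j, Finset.mem_range.2 hj, hω, h'⟩
  refine (measureReal_mono h1 (measure_ne_top _ _)).trans ((measureReal_biUnion_finset_le _ _).trans ?_)
  refine (Finset.sum_le_card_nsmul _ _ _ fun j _ => measure_draw_mem
    (h.mono (Nat.le_add_right s (j * b))) (fun ω ω' e => hF ω ω' fun i hi => e i (by omega)) hk).trans
    (le_of_eq ?_)
  rw [Finset.card_range, nsmul_eq_mul]; ring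

/-- All of `r` draws hit a set that is not too large. -/
lemma measure_forall_draw (S : Finset ℕ) (s b r : ℕ) :
    coinLaw.real {ω | ∀ j < r, draw ω (s + j * b) b ∈ S} ≤ (S.card / 2 ^ b) ^ r := by
  induction r with
  | zero => simp
  | succ r ih =>
    have hB : Before (s + r * b) {ω | ∀ j < r, draw ω (s + j * b) b ∈ S} := by
      intro ω ω' e hω j hj
      rw [← draw_congr (ω := ω) fun i hi => e i (hi.trans_le ?_)]
      · exact hω j hj
      · have : (j + 1) * b ≤ r * b := Nat.mul_le_mul_right _ hj
        rw [add_mul] at this; omega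
    have e : {ω | ∀ j < r + 1, draw ω (s + j * b) b ∈ S} ⊆
        {ω | ∀ j < r, draw ω (s + j * b) b ∈ S} ∩ {ω | draw ω (s + r * b) b ∈ S} :=
      fun ω hω => ⟨fun j hj => hω j (by omega), hω r (by omega)⟩
    refine (measureReal_mono e (measure_ne_top _ _)).trans ((measure_draw_mem hB (F := fun _ => S) (fun _ _ _ => rfl)
      fun _ => le_rfl).trans ?_)
    rw [pow_succ, mul_comm]
    gcongr

/-- A weak form of Chebyshev's lower bound for the number of primes below a power of two. -/
lemma two_pow_le_card_primes (hb : 2 ≤ b) :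
    2 ^ b ≤ 4 * b * ((Finset.range (2 ^ b)).filter Nat.Prime).card := by
  have h1 := (Chebyshev.psi_ge (2 ^ b)).trans (Chebyshev.psi_le_primeCounting_mul_log (2 ^ b))
  have h2 : Real.log (((2 ^ b : ℕ) : ℝ) + 1) ≤ (b + 1) * Real.log 2 := by
    rw [← Nat.cast_succ b, ← Real.log_pow]
    refine Real.log_le_log (by positivity) ?_
    have : (1 : ℝ) ≤ 2 ^ b := one_le_pow₀ (by norm_num)
    push_cast
    rw [pow_succ]; linarith
  have h3 : Real.log ((2 ^ b : ℕ) : ℝ) = b * Real.log 2 := by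
    rw [Nat.cast_pow, Real.log_pow]; norm_num
  have h4 : ((2 ^ b : ℕ) : ℝ) ≤ Nat.primeCounting (2 ^ b) * b + (b + 1) := by
    have hl : 0 < Real.log 2 := Real.log_pos (by norm_num)
    rw [h3] at h1; nlinarith
  have h5 : 2 ^ b ≤ Nat.primeCounting (2 ^ b) * b + (b + 1) := by exact_mod_cast h4
  have h6 : Nat.primeCounting (2 ^ b) = ((Finset.range (2 ^ b)).filter Nat.Prime).card := by
    rw [Nat.primeCounting, Nat.primeCounting', Nat.count_succ, if_neg, add_zero, Nat.count_eq_card_filter_range]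
    exact Nat.Prime.not_prime_pow hb
  have h7 : 4 * (b + 1) ≤ 3 * 2 ^ b := by
    induction b, hb using Nat.le_induction with
    | base => norm_num
    | succ b hb _ =>
      have := Nat.lt_two_pow_self (n := b)
      rw [pow_succ]; omega
  rw [h6] at h5; nlinarith

lemma card_primeFactors_le {d B : ℕ} (hd : d ≠ 0) (hB : d < 2 ^ B) : d.primeFactors.card ≤ B := by
  have h1 : 2 ^ d.primeFactors.card ≤ d := by
    refine le_trans ?_ (Nat.le_of_dvd (Nat.pos_of_ne_zero hd) (Nat.prod_primeFactors_dvd d))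
    rw [← Finset.prod_const]
    exact Finset.prod_le_prod' fun p hp => (Nat.prime_of_mem_primeFactors hp).two_le
  exact ((Nat.pow_lt_pow_iff_right (by norm_num)).1 (h1.trans_lt hB)).le

/-- The bound for the probability that many trials fail. -/
lemma trials_le {x : ℝ} {lam : ℕ} (h : 1000 ≤ lam) (h0 : 0 ≤ x) (hx : x ≤ 1 - 1 / (16 * lam)) :
    2 ^ lam * x ^ lam ^ 3 ≤ 1 / (lam : ℝ) := by
  have hl : (1000 : ℝ) ≤ lam := by exact_mod_cast h
  have h1 : x ≤ Real.exp (-(1 / (16 * lam))) := hx.trans (by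
    have := Real.add_one_le_exp (-(1 / (16 * lam : ℝ))); linarith)
  have h2 : x ^ lam ^ 3 ≤ Real.exp (-(2 * lam)) := by
    refine (pow_le_pow_left₀ h0 h1 _).trans ?_
    rw [← Real.exp_nat_mul]
    refine Real.exp_le_exp.2 ?_
    have : ((lam ^ 3 : ℕ) : ℝ) * -(1 / (16 * lam)) = -((lam : ℝ) * lam / 16) := by
      push_cast; field_simp
    rw [this]; nlinarith
  have h3 : (2 : ℝ) ^ lam ≤ Real.exp lam := by
    rw [← mul_one (lam : ℝ), Real.exp_nat_mul]
    exact pow_le_pow_left₀ (by norm_num) (by have := Real.add_one_le_exp 1; linarith) _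
  calc 2 ^ lam * x ^ lam ^ 3 ≤ Real.exp lam * Real.exp (-(2 * lam)) := by gcongr
    _ = 1 / Real.exp lam := by rw [← Real.exp_add, one_div, ← Real.exp_neg]; congr 1; ring
    _ ≤ 1 / lam := by
      gcongr
      have := Real.add_one_le_exp (lam : ℝ); linarith

/-! ### The probability of failure -/

/-- The number of coins that are flipped before the prime of level `i + 1` is drawn. -/
def coinsBefore (s r m c i : ℕ) : ℕ := s + ∑ k ∈ Finset.range i, r * primeBits m c (k + 1)

/-- One of the numbers drawn for level `i + 1` is a prime divisor of `d`. -/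
def Hit (s r m c : ℕ) (ω : ℕ → Bool) (i d : ℕ) : Prop :=
  ∃ k < r, draw ω (coinsBefore s r m c i + k * primeBits m c (i + 1)) (primeBits m c (i + 1)) ∈
    d.primeFactors

/-- A prime is drawn for level `i + 1`. -/
def FindsPrime (s r m c : ℕ) (ω : ℕ → Bool) (i : ℕ) : Prop :=
  ∃ k < r, (draw ω (coinsBefore s r m c i + k * primeBits m c (i + 1))
    (primeBits m c (i + 1))).Prime

section

variable {s r m c B W len q i lam : ℕ} {ω ω' : ℕ → Bool}

lemma coinsBefore_mono {j : ℕ} (h : i < j) {k : ℕ} (hk : k < r) :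
    coinsBefore s r m c i + k * primeBits m c (i + 1) + primeBits m c (i + 1) ≤
      coinsBefore s r m c j := by
  have h1 : coinsBefore s r m c (i + 1) ≤ coinsBefore s r m c j :=
    Nat.add_le_add_left (Finset.sum_le_sum_of_subset (Finset.range_mono h)) _
  have h2 : (k + 1) * primeBits m c (i + 1) ≤ r * primeBits m c (i + 1) :=
    Nat.mul_le_mul_right _ hk
  have h3 : coinsBefore s r m c (i + 1) = coinsBefore s r m c i + r * primeBits m c (i + 1) := by
    rw [coinsBefore, Finset.sum_range_succ, ← add_assoc]; rfl
  rw [add_mul] at h2; omega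

lemma Hit.congr {d : ℕ} (hi : i < q) (h : ∀ j < coinsBefore s r m c q, ω j = ω' j)
    (hd : Hit s r m c ω i d) : Hit s r m c ω' i d := by
  obtain ⟨k, hk, hd⟩ := hd
  refine ⟨k, hk, ?_⟩
  rwa [← draw_congr fun j hj => h j (hj.trans_le (coinsBefore_mono hi hk))]

lemma measure_hits {d : (ℕ → Bool) → ℕ} (hd : ∀ ω ω', (∀ i < s, ω i = ω' i) → d ω = d ω')
    (hB : ∀ ω, d ω < 2 ^ B) (K : Finset ℕ) :
    coinLaw.real {ω | ∀ i ∈ K, Hit s r m c ω i (d ω)} ≤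
      ∏ i ∈ K, ((r * B / 2 ^ primeBits m c (i + 1) : ℝ)) := by
  induction K using Finset.induction_on_max with
  | empty => simp
  | insert a K ha ih =>
    have hs : s ≤ coinsBefore s r m c a := Nat.le_add_right _ _
    have h1 : Before (coinsBefore s r m c a) {ω | ∀ i ∈ K, Hit s r m c ω i (d ω)} :=
      fun ω ω' e hω i hi => hd ω ω' (fun j hj => e j (hj.trans_le hs)) ▸ (hω i hi).congr (ha i hi) e
    have h2 := measure_exists_draw (b := primeBits m c (a + 1)) (r := r) h1
      (F := fun ω => (d ω).primeFactors) (k := B)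
      (fun ω ω' e => by rw [hd ω ω' fun j hj => e j (hj.trans_le hs)])
      (fun ω => by
        rcases eq_or_ne (d ω) 0 with h0 | h0
        · simp [h0]
        · exact card_primeFactors_le h0 (hB ω))
    have hn : a ∉ K := fun h => lt_irrefl _ (ha a h)
    rw [Finset.prod_insert hn]
    refine le_trans (measureReal_mono ?_ (measure_ne_top _ _)) (h2.trans ?_)
    · exact fun ω hω => ⟨fun i hi => hω i (Finset.mem_insert_of_mem hi),
        hω a (Finset.mem_insert_self _ _)⟩
    · gcongr

open Classical in
/-- If the random primes thin out the `2 ^ len` numbers `d ω e` well below `W`, then probably fewer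
than `W` of them are zero modulo the primes of the levels `i + 1` with `i ∈ K`. -/
lemma measure_crowd {d : (ℕ → Bool) → ℕ → ℕ} {K : Finset ℕ}
    (hd : ∀ ω ω', (∀ i < s, ω i = ω' i) → d ω = d ω') (hB : ∀ ω e, d ω e < 2 ^ B)
    (hlam : 0 < lam) (hW : lam * (2 ^ len * (r * B) ^ K.card) ≤
      W * 2 ^ ∑ i ∈ K, primeBits m c (i + 1)) (hW0 : 0 < W) :
    coinLaw.real {ω | W ≤ ((Finset.range (2 ^ len)).filter
      fun e => ∀ i ∈ K, Hit s r m c ω i (d ω e)).card} ≤ 1 / lam := by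
  set q := K.sup id + 1 with hq
  have hK : ∀ i ∈ K, i < q := fun i hi => Nat.lt_succ_of_le (Finset.le_sup (f := id) hi)
  have hs : s ≤ coinsBefore s r m c q := Nat.le_add_right _ _
  have h1 : ∀ e, Before (coinsBefore s r m c q) {ω | ∀ i ∈ K, Hit s r m c ω i (d ω e)} :=
    fun e ω ω' h hω i hi => hd ω ω' (fun j hj => h j (hj.trans_le hs)) ▸ (hω i hi).congr (hK i hi) h
  have h2 : Before (coinsBefore s r m c q) {ω | W ≤ ((Finset.range (2 ^ len)).filter
      fun e => ∀ i ∈ K, Hit s r m c ω i (d ω e)).card} := fun ω ω' h hω =>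
    le_trans hω (Finset.card_le_card
      (Finset.monotone_filter_right _ fun e _ he => h1 e ω ω' h he))
  have h3 := (le_sum_measure (S := Finset.range (2 ^ len)) (k := W)
    (fun e _ => (h1 e).measurableSet) h2.measurableSet fun ω hω =>
      ⟨_, Finset.filter_subset _ _, fun e he => (Finset.mem_filter.1 he).2, hω⟩).trans
    (Finset.sum_le_card_nsmul _ _ _ fun e _ => measure_hits (fun ω ω' h => congrFun (hd ω ω' h) e)
      (fun ω => hB ω e) K)
  rw [Finset.card_range, nsmul_eq_mul, Finset.prod_div_distrib, Finset.prod_const,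
    Finset.prod_pow_eq_pow_sum] at h3
  have hW' : (lam * (2 ^ len * (r * B) ^ K.card) : ℝ) ≤
      W * 2 ^ ∑ i ∈ K, primeBits m c (i + 1) := by exact_mod_cast hW
  rw [le_div_iff₀ (by exact_mod_cast hlam)]
  have hW0' : (0 : ℝ) < W := by exact_mod_cast hW0
  refine le_of_mul_le_mul_left ?_ hW0'
  rw [← mul_div_assoc, le_div_iff₀ (by positivity)] at h3
  refine le_of_mul_le_mul_right ?_ (show (0 : ℝ) < 2 ^ ∑ i ∈ K, primeBits m c (i + 1) by positivity)
  push_cast at h3; nlinarith [show (0 : ℝ) < lam by exact_mod_cast hlam]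

lemma lastPrime_eq {s b r : ℕ} (h : ∃ k < r, (draw ω (s + k * b) b).Prime) :
    ∃ k < r, lastPrime ω s b r = draw ω (s + k * b) b := by
  induction r with
  | zero => simp at h
  | succ r ih =>
    rw [lastPrime]
    split_ifs with hp
    · exact ⟨r, Nat.lt_succ_self r, rfl⟩
    · obtain ⟨k, hk, h⟩ := h
      obtain ⟨k', hk', e⟩ := ih ⟨k, lt_of_le_of_ne (Nat.le_of_lt_succ hk) (by rintro rfl; exact hp h), h⟩
      exact ⟨k', by omega, e⟩

lemma FindsPrime.hit {d : ℕ} (h : FindsPrime s r m c ω i) (hd : d ≠ 0)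
    (hp : primes ω s r m c (i + 1) ∣ d) : Hit s r m c ω i d := by
  obtain ⟨k, hk, e⟩ := lastPrime_eq h
  exact ⟨k, hk, Nat.mem_primeFactors.2 ⟨e ▸ lastPrime_prime _ _ _ _, e ▸ hp, hd⟩⟩

lemma measure_not_findsPrime (h : 1000 ≤ lam) (hb : primeBits m c (i + 1) ≤ lam) :
    coinLaw.real {ω | ¬ FindsPrime s (lam ^ 3) m c ω i} ≤ 1 / lam := by
  set b := primeBits m c (i + 1) with hbdef
  have hb2 : 2 ≤ b := by rw [hbdef]; unfold primeBits; split_ifs <;> omega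
  have h1 := measure_forall_draw ((Finset.range (2 ^ b)).filter fun p => ¬ p.Prime)
    (coinsBefore s (lam ^ 3) m c i) b (lam ^ 3)
  have h2 := two_pow_le_card_primes hb2
  have h3 := Finset.card_filter_add_card_filter_not (s := Finset.range (2 ^ b)) Nat.Prime
  rw [Finset.card_range] at h3
  set S := (Finset.range (2 ^ b)).filter fun p => ¬ p.Prime
  have h4 : (S.card / 2 ^ b : ℝ) ≤ 1 - 1 / (16 * lam) := by
    have h5 : (2 ^ b : ℝ) ≤ 4 * b * ((Finset.range (2 ^ b)).filter Nat.Prime).card := by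
      exact_mod_cast h2
    have h6 : (((Finset.range (2 ^ b)).filter Nat.Prime).card + S.card : ℝ) = 2 ^ b := by
      exact_mod_cast h3
    have hl : (1000 : ℝ) ≤ lam := by exact_mod_cast h
    have hb' : (b : ℝ) ≤ lam := by exact_mod_cast hb
    have h7 : (2 ^ b : ℝ) / (16 * lam) ≤ ((Finset.range (2 ^ b)).filter Nat.Prime).card := by
      rw [div_le_iff₀ (by positivity)]
      nlinarith [Nat.cast_nonneg (α := ℝ) ((Finset.range (2 ^ b)).filter Nat.Prime).card]
    rw [div_le_iff₀ (by positivity), sub_mul, one_mul, one_div_mul_eq_div]; linarith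
  have h8 := trials_le h (by positivity) h4
  refine le_trans (measureReal_mono ?_ (measure_ne_top _ _)) (h1.trans (le_trans ?_ h8))
  · intro ω hω k hk
    exact Finset.mem_filter.2 ⟨Finset.mem_range.2 (draw_lt _ _ _), fun hp => hω ⟨k, hk, hp⟩⟩
  · exact le_mul_of_one_le_left (by positivity) (one_le_pow₀ (by norm_num))

end

section

variable {lam B d : ℕ}

/-- A number `q + 1` does not divide `d` if it is one of the primes below `2 ^ (2 lam)` that do not
divide `d`. These are so many that each of the factors of the modulus is one with probability at least
`1 / (16 lam)`. -/
lemma measure_modulus_dvd (h : 1000 ≤ lam) (hd : d ≠ 0) (hB : d < 2 ^ B) (hl : B ≤ 2 ^ lam) :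
    2 ^ lam * coinLaw.real {ω | modulus ω (2 * lam) (lam ^ 3) ∣ d} ≤ 1 / lam := by
  set b := 2 * lam with hb
  set S := (Finset.range (2 ^ b)).filter fun q => q + 1 ∣ d
  have h1 := measure_forall_draw S 0 b (lam ^ 3)
  have h2 := two_pow_le_card_primes (b := b) (by omega)
  set T := (Finset.range (2 ^ b)).filter Nat.Prime
  have h3 : S.card + T.card ≤ 2 ^ b + 2 ^ lam := by
    have e1 : T ⊆ (Finset.range (2 ^ b) \ S).image (· + 1) ∪ d.primeFactors := by
      intro p hp
      obtain ⟨hp1, hp2⟩ := Finset.mem_filter.1 hp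
      have hp3 := Finset.mem_range.1 hp1
      have := hp2.pos
      rw [Finset.mem_union, Finset.mem_image]
      by_cases hpd : p ∣ d
      · exact Or.inr (Nat.mem_primeFactors.2 ⟨hp2, hpd, hd⟩)
      · refine Or.inl ⟨p - 1, Finset.mem_sdiff.2 ⟨Finset.mem_range.2 (by omega), fun hS => hpd ?_⟩,
          by omega⟩
        have := (Finset.mem_filter.1 hS).2
        rwa [Nat.sub_add_cancel hp2.pos] at this
    have e2 := (Finset.card_le_card e1).trans ((Finset.card_union_le _ _).trans
      (Nat.add_le_add_right Finset.card_image_le _))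
    have e3 := card_primeFactors_le hd hB
    have e0 : S ⊆ Finset.range (2 ^ b) := Finset.filter_subset _ _
    have e4 := Finset.card_le_card e0
    rw [Finset.card_sdiff_of_subset e0] at e2
    rw [Finset.card_range] at e2 e4; omega
  have h4 : (S.card / 2 ^ b : ℝ) ≤ 1 - 1 / (16 * lam) := by
    have h5 : (2 ^ b : ℝ) ≤ 8 * lam * T.card := by
      have : 2 ^ b ≤ 8 * lam * T.card := by rw [hb] at h2 ⊢; linarith
      exact_mod_cast this
    have h6 : (S.card + T.card : ℝ) ≤ 2 ^ b + 2 ^ lam := by exact_mod_cast h3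
    have hl : (1000 : ℝ) ≤ lam := by exact_mod_cast h
    have h7 : (2 ^ b : ℝ) / (8 * lam) ≤ T.card := by rw [div_le_iff₀ (by positivity)]; linarith
    have h8 : (2 ^ lam : ℝ) ≤ 2 ^ b / (16 * lam) := by
      rw [le_div_iff₀ (by positivity), hb, two_mul, pow_add]
      gcongr
      have e : 16 * lam ≤ 2 ^ lam := by
        obtain ⟨k, rfl⟩ := Nat.exists_eq_add_of_le' (show 5 ≤ lam by omega)
        have := Nat.lt_two_pow_self (n := k)
        rw [pow_add]; omega
      exact_mod_cast e
    have h9 : (2 ^ b : ℝ) / (8 * lam) = 2 * (2 ^ b / (16 * lam)) := by field_simp; norm_num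
    rw [div_le_iff₀ (by positivity), sub_mul, one_mul, one_div_mul_eq_div]; linarith
  refine le_trans ?_ (trials_le h (by positivity) h4)
  gcongr
  refine le_trans (measureReal_mono ?_ (measure_ne_top _ _)) h1
  intro ω hω k hk
  rw [zero_add]
  exact Finset.mem_filter.2 ⟨Finset.mem_range.2 (draw_lt _ _ _),
    (Finset.dvd_prod_of_mem (fun k => draw ω (k * b) b + 1) (Finset.mem_range.2 hk)).trans hω⟩

lemma selected_le_total (inp : ℕ → ℕ) (x : ℕ → Bool) : selected inp x + inp 1 ≤ total inp := by
  have : selected inp x ≤ ∑ i ∈ Finset.range (inp 0), inp (i + 2) :=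
    Finset.sum_le_sum fun i _ => mul_le_of_le_one_left (Nat.zero_le _) (Bool.toNat_le _)
  unfold total; omega

/-- Modulo the random modulus, probably no wrong selection has the right sum. -/
lemma measure_not_goodModulus (C : ℕ) (inp : ℕ → ℕ) (h : 1000 ≤ param C inp) :
    coinLaw.real {ω | ¬ GoodModulus inp (theModulus C inp ω)} ≤ 1 / param C inp := by
  set lam := param C inp with hlam
  set sel : Finset ℕ → ℕ → Bool := fun s i => decide (i ∈ s)
  -- a union bound over the at most `2 ^ lam` wrong selections
  set G : Finset (Finset ℕ) :=
    (Finset.range (inp 0)).powerset.filter fun s => selected inp (sel s) ≠ inp 1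
  set d : Finset ℕ → ℕ := fun s => ((selected inp (sel s) : ℤ) - inp 1).natAbs
  have h1 : {ω | ¬ GoodModulus inp (theModulus C inp ω)} ⊆
      ⋃ s ∈ G, {ω | modulus ω (2 * lam) (lam ^ 3) ∣ d s} := by
    intro ω hω
    obtain ⟨x, hx, hne⟩ : ∃ x, selected inp x ≡ inp 1 [MOD theModulus C inp ω] ∧
        selected inp x ≠ inp 1 := by simpa [GoodModulus] using hω
    have e : selected inp x = selected inp (sel ((Finset.range (inp 0)).filter fun i => x i)) :=
      Finset.sum_congr rfl fun i hi => by simp [sel, Finset.mem_range.1 hi]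
    simp only [Set.mem_iUnion]
    refine ⟨_, Finset.mem_filter.2 ⟨Finset.mem_powerset.2 (Finset.filter_subset _ _), e ▸ hne⟩, ?_⟩
    have h2 := Int.natCast_dvd.1 ((Nat.modEq_iff_dvd.1 hx.symm))
    rwa [e] at h2
  have h2 : ∀ s ∈ G, coinLaw.real {ω | modulus ω (2 * lam) (lam ^ 3) ∣ d s} ≤
      1 / lam / 2 ^ lam := by
    intro s hs
    have hne := (Finset.mem_filter.1 hs).2
    have hle := selected_le_total inp (sel s)
    rw [le_div_iff₀ (by positivity), mul_comm]
    refine measure_modulus_dvd (B := Nat.size (total inp)) h ?_ ?_ ?_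
    · simp only [d]; omega
    · have := Nat.lt_size_self (total inp); simp only [d]; omega
    · refine (Nat.size_le.1 ?_).le
      rw [hlam, param]; omega
  have h3 : G.card ≤ 2 ^ lam := (Finset.card_filter_le _ _).trans (by
    rw [Finset.card_powerset, Finset.card_range]
    exact Nat.pow_le_pow_right (by norm_num) (by rw [hlam, param]; omega))
  calc _ ≤ ∑ s ∈ G, coinLaw.real {ω | modulus ω (2 * lam) (lam ^ 3) ∣ d s} :=
        (measureReal_mono h1 (measure_ne_top _ _)).trans (measureReal_biUnion_finset_le _ _)
    _ ≤ G.card * (1 / lam / 2 ^ lam) := by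
        rw [← nsmul_eq_mul]; exact Finset.sum_le_card_nsmul _ _ _ h2
    _ ≤ (2 ^ lam : ℕ) * (1 / lam / 2 ^ lam) := by gcongr
    _ = 1 / lam := by push_cast; field_simp

end

section

variable {l c₀ C m c lam : ℕ} {I : Instance} {x : ℕ → Bool}

/-- The difference between the sum of the items from `lo` on that are selected by the binary digits
of `e`, and the sum of those selected by `x`. -/
def Data.gap (D : Data) (x : ℕ → Bool) (lo len e : ℕ) : ℕ :=
  ((D.itemSum lo len e / D.Q : ℕ) - D.sum x lo (lo + len) : ℤ).natAbs

lemma gap_congr {D D' : Data} (hn : D.n = D'.n) (ha : D.a = D'.a) (x : ℕ → Bool) (lo len : ℕ) :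
    D.gap x lo len = D'.gap x lo len := by
  funext e
  simp only [gap, itemSum, Data.sum, w, Data.Q, hn, ha]

lemma gap_le {D : Data} {N lo len : ℕ} (ha : ∀ i, D.a i ≤ N) (h : lo + len ≤ D.n) (x : ℕ → Bool)
    (e : ℕ) : D.gap x lo len e ≤ D.n * N := by
  have h1 : ∀ y, D.sum y lo (lo + len) ≤ D.n * N := fun y => by
    refine (Finset.sum_le_card_nsmul _ _ N fun i _ =>
      (mul_le_of_le_one_left (Nat.zero_le _) (Bool.toNat_le _)).trans (ha i)).trans ?_
    rw [Nat.card_Ico, Nat.add_sub_cancel_left, smul_eq_mul]; exact Nat.mul_le_mul_right _ (by omega)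
  obtain ⟨y, hy⟩ := D.itemSum_sub lo len e
  have h2 := h1 x
  have h3 := h1 y
  unfold gap
  rw [hy, val_div y h]; omega

lemma modulus_congr {ω ω' : ℕ → Bool} {b r : ℕ} (h : ∀ i < r * b, ω i = ω' i) :
    modulus ω b r = modulus ω' b r := by
  refine Finset.prod_congr rfl fun k hk => ?_
  have : (k + 1) * b ≤ r * b := Nat.mul_le_mul_right _ (Finset.mem_range.1 hk)
  rw [add_mul] at this
  rw [draw_congr fun i hi => h i (by omega)]

/-- No bucket overflows if few sums agree with the right one modulo the primes. -/
lemma room_of_card_lt {inp : ℕ → ℕ} {ω : ℕ → Bool} {lo hi len W β : ℕ} {ok : ℕ → ℕ → Prop}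
    {K : Finset ℕ} (hhi : hi = lo + len) (h : hi ≤ inp 0)
    (hp : ∀ i ∈ K, FindsPrime (param C inp ^ 3 * (2 * param C inp)) (param C inp ^ 3) m c ω i)
    (hok : ∀ v, ok β v → (theData l C m c inp ω).Sub lo hi v ∧
      ∀ i ∈ K, v / (theData l C m c inp ω).Q ≡ (theData l C m c inp ω).sum x lo hi
        [MOD (theData l C m c inp ω).p (i + 1)])
    (hW : open Classical in ((Finset.range (2 ^ len)).filter fun e => ∀ i ∈ K,
      Hit (param C inp ^ 3 * (2 * param C inp)) (param C inp ^ 3) m c ω i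
        ((theData l C m c inp ω).gap x lo len e)).card < W) :
    Room (theData l C m c inp ω).Q W ok β := by
  classical
  set D := theData l C m c inp ω with hD
  subst hhi
  refine ⟨_, (Finset.card_insert_le (D.sum x lo (lo + len)) (Finset.image
    (fun e => D.itemSum lo len e / D.Q) _)).trans ((Nat.add_le_add_right
      Finset.card_image_le 1).trans hW), fun v hv => ?_⟩
  obtain ⟨hsub, hmod⟩ := hok v hv
  obtain ⟨e, he, rfl⟩ := exists_itemSum hsub rfl
  rw [Finset.mem_insert, Finset.mem_image]
  refine or_iff_not_imp_left.2 fun hne => ⟨e, Finset.mem_filter.2 ⟨Finset.mem_range.2 he,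
    fun i hi => (hp i hi).hit ?_ ?_⟩, rfl⟩
  · unfold gap; omega
  · exact Int.natCast_dvd.1 (Nat.modEq_iff_dvd.1 (hmod i hi).symm)

open Classical in
/-- `measure_crowd` for the differences between sums in a block: the instance is reduced modulo a
number below `2 ^ (2 lam ^ 4)`, so that these have at most `3 lam ^ 4` prime factors. -/
lemma measure_not_room {inp : ℕ → ℕ} (hs : Sizes l c₀ (inp 0) m c (param C inp)) {lo len W : ℕ}
    {K : Finset ℕ} (h : lo + len ≤ inp 0) (hW : param C inp * (2 ^ len * (param C inp ^ 8) ^ K.card) ≤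
      W * 2 ^ ∑ i ∈ K, primeBits m c (i + 1)) (hW0 : 0 < W) :
    coinLaw.real {ω | W ≤ ((Finset.range (2 ^ len)).filter fun e => ∀ i ∈ K,
      Hit (param C inp ^ 3 * (2 * param C inp)) (param C inp ^ 3) m c ω i
        ((theData l C m c inp ω).gap x lo len e)).card} ≤ 1 / param C inp := by
  set lam := param C inp with hlam
  have hl := hs.thousand_le
  refine measure_crowd (B := 3 * lam ^ 4) (fun ω ω' h => ?_) (fun ω e => ?_) (by omega) ?_ hW0
  · have e : theModulus C inp ω = theModulus C inp ω' := modulus_congr h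
    have ha : (theData l C m c inp ω).a = (theData l C m c inp ω').a := by
      simp only [theData, params, e]
    exact gap_congr (D := theData l C m c inp ω) (D' := theData l C m c inp ω') rfl ha x lo len
  · have h1 : theModulus C inp ω ≤ 2 ^ (2 * lam * lam ^ 3) := modulus_le _ _ _
    refine (gap_le (N := 2 ^ (2 * lam * lam ^ 3)) (fun i => ((Nat.mod_lt _ (modulus_pos _ _ _)).le.trans
      h1)) h x e).trans_lt ?_
    have h2 : inp 0 < 2 ^ lam := lt_of_le_of_lt (by have := hs.le_lam; omega) Nat.lt_two_pow_self
    refine (Nat.mul_lt_mul_of_pos_right h2 (by positivity)).trans_le ?_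
    rw [← pow_add]
    refine Nat.pow_le_pow_right (by norm_num) ?_
    have e : 2 * lam * lam ^ 3 = 2 * lam ^ 4 := by ring
    have : lam ≤ lam ^ 4 := Nat.le_self_pow (by norm_num) lam; omega
  · refine le_trans ?_ hW
    gcongr
    calc lam ^ 3 * (3 * lam ^ 4) = 3 * lam ^ 7 := by ring
      _ ≤ lam * lam ^ 7 := Nat.mul_le_mul_right _ (by omega)
      _ = lam ^ 8 := by ring

lemma sum_primeBits (m c q : ℕ) :
    ∑ i ∈ Finset.range (q + 1), primeBits m c (i + 1) = c + 2 + q * (m + 2) := by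
  rw [Finset.sum_range_succ']; simp [primeBits, add_comm]

lemma Suits.measure_answersCorrectly {σ : ℝ} {e : Expr Rg Ar} (h : Suits σ l c₀ C m c I e) :
    1 - (3 * l + 4 : ℕ) / (I.n + 1) ≤ coinLaw.real {ω | AnswersCorrectly σ (program l C e) I ω} := by
  classical
  have hs := h.sizes
  set inp := I.input
  set lam := param C inp with hlam
  -- Overflow is examined for the buckets of one solution `x`, chosen independently of the coins.
  obtain ⟨x, hx⟩ : ∃ x : ℕ → Bool, ∀ y, I.IsSolution y → ∃ y', I.IsSolution y' ∧ extension y' = x := by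
    by_cases hy : ∃ y, I.IsSolution y
    · obtain ⟨y, hy⟩ := hy
      exact ⟨extension y, fun _ _ => ⟨y, hy, rfl⟩⟩
    · exact ⟨fun _ => false, fun y h => (hy ⟨y, h⟩).elim⟩
  have hl1 : ∀ j ≤ l, max j 1 ≤ l := fun j hj => max_le hj hs.l_pos
  set off : ℕ → ℕ := (theData l C m c inp fun _ => false).off with hoff
  have hoffn : ∀ j ≤ l, off (j + 1) ≤ inp 0 := fun j hj =>
    ((theData l C m c inp fun _ => false).off_mono (by omega)).trans
      (off_params hs.m_le hs.c_eq).le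
  have hoff1 : ∀ j, off (j + 1) = off j + firstPart l (inp 0) m c j + secondPart m c j := fun j =>
    (theData l C m c inp fun _ => false).off_succ j
  -- The search can fail only if the modulus is bad (`EM`), no prime is found for some level (`EP`),
  -- or a bucket that matters overflows in a table `B j` (`EB`) or `T j` (`ET`).
  set EM : Set (ℕ → Bool) := {ω | ¬ GoodModulus inp (theModulus C inp ω)}
  set EP : ℕ → Set (ℕ → Bool) := fun i =>
    {ω | ¬ FindsPrime (lam ^ 3 * (2 * lam)) (lam ^ 3) m c ω i}
  set crowd : ℕ → ℕ → Finset ℕ → ℕ → Set (ℕ → Bool) := fun lo len K W =>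
    {ω | W ≤ ((Finset.range (2 ^ len)).filter fun e => ∀ i ∈ K,
      Hit (lam ^ 3 * (2 * lam)) (lam ^ 3) m c ω i
        ((theData l C m c inp ω).gap x lo len e)).card}
  set EB : ℕ → Set (ℕ → Bool) := fun j => crowd (off j + firstPart l (inp 0) m c j)
    (secondPart m c j) {max j 1 - 1} ((theData l C m c inp fun _ => false).W j)
  set ET : ℕ → Set (ℕ → Bool) := fun j => crowd (off j)
    (firstPart l (inp 0) m c j + secondPart m c j) (Finset.range (max j 1 + 1)) (lam ^ (9 * l + 9))
  have hEM : coinLaw.real EM ≤ 1 / lam := measure_not_goodModulus C inp hs.thousand_le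
  have hEP : ∀ i, coinLaw.real (EP i) ≤ 1 / lam := fun i =>
    measure_not_findsPrime hs.thousand_le ((primeBits_le hs.paramFits _).trans (by
      have := hs.le_lam; omega))
  have hlam0 := hs.thousand_le
  have hP0 : 0 < lam ^ (9 * l + 9) := by positivity
  have hEB : ∀ j ≤ l, coinLaw.real (EB j) ≤ 1 / lam := by
    intro j hj
    refine measure_not_room hs ((hoff1 j).symm.trans_le (hoffn j hj)) ?_ ?_
    · change _ ≤ (if j ≤ 1 then _ else _) * _
      rw [Finset.sum_singleton, Finset.card_singleton, Nat.sub_add_cancel (le_max_right j 1),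
        secondPart, primeBits]
      have h1 : lam * lam ^ 8 ≤ lam ^ (9 * l + 9) := by
        rw [← pow_succ']; exact Nat.pow_le_pow_right (by omega) (by omega)
      have h2 : ∀ {a b : ℕ}, a ≤ b → lam * (2 ^ a * (lam ^ 8) ^ 1) ≤ lam ^ (9 * l + 9) * 2 ^ b :=
        fun hab => by
          rw [pow_one, mul_left_comm, mul_comm]
          exact Nat.mul_le_mul h1 (Nat.pow_le_pow_right (by norm_num) hab)
      split_ifs <;> first | omega | skip
      · rw [mul_assoc, ← pow_add]; exact h2 (by omega)
      · exact h2 (by omega)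
    · change 0 < (if j ≤ 1 then _ else _)
      split_ifs <;> positivity
  have hET : ∀ j ≤ l, coinLaw.real (ET j) ≤ 1 / lam := by
    intro j hj
    refine measure_not_room hs (le_of_eq_of_le ((add_assoc _ _ _).symm.trans (hoff1 j).symm)
      (hoffn j hj)) ?_ hP0
    rw [Finset.card_range, sum_primeBits]
    have h1 := hl1 j hj
    have hlen : firstPart l (inp 0) m c j + secondPart m c j ≤ c + 2 + max j 1 * (m + 2) + l := by
      rcases Nat.eq_zero_or_pos j with rfl | hj0
      · have hd := Nat.lt_div_mul_add (a := inp 0 - (1 + l * (l + 1) / 2) * m) (b := l + 1) (by omega)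
        rw [show (inp 0 - _) / (l + 1) = c from hs.c_eq.symm] at hd
        have e1 : (1 + l * (l + 1) / 2) * m = m + l * (l + 1) / 2 * m := by ring
        have e2 : c * (l + 1) = l * c + c := by ring
        simp only [firstPart, secondPart, if_true, zero_le, max_eq_right, one_mul]; omega
      · rw [firstPart_add_secondPart hj0, max_eq_left hj0, mul_add]; omega
    calc _ ≤ lam * (2 ^ (c + 2 + max j 1 * (m + 2) + l) * (lam ^ 8) ^ (l + 1)) := by
          have : 1 ≤ lam ^ 8 := Nat.one_le_pow _ _ (by omega)
          gcongr
          norm_num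
      _ = lam * lam ^ (8 * (l + 1)) * 2 ^ l * 2 ^ (c + 2 + max j 1 * (m + 2)) := by
          rw [pow_add, pow_mul]; ring
      _ ≤ lam * lam ^ (8 * (l + 1)) * lam ^ l * 2 ^ (c + 2 + max j 1 * (m + 2)) := by gcongr; omega
      _ = _ := by ring
  have hsub : (Set.univ : Set (ℕ → Bool)) ⊆ {ω | AnswersCorrectly σ (program l C e) I ω} ∪ (EM ∪
      ⋃ j ∈ Finset.range (l + 1), (EP j ∪ (EB j ∪ ET j))) := by
    intro ω _
    refine or_iff_not_imp_right.2 fun hω => ?_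
    obtain ⟨hM, hω'⟩ := not_or.1 hω
    have hω : ∀ j ≤ l, (FindsPrime (lam ^ 3 * (2 * lam)) (lam ^ 3) m c ω j) ∧ ω ∉ EB j ∧
        ω ∉ ET j := fun j hj => by
      have := fun h => hω' (Set.mem_biUnion (Finset.mem_coe.2 (Finset.mem_range_succ_iff.2 hj)) h)
      have := not_or.1 this; exact ⟨not_not.1 this.1, not_or.1 this.2⟩
    refine h.answersCorrectly (not_not.1 hM) fun y hy => ?_
    obtain ⟨y', hy', rfl⟩ := hx y hy
    refine ⟨y', hy', fun j (hj : j ≤ l) => ?_, fun j (hj : j ≤ l) => ?_⟩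
    · refine room_of_card_lt (x := extension y') (K := {max j 1 - 1}) (off_succ _ j) (hoffn j hj)
        (fun i hi => (hω i ?_).1) (fun v hv => ⟨hv.1, fun i hi => ?_⟩) (not_le.1 (hω j hj).2.1)
      · have := hl1 j hj
        rw [Finset.mem_singleton.1 hi]; omega
      · rw [Finset.mem_singleton.1 hi, Nat.sub_add_cancel (le_max_right j 1)]; exact hv.2
    · refine room_of_card_lt (x := extension y') (K := Finset.range (max j 1 + 1))
        ((hoff1 j).trans (add_assoc _ _ _)) (hoffn j hj)
        (fun i hi => (hω i ?_).1) (fun v hv => ⟨hv.1, fun i hi => ?_⟩) (not_le.1 (hω j hj).2.2)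
      · have := hl1 j hj
        have := Finset.mem_range.1 hi; omega
      · rcases Nat.lt_succ_iff_lt_or_eq.1 (Finset.mem_range.1 hi) with hi | rfl
        · exact Nat.ModEq.of_dvd (Finset.dvd_prod_of_mem
            (fun k => (theData l C m c inp ω).p (k + 1)) (Finset.mem_range.2 hi)) hv.2.1
        · exact hv.2.2
  have h1 := (measureReal_mono hsub (measure_ne_top coinLaw _)).trans
    ((measureReal_union_le _ _).trans (add_le_add_right ((measureReal_union_le _ _).trans
      (add_le_add hEM (measureReal_biUnion_finset_le _ _))) _))
  have h2 : ∀ j ∈ Finset.range (l + 1), coinLaw.real (EP j ∪ (EB j ∪ ET j)) ≤ 3 * (1 / lam) := by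
    intro j hj
    have hj := Nat.le_of_lt_succ (Finset.mem_range.1 hj)
    have h3 := measureReal_union_le (μ := coinLaw) (EP j) (EB j ∪ ET j)
    have h4 := measureReal_union_le (μ := coinLaw) (EB j) (ET j)
    linarith [hEP j, hEB j hj, hET j hj]
  have h3 := Finset.sum_le_card_nsmul _ _ _ h2
  rw [Finset.card_range, nsmul_eq_mul] at h3
  rw [probReal_univ] at h1
  have h4 : (1 : ℝ) / lam ≤ 1 / (I.n + 1) := by
    have : (I.n : ℝ) + 1 ≤ lam := by
      have := hs.le_lam
      exact_mod_cast (show I.n + 1 ≤ lam by omega)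
    gcongr
  have h5 : ((3 * l + 4 : ℕ) : ℝ) / (I.n + 1) = (3 * l + 4) * (1 / (I.n + 1)) := by push_cast; ring
  rw [h5]
  push_cast at h3; nlinarith [Nat.cast_nonneg (α := ℝ) l]

end

/-! ### The tradeoff -/

open Polynomial

section polynomials

lemma eval_mono (p : ℕ[X]) {x y : ℕ} (h : x ≤ y) : p.eval x ≤ p.eval y := by
  simp only [eval_eq_sum_range]
  gcongr

lemma one_add_sum_le_prod {ι : Type*} (s : Finset ι) (f : ι → ℕ) :
    1 + ∑ i ∈ s, f i ≤ ∏ i ∈ s, 2 ^ Nat.size (f i) := by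
  classical
  induction s using Finset.induction_on with
  | empty => simp
  | insert i s hi ih =>
    rw [Finset.sum_insert hi, Finset.prod_insert hi]
    refine le_trans ?_ (Nat.mul_le_mul (Nat.lt_size_self (f i)) ih)
    nlinarith [Nat.zero_le (f i * ∑ i ∈ s, f i)]

lemma size_total_le (I : Instance) : Nat.size (total I.input) ≤ I.bitLength := by
  rw [Nat.size_le, Instance.bitLength, pow_add, pow_add, ← Finset.prod_pow_eq_pow_sum]
  have h1 := one_add_sum_le_prod Finset.univ I.a
  have h2 := Nat.lt_size_self I.t
  have h3 := Nat.lt_two_pow_self (n := I.n)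
  have h4 : total I.input = I.n + I.t + ∑ i, I.a i := by
    rw [total, Finset.sum_range]
    congr 1
    exact Finset.sum_congr rfl fun i _ => dif_pos i.2
  have h5 : (I.n + 1) * (I.t + 1) * (1 + ∑ i, I.a i) ≤ _ := Nat.mul_le_mul (Nat.mul_le_mul h3 h2) h1
  refine lt_of_lt_of_le ?_ h5
  rw [h4]
  have h6 := Nat.zero_le (I.n * I.t)
  have h7 := Nat.zero_le ((I.n * I.t + I.n + I.t) * ∑ i, I.a i); linarith

/-- A polynomial in `param`, times `2 ^ (e n)`, is within the bound `O*(2 ^ (e n))`: the parameter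
is linear in `n`, unless the instance is so long that `2 ^ n` is less than its bit length. -/
lemma exists_starBound (F G : ℕ[X]) (C : ℕ) {e : ℝ} (he : e ≤ 1) : ∃ p q : ℕ[X], ∀ I : Instance,
    (F.eval (param C I.input) : ℕ) * (2 : ℝ) ^ (e * I.n) + (G.eval (2 * I.bitLength + C) : ℕ) ≤
      starBound e p q I := by
  refine ⟨F.comp (2 * X + Polynomial.C C), F.comp (2 * X + Polynomial.C C) * X + G.comp (2 * X + Polynomial.C C), fun I => ?_⟩
  have hz := size_total_le I
  have hn : I.n ≤ I.bitLength := by unfold Instance.bitLength; omega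
  set z := Nat.size (total I.input)
  set L := I.bitLength
  have hparam : param C I.input = I.n + Nat.size z + C := rfl
  simp only [starBound, eval_comp, eval_add, eval_mul, eval_X, eval_C, eval_ofNat]
  push_cast
  have hpos : (0 : ℝ) < 2 ^ (e * I.n) := by positivity
  rcases lt_or_ge z (2 ^ I.n) with h | h
  · have h1 : ((F.eval (param C I.input) : ℕ) : ℝ) ≤ (F.eval (2 * I.n + C) : ℕ) := by
      have := Nat.size_le.2 h
      exact_mod_cast eval_mono F (by omega)
    have h2 := mul_le_mul_of_nonneg_right h1 hpos.le
    have h3 : (0 : ℝ) ≤ (F.eval (2 * L + C) : ℕ) * L := by positivity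
    linarith
  · have h1 : ((F.eval (param C I.input) : ℕ) : ℝ) ≤ (F.eval (2 * L + C) : ℕ) := by
      have : Nat.size z ≤ z := Nat.size_le.2 Nat.lt_two_pow_self
      exact_mod_cast eval_mono F (by omega)
    have h2 : (2 : ℝ) ^ (e * I.n) ≤ L := by
      calc (2 : ℝ) ^ (e * I.n) ≤ 2 ^ (I.n : ℝ) := by
            refine Real.rpow_le_rpow_of_exponent_le (by norm_num) ?_
            exact mul_le_of_le_one_left (Nat.cast_nonneg _) he
        _ = (2 ^ I.n : ℕ) := by rw [Real.rpow_natCast]; push_cast; rfl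
        _ ≤ L := by exact_mod_cast h.trans hz
    have h3 := mul_le_mul h1 h2 hpos.le (Nat.cast_nonneg _)
    have h4 : (0 : ℝ) ≤ (F.eval (2 * I.n + C) : ℕ) * (2 : ℝ) ^ (e * I.n) := by positivity
    linarith

end polynomials

section exponents

lemma rho_eq (l : ℕ) : rho l = ((1 + l * (l + 1) / 2 : ℕ) : ℝ) := by
  rw [rho, Nat.cast_add, Nat.cast_div (Nat.even_mul_succ_self l).two_dvd (by norm_num)]
  push_cast; ring

lemma index_spec {σ : ℝ} (h0 : 0 < σ) (h1 : σ ≤ 1 / 2) :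
    1 ≤ index σ ∧ 1 / rho (index σ + 1) < σ ∧ σ ≤ 1 / rho (index σ) := by
  have hex : ∃ k : ℕ, 1 / rho (k + 1) < σ := by
    obtain ⟨k, hk⟩ := exists_nat_gt (1 / σ)
    refine ⟨k, ?_⟩
    rw [one_div_lt (by unfold rho; positivity) h0]
    refine hk.trans_le ?_
    unfold rho
    push_cast; nlinarith [Nat.cast_nonneg (α := ℝ) k]
  have hr1 : rho 1 = 2 := by norm_num [rho]
  have hne : {l : ℕ | 1 / rho (l + 1) < σ ∧ σ ≤ 1 / rho l}.Nonempty := by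
    classical
    refine ⟨Nat.find hex, Nat.find_spec hex, ?_⟩
    rcases Nat.eq_zero_or_pos (Nat.find hex) with h | h
    · rw [h]; norm_num [rho]; linarith
    · obtain ⟨k, hk⟩ := Nat.exists_eq_add_of_le' h
      rw [hk]; exact not_lt.1 (Nat.find_min hex (show k < _ by omega))
  obtain ⟨h2, h3⟩ : 1 / rho (index σ + 1) < σ ∧ σ ≤ 1 / rho (index σ) := Nat.sInf_mem hne
  refine ⟨Nat.one_le_iff_ne_zero.2 fun h => ?_, h2, h3⟩
  rw [h, zero_add, hr1] at h2; linarith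

/-- For `σ > 1 / 2`, the bound is the one for `1 / 2`. -/
lemma tau_eq (σ : ℝ) : tau σ = 1 - 1 / ((index (min σ (1 / 2)) : ℝ) + 1) -
    (rho (index (min σ (1 / 2))) - 2) / ((index (min σ (1 / 2)) : ℝ) + 1) * min σ (1 / 2) := by
  unfold tau
  split_ifs with h
  · rw [min_eq_right h.le]
    obtain ⟨h1, h2, h3⟩ := index_spec (σ := 1 / 2) (by norm_num) le_rfl
    have h4 : index (1 / 2) = 1 := by
      refine le_antisymm (Nat.le_of_not_lt fun h5 => ?_) h1
      have h5 : (2 : ℝ) ≤ index (1 / 2) := by exact_mod_cast h5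
      rw [one_div_le_one_div (by norm_num) (by unfold rho; positivity), rho] at h3; nlinarith
    rw [h4]; norm_num [rho]
  · rw [min_eq_left (not_lt.1 h)]

/-- The block size. -/
noncomputable def blockSize (σ : ℝ) (n : ℕ) : ℕ := ⌊min σ (1 / 2) * n⌋₊

/-- The offset: the blocks other than the first have `j m + c` items. -/
noncomputable def offset (σ : ℝ) (l n : ℕ) : ℕ := (n - (1 + l * (l + 1) / 2) * blockSize σ n) / (l + 1)

lemma sizes_blockSize {σ : ℝ} (h0 : 0 < σ) {l n lam : ℕ} (hl : l = index (min σ (1 / 2)))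
    (hlam : n + 100 * (l + (1 + (l + 1) * (l + 2) / 2) + 10) ≤ lam) :
    Sizes l (1 + (l + 1) * (l + 2) / 2) n (blockSize σ n) (offset σ l n) lam := by
  obtain ⟨h1, h2, h3⟩ := index_spec (lt_min h0 (by norm_num : (0 : ℝ) < 1 / 2)) (min_le_right _ _)
  rw [← hl] at h1 h2 h3
  have hr := rho_eq l
  have hr' := rho_eq (l + 1)
  set s := min σ (1 / 2) with hs
  have hs0 : 0 < s := lt_min h0 (by norm_num)
  have hm1 : (blockSize σ n : ℝ) ≤ s * n := Nat.floor_le (by positivity)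
  have hm2 : s * n < blockSize σ n + 1 := Nat.lt_floor_add_one _
  set m := blockSize σ n with hm
  have hpos : 0 < rho l := by unfold rho; positivity
  have hpos' : 0 < rho (l + 1) := by unfold rho; positivity
  rw [le_div_iff₀ hpos] at h3
  rw [div_lt_iff₀ hpos'] at h2
  refine ⟨h1, ?_, rfl, ?_, hlam⟩
  · have : (rho l * m : ℝ) ≤ n := by nlinarith [Nat.cast_nonneg (α := ℝ) n]
    rw [hr] at this
    exact_mod_cast this
  · -- `c ≤ m + c₀` is where `s > 1 / ρ_(l+1)` is needed
    have h4 : (n : ℝ) ≤ rho (l + 1) * (m + 1) := by nlinarith [Nat.cast_nonneg (α := ℝ) n]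
    rw [hr'] at h4
    have h5 : n ≤ (1 + (l + 1) * (l + 1 + 1) / 2) * (m + 1) := by exact_mod_cast h4
    rw [offset, ← hm, Nat.div_le_iff_le_mul_add_pred (by omega)]
    rw [half_succ] at h5
    rw [show (l + 1) * (l + 2) / 2 = l * (l + 1) / 2 + (l + 1) from half_succ l]
    set R := l * (l + 1) / 2
    have : (l + 1) * (m + (1 + (R + (l + 1)))) = (l + 1) * m + (1 + (R + (l + 1))) + l * (1 + (R + (l + 1))) := by ring
    have h6 : (1 + (R + (l + 1))) * (m + 1) = (1 + R) * m + (l + 1) * m + (1 + (R + (l + 1))) := by ring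
    omega

/-- The exponent of the running time. -/
lemma exponent_le {σ : ℝ} {l n c₀ lam : ℕ} (hl : l = index (min σ (1 / 2)))
    (hs : Sizes l c₀ n (blockSize σ n) (offset σ l n) lam) :
    (((1 + l * (l - 1) / 2) * blockSize σ n + l * offset σ l n : ℕ) : ℝ) ≤ tau σ * n + l := by
  have hc : ((offset σ l n * (l + 1) + (1 + l * (l + 1) / 2) * blockSize σ n : ℕ) : ℝ) ≤ n := by
    have h1 : offset σ l n * (l + 1) ≤ _ := Nat.div_mul_le_self _ _
    have h2 := hs.m_le
    exact_mod_cast (by omega)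
  have hm2 : min σ (1 / 2) * n < blockSize σ n + 1 := Nat.lt_floor_add_one _
  rw [tau_eq σ, ← hl]
  set s := min σ (1 / 2)
  set m := blockSize σ n
  set c := offset σ l n
  have hl1 := hs.l_pos
  have e : ((1 + l * (l - 1) / 2 : ℕ) : ℝ) = 1 + l * (l - 1) / 2 := by
    rw [Nat.cast_add, Nat.cast_div (Nat.even_mul_pred_self l).two_dvd (by norm_num)]
    push_cast [Nat.cast_sub hl1]; ring
  have e' := rho_eq l
  rw [Nat.cast_add, Nat.cast_mul (1 + _), ← e'] at hc
  rw [Nat.cast_add, Nat.cast_mul (1 + _), e]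
  push_cast at hc ⊢
  rw [rho] at hc ⊢
  have hl1' : (1 : ℝ) ≤ l := by exact_mod_cast hl1
  have h3 : (1 - 1 / ((l : ℝ) + 1) - (1 + l * (l + 1) / 2 - 2) / (l + 1) * s) * n + l =
      (l * n - (l * (l + 1) / 2 - 1) * (s * n) + l * (l + 1)) / (l + 1) := by field_simp; ring
  rw [h3, le_div_iff₀ (by positivity)]
  nlinarith [mul_le_mul_of_nonneg_left hc (by positivity : (0 : ℝ) ≤ l),
    mul_le_mul_of_nonneg_left hm2.le (by nlinarith : (0 : ℝ) ≤ l * (l + 1) / 2 - 1)]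

lemma tau_le_one {σ : ℝ} (h0 : 0 < σ) : tau σ ≤ 1 := by
  have h1 := (index_spec (lt_min h0 (by norm_num : (0 : ℝ) < 1 / 2)) (min_le_right _ _)).1
  rw [tau_eq σ]
  set l := index (min σ (1 / 2))
  have h2 : (1 : ℝ) ≤ l := by exact_mod_cast h1
  have h3 : 0 ≤ (rho l - 2) / ((l : ℝ) + 1) * min σ (1 / 2) := by
    refine mul_nonneg (div_nonneg ?_ (by positivity)) (le_min h0.le (by norm_num))
    unfold rho; nlinarith
  have h4 : 0 ≤ 1 / ((l : ℝ) + 1) := by positivity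
  linarith

end exponents

/-- The block size can be computed; if `σ` is rational, without `scale`. -/
lemma exists_blockSize_expr {σ : ℝ} (h0 : 0 < σ) : ∃ (e : Expr Rg Ar) (K : ℕ),
    (σ ∈ Set.range ((↑) : ℚ → ℝ) → e.Plain) ∧
    ∀ (L : Layout Rg Ar) (A V : ℕ) (E : Env) (st : St Rg Ar), E.σ = σ → st.reg (.sc .n) + K ≤ V →
      e.eval E st = blockSize σ (st.reg (.sc .n)) ∧ e.Ok L A V E st := by
  -- `min σ (1 / 2)` is irrational only if it is `σ`, and then `scale` may be used
  by_cases h : min σ (1 / 2) ∈ Set.range ((↑) : ℚ → ℝ)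
  · obtain ⟨q, hq⟩ := h
    have hq0 : 0 < q := by
      have : (0 : ℝ) < q := hq ▸ lt_min h0 (by norm_num)
      exact_mod_cast this
    refine ⟨rg .n * num q.num.toNat / num q.den, q.num.toNat + q.den, fun _ => ⟨⟨trivial, trivial⟩, trivial⟩,
      fun L A V E st _ hV => ⟨?_, ?_⟩⟩
    · have e1 : (q : ℝ) = (q.num.toNat : ℝ) / q.den := by
        have h1 : ((q.num.toNat : ℤ) : ℚ) = q.num := by
          rw [Int.toNat_of_nonneg (Rat.num_nonneg.2 hq0.le)]
        have h2 : q = (q.num.toNat : ℚ) / q.den := by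
          rw [← Int.cast_natCast q.num.toNat, h1, Rat.num_div_den]
        simpa using congrArg (Rat.cast : ℚ → ℝ) h2
      rw [blockSize, ← hq, e1, div_mul_eq_mul_div, ← Nat.cast_mul, Nat.floor_div_natCast,
        Nat.floor_natCast, mul_comm]
      rfl
    · have hlt : ∀ a ≤ V, a < 2 ^ V := fun a ha => Nat.lt_two_pow_self.trans_le
        (Nat.pow_le_pow_right (by norm_num) ha)
      refine ⟨⟨trivial, hlt _ (by omega), ?_⟩, hlt _ (by omega), trivial⟩
      change st.reg (.sc .n) * q.num.toNat < 2 ^ V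
      refine (Nat.mul_lt_mul'' Nat.lt_two_pow_self Nat.lt_two_pow_self).trans_le ?_
      rw [← pow_add]; exact Nat.pow_le_pow_right (by norm_num) (by omega)
  · have hσ : min σ (1 / 2) = σ := by
      refine (min_choice _ _).resolve_right fun h' => h ⟨1 / 2, ?_⟩
      rw [h']; norm_num
    rw [hσ] at h
    refine ⟨.scale (rg .n), 0, fun h' => (h h').elim, fun L A V E st hE _ => ⟨?_, trivial⟩⟩
    rw [blockSize, hσ, ← hE]; rfl

section

variable {σ : ℝ} {l c₀ C : ℕ} {e : Expr Rg Ar}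

/-- The running time, as a polynomial in `param` and the bit length. -/
lemma exists_time_bound (h0 : 0 < σ) (hl : l = index (min σ (1 / 2)))
    (h : ∀ I, Suits σ l c₀ C (blockSize σ I.n) (offset σ l I.n) I e) : ∃ p q : ℕ[X], ∀ I : Instance,
    ((1000 * (param C I.input ^ 4 + Nat.size (total I.input)) * (1 + bits₁ l C I.input) ^ 2 +
      steps₂ l c₀ (blockSize σ I.n) (offset σ l I.n) (param C I.input) e *
        (1 + (2 * param C I.input ^ 5 + 3)) ^ 2 : ℕ) : ℝ) ≤ starBound (tau σ) p q I := by
  set K := (reduce 0).top (layout l) 0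
  obtain ⟨p, q, hpq⟩ := exists_starBound
    ((Polynomial.C e.len + Polynomial.C (1000 * (l + 2)) * (X + 1) * ((X ^ 3 + 1) * 2 ^ (c₀ + 2)) +
      (X ^ (9 * l + 9)) ^ (2 * l + 8) * (X ^ (9 * l + 9) * 2 ^ (l * (l + 1) + l + c₀ + 6))) *
      (1 + (2 * X ^ 5 + 3)) ^ 2 * 2 ^ l)
    (1000 * (X ^ 4 + X) * (1 + (4 * X ^ 4 + X + (2 * (X + 1) * Polynomial.C (2 * l + 4) +
      Polynomial.C K))) ^ 2) C (tau_le_one h0)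
  refine ⟨p, q, fun I => le_trans ?_ (hpq I)⟩
  have hs := (h I).sizes
  have hexp := exponent_le hl hs
  have hz := size_total_le I
  have hn : I.n ≤ I.bitLength := by unfold Instance.bitLength; omega
  have hparam : param C I.input = I.n + Nat.size (Nat.size (total I.input)) + C := rfl
  have hzz : Nat.size (Nat.size (total I.input)) ≤ Nat.size (total I.input) :=
    Nat.size_le.2 Nat.lt_two_pow_self
  simp only [eval_add, eval_mul, eval_pow, eval_X, eval_C, eval_ofNat, eval_one]
  set lam := param C I.input
  set Y := 2 * I.bitLength + C with hY
  set m := blockSize σ I.n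
  set c := offset σ l I.n
  set x := (1 + l * (l - 1) / 2) * m + l * c with hx
  have hmx : m ≤ x := le_trans (Nat.le_mul_of_pos_left _ (by omega)) (Nat.le_add_right _ _)
  rw [Nat.cast_add, add_comm]
  refine add_le_add ?_ (Nat.cast_le.2 ?_)
  · have h1 : steps₂ l c₀ m c lam e ≤ (e.len + 1000 * (l + 2) * (lam + 1) *
        ((lam ^ 3 + 1) * 2 ^ (c₀ + 2)) + (lam ^ (9 * l + 9)) ^ (2 * l + 8) *
        (lam ^ (9 * l + 9) * 2 ^ (l * (l + 1) + l + c₀ + 6))) * 2 ^ x := by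
      have h2 : 2 ^ (m + c₀ + 2) ≤ 2 ^ (c₀ + 2) * 2 ^ x := by
        rw [← pow_add]; exact Nat.pow_le_pow_right (by norm_num) (by omega)
      have h3 : e.len ≤ e.len * 2 ^ x := Nat.le_mul_of_pos_right _ (by positivity)
      rw [steps₂, work, ← hx, pow_add 2 x]
      refine (Nat.add_le_add_right (Nat.add_le_add h3 (Nat.mul_le_mul_left _
        (Nat.mul_le_mul_left _ h2))) _).trans (le_of_eq (by ring))
    have h4 : ((2 ^ x : ℕ) : ℝ) ≤ 2 ^ l * 2 ^ (tau σ * I.n) := by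
      rw [mul_comm, ← Real.rpow_natCast, ← Real.rpow_add (by norm_num), Nat.cast_pow,
        ← Real.rpow_natCast]
      exact Real.rpow_le_rpow_of_exponent_le (by norm_num) hexp
    refine (Nat.cast_le.2 (Nat.mul_le_mul_right _ h1)).trans ?_
    rw [mul_right_comm, Nat.cast_mul _ (2 ^ x), Nat.cast_mul _ (2 ^ l), mul_assoc _ _ (2 ^ (tau σ * _))]
    push_cast at h4 ⊢
    gcongr
  · change 1000 * _ * (1 + (4 * lam ^ 4 + _ + (2 * (I.n + 1) * (2 * l + 4) + K))) ^ 2 ≤ _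
    have h1 : lam ≤ Y := by omega
    have h2 : Nat.size (total I.input) ≤ Y := by omega
    have h3 : I.n ≤ Y := by omega
    gcongr

/-- The space, as a polynomial in `param` and the bit length. -/
lemma exists_space_bound (h0 : 0 < σ) (h1 : σ ≤ 1)
    (h : ∀ I, Suits σ l c₀ C (blockSize σ I.n) (offset σ l I.n) I e) : ∃ p q : ℕ[X], ∀ I : Instance,
    ((addresses₁ l I.n * (Nat.size (addresses₁ l I.n) + bits₁ l C I.input) +
      addresses l c₀ (blockSize σ I.n) (param C I.input) *
        (Nat.size (addresses l c₀ (blockSize σ I.n) (param C I.input)) +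
          (2 * param C I.input ^ 5 + 3)) : ℕ) : ℝ) ≤ starBound σ p q I := by
  set K := (reduce 0).top (layout l) 0
  obtain ⟨p, q, hpq⟩ := exists_starBound
    (2 * (X ^ (9 * l + 9) * 2 ^ (c₀ + 4) + 1) * Polynomial.C (2 * l + 4) *
      (X * X * X + (2 * X ^ 5 + 3)))
    ((2 * (X + 1) * Polynomial.C (2 * l + 4) + Polynomial.C K) *
      ((2 * (X + 1) * Polynomial.C (2 * l + 4) + Polynomial.C K) +
      (4 * X ^ 4 + X + (2 * (X + 1) * Polynomial.C (2 * l + 4) + Polynomial.C K)))) C h1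
  refine ⟨p, q, fun I => le_trans ?_ (hpq I)⟩
  have hs := (h I).sizes
  have hz := size_total_le I
  have hn : I.n ≤ I.bitLength := by unfold Instance.bitLength; omega
  have hparam : param C I.input = I.n + Nat.size (Nat.size (total I.input)) + C := rfl
  have hzz : Nat.size (Nat.size (total I.input)) ≤ Nat.size (total I.input) :=
    Nat.size_le.2 Nat.lt_two_pow_self
  have hm : (blockSize σ I.n : ℝ) ≤ σ * I.n :=
    (Nat.floor_le (mul_nonneg (le_min h0.le (by norm_num)) (Nat.cast_nonneg _))).trans
      (mul_le_mul_of_nonneg_right (min_le_left _ _) (Nat.cast_nonneg _))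
  simp only [eval_add, eval_mul, eval_pow, eval_X, eval_C, eval_ofNat, eval_one]
  set lam := param C I.input
  set Y := 2 * I.bitLength + C with hY
  set m := blockSize σ I.n
  rw [Nat.cast_add, add_comm]
  refine add_le_add ?_ (Nat.cast_le.2 ?_)
  · have h2 : addresses l c₀ m lam ≤
        2 * (lam ^ (9 * l + 9) * 2 ^ (c₀ + 4) + 1) * (2 * l + 4) * 2 ^ m := by
      have h3 : 1 ≤ 2 ^ m := Nat.one_le_two_pow
      calc addresses l c₀ m lam
          ≤ 2 * (lam ^ (9 * l + 9) * 2 ^ (m + c₀ + 4) + 2 ^ m) * (2 * l + 4) := by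
            unfold addresses cells; gcongr
        _ = _ := by rw [add_assoc m, pow_add 2 m]; ring
    have h4 : ((2 ^ m : ℕ) : ℝ) ≤ 2 ^ (σ * I.n) := by
      rw [Nat.cast_pow, ← Real.rpow_natCast]
      exact Real.rpow_le_rpow_of_exponent_le (by norm_num) hm
    refine (Nat.cast_le.2 (Nat.mul_le_mul h2 (Nat.add_le_add_right
      (Nat.size_le.2 hs.cells_le.1) _))).trans ?_
    rw [mul_right_comm, Nat.cast_mul _ (2 ^ m)]
    gcongr
  · have h5 : addresses₁ l I.n ≤ 2 * (Y + 1) * (2 * l + 4) + K := by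
      unfold addresses₁
      have h3 : I.n ≤ Y := by omega
      gcongr
    have h6 : Nat.size (addresses₁ l I.n) ≤ addresses₁ l I.n := Nat.size_le.2 Nat.lt_two_pow_self
    have h7 : bits₁ l C I.input ≤ 4 * Y ^ 4 + Y + (2 * (Y + 1) * (2 * l + 4) + K) := by
      have h1 : lam ≤ Y := by omega
      have h2 : Nat.size (total I.input) ≤ Y := by omega
      have : bits₁ l C I.input = 4 * lam ^ 4 + Nat.size (total I.input) + addresses₁ l I.n := rfl
      rw [this]
      gcongr
    exact Nat.mul_le_mul h5 (add_le_add (h6.trans h5) h7)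

end

end SubsetSum

theorem theorem1 (σ : ℝ) (h0 : 0 < σ) (h1 : σ ≤ 1) :
    ∃ P : SubsetSum.Program,
      -- For rational `σ` the program is an ordinary one, without the instruction `scale`.
      (σ ∈ Set.range ((↑) : ℚ → ℝ) → ∀ r s : ℕ, SubsetSum.Instr.scale r s ∉ P) ∧
      SubsetSum.SolvesWithHighProbability σ P ∧
      ∃ pT qT pS qS : Polynomial ℕ,
        SubsetSum.RunsWithin σ P
          (SubsetSum.starBound (SubsetSum.tau σ) pT qT)
          (SubsetSum.starBound σ pS qS) := by
  obtain ⟨e, K, hplain, he⟩ := SubsetSum.exists_blockSize_expr h0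
  set l := SubsetSum.index (min σ (1 / 2)) with hl
  set c₀ := 1 + (l + 1) * (l + 2) / 2 with hc₀
  set C := (SubsetSum.mainPhase l e).top (SubsetSum.layout l) 0 + K + 100 * (l + c₀ + 10) with hC
  have h : ∀ I : SubsetSum.Instance, SubsetSum.Suits σ l c₀ C (SubsetSum.blockSize σ I.n)
      (SubsetSum.offset σ l I.n) I e := fun I => by
    have hparam : SubsetSum.param C I.input = I.n + _ + C := rfl
    refine ⟨h1, SubsetSum.sizes_blockSize h0 hl (by omega), by omega, fun ω st hst => ?_⟩
    have := he (SubsetSum.layout l) (SubsetSum.addresses l c₀ (SubsetSum.blockSize σ I.n)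
      (SubsetSum.param C I.input)) (2 * SubsetSum.param C I.input ^ 5 + 3) (SubsetSum.env σ I ω) st
      rfl (by
        have : SubsetSum.param C I.input ≤ SubsetSum.param C I.input ^ 5 :=
          Nat.le_self_pow (by norm_num) _
        have : st.reg (.sc .n) = I.n := hst
        omega)
    rwa [hst] at this
  refine ⟨SubsetSum.program l C e, fun hσ => SubsetSum.program_plain (hplain hσ),
    ⟨fun n => (3 * l + 4 : ℕ) / (n + 1), ?_, fun I => (h I).measure_answersCorrectly⟩, ?_⟩
  · exact_mod_cast (tendsto_const_div_atTop_nhds_zero_nat ((3 * l + 4 : ℕ) : ℝ)).comp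
      (Filter.tendsto_add_atTop_nat 1)
  · obtain ⟨pT, qT, hT⟩ := SubsetSum.exists_time_bound h0 hl h
    obtain ⟨pS, qS, hS⟩ := SubsetSum.exists_space_bound h0 h1 h
    refine ⟨pT, qT, pS, qS, fun I ω => ?_⟩
    obtain ⟨⟨k, hk, ht⟩, hs⟩ := (h I).runsWithin ω
    exact ⟨⟨k, hk, (Nat.cast_le.2 ht).trans (hT I)⟩, fun k => (Nat.cast_le.2 (hs k)).trans (hS I)⟩
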